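/- **Conventions.** $\Gamma$ is Segal's category: objects are the finite sets $\underline n=\{1,\dots,n\}$, a morphism $\underline m\to\underline n$ is an $m$-tuple of pairwise disjoint subsets of $\underline n$; it is *active* if the subsets cover $\underline n$ and *inert* if they are singletons. "Essentially unique" means unique up to a unique compatible isomorphism. A *hypermoment category* is a category $\mathcal C$ with two classes of morphisms, active and inert, each closed under composition and containing the isomorphisms, such that each morphism factors essentially uniquely as an active followed by an inert morphism, and with a functor $\gamma:\mathcal C\to\Gamma$ preserving active and inert morphisms such that for every object $A$ each element of $\gamma(A)$ has an essentially unique inert lift $U\to A$ with $U$ a *unit*: $\gamma(U)=\underline 1$ and each active morphism with target $U$ has exactly one inert section. Thus $\gamma(A)$ indexes the elementary inert subobjects $\alpha:U_\alpha\to A$ of $A$. For $f:A\to B$ write $U_\alpha\xrightarrow{f_\alpha}B_\alpha\to B$ for the active/inert factorisation of $f\alpha$. $\mathcal C$ is *unital* if each object receives an essentially unique active morphism from a unit; *extensional* if moreover inert morphisms with unital domain have pushouts along active morphisms and these pushouts are inert; *strongly extensional* if moreover for each $A$ and each family of active morphisms $f_\alpha:U_\alpha\to B_\alpha$, $\alpha\in\gamma(A)$,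 there is an essentially unique active $f:A\to B$ with inert $j_\alpha:B_\alpha\to B$ such that $f\alpha=j_\alpha f_\alpha$ for all $\alpha$. Let $(\mathcal E,\otimes,I)$ be symmetric monoidal. A *$\mathcal C$-collection* in $\mathcal E$ is a functor $X$ from the groupoid of isomorphisms of $\mathcal C$ to $\mathcal E$; put $X(f)=\bigotimes_{\alpha\in\gamma(A)}X(B_\alpha)$ for $f:A\to B$. A *$\mathcal C$-operad* is a collection $O$ with maps $\eta_U:I\to O(U)$ for units $U$ and $\mu_f:O(A)\otimes O(f)\to O(B)$ for active $f:A\to B$, satisfying the left and right unit axioms, associativity for $A\xrightarrow{f}B\xrightarrow{g}D$, and equivariance with respect to isomorphisms of active morphisms. A *marked $\mathcal C$-tree* over $A$ is a chain $T=(A_0\to A_1\to\cdots\to A_m=A)$ of active morphisms with $A_0$ a unit, together with a set of marked vertices; a *vertex* is an elementary inert subobject $\alpha$ of some $A_i$, $i<m$, and only *effaceable* vertices, those with $U_\alpha\to(A_{i+1})_\alpha$ invertible, may be marked. $T$ is *normal* if all vertices above a marked vertex are marked and each level $i<m$ has an unmarked vertex. Put $S(X,T)=\bigotimes_{\alpha}X((A_{i+1})_\alpha)$,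 over the unmarked vertices. A *stretching* of a marked tree adds, up to isomorphism, levels at the top which consist of isomorphisms and have all vertices marked (it has a contraction back to the tree). A map of collections $\varphi:X\to O$ into an operad induces *evaluation maps* $\iota_T:S(X,T)\to O(A)$ for all marked trees $T$ over $A$: apply $\varphi$, insert units of $O$ at the marked vertices and compose the levels in $O$; for the tree of height $0$ consisting of a unit $U$ this is $\eta_U$. **Theorem.** Let $\mathcal C$ be a small strongly extensional hypermoment category and $\mathcal E$ a cocomplete closed symmetric monoidal category. The forgetful functor from $\mathcal C$-operads in $\mathcal E$ to $\mathcal C$-collections in $\mathcal E$ is monadic. Moreover, if $O=F(X)$ is the free operad on a collection $X$ and $\varphi:X\to F(X)$ the unit of the adjunction, then: 1. (coend formula) for each object $A$, the maps $\iota_T:S(X,T)\to F(X)(A)$ exhibit $F(X)(A)$ as the colimit of $S(X,-)$ over the groupoid of normal marked $\mathcal C$-trees over $A$ and their isomorphisms which are the identity on $A$: $$F(X)(A)=\int^{T\ \text{normal over }A}S(X,T);$$ 2. (stretching and contraction) if $T'$ over $B$ is a stretching of $T$ over $A$, with induced isomorphism $e:A\cong B$, then $\iota_{T'}$ composed with the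 canonical isomorphism $S(X,T)\cong S(X,T')$ equals $F(X)(e)\,\iota_T$; 3. (simultaneous insertion) for each active $f:A\to B$, each marked tree $T$ over $A$ and all marked trees $Q_\alpha$ over $B_\alpha$, $\alpha\in\gamma(A)$, there is a chain $R$ of active morphisms from $A$ to $B$ with composite $f$ and with marked effaceable vertices, such that for each $\alpha$ the restriction $R_\alpha$ of $R$ to $\alpha$, a marked tree over $B_\alpha$, is a stretching of $Q_\alpha$; and for each such $R$, with $TR$ the concatenation of $T$ and $R$, $$\mu_f\circ\Bigl(\iota_T\otimes\bigotimes_\alpha\iota_{Q_\alpha}\Bigr)=\iota_{TR}\circ\kappa,$$ where $\kappa:S(X,T)\otimes\bigotimes_\alpha S(X,Q_\alpha)\cong S(X,T)\otimes\bigotimes_\alpha S(X,R_\alpha)\cong S(X,TR)$ is the canonical isomorphism. -/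

import Mathlib

open CategoryTheory MonoidalCategory

universe w v₁ u₁ v u

/-! ## Finite tensor products in a symmetric monoidal category -/

namespace FinTensor

variable {E : Type u} [Category.{v} E] [MonoidalCategory E]

/-- The tensor product of the objects `X i`, with `i` running through the list `l`. -/
def tensL {ι : Type*} (X : ι → E) : List ι → E
  | [] => 𝟙_ E
  | i :: l => X i ⊗ tensL X l

/-- The tensor product of a finite family. -/
abbrev tens {n : ℕ} (X : Fin n → E) : E := tensL X (List.finRange n)

/-- Change of the index type along a map `e`. -/
def tensMapIdx {ι κ : Type*} {X : ι → E} {Y : κ → E} (e : ι → κ)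
    (φ : ∀ i, X i ⟶ Y (e i)) : ∀ l : List ι, tensL X l ⟶ tensL Y (l.map e)
  | [] => 𝟙 _
  | i :: l => φ i ⊗ₘ tensMapIdx e φ l

/-- The tensor product of a family of morphisms. -/
def tensMap {ι : Type*} {X Y : ι → E} (φ : ∀ i, X i ⟶ Y i) :
    ∀ l : List ι, tensL X l ⟶ tensL Y l
  | [] => 𝟙 _
  | i :: l => φ i ⊗ₘ tensMap φ l

theorem tensMap_id {ι : Type*} (X : ι → E) (l : List ι) :
    tensMap (fun i => 𝟙 (X i)) l = 𝟙 (tensL X l) := by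
  induction l with
  | nil => rfl
  | cons i l ih => simp [tensMap, ih, tensL]

theorem tensMap_comp {ι : Type*} {X Y Z : ι → E} (φ : ∀ i, X i ⟶ Y i) (ψ : ∀ i, Y i ⟶ Z i)
    (l : List ι) : tensMap (fun i => φ i ≫ ψ i) l = tensMap φ l ≫ tensMap ψ l := by
  induction l with
  | nil => exact (Category.comp_id _).symm
  | cons i l ih =>
    simp only [tensMap, ih]
    exact (MonoidalCategory.tensorHom_comp_tensorHom _ _ _ _).symm

/-- The canonical morphism `⨂ I ⟶ I`. -/
def tensOne {ι : Type*} : ∀ l : List ι, tensL (fun _ : ι => 𝟙_ E) l ⟶ 𝟙_ E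
  | [] => 𝟙 _
  | _ :: l => (λ_ _).hom ≫ tensOne l

/-- The morphism `I ⟶ ⨂ X i` induced by morphisms `I ⟶ X i`. -/
def tensPoint {ι : Type*} {X : ι → E} (p : ∀ i, 𝟙_ E ⟶ X i) : ∀ l : List ι, 𝟙_ E ⟶ tensL X l
  | [] => 𝟙 _
  | i :: l => (λ_ (𝟙_ E)).inv ≫ (p i ⊗ₘ tensPoint p l)

/-- The canonical morphism `(⨂_{l} X) ⊗ (⨂_{l'} X) ⟶ ⨂_{l ++ l'} X`. -/
def tensAppend {ι : Type*} (X : ι → E) (l' : List ι) :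
    ∀ l : List ι, tensL X l ⊗ tensL X l' ⟶ tensL X (l ++ l')
  | [] => (λ_ _).hom
  | i :: l => (α_ _ _ _).hom ≫ X i ◁ tensAppend X l' l

/-- The canonical morphism `⨂_i ⨂_j Y i j ⟶ ⨂_{(i, j)} Y i j`. -/
def tensSigma {ι : Type*} {κ : ι → Type*} (Y : ∀ i, κ i → E) (m : ∀ i, List (κ i)) :
    ∀ l : List ι, tensL (fun i => tensL (Y i) (m i)) l ⟶
      tensL (fun p : Σ i, κ i => Y p.1 p.2) (l.sigma m)
  | [] => 𝟙 _
  | i :: l =>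
      (tensMapIdx (X := Y i) (Y := fun p : Σ i, κ i => Y p.1 p.2) (Sigma.mk i)
        (fun _ => 𝟙 _) (m i) ⊗ₘ tensSigma Y m l) ≫ tensAppend _ _ _

variable [SymmetricCategory E]

/-- Moving the factor of index `a` to its place in the list. -/
def tensInsert {ι : Type*} [DecidableEq ι] (X : ι → E) (a : ι) :
    ∀ l : List ι, a ∈ l → (X a ⊗ tensL X (l.erase a) ⟶ tensL X l)
  | [], h => absurd h List.not_mem_nil
  | b :: l, h =>
    if hb : b = a then
      eqToHom (by subst hb; simp [tensL])
    else
      eqToHom (by rw [List.erase_cons_tail (by simpa using hb)]; rfl) ≫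
        (α_ (X a) (X b) (tensL X (l.erase a))).inv ≫ (β_ (X a) (X b)).hom ▷ _ ≫
          (α_ _ _ _).hom ≫ X b ◁ tensInsert X a l
            ((List.mem_cons.1 h).resolve_left (fun e => hb e.symm))

/-- The symmetry of `E` that reorders the factors from the order of the list `l` to that of `l'`
(the lists that occur have no repetitions). -/
def tensPerm {ι : Type*} [DecidableEq ι] (X : ι → E) :
    ∀ l l' : List ι, l.Perm l' → (tensL X l ⟶ tensL X l')
  | [], _, h => eqToHom (by rw [List.nil_perm.1 h])
  | a :: l, l', h =>
    X a ◁ tensPerm X l (l'.erase a) (List.cons_perm_iff_perm_erase.1 h).2 ≫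
      tensInsert X a l' (List.cons_perm_iff_perm_erase.1 h).1

/-- The morphism `⨂_i X i ⟶ ⨂_j Y j` induced by a bijection `e` of the indices
and morphisms `X i ⟶ Y (e i)`. -/
def tensReindex {ι κ : Type*} [DecidableEq κ] {X : ι → E} {Y : κ → E} {l : List ι} {l' : List κ}
    (e : ι → κ) (h : (l.map e).Perm l') (φ : ∀ i, X i ⟶ Y (e i)) : tensL X l ⟶ tensL Y l' :=
  tensMapIdx e φ l ≫ tensPerm Y _ _ h

/-- The canonical morphism `(⨂ X i) ⊗ (⨂ Z i) ⟶ ⨂ (X i ⊗ Z i)`. -/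
def tensMul {ι : Type*} (X Z : ι → E) :
    ∀ l : List ι, tensL X l ⊗ tensL Z l ⟶ tensL (fun i => X i ⊗ Z i) l
  | [] => (λ_ _).hom
  | i :: l => tensorμ _ _ _ _ ≫ (X i ⊗ Z i) ◁ tensMul X Z l

/-- The canonical morphism `⨂ (X i ⊗ Z i) ⟶ (⨂ X i) ⊗ (⨂ Z i)`, inverse to `tensMul`. -/
def tensSplit {ι : Type*} (X Z : ι → E) :
    ∀ l : List ι, tensL (fun i => X i ⊗ Z i) l ⟶ tensL X l ⊗ tensL Z l
  | [] => (λ_ _).inv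
  | i :: l => (X i ⊗ Z i) ◁ tensSplit X Z l ≫ tensorδ _ _ _ _

theorem perm_of_bijective {m n : ℕ} {e : Fin m → Fin n} (he : Function.Bijective e) :
    ((List.finRange m).map e).Perm (List.finRange n) := by
  rw [List.perm_ext_iff_of_nodup ((List.nodup_finRange m).map he.1) (List.nodup_finRange n)]
  intro y
  obtain ⟨x, rfl⟩ := he.2 y
  simp

theorem perm_of_bijective_sigma {m n : ℕ} {k : Fin m → ℕ} {e : (Σ x, Fin (k x)) → Fin n}
    (he : Function.Bijective e) :
    (((List.finRange m).sigma (fun x => List.finRange (k x))).map e).Perm (List.finRange n) := by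
  rw [List.perm_ext_iff_of_nodup
    (((List.nodup_finRange m).sigma (fun x => List.nodup_finRange (k x))).map he.1)
    (List.nodup_finRange n)]
  intro y
  obtain ⟨⟨x, z⟩, rfl⟩ := he.2 y
  simp only [List.mem_map, List.mem_finRange, iff_true]
  exact ⟨⟨x, z⟩, by simp [List.mem_sigma], rfl⟩

end FinTensor

/-! ## Segal's category `Γ` -/

/-- The objects of Segal's category `Γ`: the finite sets `{1, …, card}`, modelled by `Fin card`. -/
structure SegalGamma where
  card : ℕ

namespace SegalGamma

/-- A morphism `m ⟶ n` is an `m`-tuple of pairwise disjoint subsets of `n`. -/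
@[ext]
structure Hom (m n : SegalGamma) where
  set : Fin m.card → Set (Fin n.card)
  disjoint : ∀ i j, i ≠ j → Disjoint (set i) (set j)

instance : Category SegalGamma where
  Hom := Hom
  id m := ⟨fun i => {i}, fun i j h => by simpa using h⟩
  comp {k m n} M N := ⟨fun i => ⋃ j ∈ M.set i, N.set j, fun i i' h => by
    simp only [Set.disjoint_iUnion_left, Set.disjoint_iUnion_right]
    intro j hj j' hj'
    refine N.disjoint _ _ ?_
    rintro rfl
    exact Set.disjoint_left.1 (M.disjoint i i' h) (by assumption) (by assumption)⟩
  id_comp f := by apply Hom.ext; funext i; simp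
  comp_id f := by apply Hom.ext; funext i; simp
  assoc f g h := by apply Hom.ext; funext i; simp

theorem id_set (m : SegalGamma) (i : Fin m.card) : Hom.set (𝟙 m) i = {i} := rfl

theorem comp_set {k m n : SegalGamma} (M : k ⟶ m) (N : m ⟶ n) (i : Fin k.card) :
    Hom.set (M ≫ N) i = ⋃ j ∈ Hom.set M i, Hom.set N j := rfl

/-- Active: the subsets cover the target. -/
def IsActive {m n : SegalGamma} (f : m ⟶ n) : Prop := ∀ y, ∃ i, y ∈ Hom.set f i

/-- Inert: the subsets are singletons. -/
def IsInert {m n : SegalGamma} (f : m ⟶ n) : Prop := ∀ i, ∃ y, Hom.set f i = {y}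

end SegalGamma

/-! ## Hypermoment categories -/

/-- An object `U` of an augmented category with active and inert morphisms is a unit if it has
cardinality one and each active morphism with target `U` has one and only one inert section. -/
structure IsUnitObj {C : Type u₁} [Category.{v₁} C] (act inert : MorphismProperty C)
    (γ : C ⥤ SegalGamma) (U : C) : Prop where
  card : (γ.obj U).card = 1
  section_unique : ∀ ⦃A : C⦄ (f : A ⟶ U), act f → ∃! s : U ⟶ A, inert s ∧ s ≫ f = 𝟙 U

/-- A hypermoment category: an active/inert factorisation system and an augmentation over `Γ`
preserving active and inert morphisms, such that each element of `γ A` has an inert lift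
`U ⟶ A` with `U` a unit.  Essential uniqueness means: up to a unique isomorphism. -/
class HypermomentCategory (C : Type u₁) [Category.{v₁} C] where
  act : MorphismProperty C
  inert : MorphismProperty C
  act_of_isIso : ∀ {A B : C} (f : A ⟶ B), IsIso f → act f
  act_comp : ∀ {A B D : C} (f : A ⟶ B) (g : B ⟶ D), act f → act g → act (f ≫ g)
  inert_of_isIso : ∀ {A B : C} (f : A ⟶ B), IsIso f → inert f
  inert_comp : ∀ {A B D : C} (f : A ⟶ B) (g : B ⟶ D), inert f → inert g → inert (f ≫ g)
  exists_fact : ∀ {A B : C} (f : A ⟶ B),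
    ∃ (M : C) (a : A ⟶ M) (i : M ⟶ B), act a ∧ inert i ∧ a ≫ i = f
  fact_unique : ∀ {A B M M' : C} (a : A ⟶ M) (i : M ⟶ B) (a' : A ⟶ M') (i' : M' ⟶ B),
    act a → inert i → act a' → inert i' → a ≫ i = a' ≫ i' →
      ∃! h : M ≅ M', a ≫ h.hom = a' ∧ h.hom ≫ i' = i
  γ : C ⥤ SegalGamma
  γ_act : ∀ {A B : C} (f : A ⟶ B), act f → SegalGamma.IsActive (γ.map f)
  γ_inert : ∀ {A B : C} (f : A ⟶ B), inert f → SegalGamma.IsInert (γ.map f)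
  exists_lift : ∀ (A : C) (x : Fin (γ.obj A).card), ∃ (U : C) (α : U ⟶ A),
    IsUnitObj act inert γ U ∧ inert α ∧ ∀ j, (γ.map α).set j = {x}
  lift_unique : ∀ (A : C) (x : Fin (γ.obj A).card) {U U' : C} (α : U ⟶ A) (α' : U' ⟶ A),
    IsUnitObj act inert γ U → IsUnitObj act inert γ U' → inert α → inert α' →
    (∀ j, (γ.map α).set j = {x}) → (∀ j, (γ.map α').set j = {x}) →
      ∃! h : U ≅ U', h.hom ≫ α' = α

namespace HypermomentCategory

section Basic

variable {C : Type u₁} [Category.{v₁} C] [HypermomentCategory C]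

/-- The units of a hypermoment category. -/
abbrev IsUnit (U : C) : Prop := IsUnitObj (act (C := C)) inert γ U

/-- The set `γ A`.  It indexes the elementary inert subobjects of `A`. -/
abbrev El (A : C) : Type := Fin ((γ (C := C)).obj A).card

/-- The index of a unit's only elementary inert subobject. -/
def IsUnit.idx {U : C} (hU : IsUnit U) : El U := ⟨0, by rw [hU.card]; exact Nat.one_pos⟩

/-- The domain of the chosen elementary inert morphism `α : U_α ⟶ A`. -/
noncomputable def elObj (A : C) (x : El A) : C := (exists_lift A x).choose

/-- The chosen elementary inert morphism `α : U_α ⟶ A`. -/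
noncomputable def elMap (A : C) (x : El A) : elObj A x ⟶ A :=
  (exists_lift A x).choose_spec.choose

theorem elObj_isUnit (A : C) (x : El A) : IsUnit (elObj A x) :=
  (exists_lift A x).choose_spec.choose_spec.1

theorem elMap_inert (A : C) (x : El A) : inert (elMap A x) :=
  (exists_lift A x).choose_spec.choose_spec.2.1

theorem elMap_set (A : C) (x : El A) : ∀ j, (γ.map (elMap A x)).set j = {x} :=
  (exists_lift A x).choose_spec.choose_spec.2.2

/-- The object `B_α` in the chosen active/inert factorisation `U_α ⟶ B_α ⟶ B`
of the restriction of `f : A ⟶ B` to `U_α`. -/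
noncomputable def push {A B : C} (f : A ⟶ B) (x : El A) : C :=
  (exists_fact (elMap A x ≫ f)).choose

/-- The active part `f_α : U_α ⟶ B_α`. -/
noncomputable def pushAct {A B : C} (f : A ⟶ B) (x : El A) : elObj A x ⟶ push f x :=
  (exists_fact (elMap A x ≫ f)).choose_spec.choose

/-- The inert part `B_α ⟶ B`. -/
noncomputable def pushIn {A B : C} (f : A ⟶ B) (x : El A) : push f x ⟶ B :=
  (exists_fact (elMap A x ≫ f)).choose_spec.choose_spec.choose

theorem pushAct_act {A B : C} (f : A ⟶ B) (x : El A) : act (pushAct f x) :=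
  (exists_fact (elMap A x ≫ f)).choose_spec.choose_spec.choose_spec.1

theorem pushIn_inert {A B : C} (f : A ⟶ B) (x : El A) : inert (pushIn f x) :=
  (exists_fact (elMap A x ≫ f)).choose_spec.choose_spec.choose_spec.2.1

theorem push_fac {A B : C} (f : A ⟶ B) (x : El A) :
    pushAct f x ≫ pushIn f x = elMap A x ≫ f :=
  (exists_fact (elMap A x ≫ f)).choose_spec.choose_spec.choose_spec.2.2

/-- The injection `γ A → γ B` induced by an inert morphism. -/
noncomputable def inertIdx {A B : C} (i : A ⟶ B) (hi : inert i) (x : El A) : El B :=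
  (γ_inert i hi x).choose

theorem inertIdx_spec {A B : C} (i : A ⟶ B) (hi : inert i) (x : El A) :
    (γ.map i).set x = {inertIdx i hi x} := (γ_inert i hi x).choose_spec

theorem lift_comp {A A' : C} (s : A ⟶ A') (hs : inert s) (x : El A) :
    ∀ j, (γ.map (elMap A x ≫ s)).set j = {inertIdx s hs x} := by
  intro j
  rw [Functor.map_comp, SegalGamma.comp_set, elMap_set]
  simp [inertIdx_spec s hs]

/-- An inert morphism `s : A ⟶ A'` identifies the elementary inert subobject of `A` with
index `x` with the one of `A'` with index `s x`. -/
noncomputable def elIso {A A' : C} (s : A ⟶ A') (hs : inert s) (x : El A) :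
    elObj A x ≅ elObj A' (inertIdx s hs x) :=
  (lift_unique A' (inertIdx s hs x) (elMap A x ≫ s) (elMap A' (inertIdx s hs x))
    (elObj_isUnit _ _) (elObj_isUnit _ _) (inert_comp _ _ (elMap_inert _ _) hs)
    (elMap_inert _ _) (lift_comp s hs x) (elMap_set _ _)).choose

theorem elIso_hom {A A' : C} (s : A ⟶ A') (hs : inert s) (x : El A) :
    (elIso s hs x).hom ≫ elMap A' (inertIdx s hs x) = elMap A x ≫ s :=
  (lift_unique A' (inertIdx s hs x) (elMap A x ≫ s) (elMap A' (inertIdx s hs x))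
    (elObj_isUnit _ _) (elObj_isUnit _ _) (inert_comp _ _ (elMap_inert _ _) hs)
    (elMap_inert _ _) (lift_comp s hs x) (elMap_set _ _)).choose_spec.1

theorem compare_aux {A A' B B' : C} (s : A ⟶ A') (hs : inert s) (t : B ⟶ B') (ht : inert t)
    (f : A ⟶ B) (f' : A' ⟶ B') (w : f ≫ t = s ≫ f') (x : El A) :
    ∃! h : push f x ≅ push f' (inertIdx s hs x),
      pushAct f x ≫ h.hom = (elIso s hs x).hom ≫ pushAct f' (inertIdx s hs x) ∧
        h.hom ≫ pushIn f' (inertIdx s hs x) = pushIn f x ≫ t := by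
  refine fact_unique _ _ _ _ (pushAct_act _ _) (inert_comp _ _ (pushIn_inert _ _) ht)
    (act_comp _ _ (act_of_isIso _ inferInstance) (pushAct_act _ _)) (pushIn_inert _ _) ?_
  rw [← Category.assoc, push_fac, Category.assoc, w, Category.assoc, push_fac,
    ← Category.assoc, ← Category.assoc, elIso_hom]

/-- The canonical comparison isomorphism `B_α ≅ B'_{s α}` for a commutative square
`f ≫ t = s ≫ f'` with `s` and `t` inert. -/
noncomputable def compare {A A' B B' : C} (s : A ⟶ A') (hs : inert s) (t : B ⟶ B')
    (ht : inert t) (f : A ⟶ B) (f' : A' ⟶ B') (w : f ≫ t = s ≫ f') (x : El A) :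
    push f x ≅ push f' (inertIdx s hs x) :=
  (compare_aux s hs t ht f f' w x).choose

theorem compare_act {A A' B B' : C} (s : A ⟶ A') (hs : inert s) (t : B ⟶ B')
    (ht : inert t) (f : A ⟶ B) (f' : A' ⟶ B') (w : f ≫ t = s ≫ f') (x : El A) :
    pushAct f x ≫ (compare s hs t ht f f' w x).hom =
      (elIso s hs x).hom ≫ pushAct f' (inertIdx s hs x) :=
  (compare_aux s hs t ht f f' w x).choose_spec.1.1

theorem pushMap_aux {A B D : C} (f : A ⟶ B) (g : B ⟶ D) (h : A ⟶ D) (w : f ≫ g = h)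
    (x : El A) : ∃ k : push f x ⟶ push h x, act k ∧ pushAct f x ≫ k = pushAct h x ∧
      k ≫ pushIn h x = pushIn f x ≫ g := by
  obtain ⟨M, a, i, ha, hi, e⟩ := exists_fact (pushIn f x ≫ g)
  obtain ⟨k, ⟨hk₁, hk₂⟩, -⟩ := fact_unique (pushAct f x ≫ a) i (pushAct h x) (pushIn h x)
    (act_comp _ _ (pushAct_act _ _) ha) hi (pushAct_act _ _) (pushIn_inert _ _)
    (by rw [Category.assoc, e, ← Category.assoc, push_fac, push_fac, Category.assoc, w])
  exact ⟨a ≫ k.hom, act_comp _ _ ha (act_of_isIso _ inferInstance), by simpa using hk₁,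
    by rw [Category.assoc, hk₂, e]⟩

/-- The active morphism `g_α : B_α ⟶ D_α` induced by `f : A ⟶ B` and `g : B ⟶ D`, where `D_α`
belongs to `h = f ≫ g`. -/
noncomputable def pushMap {A B D : C} (f : A ⟶ B) (g : B ⟶ D) (h : A ⟶ D) (w : f ≫ g = h)
    (x : El A) : push f x ⟶ push h x := (pushMap_aux f g h w x).choose

theorem pushMap_act {A B D : C} (f : A ⟶ B) (g : B ⟶ D) (h : A ⟶ D) (w : f ≫ g = h)
    (x : El A) : act (pushMap f g h w x) := (pushMap_aux f g h w x).choose_spec.1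

theorem pushAct_pushMap {A B D : C} (f : A ⟶ B) (g : B ⟶ D) (h : A ⟶ D) (w : f ≫ g = h)
    (x : El A) : pushAct f x ≫ pushMap f g h w x = pushAct h x :=
  (pushMap_aux f g h w x).choose_spec.2.1

theorem pushMap_in {A B D : C} (f : A ⟶ B) (g : B ⟶ D) (h : A ⟶ D) (w : f ≫ g = h)
    (x : El A) : pushMap f g h w x ≫ pushIn h x = pushIn f x ≫ g :=
  (pushMap_aux f g h w x).choose_spec.2.2

/-- The comparison isomorphism `D_{α,β} ≅ D_β`, for `β` an elementary inert subobject of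
`B_α`, also regarded as one of `B`. -/
noncomputable def nested {A B D : C} (f : A ⟶ B) (g : B ⟶ D) (h : A ⟶ D) (w : f ≫ g = h)
    (x : El A) (y : El (push f x)) :
    push (pushMap f g h w x) y ≅ push g (inertIdx (pushIn f x) (pushIn_inert f x) y) :=
  compare (pushIn f x) (pushIn_inert f x) (pushIn h x) (pushIn_inert h x)
    (pushMap f g h w x) g (pushMap_in f g h w x) y

theorem inertIdx_injective {A B : C} (i : A ⟶ B) (hi : inert i) :
    Function.Injective (inertIdx i hi) := by
  intro x y h
  by_contra hne
  have := (γ.map i).disjoint x y hne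
  rw [inertIdx_spec i hi, inertIdx_spec i hi, h] at this
  simp at this

theorem inertIdx_bijective {A A' : C} (σ : A ≅ A') :
    Function.Bijective (inertIdx σ.hom (inert_of_isIso _ inferInstance)) := by
  refine ⟨inertIdx_injective _ _, fun y => ?_⟩
  obtain ⟨x, hx⟩ := γ_act σ.hom (act_of_isIso _ inferInstance) y
  rw [inertIdx_spec σ.hom (inert_of_isIso _ inferInstance)] at hx
  exact ⟨x, hx.symm⟩

theorem pushIn_range {A B : C} (f : A ⟶ B) (x : El A) (y : El B) :
    (∃ z, inertIdx (pushIn f x) (pushIn_inert f x) z = y) ↔ y ∈ (γ.map f).set x := by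
  have j : El (elObj A x) := IsUnit.idx (elObj_isUnit A x)
  have key : (γ.map (pushAct f x ≫ pushIn f x)).set j = (γ.map f).set x := by
    rw [push_fac, Functor.map_comp, SegalGamma.comp_set, elMap_set]
    simp
  rw [← key, Functor.map_comp, SegalGamma.comp_set]
  simp only [Set.mem_iUnion, inertIdx_spec (pushIn f x) (pushIn_inert f x), Set.mem_singleton_iff]
  constructor
  · rintro ⟨z, rfl⟩
    obtain ⟨k, hk⟩ := γ_act _ (pushAct_act f x) z
    have : k = j := by
      have hc := (elObj_isUnit A x).card
      apply Fin.ext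
      have := k.2
      have := j.2
      omega
    exact ⟨z, this ▸ hk, rfl⟩
  · rintro ⟨z, -, rfl⟩
    exact ⟨z, rfl⟩

/-- The elementary inert subobjects of `B` are partitioned by those of the objects `B_α`. -/
theorem nested_bijective {A B : C} (f : A ⟶ B) (hf : act f) :
    Function.Bijective (fun p : Σ x : El A, El (push f x) =>
      inertIdx (pushIn f p.1) (pushIn_inert f p.1) p.2) := by
  constructor
  · rintro ⟨x, y⟩ ⟨x', y'⟩ h
    dsimp only at h
    have h₁ := (pushIn_range f x _).1 ⟨y, rfl⟩
    have h₂ := (pushIn_range f x' _).1 ⟨y', rfl⟩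
    rw [← h] at h₂
    have hx : x = x' := by
      by_contra hne
      exact Set.disjoint_left.1 ((γ.map f).disjoint x x' hne) h₁ h₂
    subst hx
    rw [inertIdx_injective _ _ h]
  · intro y
    obtain ⟨x, hx⟩ := γ_act f hf y
    obtain ⟨z, hz⟩ := (pushIn_range f x y).2 hx
    exact ⟨⟨x, z⟩, hz⟩

theorem elMap_isIso {U : C} (hU : IsUnit U) (x : El U) : IsIso (elMap U x) := by
  obtain ⟨h, hh, -⟩ := lift_unique U x (elMap U x) (𝟙 U) (elObj_isUnit _ _) hU
    (elMap_inert _ _) (inert_of_isIso _ inferInstance) (elMap_set _ _) (by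
      intro j
      rw [CategoryTheory.Functor.map_id, SegalGamma.id_set]
      have hc := hU.card
      have : j = x := by
        apply Fin.ext
        have := j.2
        have := x.2
        omega
      rw [this])
  rw [Category.comp_id] at hh
  rw [← hh]
  infer_instance

theorem pushIn_isIso {U A : C} (hU : IsUnit U) (f : U ⟶ A) (hf : act f) (x : El U) :
    IsIso (pushIn f x) := by
  obtain ⟨h, hh, -⟩ := fact_unique (elMap U x ≫ f) (𝟙 A) (pushAct f x) (pushIn f x)
    (act_comp _ _ (act_of_isIso _ (elMap_isIso hU x)) hf) (inert_of_isIso _ inferInstance)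
    (pushAct_act _ _) (pushIn_inert _ _) (by rw [Category.comp_id, push_fac])
  have : pushIn f x = h.inv := by rw [← Category.comp_id h.inv, ← hh.2, Iso.inv_hom_id_assoc]
  rw [this]
  infer_instance

theorem pushAct_isIso_of_inert {A B : C} (f : A ⟶ B) (hf : inert f) (x : El A) :
    IsIso (pushAct f x) := by
  obtain ⟨h, hh, -⟩ := fact_unique (𝟙 _) (elMap A x ≫ f) (pushAct f x) (pushIn f x)
    (act_of_isIso _ inferInstance) (inert_comp _ _ (elMap_inert _ _) hf)
    (pushAct_act _ _) (pushIn_inert _ _) (by rw [Category.id_comp, push_fac])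
  have : pushAct f x = h.hom := by rw [← hh.1, Category.id_comp]
  rw [this]
  infer_instance

theorem isUnit_of_iso {U V : C} (e : U ≅ V) (hU : IsUnit U) : IsUnit V := by
  constructor
  · have h := Fintype.card_of_bijective (inertIdx_bijective e)
    simp only [Fintype.card_fin] at h
    rw [← h, hU.card]
  · intro A f hf
    obtain ⟨s, ⟨hs, hs'⟩, huniq⟩ := hU.section_unique (f ≫ e.inv)
      (act_comp _ _ hf (act_of_isIso _ inferInstance))
    refine ⟨e.inv ≫ s, ⟨inert_comp _ _ (inert_of_isIso _ inferInstance) hs, ?_⟩, ?_⟩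
    · have : s ≫ f = e.hom := by
        rw [← Category.assoc] at hs'
        rw [← Iso.comp_inv_eq_id, hs']
      rw [Category.assoc, this, Iso.inv_hom_id]
    · rintro t ⟨ht, ht'⟩
      have := huniq (e.hom ≫ t) ⟨inert_comp _ _ (inert_of_isIso _ inferInstance) ht, by
        rw [Category.assoc, reassoc_of% ht', Iso.hom_inv_id]⟩
      rw [← this, Iso.inv_hom_id_assoc]

end Basic

/-! ## Unital, extensional and strongly extensional hypermoment categories -/

section Conditions

variable (C : Type u₁) [Category.{v₁} C] [HypermomentCategory C]

/-- Every object receives an essentially unique active morphism from a unit. -/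
structure Unital : Prop where
  exists_unit : ∀ A : C, ∃ (U : C) (u : U ⟶ A), IsUnit U ∧ act u
  unit_unique : ∀ (A : C) {U U' : C} (u : U ⟶ A) (u' : U' ⟶ A),
    IsUnit U → IsUnit U' → act u → act u' → ∃! h : U ≅ U', h.hom ≫ u' = u

/-- Elementary inert morphisms admit pushouts along active morphisms, and these pushouts
are inert. -/
structure Extensional : Prop extends Unital C where
  exists_pushout : ∀ {U A B : C} (u : U ⟶ A) (α : U ⟶ B), IsUnit U → act u → inert α →
    ∃ (P : C) (i : A ⟶ P) (p : B ⟶ P), inert i ∧ IsPushout u α i p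

/-- For every family of active morphisms `f_α : U_α ⟶ B_α` indexed by the elementary inert
subobjects of `A` there is an essentially unique active morphism `f : A ⟶ B` with
factorisations `α ≫ f = f_α ≫ j_α`, `j_α` inert. -/
structure StronglyExtensional : Prop extends Extensional C where
  exists_ext : ∀ (A : C) (B : El A → C) (φ : ∀ x, elObj A x ⟶ B x), (∀ x, act (φ x)) →
    ∃ (D : C) (f : A ⟶ D) (j : ∀ x, B x ⟶ D), act f ∧ ∀ x, inert (j x) ∧
      elMap A x ≫ f = φ x ≫ j x
  ext_unique : ∀ (A : C) (B : El A → C) (φ : ∀ x, elObj A x ⟶ B x), (∀ x, act (φ x)) →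
    ∀ {D D' : C} (f : A ⟶ D) (j : ∀ x, B x ⟶ D) (f' : A ⟶ D') (j' : ∀ x, B x ⟶ D'),
      act f → (∀ x, inert (j x) ∧ elMap A x ≫ f = φ x ≫ j x) →
      act f' → (∀ x, inert (j' x) ∧ elMap A x ≫ f' = φ x ≫ j' x) →
        ∃! e : D ≅ D', f ≫ e.hom = f' ∧ ∀ x, j x ≫ e.hom = j' x

end Conditions

/-! ## Collections and operads -/

section Operads

open FinTensor

variable {C : Type u₁} [Category.{v₁} C] {E : Type u} [Category.{v} E]

/-- The category of `C`-collections in `E`: functors from the groupoid of isomorphisms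
of `C` to `E`. -/
abbrev Collection (C : Type u₁) [Category.{v₁} C] (E : Type u) [Category.{v} E] := Core C ⥤ E

/-- The value of a collection at an object. -/
abbrev val (X : Collection C E) (A : C) : E := X.obj ⟨A⟩

/-- The action of an isomorphism on a collection. -/
abbrev actBy (X : Collection C E) {A B : C} (e : A ≅ B) : val X A ⟶ val X B := X.map ⟨e⟩

variable [HypermomentCategory C] [MonoidalCategory E] [SymmetricCategory E]

/-- `X(f) = ⨂_α X(B_α)` for `f : A ⟶ B`. -/
noncomputable abbrev valMor (X : Collection C E) {A B : C} (f : A ⟶ B) : E :=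
  tens fun x : El A => val X (push f x)

/-- The identification of `X(A)` with `X(f)` for an active `f : U ⟶ A` with unital domain. -/
noncomputable def toUnitary (X : Collection C E) {U A : C} (hU : IsUnit U) (f : U ⟶ A)
    (hf : act f) : val X A ⟶ valMor X f :=
  (ρ_ (val X A)).inv ≫
    tensReindex (X := fun _ : Unit => val X A) (l := [()]) (fun _ => IsUnit.idx hU)
      (by
        have hc := hU.card
        rw [List.perm_ext_iff_of_nodup (by simp) (List.nodup_finRange _)]
        intro y
        have : y = IsUnit.idx hU := Fin.ext (by
          have := y.2
          have := (IsUnit.idx hU).2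
          omega)
        simp [this])
      (fun _ =>
        haveI := pushIn_isIso hU f hf (IsUnit.idx hU)
        actBy X (asIso (pushIn f (IsUnit.idx hU))).symm)

/-- The isomorphism `U_α ≅ B_α` belonging to `f : A ⟶ B` when `f_α` is invertible. -/
noncomputable def actIso {A B : C} (f : A ⟶ B) (x : El A) (h : IsIso (pushAct f x)) :
    elObj A x ≅ push f x := asIso (pushAct f x)

/-- The action of an isomorphism `(σ, ρ)` of active morphisms on the tensor products
`X(f)`. -/
noncomputable def transport (X : Collection C E) {A A' B B' : C} (σ : A ≅ A') (ρ : B ≅ B')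
    (f : A ⟶ B) (f' : A' ⟶ B') (w : f ≫ ρ.hom = σ.hom ≫ f') : valMor X f ⟶ valMor X f' :=
  tensReindex _ (perm_of_bijective (inertIdx_bijective σ)) fun x =>
    actBy X (compare σ.hom (inert_of_isIso _ inferInstance) ρ.hom
      (inert_of_isIso _ inferInstance) f f' w x)

/-- The identification of `⨂_α ⨂_β X(D_{α,β})` with `X(g)` for `f : A ⟶ B` active and
`g : B ⟶ D`, where `α` runs through `El A` and `β` through `El B_α`. -/
noncomputable def regroup (X : Collection C E) {A B D : C} (f : A ⟶ B) (hf : act f) (g : B ⟶ D)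
    (h : A ⟶ D) (w : f ≫ g = h) :
    (tens fun x : El A => valMor X (pushMap f g h w x)) ⟶ valMor X g :=
  tensSigma (fun (x : El A) (y : El (push f x)) => val X (push (pushMap f g h w x) y))
      (fun _ => List.finRange _) (List.finRange _) ≫
    tensReindex _ (perm_of_bijective_sigma (nested_bijective f hf))
      (fun p => actBy X (nested f g h w p.1 p.2))

variable (C E) in
/-- A `C`-operad in `E`. -/
structure Operad where
  coll : Collection C E
  /-- the units -/
  η : ∀ U : C, IsUnit U → (𝟙_ E ⟶ val coll U)
  /-- the multiplications `O(A) ⊗ O(f) ⟶ O(B)` -/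
  μ : ∀ {A B : C} (f : A ⟶ B), act f → (val coll A ⊗ valMor coll f ⟶ val coll B)
  left_unit : ∀ {U A : C} (hU : IsUnit U) (f : U ⟶ A) (hf : act f),
    (η U hU ⊗ₘ toUnitary coll hU f hf) ≫ μ f hf = (λ_ (val coll A)).hom
  right_unit : ∀ (A : C) (h : act (𝟙 A)),
    val coll A ◁ tensMap (fun x => η (elObj A x) (elObj_isUnit A x) ≫ actBy coll
        (actIso (𝟙 A) x (pushAct_isIso_of_inert _ (inert_of_isIso _ inferInstance) x)))
          (List.finRange _) ≫ μ (𝟙 A) h =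
      val coll A ◁ tensOne (List.finRange _) ≫ (ρ_ (val coll A)).hom
  assoc : ∀ {A B D : C} (f : A ⟶ B) (hf : act f) (g : B ⟶ D) (hg : act g) (h : A ⟶ D)
    (w : f ≫ g = h) (hh : act h),
    (α_ (val coll A) (valMor coll f) (tens fun x => valMor coll (pushMap f g h w x))).inv ≫
        (μ f hf ⊗ₘ regroup coll f hf g h w) ≫ μ g hg =
      val coll A ◁ (tensMul _ _ _ ≫
        tensMap (fun x => μ (pushMap f g h w x) (pushMap_act f g h w x)) _) ≫ μ h hh
  equivariant : ∀ {A A' B B' : C} (σ : A ≅ A') (ρ : B ≅ B') (f : A ⟶ B) (hf : act f)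
    (f' : A' ⟶ B') (hf' : act f') (w : f ≫ ρ.hom = σ.hom ≫ f'),
    (actBy coll σ ⊗ₘ transport coll σ ρ f f' w) ≫ μ f' hf' = μ f hf ≫ actBy coll ρ

/-- A morphism of `C`-operads: a map of collections commuting with the structure maps. -/
@[ext]
structure Operad.Hom (P Q : Operad C E) where
  map : P.coll ⟶ Q.coll
  η_map : ∀ (U : C) (hU : IsUnit U), P.η U hU ≫ map.app ⟨U⟩ = Q.η U hU
  μ_map : ∀ {A B : C} (f : A ⟶ B) (hf : act f),
    P.μ f hf ≫ map.app ⟨B⟩ =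
      (map.app ⟨A⟩ ⊗ₘ tensMap (fun x => map.app ⟨push f x⟩) _) ≫ Q.μ f hf

instance : Category (Operad C E) where
  Hom := Operad.Hom
  id P := ⟨𝟙 _, by simp, by intros; simp [tensMap_id]⟩
  comp φ ψ := ⟨φ.map ≫ ψ.map, by
    intro U hU
    simp [← Category.assoc, φ.η_map, ψ.η_map], by
    intro A B f hf
    rw [NatTrans.comp_app, ← Category.assoc, φ.μ_map, Category.assoc, ψ.μ_map,
      ← Category.assoc, MonoidalCategory.tensorHom_comp_tensorHom, ← tensMap_comp]
    rfl⟩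
  id_comp _ := Operad.Hom.ext (Category.id_comp _)
  comp_id _ := Operad.Hom.ext (Category.comp_id _)
  assoc _ _ _ := Operad.Hom.ext (Category.assoc _ _ _)

variable (C E) in
/-- The forgetful functor from `C`-operads to `C`-collections. -/
def forgetOperad : Operad C E ⥤ Collection C E where
  obj P := P.coll
  map φ := Operad.Hom.map φ
  map_id _ := rfl
  map_comp _ _ := rfl

end Operads

/-! ## `C`-trees -/

section Trees

variable {C : Type u₁} [Category.{v₁} C] [HypermomentCategory C]

/-- A marked `C`-tree with top object `A`: a chain `A₀ ⟶ A₁ ⟶ ⋯ ⟶ Aₘ = A` of active morphisms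
starting at a unit `A₀`, together with a set of marked vertices.  A vertex is an elementary
inert subobject `α` of some `Aᵢ`, `i < m`, and only effaceable vertices, those for which the
active part `U_α ⟶ (Aᵢ₊₁)_α` is invertible, may be marked. -/
inductive CTree : C → Type (max u₁ v₁)
  | root (U : C) (hU : IsUnit U) : CTree U
  | step {A B : C} (T : CTree A) (f : A ⟶ B) (hf : act f) (M : El A → Bool)
      (hM : ∀ x, M x = true → IsIso (pushAct f x)) : CTree B

namespace CTree

/-- The vertices of the next level that lie above a marked vertex are marked. -/
def MarksAbove : ∀ {A : C}, CTree A → (El A → Bool) → Prop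
  | _, root _ _, _ => True
  | _, step _ f _ M _, N => ∀ x, M x = true → ∀ y ∈ (γ.map f).set x, N y = true

/-- A marked `C`-tree is normal if all vertices above a marked vertex are marked, and each level
has an unmarked vertex.  So the marked vertices stretch leaves of smaller height to the top,
and the height is the least possible.  (In particular no `Aᵢ` with `i < m` is a nilobject.) -/
def Normal : ∀ {A : C}, CTree A → Prop
  | _, root _ _ => True
  | _, step T _ _ M _ => Normal T ∧ MarksAbove T M ∧ ∃ x, M x = false

/-- An isomorphism of marked `C`-trees lying over an isomorphism of the top objects. -/
inductive TreeIso : ∀ {A A' : C}, CTree A → CTree A' → (A ≅ A') → Type (max u₁ v₁)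
  | root {U U' : C} (hU : IsUnit U) (hU' : IsUnit U') (e : U ≅ U') :
      TreeIso (root U hU) (root U' hU') e
  | step {A A' B B' : C} {T : CTree A} {T' : CTree A'} {e : A ≅ A'} (θ : TreeIso T T' e)
      (f : A ⟶ B) (hf : act f) (M : El A → Bool) (hM : ∀ x, M x = true → IsIso (pushAct f x))
      (f' : A' ⟶ B') (hf' : act f') (M' : El A' → Bool)
      (hM' : ∀ x, M' x = true → IsIso (pushAct f' x))
      (e' : B ≅ B') (w : f ≫ e'.hom = e.hom ≫ f')
      (marks : ∀ x, M x = M' (inertIdx e.hom (inert_of_isIso _ inferInstance) x)) :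
      TreeIso (step T f hf M hM) (step T' f' hf' M' hM') e'

/-- `Stretching T T' e`: up to isomorphism `T'` arises from `T` by adding levels at the top which
consist of isomorphisms and all of whose vertices are marked; equivalently, `T'` has a
contraction to `T`. -/
inductive Stretching {A : C} (T : CTree A) : ∀ {B : C}, CTree B → (A ≅ B) → Type (max u₁ v₁)
  | ofIso {B : C} {T' : CTree B} {e : A ≅ B} (θ : TreeIso T T' e) : Stretching T T' e
  | step {B D : C} {T' : CTree B} {e : A ≅ B} (s : Stretching T T' e) (g : B ⟶ D) (hg : act g)
      (M : El B → Bool) (hM : ∀ x, M x = true → IsIso (pushAct g x)) (all : ∀ x, M x = true)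
      (e' : A ≅ D) (w : e.hom ≫ g = e'.hom) : Stretching T (T'.step g hg M hM) e'

end CTree

/-- A chain `A = A₀ ⟶ ⋯ ⟶ Aₙ = B` of active morphisms with composite `f : A ⟶ B` and with a set
of marked effaceable elementary inert subobjects of the `Aᵢ`, `i < n`. -/
inductive Chain (A : C) : ∀ {B : C}, (A ⟶ B) → Type (max u₁ v₁)
  | nil : Chain A (𝟙 A)
  | snoc {B D : C} {f : A ⟶ B} (R : Chain A f) (g : B ⟶ D) (hg : act g) (M : El B → Bool)
      (hM : ∀ x, M x = true → IsIso (pushAct g x)) (h : A ⟶ D) (w : f ≫ g = h) : Chain A h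

namespace Chain

theorem act {A B : C} {f : A ⟶ B} (R : Chain A f) : HypermomentCategory.act f := by
  induction R with
  | nil => exact act_of_isIso _ inferInstance
  | snoc R g hg M hM h w ih => exact w ▸ act_comp _ _ ih hg

/-- The concatenation of a tree with top object `A` and a chain starting at `A`. -/
def append {A : C} (T : CTree A) : ∀ {B : C} {f : A ⟶ B}, Chain A f → CTree B
  | _, _, nil => T
  | _, _, snoc R g hg M hM _ _ => CTree.step (append T R) g hg M hM

theorem isIso_nested {A B D : C} (f : A ⟶ B) (g : B ⟶ D) (h : A ⟶ D) (w : f ≫ g = h)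
    (x : El A) (y : El (push f x))
    (hi : IsIso (pushAct g (inertIdx (pushIn f x) (pushIn_inert f x) y))) :
    IsIso (pushAct (pushMap f g h w x) y) := by
  have := compare_act (pushIn f x) (pushIn_inert f x) (pushIn h x) (pushIn_inert h x)
    (pushMap f g h w x) g (pushMap_in f g h w x) y
  rw [← Iso.eq_comp_inv] at this
  rw [this]
  infer_instance

/-- The restriction of a chain to an elementary inert subobject `α` of `A`: the tree
`U_α ≅ (A₀)_α ⟶ (A₁)_α ⟶ ⋯ ⟶ (Aₙ)_α = B_α`. -/
noncomputable def restrict {A : C} (x : El A) :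
    ∀ {B : C} {f : A ⟶ B}, Chain A f → CTree (push f x)
  | _, _, nil => CTree.root (push (𝟙 A) x) (isUnit_of_iso
      (actIso (𝟙 A) x (pushAct_isIso_of_inert _ (inert_of_isIso _ inferInstance) x))
      (elObj_isUnit A x))
  | _, _, snoc (f := f) R g _ M hM h w =>
      CTree.step (restrict x R) (pushMap f g h w x) (pushMap_act f g h w x)
        (fun y => M (inertIdx (pushIn f x) (pushIn_inert f x) y))
        (fun y hy => isIso_nested f g h w x y (hM _ hy))

end Chain

/-! ## Tensor products over the vertices of a tree and evaluation in an operad -/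

open FinTensor

variable {E : Type u} [Category.{v} E] [MonoidalCategory E]

/-- The tensor factor of a vertex: the unit object of `E` if the vertex is marked. -/
def slot : Bool → E → E
  | true, _ => 𝟙_ E
  | false, P => P

/-- Functoriality of the tensor factor. -/
def slotMap {P Q : E} (g : P ⟶ Q) : ∀ {b b' : Bool}, b = b' → (slot b P ⟶ slot b' Q)
  | true, _, rfl => 𝟙 _
  | false, _, rfl => g

/-- The map out of a tensor factor which is `p` on a marked and the identity on an unmarked
vertex. -/
def slotElim {P : E} : ∀ b : Bool, (b = true → (𝟙_ E ⟶ P)) → (slot b P ⟶ P)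
  | true, p => p rfl
  | false, _ => 𝟙 _

/-- The identification of `I` with the tensor factor of a marked vertex. -/
def slotPoint (P : E) : ∀ {b : Bool}, b = true → (𝟙_ E ⟶ slot b P)
  | _, rfl => 𝟙 _

/-- `S(X, T)`: the tensor product of the objects `X((Aᵢ₊₁)_α)` over the unmarked vertices `α` of
the tree `T`. -/
noncomputable def treeTensor (X : Collection C E) : ∀ {A : C}, CTree A → E
  | _, .root _ _ => 𝟙_ E
  | _, .step T f _ M _ => treeTensor X T ⊗ tens fun x => slot (M x) (val X (push f x))

/-- Functoriality of `S(X, T)` in `X`. -/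
noncomputable def treeTensorMap {X Y : Collection C E} (φ : X ⟶ Y) :
    ∀ {A : C} (T : CTree A), treeTensor X T ⟶ treeTensor Y T
  | _, .root _ _ => 𝟙 _
  | _, .step T f _ _ _ =>
      treeTensorMap φ T ⊗ₘ tensMap (fun x => slotMap (φ.app ⟨push f x⟩) rfl) _

variable [SymmetricCategory E]

/-- The action of an isomorphism of trees on `S(X, -)`. -/
noncomputable def CTree.TreeIso.map (X : Collection C E) :
    ∀ {A A' : C} {T : CTree A} {T' : CTree A'} {e : A ≅ A'},
      CTree.TreeIso T T' e → (treeTensor X T ⟶ treeTensor X T')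
  | _, _, _, _, _, .root _ _ _ => 𝟙 _
  | _, _, _, _, _, .step (e := e) θ f _ _ _ f' _ _ _ e' w marks =>
      θ.map X ⊗ₘ tensReindex _ (perm_of_bijective (inertIdx_bijective e))
        (fun x => slotMap (actBy X (compare e.hom (inert_of_isIso _ inferInstance) e'.hom
          (inert_of_isIso _ inferInstance) f f' w x)) (marks x))

/-- The action of a stretching on `S(X, -)`: tensoring with `I` for the new marked vertices. -/
noncomputable def CTree.Stretching.map (X : Collection C E) {A : C} {T : CTree A} :
    ∀ {B : C} {T' : CTree B} {e : A ≅ B},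
      CTree.Stretching T T' e → (treeTensor X T ⟶ treeTensor X T')
  | _, _, _, .ofIso θ => θ.map X
  | _, _, _, .step s _ _ _ _ all _ _ =>
      s.map X ≫ (ρ_ _).inv ≫ _ ◁ tensPoint (fun x => slotPoint _ (all x)) _

/-- The canonical morphism `S(X, T) ⊗ ⨂_α S(X, R_α) ⟶ S(X, T R)`, for a chain `R` starting at the
top object of the tree `T`, which permutes the tensor factors. -/
noncomputable def Chain.shuffle (X : Collection C E) {A : C} (T : CTree A) :
    ∀ {B : C} {f : A ⟶ B} (R : Chain A f),
      (treeTensor X T ⊗ tens fun x => treeTensor X (R.restrict x)) ⟶ treeTensor X (R.append T)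
  | _, _, .nil => treeTensor X T ◁ tensOne _ ≫ (ρ_ _).hom
  | _, _, .snoc (f := f) R g _ M _ h w =>
      treeTensor X T ◁ tensSplit _ _ _ ≫ (α_ _ _ _).inv ≫
        (R.shuffle X T ⊗ₘ
          (tensSigma (fun (x : El A) (y : El (push f x)) =>
              slot (M (inertIdx (pushIn f x) (pushIn_inert f x) y))
                (val X (push (pushMap f g h w x) y)))
              (fun _ => List.finRange _) (List.finRange _) ≫
            tensReindex _ (perm_of_bijective_sigma (nested_bijective f R.act))
              (fun p => slotMap (actBy X (nested f g h w p.1 p.2)) rfl)))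

/-- The evaluation `S(O, T) ⟶ O(A)` of the trees with top object `A` in an operad `O`: the units
of `O` are inserted at the marked vertices, and the levels are composed one after another. -/
noncomputable def Operad.eval (O : Operad C E) :
    ∀ {A : C} (T : CTree A), treeTensor O.coll T ⟶ val O.coll A
  | _, .root U hU => O.η U hU
  | _, .step (A := A) T f hf M hM =>
      (O.eval T ⊗ₘ tensMap (fun x => slotElim (M x) (fun hx =>
        O.η (elObj A x) (elObj_isUnit A x) ≫ actBy O.coll (actIso f x (hM x hx)))) _) ≫ O.μ f hf

/-- The composite `S(X, T) ⟶ S(O, T) ⟶ O(A)` belonging to a map of collections `X ⟶ O`. -/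
noncomputable def Operad.treeMap {X : Collection C E} (O : Operad C E) (φ : X ⟶ O.coll) {A : C}
    (T : CTree A) : treeTensor X T ⟶ val O.coll A :=
  treeTensorMap φ T ≫ O.eval T

/-- The coend formula: for each `A` the maps `S(X, T) ⟶ O(A)` exhibit `O(A)` as the colimit of
`S(X, -)` over the groupoid of normal trees with top object `A` (with the isomorphisms that are
the identity on `A`). -/
def IsTreeCoend {X : Collection C E} (O : Operad C E) (φ : X ⟶ O.coll) : Prop :=
  ∀ A : C,
    (∀ (T T' : CTree A), T.Normal → T'.Normal → ∀ θ : CTree.TreeIso T T' (Iso.refl A),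
      θ.map X ≫ O.treeMap φ T' = O.treeMap φ T) ∧
    ∀ (Z : E) (g : ∀ T : CTree A, T.Normal → (treeTensor X T ⟶ Z)),
      (∀ (T T' : CTree A) (hT : T.Normal) (hT' : T'.Normal)
        (θ : CTree.TreeIso T T' (Iso.refl A)), θ.map X ≫ g T' hT' = g T hT) →
      ∃! k : val O.coll A ⟶ Z, ∀ (T : CTree A) (hT : T.Normal), O.treeMap φ T ≫ k = g T hT

/-- The maps `S(X, T) ⟶ O(A)` are compatible with stretching, hence with contraction. -/
def IsStretchInvariant {X : Collection C E} (O : Operad C E) (φ : X ⟶ O.coll) : Prop :=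
  ∀ {A B : C} (T : CTree A) (T' : CTree B) (e : A ≅ B) (s : CTree.Stretching T T' e),
    s.map X ≫ O.treeMap φ T' = O.treeMap φ T ≫ actBy O.coll e

/-- Simultaneous insertion: for active `f : A ⟶ B`, a tree `T` with top object `A` and trees `Q_α`
with top objects `B_α`, there is a chain `R` with composite `f` whose restrictions `R_α` are
stretchings of the `Q_α`; and for each such `R`, the multiplication `μ_f` of the elements of
`T` with those of the `Q_α` is given by the tree `T R`. -/
def IsComposedByInsertion {X : Collection C E} (O : Operad C E) (φ : X ⟶ O.coll) : Prop :=
  ∀ {A B : C} (f : A ⟶ B) (hf : act f) (T : CTree A) (Q : ∀ x : El A, CTree (push f x)),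
    (∃ R : Chain A f, ∀ x, Nonempty (CTree.Stretching (Q x) (R.restrict x) (Iso.refl _))) ∧
    ∀ (R : Chain A f) (s : ∀ x, CTree.Stretching (Q x) (R.restrict x) (Iso.refl _)),
      (O.treeMap φ T ⊗ₘ tensMap (fun x => O.treeMap φ (Q x)) _) ≫ O.μ f hf =
        treeTensor X T ◁ tensMap (fun x => (s x).map X) _ ≫ R.shuffle X T ≫
          O.treeMap φ (R.append T)

end Trees

end HypermomentCategory

/-!
The proof constructs the free operad from trees presented by grafting, and compares these with the
trees with levels of the statement.

*The free operad.* A tree presented by grafting (`GTree`) is either a unit, or a vertex labelled by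
the source of an active morphism `d : D ⟶ A` together with a tree over each part of `d`. Such
trees over `A`, up to isomorphism (`GIso`), index the colimit `freeColl X A`. As `E` is closed, a
tensor product of colimits is a colimit over families of trees (`IsUniv.tens`), so that the grafting
of trees on `d` becomes a map `freeNode : X(D) ⊗ F(X)(d) ⟶ F(X)(A)`. The multiplication `freeMul`
is defined by recursion on the tree over the source of `f` (`GTree.graft`), through
`freeNode_freeMul`: multiplying a node along `f` is multiplying its subtrees along the parts of `f`
and grafting the results on `d ≫ f`. With this recursion formula the unit laws, associativity and
the universal property follow by induction on trees, and the resulting operad `freeOperad X` is free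
on `X` (`freeLift`, `freeLift_unique`). Levels play no role here, and neither does extensionality.

*Monadicity.* If the underlying parallel pair of two operad morphisms has a split coequalizer, the
operad structure passes to it, because a split epimorphism remains split after tensoring
(`Operad.ofSplitEpi`, `exists_coequalizer`). Beck's theorem applies (`nonempty_monadic`).

*Stretching and insertion.* For each map from a collection to an operad, a level of isomorphisms
with units inserted at all vertices composes to the action of an isomorphism by the right unit axiom
(`CTree.Stretching.map_treeMap`), and the evaluation of a concatenation is computed by associativity
(`Chain.shuffle_treeMap`). That trees over the parts of `f` stretch to a chain with composite `f` is
strong extensionality: trees of equal height glue level by level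
(`StronglyExtensional.exists_chain`, `StronglyExtensional.exists_chain_stretching`).

*The coend formula.* The relation `Represents` says that a tree with levels arises from a tree
presented by grafting by stretching all leaves to the same height. Each tree presented by
grafting is represented by a normal tree (`StronglyExtensional.exists_normal`), the one of least
height (`Represents.normal_iff`). Each tree with levels in which vertices above marked ones are
marked represents some tree presented by grafting (`exists_represents_of_marksUp`). An isomorphism
of trees presented by grafting induces one of the representing trees if these have equal height
(`Represents.exists_treeIso`), by strong extensionality, which allows isomorphisms of restrictions
to be glued (`StronglyExtensional.exists_treeIso`). Evaluations agree (`Represents.treeMap`). Hence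
the colimit over trees presented by grafting is also the colimit over normal trees (`isTreeCoend`).

*Coherence.* Tensor products are indexed by lists. All canonical isomorphisms are composites of
`tensReindex` (a change of labels with morphisms of the factors), `tensSigma` (flattening of an
iterated product) and `tensMul`/`tensSplit` (products of pairs). Their calculus, for instance
`tensReindex_comp`, `tensReindex_tensSigma` and `tensSigma_tensSigma`, reduces each coherence
question to one about labels; there the isomorphisms of parts are the comparison isomorphisms
`cmp`, which are determined by uniqueness of active/inert factorizations (`cmp_unique`).
-/

-- the recursive definitions have to unfold in the types of morphisms between tensor products
attribute [reducible] FinTensor.tensL HypermomentCategory.treeTensor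
  HypermomentCategory.Chain.restrict HypermomentCategory.Chain.append

/-! ### Permuting the factors of a tensor product -/

namespace FinTensor

section Monoidal

variable {E : Type u} [Category.{v} E] [MonoidalCategory E]

/-- The identification of the tensor products over two equal lists. -/
def tensCast {ι : Type*} (X : ι → E) {l l' : List ι} (h : l = l') : tensL X l ⟶ tensL X l' :=
  eqToHom (by rw [h])

@[simp] theorem tensCast_rfl {ι : Type*} (X : ι → E) (l : List ι) :
    tensCast X (rfl : l = l) = 𝟙 _ := rfl

theorem tensCast_cons {ι : Type*} (X : ι → E) {l l' : List ι} (h : l = l') (c : ι)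
    (h' : c :: l = c :: l') : tensCast X h' = X c ◁ tensCast X h := by
  subst h; exact (MonoidalCategory.whiskerLeft_id _ _).symm

@[simp]
theorem tensCast_trans {ι : Type*} (X : ι → E) {l l' l'' : List ι} (h : l = l')
    (h' : l' = l'') : tensCast X h ≫ tensCast X h' = tensCast X (h.trans h') := by
  subst h h'; simp

theorem tensMapIdx_comp {ι κ τ : Type*} {X : ι → E} {Y : κ → E} {Z : τ → E} (e : ι → κ)
    (e' : κ → τ) (φ : ∀ i, X i ⟶ Y (e i)) (ψ : ∀ k, Y k ⟶ Z (e' k)) (l : List ι) :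
    tensMapIdx e φ l ≫ tensMapIdx e' ψ (l.map e) =
      tensMapIdx (e' ∘ e) (fun i => φ i ≫ ψ (e i)) l ≫ tensCast Z (by simp) := by
  induction l with
  | nil => rfl
  | cons i l ih =>
    change (φ i ⊗ₘ tensMapIdx e φ l) ≫ (ψ (e i) ⊗ₘ tensMapIdx e' ψ (l.map e)) =
      (_ ⊗ₘ tensMapIdx (e' ∘ e) (fun i => φ i ≫ ψ (e i)) l) ≫
        tensCast Z (show e' (e i) :: l.map (e' ∘ e) = e' (e i) :: (l.map e).map e' by simp)
    rw [tensorHom_comp_tensorHom, ih, tensCast_cons Z (by simp), tensorHom_comp_whiskerLeft]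

theorem tensMapIdx_id {ι : Type*} {X Y : ι → E} (φ : ∀ i, X i ⟶ Y i) (l : List ι) :
    tensMapIdx id φ l = tensMap φ l ≫ tensCast Y (by simp) := by
  induction l with
  | nil => exact (Category.comp_id _).symm
  | cons i l ih =>
    change (φ i ⊗ₘ tensMapIdx id φ l) = (φ i ⊗ₘ tensMap φ l) ≫
        tensCast Y (show i :: l = i :: l.map id by simp)
    rw [ih, tensCast_cons Y (by simp), tensorHom_comp_whiskerLeft]

instance tensMapIdx_isIso {ι κ : Type*} {X : ι → E} {Y : κ → E} (e : ι → κ)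
    (φ : ∀ i, X i ⟶ Y (e i)) [∀ i, IsIso (φ i)] (l : List ι) : IsIso (tensMapIdx e φ l) := by
  induction l with
  | nil => exact inferInstanceAs (IsIso (𝟙 _))
  | cons i l ih =>
    exact inferInstanceAs (IsIso (φ i ⊗ₘ tensMapIdx e φ l))

instance tensMap_isIso {ι : Type*} {X Y : ι → E}
    (φ : ∀ i, X i ⟶ Y i) [∀ i, IsIso (φ i)] (l : List ι) : IsIso (tensMap φ l) := by
  induction l with
  | nil => exact inferInstanceAs (IsIso (𝟙 _))
  | cons i l ih => simp only [tensMap]; infer_instance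

instance tensAppend_isIso {ι : Type*} (X : ι → E) (l' l : List ι) :
    IsIso (tensAppend X l' l) := by
  induction l with
  | nil => simp only [tensAppend]; infer_instance
  | cons i l ih => simp only [tensAppend]; infer_instance

instance tensSigma_isIso {ι : Type*} {κ : ι → Type*} (Y : ∀ i, κ i → E) (m : ∀ i, List (κ i))
    (l : List ι) : IsIso (tensSigma Y m l) := by
  induction l with
  | nil => exact inferInstanceAs (IsIso (𝟙 _))
  | cons i l ih =>
    exact inferInstanceAs (IsIso ((tensMapIdx (X := Y i) (Y := fun p : Σ i, κ i => Y p.1 p.2)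
      (Sigma.mk i) (fun _ => 𝟙 _) (m i) ⊗ₘ tensSigma Y m l) ≫ tensAppend _ _ _))

instance tensCast_isIso {ι : Type*} (X : ι → E) {l l' : List ι} (h : l = l') :
    IsIso (tensCast X h) := by unfold tensCast; infer_instance

instance tensOne_isIso {ι : Type*} (l : List ι) :
    IsIso (tensOne (E := E) l) := by
  induction l with
  | nil => exact inferInstanceAs (IsIso (𝟙 _))
  | cons i l ih => simp only [tensOne]; infer_instance

end Monoidal

section Symmetric

variable {E : Type u} [Category.{v} E] [MonoidalCategory E] [SymmetricCategory E]

/-- The isomorphism exchanging the two first factors of a triple tensor product. -/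
def swap₁₂ (A B P : E) : A ⊗ (B ⊗ P) ⟶ B ⊗ (A ⊗ P) :=
  (α_ A B P).inv ≫ (β_ A B).hom ▷ P ≫ (α_ B A P).hom

instance (A B P : E) : IsIso (swap₁₂ A B P) := by unfold swap₁₂; infer_instance

theorem swap₁₂_naturality {A A' B B' P P' : E} (f : A ⟶ A') (g : B ⟶ B') (h : P ⟶ P') :
    (f ⊗ₘ (g ⊗ₘ h)) ≫ swap₁₂ A' B' P' = swap₁₂ A B P ≫ (g ⊗ₘ (f ⊗ₘ h)) := by
  simp only [swap₁₂, associator_inv_naturality_assoc, Category.assoc]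
  rw [← associator_naturality]
  congr 1
  rw [← Category.assoc, ← Category.assoc]
  congr 1
  rw [tensorHom_comp_whiskerRight, whiskerRight_comp_tensorHom,
    BraidedCategory.braiding_naturality]

theorem swap₁₂_right {A B P P' : E} (h : P ⟶ P') :
    A ◁ B ◁ h ≫ swap₁₂ A B P' = swap₁₂ A B P ≫ B ◁ A ◁ h := by
  simpa using swap₁₂_naturality (𝟙 A) (𝟙 B) h

theorem swap₁₂_right_assoc {A B P P' Z : E} (h : P ⟶ P') (k : B ⊗ (A ⊗ P') ⟶ Z) :
    A ◁ B ◁ h ≫ swap₁₂ A B P' ≫ k = swap₁₂ A B P ≫ B ◁ A ◁ h ≫ k := by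
  rw [← Category.assoc, swap₁₂_right, Category.assoc]

@[simp] theorem swap₁₂_swap₁₂ (A B P : E) :
    swap₁₂ A B P ≫ swap₁₂ B A P = 𝟙 _ := by
  simp only [swap₁₂, Category.assoc, Iso.hom_inv_id_assoc]
  rw [← comp_whiskerRight_assoc]
  simp

@[simp] theorem swap₁₂_swap₁₂_assoc (A B P : E) {Z : E} (k : A ⊗ (B ⊗ P) ⟶ Z) :
    swap₁₂ A B P ≫ swap₁₂ B A P ≫ k = k := by
  rw [← Category.assoc, swap₁₂_swap₁₂, Category.id_comp]

/-- The two ways of reversing the order of three factors agree. -/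
theorem swap₁₂_braid (A B D P : E) :
    swap₁₂ A B (D ⊗ P) ≫ B ◁ swap₁₂ A D P ≫ swap₁₂ B D (A ⊗ P) =
      A ◁ swap₁₂ B D P ≫ swap₁₂ A D (B ⊗ P) ≫ D ◁ swap₁₂ A B P := by
  have h₁ : swap₁₂ A B (D ⊗ P) ≫ B ◁ swap₁₂ A D P =
      A ◁ (α_ B D P).inv ≫ swap₁₂ A (B ⊗ D) P ≫ (α_ B D (A ⊗ P)).hom := by
    simp only [swap₁₂, BraidedCategory.braiding_tensor_right_hom]
    monoidal
  have h₂ : swap₁₂ A D (B ⊗ P) ≫ D ◁ swap₁₂ A B P =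
      A ◁ (α_ D B P).inv ≫ swap₁₂ A (D ⊗ B) P ≫ (α_ D B (A ⊗ P)).hom := by
    simp only [swap₁₂, BraidedCategory.braiding_tensor_right_hom]
    monoidal
  rw [reassoc_of% h₁, h₂]
  have h₃ : (α_ B D (A ⊗ P)).hom ≫ swap₁₂ B D (A ⊗ P) =
      (β_ B D).hom ▷ (A ⊗ P) ≫ (α_ D B (A ⊗ P)).hom := by simp [swap₁₂]
  have h₄ : A ◁ swap₁₂ B D P ≫ A ◁ (α_ D B P).inv =
      A ◁ (α_ B D P).inv ≫ A ◁ (β_ B D).hom ▷ P := by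
    simp only [← MonoidalCategory.whiskerLeft_comp]; simp [swap₁₂]
  rw [h₃, reassoc_of% h₄]
  congr 1
  have := swap₁₂_naturality (𝟙 A) (β_ B D).hom (𝟙 P)
  simp only [id_tensorHom, tensorHom_id, id_whiskerRight] at this
  rw [reassoc_of% this]

variable {ι : Type*} [DecidableEq ι]

theorem tensInsert_self (X : ι → E) (a : ι) (l : List ι) (h : a ∈ a :: l) :
    tensInsert X a (a :: l) h = X a ◁ tensCast X (by simp) := by
  have : ∀ (l' : List ι) (h' : l' = l), eqToHom (by rw [h']) = X a ◁ tensCast X h' := by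
    rintro _ rfl; simp
  rw [tensInsert, dif_pos rfl]
  exact this _ _

theorem tensInsert_of_ne (X : ι → E) {a b : ι} (hb : b ≠ a) (l : List ι) (h : a ∈ b :: l)
    (h' : a ∈ l) :
    tensInsert X a (b :: l) h =
      X a ◁ tensCast X (List.erase_cons_tail (by simpa using hb)) ≫ swap₁₂ (X a) (X b) _ ≫
        X b ◁ tensInsert X a l h' := by
  have : ∀ (l' : List ι) (h' : l' = b :: l.erase a),
      eqToHom (by rw [h']) = X a ◁ tensCast X h' := by
    rintro _ rfl; simp
  rw [tensInsert, dif_neg hb, ← this]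
  simp only [swap₁₂, Category.assoc]

instance tensInsert_isIso (X : ι → E) (a : ι) (l : List ι) (h : a ∈ l) :
    IsIso (tensInsert X a l h) := by
  induction l with
  | nil => simp at h
  | cons b l ih =>
    by_cases hb : b = a
    · subst hb; rw [tensInsert_self]; infer_instance
    · have h' : a ∈ l := by simpa [Ne.symm hb] using h
      have := ih h'
      rw [tensInsert_of_ne X hb l h h']; infer_instance

instance tensPerm_isIso (X : ι → E) (l l' : List ι) (h : l.Perm l') :
    IsIso (tensPerm X l l' h) := by
  induction l generalizing l' with
  | nil => simp only [tensPerm]; infer_instance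
  | cons a l ih =>
    have := ih _ (List.cons_perm_iff_perm_erase.1 h).2
    simp only [tensPerm]
    infer_instance

instance tensReindex_isIso {κ : Type*} {X : κ → E} {Y : ι → E} {l : List κ} {l' : List ι}
    (e : κ → ι) (h : (l.map e).Perm l') (φ : ∀ i, X i ⟶ Y (e i)) [∀ i, IsIso (φ i)] :
    IsIso (tensReindex e h φ) := by unfold tensReindex; infer_instance

theorem tensPerm_cast (X : ι → E) {l l' l'' : List ι} (h : l.Perm l') (h' : l' = l'') :
    tensPerm X l l' h ≫ tensCast X h' = tensPerm X l l'' (h' ▸ h) := by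
  subst h'; simp

theorem tensPerm_refl (X : ι → E) (l : List ι) (h : l.Perm l) : tensPerm X l l h = 𝟙 _ := by
  induction l with
  | nil => rfl
  | cons a l ih =>
    simp only [tensPerm]
    rw [tensInsert_self, ← MonoidalCategory.whiskerLeft_comp, tensPerm_cast, ih]
    exact MonoidalCategory.whiskerLeft_id _ _

theorem tensCast_eq_perm (X : ι → E) {l l' : List ι} (h : l = l') :
    tensCast X h = tensPerm X l l' (h ▸ List.Perm.refl _) := by
  subst h; simp [tensPerm_refl]

theorem tensPerm_cons (X : ι → E) (a : ι) {l l' : List ι} (h : l.Perm l')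
    (h' : (a :: l).Perm (a :: l')) :
    tensPerm X (a :: l) (a :: l') h' = X a ◁ tensPerm X l l' h := by
  simp only [tensPerm]
  rw [tensInsert_self, ← MonoidalCategory.whiskerLeft_comp, tensPerm_cast]

/-- Moving the factor of index `a` to its place in the list `l`, where `l₀` is `l` without
this entry. -/
def tensIns (X : ι → E) (a : ι) (l₀ l : List ι) (ha : a ∈ l) (h : l.erase a = l₀) :
    X a ⊗ tensL X l₀ ⟶ tensL X l :=
  X a ◁ tensCast X h.symm ≫ tensInsert X a l ha

theorem tensIns_self (X : ι → E) (a : ι) (l : List ι) (ha : a ∈ a :: l)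
    (h : (a :: l).erase a = l) : tensIns X a l (a :: l) ha h = 𝟙 _ := by
  rw [tensIns, tensInsert_self, ← MonoidalCategory.whiskerLeft_comp]
  simp

theorem tensIns_of_ne (X : ι → E) {a b : ι} (hb : b ≠ a) (l₀ l : List ι) (ha : a ∈ b :: l)
    (ha' : a ∈ l) (h : (b :: l).erase a = b :: l₀) (h' : l.erase a = l₀) :
    tensIns X a (b :: l₀) (b :: l) ha h = swap₁₂ _ _ _ ≫ X b ◁ tensIns X a l₀ l ha' h' := by
  subst h'
  rw [tensIns, tensInsert_of_ne X hb l ha ha', ← MonoidalCategory.whiskerLeft_comp_assoc]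
  simp [tensIns]

/-- Two factors may be inserted in either order. -/
theorem tensIns_comm (X : ι → E) {a b : ι} (hab : a ≠ b) (l₀ la lb l : List ι) (ha : a ∈ l)
    (hb : b ∈ l) (ha' : a ∈ lb) (hb' : b ∈ la) (ea : l.erase a = la) (eb : l.erase b = lb)
    (eab : la.erase b = l₀) (eba : lb.erase a = l₀) :
    X a ◁ tensIns X b l₀ la hb' eab ≫ tensIns X a la l ha ea =
      swap₁₂ (X a) (X b) _ ≫ X b ◁ tensIns X a l₀ lb ha' eba ≫ tensIns X b lb l hb eb := by
  induction l generalizing l₀ la lb with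
  | nil => simp at ha
  | cons c l ih =>
    by_cases hca : c = a
    · subst hca
      obtain rfl : l = la := by simpa using ea
      have hl : (c :: l).erase b = c :: l.erase b := List.erase_cons_tail (by simpa using hab)
      obtain rfl : lb = c :: l.erase b := eb.symm.trans hl
      obtain rfl : l₀ = l.erase b := eab.symm
      rw [tensIns_self, tensIns_self, tensIns_of_ne X hab _ _ _ hb' _ rfl]
      simp
    · by_cases hcb : c = b
      · subst hcb
        obtain rfl : l = lb := by simpa using eb
        have hl : (c :: l).erase a = c :: l.erase a := List.erase_cons_tail (by simpa using hca)
        obtain rfl : la = c :: l.erase a := ea.symm.trans hl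
        obtain rfl : l₀ = l.erase a := eba.symm
        rw [tensIns_self, tensIns_self, tensIns_of_ne X hca _ _ _ ha' _ rfl]
        simp
      · have ha₁ : a ∈ l := by simpa [Ne.symm hca] using ha
        have hb₁ : b ∈ l := by simpa [Ne.symm hcb] using hb
        have hla : (c :: l).erase a = c :: l.erase a := List.erase_cons_tail (by simpa using hca)
        have hlb : (c :: l).erase b = c :: l.erase b := List.erase_cons_tail (by simpa using hcb)
        obtain rfl : la = c :: l.erase a := ea.symm.trans hla
        obtain rfl : lb = c :: l.erase b := eb.symm.trans hlb
        have hl₀ : (c :: l.erase a).erase b = c :: (l.erase a).erase b :=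
          List.erase_cons_tail (by simpa using hcb)
        obtain rfl : l₀ = c :: (l.erase a).erase b := eab.symm.trans hl₀
        have ha₂ : a ∈ l.erase b := (List.mem_erase_of_ne hab).2 ha₁
        have hb₂ : b ∈ l.erase a := (List.mem_erase_of_ne hab.symm).2 hb₁
        -- both factors move past the first entry `c`: the induction hypothesis and the braid
        -- relation
        have key := ih ((l.erase a).erase b) (l.erase a) (l.erase b) ha₁ hb₁ ha₂ hb₂ rfl rfl rfl
          (List.erase_comm ..)
        rw [tensIns_of_ne X hcb _ _ _ hb₂ _ rfl, tensIns_of_ne X hca _ _ _ ha₁ _ rfl,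
          tensIns_of_ne X hca _ _ _ ha₂ _ (List.erase_comm ..),
          tensIns_of_ne X hcb _ _ _ hb₁ _ rfl]
        simp only [MonoidalCategory.whiskerLeft_comp, Category.assoc, swap₁₂_right_assoc]
        rw [← MonoidalCategory.whiskerLeft_comp, key]
        simp only [MonoidalCategory.whiskerLeft_comp]
        have := swap₁₂_braid (X a) (X b) (X c) (tensL X ((l.erase a).erase b))
        rw [← reassoc_of% this]

theorem tensPerm_cons_eq (X : ι → E) (a : ι) (l l₀ l' : List ι) (h : (a :: l).Perm l')
    (ha : a ∈ l') (e : l'.erase a = l₀) (h₀ : l.Perm l₀) :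
    tensPerm X (a :: l) l' h = X a ◁ tensPerm X l l₀ h₀ ≫ tensIns X a l₀ l' ha e := by
  subst e
  simp [tensPerm, tensIns]

/-- Inserting a factor and then permuting is the same as permuting the other factors first and
inserting the factor at its final place. -/
theorem tensIns_perm (X : ι → E) (a : ι) (l₀ l l₀' l' : List ι) (ha : a ∈ l) (e : l.erase a = l₀)
    (ha' : a ∈ l') (e' : l'.erase a = l₀') (h : l.Perm l') (h₀ : l₀.Perm l₀') :
    tensIns X a l₀ l ha e ≫ tensPerm X l l' h =
      X a ◁ tensPerm X l₀ l₀' h₀ ≫ tensIns X a l₀' l' ha' e' := by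
  induction l generalizing l₀ l₀' l' with
  | nil => simp at ha
  | cons b l ih =>
    by_cases hba : b = a
    · subst hba
      obtain rfl : l = l₀ := by simpa using e
      rw [tensIns_self, Category.id_comp, tensPerm_cons_eq X b l l₀' l' h ha' e' h₀]
    · have hl : (b :: l).erase a = b :: l.erase a := List.erase_cons_tail (by simpa using hba)
      obtain rfl : l₀ = b :: l.erase a := e.symm.trans hl
      subst e'
      have ha₁ : a ∈ l := by simpa [Ne.symm hba] using ha
      have hb' : b ∈ l' := h.subset (by simp)
      have hb'' : b ∈ l'.erase a := (List.mem_erase_of_ne hba).2 hb'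
      have ha'' : a ∈ l'.erase b := (List.mem_erase_of_ne (Ne.symm hba)).2 ha'
      have h₁ : l.Perm (l'.erase b) := by simpa using h.erase b
      have h₂ : (l.erase a).Perm ((l'.erase b).erase a) := h₁.erase a
      have h₃ : (l.erase a).Perm ((l'.erase a).erase b) := List.erase_comm a b ▸ h₂
      rw [tensIns_of_ne X hba _ _ _ ha₁ _ rfl, tensPerm_cons_eq X b l _ l' h hb' rfl h₁,
        tensPerm_cons_eq X b (l.erase a) _ (l'.erase a) h₀ hb'' rfl h₃]
      -- `b` is inserted last in `l` and the factor of index `a` before or after it in `l'`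
      have key := tensIns_comm X (Ne.symm hba) ((l'.erase a).erase b) (l'.erase a) (l'.erase b) l'
        ha' hb' ha'' hb'' rfl rfl rfl (List.erase_comm ..)
      have key₂ := ih (l.erase a) ((l'.erase a).erase b) (l'.erase b) ha₁ rfl ha''
        (List.erase_comm ..) h₁ h₃
      simp only [MonoidalCategory.whiskerLeft_comp, Category.assoc, key]
      rw [← MonoidalCategory.whiskerLeft_comp_assoc, key₂, swap₁₂_right_assoc]
      simp only [MonoidalCategory.whiskerLeft_comp, Category.assoc]

/-- Functoriality of reorderings. Together with `tensPerm_refl` this replaces the coherence theorem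
for symmetric monoidal categories: a reordering depends only on the two lists. -/
theorem tensPerm_trans (X : ι → E) (l l' l'' : List ι) (h : l.Perm l') (h' : l'.Perm l'')
    (h'' : l.Perm l'') :
    tensPerm X l l' h ≫ tensPerm X l' l'' h' = tensPerm X l l'' h'' := by
  induction l generalizing l' l'' with
  | nil =>
    obtain rfl := List.nil_perm.1 h
    obtain rfl := List.nil_perm.1 h'
    simp [tensPerm_refl]
  | cons a l ih =>
    have ha' : a ∈ l' := h.subset (by simp)
    have ha'' : a ∈ l'' := h'.subset ha'
    have h₀ : l.Perm (l'.erase a) := by simpa using h.erase a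
    have h₁ : (l'.erase a).Perm (l''.erase a) := h'.erase a
    rw [tensPerm_cons_eq X a l _ l' h ha' rfl h₀, Category.assoc,
      tensIns_perm X a _ _ _ _ ha' rfl ha'' rfl h' h₁, ← MonoidalCategory.whiskerLeft_comp_assoc,
      ih _ _ h₀ h₁ (h₀.trans h₁), ← tensPerm_cons_eq X a l _ l'' h'' ha'' rfl]

theorem tensPerm_swap (X : ι → E) {a b : ι} (hab : a ≠ b) (l : List ι)
    (h : (a :: b :: l).Perm (b :: a :: l)) :
    tensPerm X (a :: b :: l) (b :: a :: l) h = swap₁₂ (X a) (X b) (tensL X l) := by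
  rw [tensPerm_cons_eq X a (b :: l) (b :: l) (b :: a :: l) h (by simp)
    (by rw [List.erase_cons_tail (by simpa using hab.symm)]; simp) (List.Perm.refl _),
    tensPerm_refl, tensIns_of_ne X hab.symm l (a :: l) _ (by simp) _ (by simp), tensIns_self]
  simp

/-- A family of morphisms may be moved past a permutation of the factors, also when it
comes with a change of the index type. -/
theorem tensPerm_tensMapIdx {κ : Type*} [DecidableEq κ] {X : ι → E} {Y : κ → E} (e : ι → κ)
    (φ : ∀ i, X i ⟶ Y (e i)) {l l' : List ι} (h : l.Perm l') (hl : (l.map e).Nodup) :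
    tensPerm X l l' h ≫ tensMapIdx e φ l' =
      tensMapIdx e φ l ≫ tensPerm Y (l.map e) (l'.map e) (h.map e) := by
  induction h with
  | nil => exact (Category.id_comp _).trans (Category.comp_id _).symm
  | cons a h ih =>
    rename_i l₁ l₂
    rw [tensPerm_cons X a h]
    change _ ≫ (φ a ⊗ₘ tensMapIdx e φ l₂) = (φ a ⊗ₘ tensMapIdx e φ l₁) ≫
      tensPerm Y (e a :: l₁.map e) (e a :: l₂.map e) _
    rw [tensPerm_cons Y (e a) (h.map e), whiskerLeft_comp_tensorHom, tensorHom_comp_whiskerLeft,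
      ih (by simp at hl; exact hl.2)]
  | swap a b l₁ =>
    simp only [List.map_cons, List.nodup_cons, List.mem_cons, not_or] at hl
    have hne : e b ≠ e a := hl.1.1
    rw [tensPerm_swap X (fun h => hne (by rw [h]))]
    change _ ≫ (φ a ⊗ₘ (φ b ⊗ₘ tensMapIdx e φ l₁)) = (φ b ⊗ₘ (φ a ⊗ₘ tensMapIdx e φ l₁)) ≫
      tensPerm Y (e b :: e a :: l₁.map e) (e a :: e b :: l₁.map e) _
    rw [tensPerm_swap Y hne, swap₁₂_naturality]
  | trans h₁ h₂ ih₁ ih₂ =>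
    rw [← tensPerm_trans X _ _ _ h₁ h₂, Category.assoc, ih₂ ((h₁.map e).nodup_iff.1 hl),
      ← Category.assoc, ih₁ hl, Category.assoc, tensPerm_trans Y _ _ _ _ _ ((h₁.trans h₂).map e)]

/-- Reindexings compose. Since a reindexing is determined by its index map and its components, this
reduces most coherence questions to equalities of index maps and of components. -/
theorem tensReindex_comp {ι κ τ : Type*} [DecidableEq κ] [DecidableEq τ] {X : ι → E} {Y : κ → E}
    {Z : τ → E} {l : List ι} {l' : List κ} {l'' : List τ} (e : ι → κ) (e' : κ → τ)
    (h : (l.map e).Perm l') (h' : (l'.map e').Perm l'') (φ : ∀ i, X i ⟶ Y (e i))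
    (ψ : ∀ k, Y k ⟶ Z (e' k)) (hl : l''.Nodup) :
    tensReindex e h φ ≫ tensReindex e' h' ψ =
      tensReindex (e' ∘ e) (by rw [← List.map_map]; exact (h.map e').trans h')
        (fun i => φ i ≫ ψ (e i)) := by
  simp only [tensReindex, Category.assoc]
  have hn := (h'.nodup_iff.2 hl)
  rw [← Category.assoc (tensPerm Y _ _ h), tensPerm_tensMapIdx e' ψ h ((h.map e').nodup_iff.2 hn),
    Category.assoc, tensPerm_trans _ _ _ _ _ _ ((h.map e').trans h'), ← Category.assoc,
    tensMapIdx_comp, Category.assoc, tensCast_eq_perm, tensPerm_trans]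

theorem tensReindex_congr {κ : Type*} {X : κ → E} {Y : ι → E} {l : List κ} {l' : List ι}
    {e e' : κ → ι} {h : (l.map e).Perm l'} {h' : (l.map e').Perm l'}
    {φ : ∀ i, X i ⟶ Y (e i)} {ψ : ∀ i, X i ⟶ Y (e' i)} (he : ∀ i, e i = e' i)
    (hφ : ∀ i, φ i ≫ eqToHom (by rw [he]) = ψ i) :
    tensReindex e h φ = tensReindex e' h' ψ := by
  obtain rfl : e = e' := funext he
  obtain rfl : φ = ψ := funext fun i => by simpa using hφ i
  rfl

theorem tensReindex_id {X Y : ι → E} {l : List ι} (h : (l.map id).Perm l)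
    (φ : ∀ i, X i ⟶ Y i) : tensReindex id h φ = tensMap φ l := by
  rw [tensReindex, tensMapIdx_id, Category.assoc, tensCast_eq_perm,
    tensPerm_trans _ _ _ _ _ _ (List.Perm.refl _), tensPerm_refl, Category.comp_id]

theorem tensPerm_eq_tensReindex (X : ι → E) {l l' : List ι} (h : l.Perm l') :
    tensPerm X l l' h = tensReindex id (by simpa using h) (fun i => 𝟙 (X i)) := by
  rw [tensReindex, tensMapIdx_id, tensMap_id, Category.id_comp, tensCast_eq_perm,
    tensPerm_trans _ _ _ _ _ _ h]

theorem tensMapIdx_eq_tensReindex {κ : Type*} {X : κ → E} {Y : ι → E} (e : κ → ι)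
    (φ : ∀ i, X i ⟶ Y (e i)) (l : List κ) :
    tensMapIdx e φ l = tensReindex e (List.Perm.refl _) φ := by
  rw [tensReindex, tensPerm_refl, Category.comp_id]

end Symmetric
end FinTensor

/-! ### Concatenation of tensor products -/

namespace FinTensor

section Monoidal

variable {E : Type u} [Category.{v} E] [MonoidalCategory E]

theorem tensMap_id' {ι : Type*} {X : ι → E} {φ : ∀ i, X i ⟶ X i} (h : ∀ i, φ i = 𝟙 _)
    (l : List ι) : tensMap φ l = 𝟙 _ := by
  obtain rfl : φ = fun i => 𝟙 _ := funext h
  exact tensMap_id X l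

theorem tensMap_tensMap {ι : Type*} {X Y Z : ι → E} (φ : ∀ i, X i ⟶ Y i) (ψ : ∀ i, Y i ⟶ Z i)
    (l : List ι) : tensMap φ l ≫ tensMap ψ l = tensMap (fun i => φ i ≫ ψ i) l :=
  (tensMap_comp φ ψ l).symm

theorem tensMap_mapIdx {ι κ : Type*} {X X' : ι → E} {Y : κ → E} (e : ι → κ)
    (ψ : ∀ i, X i ⟶ X' i) (φ : ∀ i, X' i ⟶ Y (e i)) (l : List ι) :
    tensMap ψ l ≫ tensMapIdx e φ l = tensMapIdx e (fun i => ψ i ≫ φ i) l := by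
  induction l with
  | nil => exact Category.id_comp _
  | cons a l ih =>
    change (ψ a ⊗ₘ tensMap ψ l) ≫ (φ a ⊗ₘ tensMapIdx e φ l) = (_ ⊗ₘ tensMapIdx e _ l)
    rw [tensorHom_comp_tensorHom, ih]

theorem tensMapIdx_map {ι κ : Type*} {X : ι → E} {Y Y' : κ → E} (e : ι → κ)
    (φ : ∀ i, X i ⟶ Y (e i)) (ψ : ∀ k, Y k ⟶ Y' k) (l : List ι) :
    tensMapIdx e φ l ≫ tensMap ψ (l.map e) = tensMapIdx e (fun i => φ i ≫ ψ (e i)) l := by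
  induction l with
  | nil => exact Category.id_comp _
  | cons a l ih =>
    change (φ a ⊗ₘ tensMapIdx e φ l) ≫ (ψ (e a) ⊗ₘ tensMap ψ (l.map e)) = (_ ⊗ₘ tensMapIdx e _ l)
    rw [tensorHom_comp_tensorHom, ih]

theorem tensAppend_mapIdx {ι κ : Type*} {X : ι → E} {Y : κ → E} (e : ι → κ)
    (φ : ∀ i, X i ⟶ Y (e i)) (l₂ l₁ : List ι) :
    (tensMapIdx e φ l₁ ⊗ₘ tensMapIdx e φ l₂) ≫ tensAppend Y (l₂.map e) (l₁.map e) =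
      tensAppend X l₂ l₁ ≫ tensMapIdx e φ (l₁ ++ l₂) ≫ tensCast Y List.map_append := by
  induction l₁ with
  | nil =>
    change (𝟙 (𝟙_ E) ⊗ₘ tensMapIdx e φ l₂) ≫ (λ_ _).hom = (λ_ _).hom ≫ tensMapIdx e φ l₂ ≫ 𝟙 _
    simp
  | cons a l₁ ih =>
    change ((φ a ⊗ₘ tensMapIdx e φ l₁) ⊗ₘ tensMapIdx e φ l₂) ≫ (α_ _ _ _).hom ≫
      Y (e a) ◁ tensAppend Y (l₂.map e) (l₁.map e) = ((α_ _ _ _).hom ≫ X a ◁ tensAppend X l₂ l₁) ≫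
      (φ a ⊗ₘ tensMapIdx e φ (l₁ ++ l₂)) ≫
      tensCast Y (show e a :: (l₁ ++ l₂).map e = e a :: (l₁.map e ++ l₂.map e) by simp)
    rw [tensCast_cons Y List.map_append, associator_naturality_assoc, tensorHom_comp_whiskerLeft,
      ih, tensorHom_comp_whiskerLeft, Category.assoc, whiskerLeft_comp_tensorHom]

theorem tensAppend_map {ι : Type*} {X Y : ι → E} (φ : ∀ i, X i ⟶ Y i) (l₂ l₁ : List ι) :
    (tensMap φ l₁ ⊗ₘ tensMap φ l₂) ≫ tensAppend Y l₂ l₁ =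
      tensAppend X l₂ l₁ ≫ tensMap φ (l₁ ++ l₂) := by
  induction l₁ with
  | nil =>
    change (𝟙 (𝟙_ E) ⊗ₘ tensMap φ l₂) ≫ (λ_ _).hom = (λ_ _).hom ≫ tensMap φ l₂
    simp
  | cons a l₁ ih =>
    change ((φ a ⊗ₘ tensMap φ l₁) ⊗ₘ tensMap φ l₂) ≫ (α_ _ _ _).hom ≫
      Y a ◁ tensAppend Y l₂ l₁ = ((α_ _ _ _).hom ≫ X a ◁ tensAppend X l₂ l₁) ≫
      (φ a ⊗ₘ tensMap φ (l₁ ++ l₂))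
    rw [associator_naturality_assoc, tensorHom_comp_whiskerLeft,
      ih, Category.assoc, whiskerLeft_comp_tensorHom]

theorem tensAppend_assoc {ι : Type*} (X : ι → E) (l₁ l₂ l₃ : List ι) :
    tensAppend X l₂ l₁ ▷ tensL X l₃ ≫ tensAppend X l₃ (l₁ ++ l₂) =
      (α_ _ _ _).hom ≫ tensL X l₁ ◁ tensAppend X l₃ l₂ ≫ tensAppend X (l₂ ++ l₃) l₁ ≫
        tensCast X (List.append_assoc l₁ l₂ l₃).symm := by
  induction l₁ with
  | nil =>
    change (λ_ _).hom ▷ _ ≫ tensAppend X l₃ l₂ = (α_ _ _ _).hom ≫ 𝟙_ E ◁ _ ≫ (λ_ _).hom ≫ 𝟙 _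
    simp
  | cons a l₁ ih =>
    change ((α_ _ _ _).hom ≫ X a ◁ tensAppend X l₂ l₁) ▷ tensL X l₃ ≫
      (α_ _ _ _).hom ≫ X a ◁ tensAppend X l₃ (l₁ ++ l₂) =
      (α_ _ _ _).hom ≫ (X a ⊗ tensL X l₁) ◁ tensAppend X l₃ l₂ ≫
      ((α_ _ _ _).hom ≫ X a ◁ tensAppend X (l₂ ++ l₃) l₁) ≫
      tensCast X (show a :: (l₁ ++ (l₂ ++ l₃)) = a :: ((l₁ ++ l₂) ++ l₃) by simp)
    rw [tensCast_cons X (List.append_assoc l₁ l₂ l₃).symm, comp_whiskerRight, Category.assoc,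
      associator_naturality_middle_assoc, ← MonoidalCategory.whiskerLeft_comp, ih]
    simp

theorem tensCast_nat {ι : Type*} {X Y : ι → E} (φ : ∀ i, X i ⟶ Y i) {l l' : List ι}
    (h : l = l') : tensCast X h ≫ tensMap φ l' = tensMap φ l ≫ tensCast Y h := by
  subst h; simp

end Monoidal

section Symmetric

variable {E : Type u} [Category.{v} E] [MonoidalCategory E] [SymmetricCategory E]

theorem swap₁₂_unit_left (B P : E) :
    swap₁₂ (𝟙_ E) B P ≫ B ◁ (λ_ P).hom = (λ_ (B ⊗ P)).hom := by
  simp [swap₁₂, braiding_tensorUnit_left]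

theorem swap₁₂_unit_right (B P : E) :
    swap₁₂ B (𝟙_ E) P ≫ (λ_ (B ⊗ P)).hom = B ◁ (λ_ P).hom := by
  simp [swap₁₂, braiding_tensorUnit_right]

theorem swap₁₂_tensor_left (A B D P : E) :
    swap₁₂ (A ⊗ B) D P = (α_ A B (D ⊗ P)).hom ≫ A ◁ swap₁₂ B D P ≫ swap₁₂ A D (B ⊗ P) ≫
      D ◁ (α_ A B P).inv := by
  simp only [swap₁₂, BraidedCategory.braiding_tensor_left_hom]
  monoidal

theorem swap₁₂_tensor_right (A B D P : E) :
    swap₁₂ A (B ⊗ D) P = A ◁ (α_ B D P).hom ≫ swap₁₂ A B (D ⊗ P) ≫ B ◁ swap₁₂ A D P ≫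
      (α_ B D (A ⊗ P)).inv := by
  simp only [swap₁₂, BraidedCategory.braiding_tensor_right_hom]
  monoidal

variable {ι : Type*} [DecidableEq ι]

theorem tensReindex_map {κ : Type*} {X : κ → E} {Y Y' : ι → E} {l : List κ} {l' : List ι}
    (e : κ → ι) (h : (l.map e).Perm l') (φ : ∀ i, X i ⟶ Y (e i)) (ψ : ∀ i, Y i ⟶ Y' i)
    (hl : l'.Nodup) :
    tensReindex e h φ ≫ tensMap ψ l' = tensReindex e h (fun i => φ i ≫ ψ (e i)) := by
  rw [← tensReindex_id (by simp), tensReindex_comp _ _ _ _ _ _ hl]; rfl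

theorem tensMap_reindex {κ : Type*} {X X' : κ → E} {Y : ι → E} {l : List κ} {l' : List ι}
    (e : κ → ι) (h : (l.map e).Perm l') (ψ : ∀ i, X i ⟶ X' i) (φ : ∀ i, X' i ⟶ Y (e i)) :
    tensMap ψ l ≫ tensReindex e h φ = tensReindex e h (fun i => ψ i ≫ φ i) := by
  rw [tensReindex, ← Category.assoc, tensMap_mapIdx]; rfl

theorem tensAppend_perm_right (X : ι → E) (l₁ : List ι) {l₂ l₂' : List ι} (h : l₂.Perm l₂') :
    tensL X l₁ ◁ tensPerm X l₂ l₂' h ≫ tensAppend X l₂' l₁ =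
      tensAppend X l₂ l₁ ≫ tensPerm X (l₁ ++ l₂) (l₁ ++ l₂') (h.append_left l₁) := by
  induction l₁ with
  | nil =>
    change 𝟙_ E ◁ _ ≫ (λ_ _).hom = (λ_ _).hom ≫ tensPerm X l₂ l₂' h
    simp
  | cons a l₁ ih =>
    change (X a ⊗ tensL X l₁) ◁ tensPerm X l₂ l₂' h ≫ (α_ _ _ _).hom ≫ X a ◁ tensAppend X l₂' l₁ =
      ((α_ _ _ _).hom ≫ X a ◁ tensAppend X l₂ l₁) ≫
        tensPerm X (a :: (l₁ ++ l₂)) (a :: (l₁ ++ l₂')) _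
    rw [tensPerm_cons X a (h.append_left l₁), Category.assoc, ← MonoidalCategory.whiskerLeft_comp,
      ← ih]
    simp

theorem tensAppend_perm_left (X : ι → E) {l₁ l₁' : List ι} (l₂ : List ι) (h : l₁.Perm l₁')
    (hl : l₁.Nodup) :
    tensPerm X l₁ l₁' h ▷ tensL X l₂ ≫ tensAppend X l₂ l₁' =
      tensAppend X l₂ l₁ ≫ tensPerm X (l₁ ++ l₂) (l₁' ++ l₂) (h.append_right l₂) := by
  induction h with
  | nil => rw [tensPerm_refl, tensPerm_refl]; simp
  | cons a h ih =>
    rename_i l l'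
    rw [tensPerm_cons X a h]
    change _ ▷ _ ≫ (α_ _ _ _).hom ≫ X a ◁ tensAppend X l₂ l' =
      ((α_ _ _ _).hom ≫ X a ◁ tensAppend X l₂ l) ≫ tensPerm X (a :: (l ++ l₂)) (a :: (l' ++ l₂)) _
    rw [tensPerm_cons X a (h.append_right l₂), Category.assoc, ← MonoidalCategory.whiskerLeft_comp,
      ← ih (List.nodup_cons.1 hl).2]
    simp
  | swap a b l =>
    have hne : b ≠ a := by
      simp only [List.nodup_cons, List.mem_cons, not_or] at hl
      exact hl.1.1
    rw [tensPerm_swap X hne]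
    change _ ▷ _ ≫ (α_ _ _ _).hom ≫ X a ◁ ((α_ _ _ _).hom ≫ X b ◁ tensAppend X l₂ l) =
      ((α_ _ _ _).hom ≫ X b ◁ ((α_ _ _ _).hom ≫ X a ◁ tensAppend X l₂ l)) ≫
        tensPerm X (b :: a :: (l ++ l₂)) (a :: b :: (l ++ l₂)) _
    rw [tensPerm_swap X hne]
    simp only [MonoidalCategory.whiskerLeft_comp, Category.assoc, swap₁₂_right]
    simp [swap₁₂]
  | trans h₁ h₂ ih₁ ih₂ =>
    rw [← tensPerm_trans X _ _ _ h₁ h₂, comp_whiskerRight, Category.assoc,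
      ih₂ (h₁.nodup_iff.1 hl), reassoc_of% (ih₁ hl), tensPerm_trans]

theorem tensAppend_reindex {κ : Type*} {X : κ → E} {Y : ι → E} (e : κ → ι)
    (φ : ∀ i, X i ⟶ Y (e i)) {l₁ l₂ : List κ} {l₁' l₂' : List ι} (h₁ : (l₁.map e).Perm l₁')
    (h₂ : (l₂.map e).Perm l₂') (h : ((l₁ ++ l₂).map e).Perm (l₁' ++ l₂')) (hl : l₁'.Nodup) :
    (tensReindex e h₁ φ ⊗ₘ tensReindex e h₂ φ) ≫ tensAppend Y l₂' l₁' =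
      tensAppend X l₂ l₁ ≫ tensReindex e h φ := by
  have h' : (l₁.map e ++ l₂.map e).Perm (l₁' ++ l₂') := by rwa [← List.map_append]
  simp only [tensReindex]
  rw [← tensorHom_comp_tensorHom, tensorHom_def (tensPerm Y _ _ h₁), Category.assoc,
    Category.assoc, tensAppend_perm_right, reassoc_of% (tensAppend_perm_left Y (l₂.map e) h₁
      (h₁.nodup_iff.2 hl)), reassoc_of% (tensAppend_mapIdx e φ l₂ l₁), tensCast_eq_perm,
    tensPerm_trans _ _ _ _ _ _ (h₁.append h₂), tensPerm_trans]

/-- A single factor moved past a block. -/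
theorem tensAppend_swap_one (X : ι → E) (a : ι) (l₂ l₁ : List ι) (ha : a ∉ l₁)
    (h : (a :: (l₁ ++ l₂)).Perm (l₁ ++ a :: l₂)) :
    swap₁₂ (X a) (tensL X l₁) (tensL X l₂) ≫ tensAppend X (a :: l₂) l₁ =
      X a ◁ tensAppend X l₂ l₁ ≫ tensPerm X (a :: (l₁ ++ l₂)) (l₁ ++ a :: l₂) h := by
  induction l₁ with
  | nil =>
    change swap₁₂ (X a) (𝟙_ E) (tensL X l₂) ≫ (λ_ _).hom = X a ◁ (λ_ _).hom ≫
      tensPerm X (a :: l₂) (a :: l₂) _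
    rw [tensPerm_refl, swap₁₂_unit_right, Category.comp_id]
  | cons b l₁ ih =>
    simp only [List.mem_cons, not_or] at ha
    have h₁ : (a :: (l₁ ++ l₂)).Perm (l₁ ++ a :: l₂) := List.perm_middle.symm
    change swap₁₂ (X a) (X b ⊗ tensL X l₁) (tensL X l₂) ≫ (α_ _ _ _).hom ≫
        X b ◁ tensAppend X (a :: l₂) l₁ =
      X a ◁ ((α_ _ _ _).hom ≫ X b ◁ tensAppend X l₂ l₁) ≫
        tensPerm X (a :: b :: (l₁ ++ l₂)) (b :: (l₁ ++ a :: l₂)) h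
    rw [swap₁₂_tensor_right, ← tensPerm_trans X _ _ _ (List.Perm.swap b a _) (h₁.cons b),
      tensPerm_swap X ha.1, tensPerm_cons X b h₁]
    simp only [Category.assoc, Iso.inv_hom_id_assoc, MonoidalCategory.whiskerLeft_comp,
      swap₁₂_right_assoc]
    rw [← MonoidalCategory.whiskerLeft_comp, ih ha.2 h₁]
    simp

/-- Two blocks moved past each other. -/
theorem tensAppend_swap (X : ι → E) (l₁ l₂ l₃ : List ι) (hl : (l₁ ++ l₂).Nodup)
    (h : (l₁ ++ (l₂ ++ l₃)).Perm (l₂ ++ (l₁ ++ l₃))) :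
    swap₁₂ (tensL X l₁) (tensL X l₂) (tensL X l₃) ≫ tensL X l₂ ◁ tensAppend X l₃ l₁ ≫
        tensAppend X (l₁ ++ l₃) l₂ =
      tensL X l₁ ◁ tensAppend X l₃ l₂ ≫ tensAppend X (l₂ ++ l₃) l₁ ≫ tensPerm X _ _ h := by
  induction l₁ with
  | nil =>
    change swap₁₂ (𝟙_ E) (tensL X l₂) (tensL X l₃) ≫ tensL X l₂ ◁ (λ_ _).hom ≫
        tensAppend X l₃ l₂ =
      𝟙_ E ◁ tensAppend X l₃ l₂ ≫ (λ_ _).hom ≫ tensPerm X (l₂ ++ l₃) (l₂ ++ l₃) _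
    rw [tensPerm_refl, reassoc_of% (swap₁₂_unit_left (tensL X l₂) (tensL X l₃))]
    simp
  | cons a l₁ ih =>
    have hl' : (l₁ ++ l₂).Nodup := (List.nodup_cons.1 hl).2
    have ha : a ∉ l₂ := fun h => (List.nodup_cons.1 hl).1 (by simp [h])
    have h₁ : (l₁ ++ (l₂ ++ l₃)).Perm (l₂ ++ (l₁ ++ l₃)) := by
      rw [← List.append_assoc, ← List.append_assoc]
      exact List.perm_append_comm.append_right _
    have h₂ : (a :: (l₂ ++ (l₁ ++ l₃))).Perm (l₂ ++ a :: (l₁ ++ l₃)) := List.perm_middle.symm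
    change swap₁₂ (X a ⊗ tensL X l₁) (tensL X l₂) (tensL X l₃) ≫
        tensL X l₂ ◁ ((α_ _ _ _).hom ≫ X a ◁ tensAppend X l₃ l₁) ≫
        tensAppend X (a :: (l₁ ++ l₃)) l₂ =
      (X a ⊗ tensL X l₁) ◁ tensAppend X l₃ l₂ ≫ ((α_ _ _ _).hom ≫
        X a ◁ tensAppend X (l₂ ++ l₃) l₁) ≫
        tensPerm X (a :: (l₁ ++ (l₂ ++ l₃))) (l₂ ++ (a :: (l₁ ++ l₃))) h
    rw [swap₁₂_tensor_left, ← tensPerm_trans X _ _ _ (h₁.cons a) h₂, tensPerm_cons X a h₁]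
    simp only [Category.assoc, MonoidalCategory.whiskerLeft_comp]
    rw [← MonoidalCategory.whiskerLeft_comp_assoc (tensL X l₂) (α_ _ _ _).inv, Iso.inv_hom_id,
      MonoidalCategory.whiskerLeft_id, Category.id_comp, ← swap₁₂_right_assoc,
      tensAppend_swap_one X a _ _ ha h₂]
    have := ih hl' h₁
    simp only [← MonoidalCategory.whiskerLeft_comp_assoc]
    rw [this]
    simp

theorem tensCast_tensReindex {κ : Type*} (X : κ → E) {Y : ι → E} {l₀ l : List κ} {l' : List ι}
    (h₀ : l₀ = l) (e : κ → ι) (h : (l.map e).Perm l') (φ : ∀ i, X i ⟶ Y (e i)) :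
    tensCast X h₀ ≫ tensReindex e h φ = tensReindex e (h₀ ▸ h) φ := by
  subst h₀; simp

theorem tensReindex_nil {κ : Type*} {X : κ → E} {Y : ι → E} (e : κ → ι)
    (h : (List.map e []).Perm []) (φ : ∀ i, X i ⟶ Y (e i)) : tensReindex e h φ = 𝟙 (𝟙_ E) := by
  change 𝟙 (𝟙_ E) ≫ tensPerm Y [] [] h = 𝟙 (𝟙_ E)
  rw [tensPerm_refl]
  exact Category.comp_id _

/-! ### Iterated tensor products -/

section Sigma

variable {κ : ι → Type*} [∀ i, DecidableEq (κ i)]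

omit [SymmetricCategory E] [DecidableEq ι] [∀ i, DecidableEq (κ i)] in
theorem tensSigma_cons (Y : ∀ i, κ i → E) (m : ∀ i, List (κ i)) (a : ι) (l : List ι) :
    tensSigma Y m (a :: l) = (tensMapIdx (X := Y a) (Y := fun p : Σ i, κ i => Y p.1 p.2)
      (Sigma.mk a) (fun _ => 𝟙 _) (m a) ⊗ₘ tensSigma Y m l) ≫ tensAppend _ _ _ := rfl

omit [DecidableEq ι] [∀ i, DecidableEq (κ i)] in
theorem nodup_sigma {l : List ι} {m : ∀ i, List (κ i)} (hl : l.Nodup) (hm : ∀ i, (m i).Nodup) :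
    (l.sigma m).Nodup := hl.sigma hm

omit [DecidableEq ι] [∀ i, DecidableEq (κ i)] in
theorem sigma_perm {l l' : List ι} {m : ∀ i, List (κ i)} (h : l.Perm l') :
    (l.sigma m).Perm (l'.sigma m) := by
  unfold List.sigma
  exact h.flatMap_right _

omit [DecidableEq ι] [∀ i, DecidableEq (κ i)] in
theorem sigma_map_perm {ι' : Type*} {κ' : ι' → Type*} {l : List ι} {l' : List ι'}
    {m : ∀ i, List (κ i)} {m' : ∀ i, List (κ' i)} (e : ι → ι') (g : ∀ i, κ i → κ' (e i))
    (h : (l.map e).Perm l') (hm : ∀ i, ((m i).map (g i)).Perm (m' (e i))) :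
    ((l.sigma m).map (fun p => (⟨e p.1, g p.1 p.2⟩ : Σ i, κ' i))).Perm (l'.sigma m') := by
  refine List.Perm.trans ?_ (sigma_perm h)
  clear h
  induction l with
  | nil => exact List.Perm.refl _
  | cons a l ih =>
    simp only [List.sigma_cons, List.map_append, List.map_map, List.map_cons]
    refine List.Perm.append ?_ ih
    rw [show ((fun p : Σ i, κ i => (⟨e p.1, g p.1 p.2⟩ : Σ i, κ' i)) ∘ Sigma.mk a) =
      Sigma.mk (e a) ∘ g a from rfl, ← List.map_map]
    exact (hm a).map _

/-- Reordering the blocks of an iterated tensor product. -/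
theorem tensPerm_tensSigma (Y : ∀ i, κ i → E) (m : ∀ i, List (κ i)) {l l' : List ι}
    (h : l.Perm l') (hl : l.Nodup) (hm : ∀ i, (m i).Nodup) :
    tensPerm (fun i => tensL (Y i) (m i)) l l' h ≫ tensSigma Y m l' =
      tensSigma Y m l ≫ tensPerm _ _ _ (sigma_perm h) := by
  induction h with
  | nil =>
    rw [tensPerm_refl, tensPerm_refl]
    exact (Category.id_comp _).trans (Category.comp_id _).symm
  | cons a h ih =>
    rename_i l l'
    have h' : (l.sigma m).Perm (l'.sigma m) := sigma_perm h
    rw [tensPerm_cons _ a h]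
    change _ ◁ _ ≫ (_ ⊗ₘ tensSigma Y m l') ≫ tensAppend _ _ _ =
      ((_ ⊗ₘ tensSigma Y m l) ≫ tensAppend _ _ _) ≫
        tensPerm _ ((m a).map (Sigma.mk a) ++ l.sigma m) ((m a).map (Sigma.mk a) ++ l'.sigma m) _
    rw [Category.assoc, ← tensAppend_perm_right _ _ h', whiskerLeft_comp_tensorHom_assoc,
      tensorHom_comp_whiskerLeft_assoc, ih (List.nodup_cons.1 hl).2]
  | swap a b l =>
    have hne : b ≠ a := by
      simp only [List.nodup_cons, List.mem_cons, not_or] at hl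
      exact hl.1.1
    have hp : ((m b).map (Sigma.mk b) ++ ((m a).map (Sigma.mk a) ++ l.sigma m)).Perm
          ((m a).map (Sigma.mk a) ++ ((m b).map (Sigma.mk b) ++ l.sigma m)) :=
      sigma_perm (List.Perm.swap a b l)
    rw [tensPerm_swap _ hne]
    change _ ≫ (_ ⊗ₘ ((_ ⊗ₘ tensSigma Y m l) ≫ tensAppend _ _ _)) ≫ tensAppend _ _ _ =
      ((_ ⊗ₘ ((_ ⊗ₘ tensSigma Y m l) ≫ tensAppend _ _ _)) ≫ tensAppend _ _ _) ≫
        tensPerm _ ((m b).map (Sigma.mk b) ++ ((m a).map (Sigma.mk a) ++ l.sigma m))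
          ((m a).map (Sigma.mk a) ++ ((m b).map (Sigma.mk b) ++ l.sigma m)) hp
    have hab : ((m b).map (Sigma.mk b) ++ (m a).map (Sigma.mk a)).Nodup := by
      refine List.Nodup.append ((hm b).map sigma_mk_injective)
        ((hm a).map sigma_mk_injective) ?_
      intro x hx hx'
      simp only [List.mem_map] at hx hx'
      obtain ⟨y, -, rfl⟩ := hx
      obtain ⟨z, -, hz⟩ := hx'
      exact hne (congrArg Sigma.fst hz).symm
    rw [← tensorHom_comp_whiskerLeft, ← tensorHom_comp_whiskerLeft]
    simp only [Category.assoc]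
    rw [← tensAppend_swap _ _ _ _ hab hp, ← reassoc_of% swap₁₂_naturality]
  | trans h₁ h₂ ih₁ ih₂ =>
    rw [← tensPerm_trans _ _ _ _ h₁ h₂, Category.assoc, ih₂ (h₁.nodup_iff.1 hl),
      reassoc_of% (ih₁ hl), tensPerm_trans]

variable {ι' : Type*} [DecidableEq ι'] {κ' : ι' → Type*} [∀ i, DecidableEq (κ' i)]

/-- Reindexing an iterated tensor product: the outer and the inner reindexings combine to one of the
pairs of indices. -/
theorem tensReindex_tensSigma {Y : ∀ i, κ i → E} {m : ∀ i, List (κ i)} {Y' : ∀ i, κ' i → E}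
    {m' : ∀ i, List (κ' i)} {l : List ι} {l' : List ι'} (e : ι → ι') (h : (l.map e).Perm l')
    (g : ∀ i, κ i → κ' (e i)) (hg : ∀ i, ((m i).map (g i)).Perm (m' (e i)))
    (φ : ∀ i j, Y i j ⟶ Y' (e i) (g i j)) (hl : l'.Nodup) (hm : ∀ i, (m' i).Nodup) :
    tensReindex e h (fun i => tensReindex (Y := Y' (e i)) (g i) (hg i) (φ i)) ≫
        tensSigma Y' m' l' =
      tensSigma Y m l ≫ tensReindex (Y := fun p : Σ i, κ' i => Y' p.1 p.2)
        (fun p : Σ i, κ i => (⟨e p.1, g p.1 p.2⟩ : Σ i, κ' i))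
        (sigma_map_perm e g h hg) (fun p => φ p.1 p.2) := by
  have hl₁ : (l.map e).Nodup := h.nodup_iff.2 hl
  -- the case without reordering of the outer factors
  have step : ∀ l : List ι, (l.map e).Nodup →
      tensMapIdx e (fun i => tensReindex (Y := Y' (e i)) (g i) (hg i) (φ i)) l ≫
        tensSigma Y' m' (l.map e) =
      tensSigma Y m l ≫ tensReindex (Y := fun p : Σ i, κ' i => Y' p.1 p.2)
        (fun p : Σ i, κ i => (⟨e p.1, g p.1 p.2⟩ : Σ i, κ' i))
        (sigma_map_perm e g (List.Perm.refl _) hg) (fun p => φ p.1 p.2) := by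
    intro l hl
    induction l with
    | nil =>
      have h₀ : (List.map (fun p : Σ i, κ i => (⟨e p.1, g p.1 p.2⟩ : Σ i, κ' i)) []).Perm [] :=
        List.Perm.refl []
      change 𝟙 (𝟙_ E) ≫ 𝟙 (𝟙_ E) = 𝟙 (𝟙_ E) ≫ tensReindex (l := []) (l' := []) _ h₀ _
      rw [tensReindex_nil]
    | cons a l ih =>
      have hl' := (List.nodup_cons.1 hl).2
      have hn : ((m' (e a)).map (Sigma.mk (e a))).Nodup := (hm _).map sigma_mk_injective
      have h₁ : (((m a).map (Sigma.mk a)).map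
          (fun p : Σ i, κ i => (⟨e p.1, g p.1 p.2⟩ : Σ i, κ' i))).Perm
          ((m' (e a)).map (Sigma.mk (e a))) := by
        have := (hg a).map (Sigma.mk (e a))
        rw [List.map_map] at this ⊢
        exact this
      have h₂ : (((m a).map (Sigma.mk a) ++ l.sigma m).map
          (fun p : Σ i, κ i => (⟨e p.1, g p.1 p.2⟩ : Σ i, κ' i))).Perm
          ((m' (e a)).map (Sigma.mk (e a)) ++ (l.map e).sigma m') := by
        rw [List.map_append]
        exact h₁.append (sigma_map_perm e g (List.Perm.refl _) hg)
      change (tensReindex _ _ _ ⊗ₘ tensMapIdx e _ l) ≫ (_ ⊗ₘ tensSigma Y' m' (l.map e)) ≫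
        tensAppend _ _ _ = ((_ ⊗ₘ tensSigma Y m l) ≫ tensAppend _ _ _) ≫
          tensReindex (l := (m a).map (Sigma.mk a) ++ l.sigma m)
          (l' := (m' (e a)).map (Sigma.mk (e a)) ++ (l.map e).sigma m') _ h₂ _
      rw [tensorHom_comp_tensorHom_assoc, ih hl', Category.assoc,
        ← tensAppend_reindex (Y := fun p : Σ i, κ' i => Y' p.1 p.2) _ _ h₁
          (sigma_map_perm e g (List.Perm.refl _) hg) h₂ hn, tensorHom_comp_tensorHom_assoc]
      congr 2
      rw [tensMapIdx_eq_tensReindex, tensMapIdx_eq_tensReindex, tensReindex_comp _ _ _ _ _ _ hn,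
        tensReindex_comp _ _ _ _ _ _ hn]
      exact tensReindex_congr (fun _ => rfl) (fun _ => by simp)
  have hσ : (l'.sigma m').Nodup := nodup_sigma hl hm
  rw [tensReindex, Category.assoc, tensPerm_tensSigma Y' m' h hl₁ hm, reassoc_of% (step l hl₁),
    tensPerm_eq_tensReindex, tensReindex_comp _ _ _ _ _ _ hσ]
  congr 1
  exact tensReindex_congr (fun _ => rfl) (fun _ => by simp)

omit [SymmetricCategory E] [DecidableEq ι] [∀ i, DecidableEq (κ i)] in
theorem tensMap_tensSigma {Y Y' : ∀ i, κ i → E} (m : ∀ i, List (κ i)) (l : List ι)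
    (φ : ∀ i j, Y i j ⟶ Y' i j) :
    tensMap (fun i => tensMap (φ i) (m i)) l ≫ tensSigma Y' m l =
      tensSigma Y m l ≫ tensMap (fun p : Σ i, κ i => φ p.1 p.2) (l.sigma m) := by
  induction l with
  | nil => rfl
  | cons a l ih =>
    change (tensMap (φ a) (m a) ⊗ₘ tensMap _ l) ≫ (_ ⊗ₘ tensSigma Y' m l) ≫ tensAppend _ _ _ =
      ((_ ⊗ₘ tensSigma Y m l) ≫ tensAppend _ _ _) ≫
        tensMap _ ((m a).map (Sigma.mk a) ++ l.sigma m)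
    rw [Category.assoc, ← tensAppend_map, tensorHom_comp_tensorHom_assoc, ih,
      tensorHom_comp_tensorHom_assoc, tensMap_mapIdx, tensMapIdx_map]
    simp

omit [SymmetricCategory E] [DecidableEq ι] [∀ i, DecidableEq (κ i)] in
/-- An iterated tensor product over a concatenation of lists splits accordingly. -/
theorem tensSigma_append (Y : ∀ i, κ i → E) (m : ∀ i, List (κ i)) (l₁ l₂ : List ι)
    (h : (l₁ ++ l₂).sigma m = l₁.sigma m ++ l₂.sigma m) :
    (tensSigma Y m l₁ ⊗ₘ tensSigma Y m l₂) ≫ tensAppend _ _ _ =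
      tensAppend _ _ _ ≫ tensSigma Y m (l₁ ++ l₂) ≫ tensCast _ h := by
  induction l₁ with
  | nil =>
    change (𝟙 (𝟙_ E) ⊗ₘ tensSigma Y m l₂) ≫ (λ_ _).hom = (λ_ _).hom ≫ tensSigma Y m l₂ ≫ 𝟙 _
    simp
  | cons a l₁ ih =>
    have h' : (l₁ ++ l₂).sigma m = l₁.sigma m ++ l₂.sigma m := by
      simpa [List.sigma_cons] using h
    change (((_ ⊗ₘ tensSigma Y m l₁) ≫ tensAppend (fun p : Σ i, κ i => Y p.1 p.2) (l₁.sigma m)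
        ((m a).map (Sigma.mk a))) ⊗ₘ tensSigma Y m l₂) ≫
        tensAppend (fun p : Σ i, κ i => Y p.1 p.2) (l₂.sigma m)
          ((m a).map (Sigma.mk a) ++ l₁.sigma m) =
      ((α_ _ _ _).hom ≫ _ ◁ tensAppend (fun i => tensL (Y i) (m i)) l₂ l₁) ≫
        ((_ ⊗ₘ tensSigma Y m (l₁ ++ l₂)) ≫ tensAppend (fun p : Σ i, κ i => Y p.1 p.2)
          ((l₁ ++ l₂).sigma m) ((m a).map (Sigma.mk a))) ≫
        tensCast _ (show (m a).map (Sigma.mk a) ++ (l₁ ++ l₂).sigma m =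
          ((m a).map (Sigma.mk a) ++ l₁.sigma m) ++ l₂.sigma m by rw [h', List.append_assoc])
    have h₁ := tensAppend_assoc (fun p : Σ i, κ i => Y p.1 p.2) ((m a).map (Sigma.mk a))
      (l₁.sigma m) (l₂.sigma m)
    have h₂ : ∀ {l l' : List (Σ i, κ i)} (h : l = l'),
        tensAppend (fun p : Σ i, κ i => Y p.1 p.2) l ((m a).map (Sigma.mk a)) ≫
          tensCast _ (by rw [h]) = _ ◁ tensCast _ h ≫
        tensAppend (fun p : Σ i, κ i => Y p.1 p.2) l' ((m a).map (Sigma.mk a)) := by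
      rintro l _ rfl; simp
    have h₃ : ∀ {A B A' B' D : E} (f : A ⟶ A') (g : A' ⟶ B') (k : B ⟶ D),
        ((f ≫ g) ⊗ₘ k) = (f ⊗ₘ k) ≫ g ▷ D := by
      intros; rw [tensorHom_comp_whiskerRight]
    rw [h₃, Category.assoc, h₁, ← tensCast_trans _ (by rw [h'] :
      (m a).map (Sigma.mk a) ++ (l₁ ++ l₂).sigma m =
        (m a).map (Sigma.mk a) ++ (l₁.sigma m ++ l₂.sigma m)) (List.append_assoc ..).symm]
    simp only [Category.assoc]
    rw [reassoc_of% (h₂ h'), associator_naturality_assoc, tensorHom_comp_whiskerLeft_assoc, ih,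
      tensorHom_comp_whiskerLeft_assoc, whiskerLeft_comp_tensorHom_assoc]

end Sigma

section SigmaSigma

variable {J : ι → Type*} [∀ i, DecidableEq (J i)] {K : ∀ i, J i → Type*}
  [∀ i j, DecidableEq (K i j)]

omit [DecidableEq ι] [∀ i, DecidableEq (J i)] [∀ i j, DecidableEq (K i j)] in
theorem sigma_assoc_perm (m : ∀ i, List (J i)) (n : ∀ i j, List (K i j)) (l : List ι) :
    (((l.sigma m).sigma fun p => n p.1 p.2).map
      (fun q : Σ p : (Σ i, J i), K p.1 p.2 => (⟨q.1.1, q.1.2, q.2⟩ : Σ i, Σ j, K i j))).Perm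
      (l.sigma fun i => (m i).sigma (n i)) := by
  induction l with
  | nil => exact List.Perm.refl _
  | cons a l ih =>
    have : ((a :: l).sigma m).sigma (fun p => n p.1 p.2) =
        ((m a).map (Sigma.mk a)).sigma (fun p : Σ i, J i => n p.1 p.2) ++
          (l.sigma m).sigma (fun p => n p.1 p.2) := by
      simp [List.sigma, List.flatMap_append]
    rw [this, List.map_append, List.sigma_cons]
    refine List.Perm.append ?_ ih
    rw [show ((m a).map (Sigma.mk a)).sigma (fun p : Σ i, J i => n p.1 p.2) =
      ((m a).sigma (n a)).map (fun q => (⟨⟨a, q.1⟩, q.2⟩ : Σ p : (Σ i, J i), K p.1 p.2)) by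
        simp [List.sigma, List.flatMap_map, List.map_flatMap]; rfl]
    rw [List.map_map]
    exact List.Perm.refl _

/-- Associativity of iterated tensor products. -/
theorem tensSigma_tensSigma (Y : ∀ i j, K i j → E) (m : ∀ i, List (J i))
    (n : ∀ i j, List (K i j)) (l : List ι) (hl : l.Nodup) (hm : ∀ i, (m i).Nodup)
    (hn : ∀ i j, (n i j).Nodup) :
    tensMap (fun i => tensSigma (Y i) (n i) (m i)) l ≫
        tensSigma (fun i (q : Σ j, K i j) => Y i q.1 q.2) (fun i => (m i).sigma (n i)) l =
      tensSigma (fun i j => tensL (Y i j) (n i j)) m l ≫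
        tensSigma (fun p : Σ i, J i => Y p.1 p.2) (fun p => n p.1 p.2) (l.sigma m) ≫
        tensReindex (X := fun q : Σ p : (Σ i, J i), K p.1 p.2 => Y q.1.1 q.1.2 q.2)
          (Y := fun q : Σ i, Σ j, K i j => Y q.1 q.2.1 q.2.2)
          (fun q : Σ p : (Σ i, J i), K p.1 p.2 => (⟨q.1.1, q.1.2, q.2⟩ : Σ i, Σ j, K i j))
          (sigma_assoc_perm m n l) (fun _ => 𝟙 _) := by
  induction l with
  | nil =>
    have h₀ : (List.map (fun q : Σ p : (Σ i, J i), K p.1 p.2 =>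
        (⟨q.1.1, q.1.2, q.2⟩ : Σ i, Σ j, K i j)) []).Perm [] := List.Perm.refl []
    change 𝟙 (𝟙_ E) ≫ 𝟙 (𝟙_ E) = 𝟙 (𝟙_ E) ≫ 𝟙 (𝟙_ E) ≫ tensReindex (l := []) (l' := []) _ h₀ _
    rw [tensReindex_nil]
    simp
  | cons a l ih =>
    -- `A` is the reassociation of triples of indices, `B` and `mk` embed the pairs belonging to the
    -- first block, and `W`, `V` are the factors before and after reassociation
    let A : (Σ p : (Σ i, J i), K p.1 p.2) → Σ i, Σ j, K i j := fun q => ⟨q.1.1, q.1.2, q.2⟩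
    let mk : (Σ j, K a j) → Σ i, Σ j, K i j := fun q => ⟨a, q⟩
    let B : (Σ j, K a j) → Σ p : (Σ i, J i), K p.1 p.2 := fun q => ⟨⟨a, q.1⟩, q.2⟩
    let W : (Σ p : (Σ i, J i), K p.1 p.2) → E := fun q => Y q.1.1 q.1.2 q.2
    let V : (Σ i, Σ j, K i j) → E := fun q => Y q.1 q.2.1 q.2.2
    have hmk : Function.Injective mk := fun x y h => by cases h; rfl
    have hl' := (List.nodup_cons.1 hl).2
    have hna : ((m a).sigma (n a)).Nodup := nodup_sigma (hm a) (hn a)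
    have e₁ : (((m a).map (Sigma.mk a) ++ l.sigma m).sigma (fun p : Σ i, J i => n p.1 p.2)) =
        ((m a).map (Sigma.mk a)).sigma (fun p : Σ i, J i => n p.1 p.2) ++
          (l.sigma m).sigma (fun p => n p.1 p.2) := by
      simp [List.sigma, List.flatMap_append]
    have e₂ : ((m a).map (Sigma.mk a)).sigma (fun p : Σ i, J i => n p.1 p.2) =
      ((m a).sigma (n a)).map B := by
        simp [List.sigma, List.flatMap_map, List.map_flatMap]; rfl
    have hp : ((((m a).map (Sigma.mk a)).sigma (fun p : Σ i, J i => n p.1 p.2)).map A).Perm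
        (((m a).sigma (n a)).map mk) := by
      rw [e₂, List.map_map]; exact List.Perm.refl _
    have hq := sigma_assoc_perm m n l
    have hpq : ((((m a).map (Sigma.mk a)).sigma (fun p : Σ i, J i => n p.1 p.2) ++
          (l.sigma m).sigma (fun p => n p.1 p.2)).map A).Perm
        (((m a).sigma (n a)).map mk ++ l.sigma fun i => (m i).sigma (n i)) := by
      rw [List.map_append]; exact hp.append hq
    have hr : ((((m a).map (Sigma.mk a) ++ l.sigma m).sigma
          (fun p : Σ i, J i => n p.1 p.2)).map A).Perm
        (((m a).sigma (n a)).map mk ++ l.sigma fun i => (m i).sigma (n i)) := by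
      rw [e₁]; exact hpq
    change (tensSigma (Y a) (n a) (m a) ⊗ₘ tensMap _ l) ≫
        (tensMapIdx (Y := V) mk (fun _ => 𝟙 _) ((m a).sigma (n a)) ⊗ₘ
          tensSigma (fun i (q : Σ j, K i j) => Y i q.1 q.2) (fun i => (m i).sigma (n i)) l) ≫
          tensAppend V _ _ =
      ((tensMapIdx (X := fun j => tensL (Y a j) (n a j))
          (Y := fun p : Σ i, J i => tensL (Y p.1 p.2) (n p.1 p.2)) (Sigma.mk a) (fun _ => 𝟙 _)
          (m a) ⊗ₘ tensSigma (fun i j => tensL (Y i j) (n i j)) m l) ≫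
          tensAppend (fun p : Σ i, J i => tensL (Y p.1 p.2) (n p.1 p.2)) _ _) ≫
        tensSigma (fun p : Σ i, J i => Y p.1 p.2) (fun p => n p.1 p.2)
          ((m a).map (Sigma.mk a) ++ l.sigma m) ≫
        tensReindex (X := W) (Y := V) A hr (fun _ => 𝟙 _)
    -- split off the block of the index `a`, which `h₃` handles; the remaining blocks are the
    -- induction hypothesis
    have h₁ := tensSigma_append (fun p : Σ i, J i => Y p.1 p.2) (fun p => n p.1 p.2)
      ((m a).map (Sigma.mk a)) (l.sigma m) e₁
    have h₂ : tensReindex (X := W) (Y := V) A hr (fun _ => 𝟙 _) =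
        tensCast W e₁ ≫ tensReindex (X := W) (Y := V) A hpq (fun _ => 𝟙 _) := by
      exact (tensCast_tensReindex W e₁ A hpq _).symm
    have h₃ : tensMapIdx (X := fun j => tensL (Y a j) (n a j))
          (Y := fun p : Σ i, J i => tensL (Y p.1 p.2) (n p.1 p.2)) (Sigma.mk a) (fun _ => 𝟙 _)
          (m a) ≫ tensSigma (fun p : Σ i, J i => Y p.1 p.2) (fun p => n p.1 p.2)
            ((m a).map (Sigma.mk a)) = tensSigma (Y a) (n a) (m a) ≫
          tensReindex (X := fun q : Σ j, K a j => Y a q.1 q.2) (Y := W) B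
            (by rw [e₂]) (fun _ => 𝟙 _) := by
      have := tensReindex_tensSigma (Y := Y a) (m := n a) (Y' := fun p : Σ i, J i => Y p.1 p.2)
        (m' := fun p : Σ i, J i => n p.1 p.2) (l := m a) (l' := (m a).map (Sigma.mk a))
        (Sigma.mk a) (List.Perm.refl _) (fun j => id) (fun j => by simp) (fun j k => 𝟙 _)
        ((hm a).map sigma_mk_injective) (fun p => hn _ _)
      simp only [tensReindex_id, tensMap_id] at this
      rw [tensMapIdx_eq_tensReindex]
      exact this
    have h₄ := tensAppend_reindex (X := W) (Y := V) A (fun _ => 𝟙 _) hp hq hpq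
      (hna.map hmk)
    rw [Category.assoc, h₂, ← reassoc_of% h₁, tensorHom_comp_tensorHom_assoc,
      tensorHom_comp_tensorHom_assoc, h₃]
    erw [← h₄]
    rw [tensorHom_comp_tensorHom_assoc, ih hl', tensMapIdx_eq_tensReindex, Category.assoc,
      Category.assoc, tensReindex_comp _ _ _ _ _ _ (hna.map hmk)]
    congr 3
    exact tensReindex_congr (fun _ => rfl) (fun _ => by simp [V, mk])

end SigmaSigma

end Symmetric
end FinTensor

/-! ### Tensor products of pairs -/

namespace FinTensor

section Mul

variable {E : Type u} [Category.{v} E] [MonoidalCategory E] [SymmetricCategory E]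

theorem braiding_tensorμ (X₁ X₂ Y₁ Y₂ : E) :
    ((β_ X₁ X₂).hom ⊗ₘ (β_ Y₁ Y₂).hom) ≫ tensorμ X₂ X₁ Y₂ Y₁ =
      tensorμ X₁ X₂ Y₁ Y₂ ≫ (β_ (X₁ ⊗ Y₁) (X₂ ⊗ Y₂)).hom := by
  simp [tensorμ, SymmetricCategory.braiding_swap_eq_inv_braiding Y₁ X₂,
    MonoidalCategory.tensorHom_def]

/-- Exchanging the first two factors commutes with pairing two triple tensor products factor by
factor. -/
theorem swap₁₂_tensorμ (A B P A' B' P' : E) :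
    (swap₁₂ A B P ⊗ₘ swap₁₂ A' B' P') ≫ tensorμ B (A ⊗ P) B' (A' ⊗ P') ≫
        (B ⊗ B') ◁ tensorμ A P A' P' =
      tensorμ A (B ⊗ P) A' (B' ⊗ P') ≫ (A ⊗ A') ◁ tensorμ B P B' P' ≫
        swap₁₂ (A ⊗ A') (B ⊗ B') (P ⊗ P') := by
  have h₁ := associator_monoidal A B P A' B' P'
  have h₂ := associator_monoidal B A P B' A' P'
  have h₁' : tensorμ A (B ⊗ P) A' (B' ⊗ P') ≫ (A ⊗ A') ◁ tensorμ B P B' P' =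
      ((α_ A B P).inv ⊗ₘ (α_ A' B' P').inv) ≫ tensorμ (A ⊗ B) P (A' ⊗ B') P' ≫
        tensorμ A B A' B' ▷ (P ⊗ P') ≫ (α_ (A ⊗ A') (B ⊗ B') (P ⊗ P')).hom := by
    rw [h₁, tensorHom_comp_tensorHom_assoc]; simp
  have h₂' : ((α_ B A P).hom ⊗ₘ (α_ B' A' P').hom) ≫ tensorμ B (A ⊗ P) B' (A' ⊗ P') ≫
      (B ⊗ B') ◁ tensorμ A P A' P' = tensorμ (B ⊗ A) P (B' ⊗ A') P' ≫
        tensorμ B A B' A' ▷ (P ⊗ P') ≫ (α_ (B ⊗ B') (A ⊗ A') (P ⊗ P')).hom := h₂.symm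
  simp only [swap₁₂, ← tensorHom_comp_tensorHom, Category.assoc]
  rw [h₂', reassoc_of% h₁']
  have h₃ := tensorμ_natural (β_ A B).hom (𝟙 P) (β_ A' B').hom (𝟙 P')
  simp only [tensorHom_id, id_whiskerRight] at h₃
  simp only [Iso.hom_inv_id_assoc]
  rw [reassoc_of% h₃]
  simp only [← comp_whiskerRight_assoc]
  rw [← braiding_tensorμ]

theorem tensorHom_tensMap_tensMul {ι : Type*} {X Y X' Y' : ι → E} (φ : ∀ i, X i ⟶ X' i)
    (ψ : ∀ i, Y i ⟶ Y' i) (l : List ι) :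
    (tensMap φ l ⊗ₘ tensMap ψ l) ≫ tensMul X' Y' l =
      tensMul X Y l ≫ tensMap (fun i => φ i ⊗ₘ ψ i) l := by
  induction l with
  | nil =>
    change (𝟙 (𝟙_ E) ⊗ₘ 𝟙 (𝟙_ E)) ≫ (λ_ _).hom = (λ_ _).hom ≫ 𝟙 _
    simp
  | cons a l ih =>
    change ((φ a ⊗ₘ tensMap φ l) ⊗ₘ (ψ a ⊗ₘ tensMap ψ l)) ≫ tensorμ _ _ _ _ ≫ _ ◁ _ =
      (tensorμ _ _ _ _ ≫ _ ◁ _) ≫ ((φ a ⊗ₘ ψ a) ⊗ₘ tensMap (fun i => φ i ⊗ₘ ψ i) l)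
    rw [reassoc_of% tensorμ_natural, tensorHom_comp_whiskerLeft, ih, Category.assoc,
      whiskerLeft_comp_tensorHom]

theorem tensMul_tensSplit {ι : Type*} (X Y : ι → E) (l : List ι) :
    tensMul X Y l ≫ tensSplit X Y l = 𝟙 _ := by
  induction l with
  | nil => exact (λ_ _).hom_inv_id
  | cons a l ih =>
    change (tensorμ _ _ _ _ ≫ _ ◁ _) ≫ _ ◁ _ ≫ tensorδ _ _ _ _ = 𝟙 _
    rw [Category.assoc, ← MonoidalCategory.whiskerLeft_comp_assoc, ih]
    simp

theorem tensSplit_tensMul {ι : Type*} (X Y : ι → E) (l : List ι) :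
    tensSplit X Y l ≫ tensMul X Y l = 𝟙 _ := by
  induction l with
  | nil => exact (λ_ _).inv_hom_id
  | cons a l ih =>
    change (_ ◁ _ ≫ tensorδ _ _ _ _) ≫ tensorμ _ _ _ _ ≫ _ ◁ _ = 𝟙 _
    rw [Category.assoc, tensorδ_tensorμ_assoc, ← MonoidalCategory.whiskerLeft_comp, ih]
    simp

instance tensMul_isIso {ι : Type*} (X Y : ι → E) (l : List ι) : IsIso (tensMul X Y l) :=
  ⟨tensSplit X Y l, tensMul_tensSplit X Y l, tensSplit_tensMul X Y l⟩

theorem tensMul_mapIdx {ι κ : Type*} {X Y : ι → E} {X' Y' : κ → E} (e : ι → κ)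
    (φ : ∀ i, X i ⟶ X' (e i)) (ψ : ∀ i, Y i ⟶ Y' (e i)) (l : List ι) :
    (tensMapIdx e φ l ⊗ₘ tensMapIdx e ψ l) ≫ tensMul X' Y' (l.map e) =
      tensMul X Y l ≫ tensMapIdx (Y := fun k => X' k ⊗ Y' k) e (fun i => φ i ⊗ₘ ψ i) l := by
  induction l with
  | nil =>
    change (𝟙 (𝟙_ E) ⊗ₘ 𝟙 (𝟙_ E)) ≫ (λ_ _).hom = (λ_ _).hom ≫ 𝟙 _
    simp
  | cons a l ih =>
    change ((φ a ⊗ₘ tensMapIdx e φ l) ⊗ₘ (ψ a ⊗ₘ tensMapIdx e ψ l)) ≫ tensorμ _ _ _ _ ≫ _ ◁ _ =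
      (tensorμ _ _ _ _ ≫ _ ◁ _) ≫ ((φ a ⊗ₘ ψ a) ⊗ₘ
        tensMapIdx (Y := fun k => X' k ⊗ Y' k) e (fun i => φ i ⊗ₘ ψ i) l)
    rw [reassoc_of% tensorμ_natural, tensorHom_comp_whiskerLeft, ih, Category.assoc,
      whiskerLeft_comp_tensorHom]

theorem tensPerm_tensMul {ι : Type*} [DecidableEq ι] (X Y : ι → E) {l l' : List ι}
    (h : l.Perm l') (hl : l.Nodup) :
    (tensPerm X l l' h ⊗ₘ tensPerm Y l l' h) ≫ tensMul X Y l' =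
      tensMul X Y l ≫ tensPerm (fun i => X i ⊗ Y i) l l' h := by
  induction h with
  | nil => simp [tensPerm_refl]
  | cons a h ih =>
    rename_i l₁ l₂
    rw [tensPerm_cons X a h, tensPerm_cons Y a h, tensPerm_cons _ a h]
    change (_ ⊗ₘ _) ≫ tensorμ _ _ _ _ ≫ _ ◁ _ = (tensorμ _ _ _ _ ≫ _ ◁ _) ≫ _
    rw [← id_tensorHom, ← id_tensorHom, reassoc_of% tensorμ_natural, tensorHom_comp_whiskerLeft,
      ih (List.nodup_cons.1 hl).2]
    simp
  | swap a b l =>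
    have hne : b ≠ a := by
      simp only [List.nodup_cons, List.mem_cons, not_or] at hl
      exact hl.1.1
    rw [tensPerm_swap X hne, tensPerm_swap Y hne, tensPerm_swap _ hne]
    change _ ≫ tensorμ _ _ _ _ ≫ _ ◁ (tensorμ _ _ _ _ ≫ _ ◁ _) =
      (tensorμ _ _ _ _ ≫ _ ◁ (tensorμ _ _ _ _ ≫ _ ◁ _)) ≫ _
    have := swap₁₂_tensorμ (X b) (X a) (tensL X l) (Y b) (Y a) (tensL Y l)
    simp only [MonoidalCategory.whiskerLeft_comp, Category.assoc]
    rw [reassoc_of% this, swap₁₂_right]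
  | trans h₁ h₂ ih₁ ih₂ =>
    rw [← tensPerm_trans X _ _ _ h₁ h₂, ← tensPerm_trans Y _ _ _ h₁ h₂,
      ← tensorHom_comp_tensorHom, Category.assoc, ih₂ (h₁.nodup_iff.1 hl),
      reassoc_of% (ih₁ hl), tensPerm_trans]

theorem tensReindex_tensMul {ι κ : Type*} [DecidableEq κ] {X Y : ι → E} {X' Y' : κ → E}
    {l : List ι} {l' : List κ} (e : ι → κ) (h : (l.map e).Perm l') (φ : ∀ i, X i ⟶ X' (e i))
    (ψ : ∀ i, Y i ⟶ Y' (e i)) (hl : l'.Nodup) :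
    (tensReindex e h φ ⊗ₘ tensReindex e h ψ) ≫ tensMul X' Y' l' =
      tensMul X Y l ≫ tensReindex (Y := fun k => X' k ⊗ Y' k) e h (fun i => φ i ⊗ₘ ψ i) := by
  simp only [tensReindex]
  rw [← tensorHom_comp_tensorHom, Category.assoc, tensPerm_tensMul _ _ h (h.nodup_iff.2 hl),
    reassoc_of% tensMul_mapIdx]

theorem tensAppend_tensMul {ι : Type*} (X Y : ι → E) (l₁ l₂ : List ι) :
    (tensAppend X l₂ l₁ ⊗ₘ tensAppend Y l₂ l₁) ≫ tensMul X Y (l₁ ++ l₂) =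
      tensorμ _ _ _ _ ≫ (tensMul X Y l₁ ⊗ₘ tensMul X Y l₂) ≫
        tensAppend (fun i => X i ⊗ Y i) l₂ l₁ := by
  induction l₁ with
  | nil =>
    change ((λ_ _).hom ⊗ₘ (λ_ _).hom) ≫ tensMul X Y l₂ =
      tensorμ (𝟙_ E) _ (𝟙_ E) _ ≫ ((λ_ _).hom ⊗ₘ _) ≫ (λ_ _).hom
    have := leftUnitor_monoidal (tensL X l₂) (tensL Y l₂)
    rw [this, MonoidalCategory.tensorHom_def _ (tensMul X Y l₂)]
    change _ = _ ≫ ((λ_ _).hom ▷ _ ≫ _) ≫ _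
    simp
  | cons a l₁ ih =>
    change (((α_ _ _ _).hom ≫ X a ◁ tensAppend X l₂ l₁) ⊗ₘ
        ((α_ _ _ _).hom ≫ Y a ◁ tensAppend Y l₂ l₁)) ≫
        tensorμ _ _ _ _ ≫ _ ◁ tensMul X Y (l₁ ++ l₂) =
      tensorμ (X a ⊗ _) _ (Y a ⊗ _) _ ≫ ((tensorμ _ _ _ _ ≫ _ ◁ _) ⊗ₘ _) ≫
        (α_ _ _ _).hom ≫ _ ◁ _
    have h₁ := associator_monoidal (X a) (tensL X l₁) (tensL X l₂) (Y a) (tensL Y l₁) (tensL Y l₂)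
    have h₂ := tensorμ_natural (𝟙 (X a)) (tensAppend X l₂ l₁) (𝟙 (Y a)) (tensAppend Y l₂ l₁)
    simp only [id_tensorHom, tensorHom_id, id_whiskerRight] at h₂
    rw [← tensorHom_comp_tensorHom, Category.assoc, reassoc_of% h₂,
      ← MonoidalCategory.whiskerLeft_comp, ih]
    simp only [MonoidalCategory.whiskerLeft_comp]
    rw [← reassoc_of% h₁, MonoidalCategory.tensorHom_def (tensorμ _ _ _ _ ≫ _),
      MonoidalCategory.comp_whiskerRight, Category.assoc, Category.assoc]
    congr 2
    rw [MonoidalCategory.tensorHom_def]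
    simp

/-- Pairing the factors of two iterated tensor products may be done block by block. -/
theorem tensSigma_tensMul {ι : Type*} {κ : ι → Type*} (X Y : ∀ i, κ i → E)
    (m : ∀ i, List (κ i)) (l : List ι) :
    (tensSigma X m l ⊗ₘ tensSigma Y m l) ≫ tensMul _ _ (l.sigma m) =
      tensMul _ _ l ≫ tensMap (fun i => tensMul (X i) (Y i) (m i)) l ≫
        tensSigma (fun i j => X i j ⊗ Y i j) m l := by
  induction l with
  | nil =>
    change (𝟙 (𝟙_ E) ⊗ₘ 𝟙 (𝟙_ E)) ≫ (λ_ _).hom = (λ_ _).hom ≫ 𝟙 _ ≫ 𝟙 _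
    simp
  | cons a l ih =>
    change (((tensMapIdx (X := X a) (Y := fun p : Σ i, κ i => X p.1 p.2) (Sigma.mk a)
          (fun _ => 𝟙 _) (m a) ⊗ₘ tensSigma X m l) ≫
          tensAppend (fun p : Σ i, κ i => X p.1 p.2) _ _) ⊗ₘ
      ((tensMapIdx (X := Y a) (Y := fun p : Σ i, κ i => Y p.1 p.2) (Sigma.mk a)
          (fun _ => 𝟙 _) (m a) ⊗ₘ tensSigma Y m l) ≫
          tensAppend (fun p : Σ i, κ i => Y p.1 p.2) _ _)) ≫
        tensMul _ _ ((m a).map (Sigma.mk a) ++ l.sigma m) =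
      (tensorμ _ _ _ _ ≫ _ ◁ tensMul _ _ l) ≫
        (tensMul (X a) (Y a) (m a) ⊗ₘ tensMap (fun i => tensMul (X i) (Y i) (m i)) l) ≫
        (tensMapIdx (X := fun j => X a j ⊗ Y a j) (Y := fun p : Σ i, κ i => X p.1 p.2 ⊗ Y p.1 p.2)
          (Sigma.mk a) (fun _ => 𝟙 _) (m a) ⊗ₘ tensSigma (fun i j => X i j ⊗ Y i j) m l) ≫
          tensAppend (fun p : Σ i, κ i => X p.1 p.2 ⊗ Y p.1 p.2) _ _
    rw [← tensorHom_comp_tensorHom, Category.assoc, tensAppend_tensMul, reassoc_of% tensorμ_natural,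
      tensorHom_comp_tensorHom_assoc, tensMul_mapIdx, ih]
    simp only [id_tensorHom_id, Category.assoc, tensorHom_comp_tensorHom_assoc,
      whiskerLeft_comp_tensorHom_assoc]

/-- Associativity of pairing the factors of tensor products. -/
theorem tensMul_assoc {ι : Type*} (X Y Z : ι → E) (l : List ι) :
    tensMul X Y l ▷ tensL Z l ≫ tensMul (fun i => X i ⊗ Y i) Z l ≫
        tensMap (fun i => (α_ (X i) (Y i) (Z i)).hom) l =
      (α_ _ _ _).hom ≫ tensL X l ◁ tensMul Y Z l ≫ tensMul X (fun i => Y i ⊗ Z i) l := by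
  induction l with
  | nil =>
    change (λ_ _).hom ▷ _ ≫ (λ_ _).hom ≫ 𝟙 _ = (α_ _ _ _).hom ≫ _ ◁ (λ_ _).hom ≫ (λ_ _).hom
    simp [unitors_equal]
  | cons a l ih =>
    change (tensorμ _ _ _ _ ≫ _ ◁ tensMul X Y l) ▷ _ ≫ (tensorμ _ _ _ _ ≫ _ ◁ _) ≫
      ((α_ _ _ _).hom ⊗ₘ tensMap _ l) =
      (α_ _ _ _).hom ≫ _ ◁ (tensorμ _ _ _ _ ≫ _ ◁ _) ≫ tensorμ _ _ _ _ ≫ _ ◁ _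
    have h₁ := tensor_associativity (X a) (tensL X l) (Y a) (tensL Y l) (Z a) (tensL Z l)
    have h₂ := tensorμ_natural (𝟙 (X a ⊗ Y a)) (tensMul X Y l) (𝟙 (Z a)) (𝟙 (tensL Z l))
    have h₃ := tensorμ_natural (𝟙 (X a)) (𝟙 (tensL X l)) (𝟙 (Y a ⊗ Z a)) (tensMul Y Z l)
    simp only [id_tensorHom, tensorHom_id, id_whiskerRight] at h₂ h₃
    simp only [comp_whiskerRight, Category.assoc, MonoidalCategory.whiskerLeft_comp]
    rw [reassoc_of% h₂, reassoc_of% h₃, ← reassoc_of% h₁, ← MonoidalCategory.whiskerLeft_comp_assoc]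
    rw [MonoidalCategory.whiskerLeft_comp_tensorHom, Category.assoc, ih,
      ← MonoidalCategory.whiskerLeft_comp, tensorHom_comp_whiskerLeft]

end Mul

end FinTensor

/-! ### Comparison isomorphisms of the parts of morphisms -/

namespace HypermomentCategory

section Compare

variable {C : Type u₁} [Category.{v₁} C] [HypermomentCategory C]

theorem inertIdx_eq {A B : C} {i : A ⟶ B} (hi : inert i) {x : El A} {y : El B}
    (h : (γ.map i).set x = {y}) : inertIdx i hi x = y := by
  rw [inertIdx_spec i hi] at h
  exact Set.singleton_injective h

theorem inertIdx_id (A : C) (h : inert (𝟙 A)) (x : El A) : inertIdx (𝟙 A) h x = x :=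
  inertIdx_eq h (by rw [CategoryTheory.Functor.map_id, SegalGamma.id_set])

theorem inertIdx_comp {A B D : C} (i : A ⟶ B) (j : B ⟶ D) (hi : inert i) (hj : inert j)
    (hij : inert (i ≫ j)) (x : El A) :
    inertIdx (i ≫ j) hij x = inertIdx j hj (inertIdx i hi x) :=
  inertIdx_eq hij (by
    rw [Functor.map_comp, SegalGamma.comp_set, inertIdx_spec i hi]
    simp [inertIdx_spec j hj])

theorem inert_iso {A B : C} (e : A ≅ B) : inert e.hom := inert_of_isIso _ inferInstance

theorem act_iso {A B : C} (e : A ≅ B) : act e.hom := act_of_isIso _ inferInstance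

/-- The bijection of the elementary inert subobjects induced by an isomorphism. -/
noncomputable abbrev isoIdx {A B : C} (e : A ≅ B) (x : El A) : El B :=
  inertIdx e.hom (inert_iso e) x

theorem isoIdx_refl (A : C) (x : El A) : isoIdx (Iso.refl A) x = x := inertIdx_id _ _ _

theorem isoIdx_trans {A B D : C} (e : A ≅ B) (e' : B ≅ D) (x : El A) :
    isoIdx (e ≪≫ e') x = isoIdx e' (isoIdx e x) := inertIdx_comp _ _ _ _ _ _

@[simp] theorem isoIdx_symm_isoIdx {A B : C} (e : A ≅ B) (x : El A) :
    isoIdx e.symm (isoIdx e x) = x := by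
  rw [← isoIdx_trans, Iso.self_symm_id, isoIdx_refl]

@[simp] theorem isoIdx_isoIdx_symm {A B : C} (e : A ≅ B) (x : El B) :
    isoIdx e (isoIdx e.symm x) = x := by
  rw [← isoIdx_trans, Iso.symm_self_id, isoIdx_refl]

/-- Isomorphisms onto the domain of an elementary inert morphism are determined by their composite
with it. -/
theorem elMap_iso_ext {A : C} {x : El A} {U : C} {ε ε' : U ≅ elObj A x}
    (h : ε.hom ≫ elMap A x = ε'.hom ≫ elMap A x) : ε = ε' := by
  have := (lift_unique A x (ε.hom ≫ elMap A x) (elMap A x) (isUnit_of_iso ε.symm (elObj_isUnit A x))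
    (elObj_isUnit A x) (inert_comp _ _ (inert_iso ε) (elMap_inert A x)) (elMap_inert A x)
    (fun j => by
      rw [Functor.map_comp, SegalGamma.comp_set, inertIdx_spec _ (inert_iso ε)]
      simp [elMap_set])
    (elMap_set A x)).unique (y₁ := ε) (y₂ := ε') rfl h.symm
  exact this

/-- A commutative square `f ≫ t = s ≫ f'` whose sides `s` and `t` are inert. Such a square
identifies each part `B_x` of `f` with a part of `f'`. -/
structure InSq {A A' B B' : C} (s : A ⟶ A') (t : B ⟶ B') (f : A ⟶ B) (f' : A' ⟶ B') : Prop where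
  hs : inert s
  ht : inert t
  w : f ≫ t = s ≫ f'

namespace InSq

variable {A A' A'' B B' B'' D D' : C}

theorem comp {s : A ⟶ A'} {t : B ⟶ B'} {f : A ⟶ B} {f' : A' ⟶ B'} {s' : A' ⟶ A''} {t' : B' ⟶ B''}
    {f'' : A'' ⟶ B''} (q : InSq s t f f') (q' : InSq s' t' f' f'') :
    InSq (s ≫ s') (t ≫ t') f f'' :=
  ⟨inert_comp _ _ q.hs q'.hs, inert_comp _ _ q.ht q'.ht, by
    rw [reassoc_of% q.w, q'.w, Category.assoc]⟩

theorem ofEq {f f' : A ⟶ B} (h : f = f') : InSq (𝟙 A) (𝟙 B) f f' :=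
  ⟨inert_of_isIso _ inferInstance, inert_of_isIso _ inferInstance, by simp [h]⟩

theorem ofIso {σ : A ≅ A'} {ρ : B ≅ B'} {f : A ⟶ B} {f' : A' ⟶ B'} (w : f ≫ ρ.hom = σ.hom ≫ f') :
    InSq σ.hom ρ.hom f f' := ⟨inert_iso σ, inert_iso ρ, w⟩

theorem symm {σ : A ≅ A'} {ρ : B ≅ B'} {f : A ⟶ B} {f' : A' ⟶ B'} (q : InSq σ.hom ρ.hom f f') :
    InSq σ.inv ρ.inv f' f :=
  ⟨inert_iso σ.symm, inert_iso ρ.symm, by rw [Iso.comp_inv_eq, Category.assoc, q.w]; simp⟩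

end InSq

section Cmp

variable {A A' A'' B B' B'' D D' : C} {s : A ⟶ A'} {t : B ⟶ B'} {f : A ⟶ B} {f' : A' ⟶ B'}

/-- The comparison isomorphism `B_x ≅ B'_{x'}` belonging to a square with inert sides, where `x'`
is the image of `x`. -/
noncomputable def cmp (q : InSq s t f f') {x : El A} {x' : El A'} (hx : inertIdx s q.hs x = x') :
    push f x ≅ push f' x' :=
  compare s q.hs t q.ht f f' q.w x ≪≫ eqToIso (by rw [hx])

theorem cmp_rfl (q : InSq s t f f') (x : El A) :
    cmp q (x := x) rfl = compare s q.hs t q.ht f f' q.w x := by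
  ext; simp [cmp]

theorem cmp_in (q : InSq s t f f') {x : El A} {x' : El A'} (hx : inertIdx s q.hs x = x') :
    (cmp q hx).hom ≫ pushIn f' x' = pushIn f x ≫ t := by
  subst hx
  rw [cmp_rfl]
  exact (compare_aux s q.hs t q.ht f f' q.w x).choose_spec.1.2

theorem cmp_act (q : InSq s t f f') {x : El A} {x' : El A'} (hx : inertIdx s q.hs x = x')
    (ε : elObj A x ≅ elObj A' x') (hε : ε.hom ≫ elMap A' x' = elMap A x ≫ s) :
    pushAct f x ≫ (cmp q hx).hom = ε.hom ≫ pushAct f' x' := by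
  subst hx
  rw [cmp_rfl, compare_act]
  congr 2
  exact elMap_iso_ext (by rw [elIso_hom, hε])

theorem exists_elIso (hs : inert s) {x : El A} {x' : El A'} (hx : inertIdx s hs x = x') :
    ∃ ε : elObj A x ≅ elObj A' x', ε.hom ≫ elMap A' x' = elMap A x ≫ s := by
  subst hx
  exact ⟨elIso s hs x, elIso_hom s hs x⟩

/-- The comparison isomorphism is the only one compatible with the active and inert parts. All
identities between comparison isomorphisms rest on this. -/
theorem cmp_unique (q : InSq s t f f') {x : El A} {x' : El A'} (hx : inertIdx s q.hs x = x')
    (k : push f x ≅ push f' x') (ε : elObj A x ≅ elObj A' x')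
    (hε : ε.hom ≫ elMap A' x' = elMap A x ≫ s)
    (h₁ : pushAct f x ≫ k.hom = ε.hom ≫ pushAct f' x')
    (h₂ : k.hom ≫ pushIn f' x' = pushIn f x ≫ t) : k = cmp q hx := by
  subst hx
  rw [cmp_rfl]
  refine (compare_aux s q.hs t q.ht f f' q.w x).choose_spec.2 _ ⟨?_, h₂⟩
  rw [h₁]
  congr 2
  exact elMap_iso_ext (by rw [elIso_hom, hε])

theorem cmp_comp {s' : A' ⟶ A''} {t' : B' ⟶ B''} {f'' : A'' ⟶ B''} (q : InSq s t f f')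
    (q' : InSq s' t' f' f'') {x : El A} {x' : El A'} {x'' : El A''} (hx : inertIdx s q.hs x = x')
    (hx' : inertIdx s' q'.hs x' = x'') (hx'' : inertIdx (s ≫ s') (q.comp q').hs x = x'') :
    cmp q hx ≪≫ cmp q' hx' = cmp (q.comp q') hx'' := by
  obtain ⟨ε, hε⟩ := exists_elIso q.hs hx
  obtain ⟨ε', hε'⟩ := exists_elIso q'.hs hx'
  refine cmp_unique _ _ _ (ε ≪≫ ε') ?_ ?_ ?_
  · simp [hε', reassoc_of% hε]
  · simp [reassoc_of% cmp_act q hx ε hε, cmp_act q' hx' ε' hε']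
  · simp [cmp_in, reassoc_of% cmp_in]

/-- Comparison isomorphisms compose; the composite is recognised by its inert sides. -/
theorem cmp_trans {s' : A' ⟶ A''} {t' : B' ⟶ B''} {f'' : A'' ⟶ B''} {s'' : A ⟶ A''} {t'' : B ⟶ B''}
    (q : InSq s t f f') (q' : InSq s' t' f' f'') (r : InSq s'' t'' f f'') (es : s ≫ s' = s'')
    (et : t ≫ t' = t'') {x : El A} {x' : El A'} {x'' : El A''} (hx : inertIdx s q.hs x = x')
    (hx' : inertIdx s' q'.hs x' = x'') (hx'' : inertIdx s'' r.hs x = x'') :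
    cmp q hx ≪≫ cmp q' hx' = cmp r hx'' := by
  subst es et
  exact cmp_comp q q' hx hx' hx''

theorem cmp_eq_eqToIso {f f' : A ⟶ B} {s : A ⟶ A} {t : B ⟶ B} (q : InSq s t f f') (hs : s = 𝟙 A)
    (ht : t = 𝟙 B) (hf : f = f') {x x' : El A} (hx : inertIdx s q.hs x = x') (h : x = x') :
    cmp q hx = eqToIso (by rw [hf, h]) := by
  subst hf h hs ht
  exact (cmp_unique q hx (Iso.refl _) (Iso.refl _) (by simp) (by simp) (by simp)).symm

theorem cmp_refl {s : A ⟶ A} {t : B ⟶ B} (q : InSq s t f f) (hs : s = 𝟙 A)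
    (ht : t = 𝟙 B) {x : El A} (hx : inertIdx s q.hs x = x) : cmp q hx = Iso.refl _ :=
  cmp_eq_eqToIso q hs ht rfl hx rfl

theorem cmp_eqToHom (q : InSq s t f f') {x : El A} {x' x'' : El A'} (hx : inertIdx s q.hs x = x')
    (h : x' = x'') (h' : push f' x' = push f' x'') :
    cmp q hx ≪≫ eqToIso h' = cmp q (hx.trans h) := by
  subst h
  simp

/-- The active morphism induced on a part by a second active morphism is determined by its
compatibility with the active and inert parts. -/
theorem pushMap_unique {f : A ⟶ B} {g : B ⟶ D} {h : A ⟶ D} (w : f ≫ g = h) {x : El A}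
    (k : push f x ⟶ push h x) (hk : act k) (h₁ : pushAct f x ≫ k = pushAct h x)
    (h₂ : k ≫ pushIn h x = pushIn f x ≫ g) : k = pushMap f g h w x := by
  obtain ⟨e, ⟨he₁, he₂⟩, -⟩ := fact_unique k (pushIn h x) (pushMap f g h w x) (pushIn h x) hk
    (pushIn_inert _ _) (pushMap_act _ _ _ _ _) (pushIn_inert _ _) (by rw [h₂, pushMap_in])
  have he : e = Iso.refl _ := by
    refine (fact_unique (pushAct h x) (pushIn h x) (pushAct h x) (pushIn h x) (pushAct_act _ _)
      (pushIn_inert _ _) (pushAct_act _ _) (pushIn_inert _ _) rfl).unique ⟨?_, he₂⟩ (by simp)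
    rw [← h₁, Category.assoc, he₁, pushAct_pushMap, h₁]
  rw [← he₁, he]
  simp

/-- Comparison isomorphisms commute with the morphisms induced on the parts by a second morphism. -/
theorem pushMap_cmp {u : D ⟶ D'} {g : B ⟶ D} {g' : B' ⟶ D'} {h : A ⟶ D} {h' : A' ⟶ D'}
    (q : InSq s t f f') (r : InSq t u g g') (p : InSq s u h h') (w : f ≫ g = h) (w' : f' ≫ g' = h')
    {x : El A} {x' : El A'} (hx : inertIdx s q.hs x = x') :
    pushMap f g h w x ≫ (cmp p hx).hom = (cmp q hx).hom ≫ pushMap f' g' h' w' x' := by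
  obtain ⟨ε, hε⟩ := exists_elIso q.hs hx
  -- conjugating by the comparison isomorphisms yields a morphism with the properties that
  -- characterise the induced one
  have key : (cmp q hx).inv ≫ pushMap f g h w x ≫ (cmp p hx).hom = pushMap f' g' h' w' x' := by
    refine pushMap_unique w' _ (act_comp _ _ (act_iso (cmp q hx).symm)
      (act_comp _ _ (pushMap_act _ _ _ _ _) (act_iso _))) ?_ ?_
    · have h₁ := cmp_act q hx ε hε
      have h₂ := cmp_act p hx ε hε
      rw [← Iso.eq_comp_inv, Category.assoc] at h₁
      rw [← cancel_epi ε.hom, ← h₂, ← pushAct_pushMap f g h w, h₁]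
      simp
    · rw [Category.assoc, Category.assoc, cmp_in, reassoc_of% (pushMap_in f g h w x), r.w,
        Iso.inv_comp_eq, reassoc_of% (cmp_in q hx)]
  rw [← key, Iso.hom_inv_id_assoc]

theorem pushMap_comp {D D' : C} {f : A ⟶ B} {g : B ⟶ D} {h : A ⟶ D} (w : f ≫ g = h) {k : D ⟶ D'}
    {l : A ⟶ D'} (w' : h ≫ k = l) {m : B ⟶ D'} (w'' : f ≫ m = l) (hm : g ≫ k = m) (x : El A) :
    pushMap f g h w x ≫ pushMap h k l w' x = pushMap f m l w'' x :=
  pushMap_unique w'' _ (act_comp _ _ (pushMap_act _ _ _ _ _) (pushMap_act _ _ _ _ _))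
    (by rw [reassoc_of% (pushAct_pushMap f g h w x), pushAct_pushMap])
    (by rw [Category.assoc, pushMap_in, reassoc_of% (pushMap_in f g h w x), hm])

theorem pushMap_sq {u : D ⟶ D'} {g : B ⟶ D} {g' : B' ⟶ D'} {h : A ⟶ D} {h' : A' ⟶ D'}
    (q : InSq s t f f') (r : InSq t u g g') (p : InSq s u h h') (w : f ≫ g = h) (w' : f' ≫ g' = h')
    {x : El A} {x' : El A'} (hx : inertIdx s q.hs x = x') :
    InSq (cmp q hx).hom (cmp p hx).hom (pushMap f g h w x) (pushMap f' g' h' w' x') :=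
  ⟨inert_iso _, inert_iso _, pushMap_cmp q r p w w' hx⟩

/-- The square that identifies the parts of the restriction of `g` to `B_x` with parts of `g`. -/
theorem nestSq (f : A ⟶ B) (g : B ⟶ D) (h : A ⟶ D) (w : f ≫ g = h) (x : El A) :
    InSq (pushIn f x) (pushIn h x) (pushMap f g h w x) g :=
  ⟨pushIn_inert _ _, pushIn_inert _ _, pushMap_in _ _ _ _ _⟩

theorem nested_eq (f : A ⟶ B) (g : B ⟶ D) (h : A ⟶ D) (w : f ≫ g = h) (x : El A)
    (y : El (push f x)) : nested f g h w x y = cmp (nestSq f g h w x) rfl := (cmp_rfl _ _).symm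

theorem compare_eq {s : A ⟶ A'} (hs : inert s) {t : B ⟶ B'} (ht : inert t) (w : f ≫ t = s ≫ f')
    (x : El A) : compare s hs t ht f f' w x = cmp ⟨hs, ht, w⟩ rfl := (cmp_rfl ⟨hs, ht, w⟩ _).symm

end Cmp

end Compare

end HypermomentCategory

/-! ### Tensor products over a one-element set -/

namespace FinTensor

variable {E : Type u} [Category.{v} E] [MonoidalCategory E] [SymmetricCategory E]

theorem perm_single {n : ℕ} {i : Fin n} (hi : ∀ j, j = i) :
    (([()] : List Unit).map (fun _ => i)).Perm (List.finRange n) := by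
  rw [List.perm_ext_iff_of_nodup (by simp) (List.nodup_finRange _)]
  intro y
  simp [hi y]

/-- The identification of a tensor product over a one-element set with its only factor. -/
def tensSingle {n : ℕ} (Z : Fin n → E) (i : Fin n) (hi : ∀ j, j = i) : Z i ⟶ tens Z :=
  (ρ_ (Z i)).inv ≫ tensReindex (X := fun _ : Unit => Z i) (l := [()]) (fun _ => i)
    (perm_single hi) (fun _ => 𝟙 _)

variable {n : ℕ} {i : Fin n} (hi : ∀ j, j = i)

/-- The form in which the identification with the only factor occurs in the unit constraint of
operads. -/
theorem single_eq {Z : Fin n → E} {A : E} (φ : A ⟶ Z i) :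
    (ρ_ A).inv ≫ tensReindex (X := fun _ : Unit => A) (l := [()]) (fun _ => i)
      (perm_single hi) (fun _ => φ) = φ ≫ tensSingle Z i hi := by
  have h : tensReindex (X := fun _ : Unit => A) (Y := Z) (l := [()]) (fun _ => i)
      (perm_single hi) (fun _ => φ) =
      (φ ▷ 𝟙_ E) ≫ tensReindex (X := fun _ : Unit => Z i) (l := [()]) (fun _ => i)
      (perm_single hi) (fun _ => 𝟙 _) := by
    have := tensMap_reindex (X := fun _ : Unit => A) (X' := fun _ : Unit => Z i) (Y := Z)
      (l := [()]) (fun _ => i) (perm_single hi) (fun _ => φ) (fun _ => 𝟙 _)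
    simp only [Category.comp_id] at this
    rw [← this]
    congr 1
    exact tensorHom_id _ _
  rw [h, tensSingle]
  simp

instance (Z : Fin n → E) : IsIso (tensSingle Z i hi) := by
  unfold tensSingle; infer_instance

theorem tensSingle_tensMap {Z Z' : Fin n → E} (φ : ∀ j, Z j ⟶ Z' j) :
    tensSingle Z i hi ≫ tensMap φ _ = φ i ≫ tensSingle Z' i hi := by
  rw [tensSingle, Category.assoc, tensReindex_map _ _ _ _ (List.nodup_finRange n), ← single_eq]
  simp

theorem tensSingle_tensMul (Z Z' : Fin n → E) :
    (tensSingle Z i hi ⊗ₘ tensSingle Z' i hi) ≫ tensMul Z Z' _ =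
      tensSingle (fun j => Z j ⊗ Z' j) i hi := by
  simp only [tensSingle]
  rw [← tensorHom_comp_tensorHom, Category.assoc,
    tensReindex_tensMul _ _ _ _ (List.nodup_finRange n)]
  change _ ≫ (tensorμ _ _ _ _ ≫ _ ◁ (λ_ _).hom) ≫ _ = _
  rw [← Category.assoc]
  have := rightUnitor_monoidal (Z i) (Z' i)
  congr 1
  · rw [← cancel_mono (ρ_ _).hom]
    have h : tensorμ (Z i) (𝟙_ E) (Z' i) (𝟙_ E) ≫ (Z i ⊗ Z' i) ◁ (λ_ (𝟙_ E)).hom ≫ (ρ_ _).hom =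
      (ρ_ (Z i)).hom ⊗ₘ (ρ_ (Z' i)).hom := this.symm
    simp only [Category.assoc]
    rw [h]
    simp
  · simp

theorem tensSingle_tensReindex {Z : Fin n → E} {m : ℕ} {j : Fin m} (hj : ∀ k, k = j)
    {Z' : Fin m → E} (e : Fin n → Fin m) (h : ((List.finRange n).map e).Perm (List.finRange m))
    (φ : ∀ k, Z k ⟶ Z' (e k)) (he : e i = j) :
    tensSingle Z i hi ≫ tensReindex e h φ = φ i ≫ eqToHom (by rw [he]) ≫ tensSingle Z' j hj := by
  subst he
  rw [tensSingle, Category.assoc, tensReindex_comp _ _ _ _ _ _ (List.nodup_finRange m)]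
  rw [eqToHom_refl, Category.id_comp, ← single_eq]
  congr 1
  exact tensReindex_congr (fun _ => rfl) (fun _ => by simp)

/-- An iterated tensor product with a single block is this block. -/
theorem tensSingle_tensSigma {κ : Fin n → Type*} [∀ i, DecidableEq (κ i)] (Y : ∀ i, κ i → E)
    (m : ∀ i, List (κ i)) (hp : ((m i).map (Sigma.mk i)).Perm ((List.finRange n).sigma m))
    (hm : ∀ i, (m i).Nodup) :
    tensSingle (fun i => tensL (Y i) (m i)) i hi ≫ tensSigma Y m _ =
      tensReindex (X := Y i) (Y := fun p : Σ i, κ i => Y p.1 p.2) (Sigma.mk i) hp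
        (fun _ => 𝟙 _) := by
  have h₁ := tensReindex_tensSigma (Y := fun (_ : Unit) => Y i) (m := fun _ => m i) (Y' := Y)
    (m' := m) (l := [()]) (fun _ => i) (perm_single hi) (fun _ => id) (fun _ => by simp)
    (fun _ _ => 𝟙 _) (List.nodup_finRange n) hm
  rw [tensSingle, Category.assoc]
  have h₂ : tensReindex (Y := Y i) id (l := m i) (l' := m i) (by simp) (fun _ => 𝟙 _) =
      𝟙 (tensL (Y i) (m i)) := by
    rw [tensReindex_id]
    exact tensMap_id _ _
  have h₃ : ∀ (hp'), (ρ_ (tensL (Y i) (m i))).inv ≫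
      tensSigma (fun _ : Unit => Y i) (fun _ => m i) [()] =
      tensReindex (X := Y i) (Y := fun p : Σ _ : Unit, κ i => Y i p.2)
        (l' := ([()] : List Unit).sigma (fun _ => m i))
        (fun j => (⟨(), j⟩ : Σ _ : Unit, κ i)) hp' (fun j => 𝟙 (Y i j)) := by
    intro hp'
    rw [tensSigma_cons]
    change _ ≫ (_ ⊗ₘ 𝟙 (𝟙_ E)) ≫ tensAppend _ [] _ = _
    have h₄ : ∀ l : List (Σ _ : Unit, κ i), (ρ_ _).inv ≫ tensAppend
        (fun p : Σ _ : Unit, κ i => Y i p.2) [] l = tensCast _ (by simp) := by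
      intro l
      induction l with
      | nil =>
        change (ρ_ (𝟙_ E)).inv ≫ (λ_ (𝟙_ E)).hom = 𝟙 _
        simp [unitors_equal]
      | cons a l ih =>
        rw [tensCast_cons _ (by simp : l = l ++ []) , ← ih]
        change (ρ_ (_ ⊗ _)).inv ≫ (α_ _ _ (𝟙_ E)).hom ≫
          _ ◁ tensAppend (fun p : Σ _ : Unit, κ i => Y i p.2) [] l = _
        simp
    rw [tensorHom_id, ← rightUnitor_inv_naturality_assoc, h₄, tensMapIdx_eq_tensReindex,
      tensCast_eq_perm, tensPerm_eq_tensReindex, tensReindex_comp]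
    · exact tensReindex_congr (fun _ => rfl) (fun _ => by simp)
    · exact List.Nodup.sigma (List.nodup_singleton _) (fun _ => hm i)
  have hp' : ((m i).map (fun j => (⟨(), j⟩ : Σ _ : Unit, κ i))).Perm
      (([()] : List Unit).sigma (fun _ => m i)) := by
    simp [List.sigma]
  have h₅ : tensReindex (X := fun _ : Unit => tensL (Y i) (m i)) (Y := fun i => tensL (Y i) (m i))
      (l := [()]) (fun _ => i) (perm_single hi) (fun _ => 𝟙 _) =
      tensReindex (fun _ => i) (perm_single hi) (fun _ => tensReindex (Y := Y i) id
        (show ((m i).map id).Perm (m i) by simp) (fun j => 𝟙 (Y i j))) :=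
    tensReindex_congr (fun _ => rfl) (fun _ => by
      rw [eqToHom_refl, Category.comp_id]; exact h₂.symm)
  rw [h₅, h₁, ← Category.assoc, h₃ hp', tensReindex_comp _ _ _ _ _ _
    (List.Nodup.sigma (List.nodup_finRange n) hm)]
  exact tensReindex_congr (fun _ => rfl) (fun _ => by simp)

end FinTensor

/-! ### The tensor products `X(f)` -/

namespace HypermomentCategory

open FinTensor

section Coll

variable {C : Type u₁} [Category.{v₁} C] {E : Type u} [Category.{v} E]

theorem actBy_refl (X : Collection C E) (A : C) : actBy X (Iso.refl A) = 𝟙 _ := X.map_id _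

theorem actBy_comp (X : Collection C E) {A B D : C} (e : A ≅ B) (e' : B ≅ D) :
    actBy X e ≫ actBy X e' = actBy X (e ≪≫ e') := (X.map_comp _ _).symm

instance actBy_isIso (X : Collection C E) {A B : C} (e : A ≅ B) : IsIso (actBy X e) :=
  ⟨actBy X e.symm, by rw [actBy_comp, Iso.self_symm_id, actBy_refl],
    by rw [actBy_comp, Iso.symm_self_id, actBy_refl]⟩

theorem actBy_comp_assoc (X : Collection C E) {A B D : C} (e : A ≅ B) (e' : B ≅ D) {Z : E}
    (k : val X D ⟶ Z) : actBy X e ≫ actBy X e' ≫ k = actBy X (e ≪≫ e') ≫ k := by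
  rw [← actBy_comp, Category.assoc]

theorem eqToHom_actBy (X : Collection C E) {A B : C} (h : A = B) (h' : val X A = val X B) :
    eqToHom h' = actBy X (eqToIso h) := by
  subst h; exact (actBy_refl X A).symm

theorem actBy_nat {X Y : Collection C E} (φ : X ⟶ Y) {A B : C} (e : A ≅ B) :
    actBy X e ≫ φ.app ⟨B⟩ = φ.app ⟨A⟩ ≫ actBy Y e := φ.naturality _

theorem actBy_nat_assoc {X Y : Collection C E} (φ : X ⟶ Y) {A B : C} (e : A ≅ B) {Z : E}
    (k : val Y B ⟶ Z) : actBy X e ≫ φ.app ⟨B⟩ ≫ k = φ.app ⟨A⟩ ≫ actBy Y e ≫ k := by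
  rw [← Category.assoc, actBy_nat, Category.assoc]

variable [HypermomentCategory C]

/-- In a commutative square of inert morphisms both paths have the same effect on indices. -/
theorem inertIdx_w {A B B' D : C} {s : A ⟶ B} {t : B ⟶ D} {s' : A ⟶ B'} {t' : B' ⟶ D}
    (hs : inert s) (ht : inert t) (hs' : inert s') (ht' : inert t') (w : s ≫ t = s' ≫ t')
    (x : El A) : inertIdx t ht (inertIdx s hs x) = inertIdx t' ht' (inertIdx s' hs' x) := by
  have h₁ := inertIdx_comp s t hs ht (inert_comp _ _ hs ht) x
  have h₂ := inertIdx_comp s' t' hs' ht' (inert_comp _ _ hs' ht') x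
  rw [← h₁, ← h₂]
  congr 1

theorem isUnit_eq {U : C} (hU : IsUnit U) (x y : El U) : x = y := by
  have hc := hU.card
  have := x.2
  have := y.2
  exact Fin.ext (by omega)

variable [MonoidalCategory E] [SymmetricCategory E]

/-- Two reindexings along comparison isomorphisms agree if their index maps and the inert sides
of the squares do. -/
theorem tensReindex_cmp_congr (X : Collection C E) {κ : Type*} {G : κ → C} {A' B' : C}
    {f' : A' ⟶ B'} {l : List κ} {l' : List (El A')} {e e' : κ → El A'}
    {h : (l.map e).Perm l'} {h' : (l.map e').Perm l'} {φ : ∀ i, G i ≅ push f' (e i)}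
    {ψ : ∀ i, G i ≅ push f' (e' i)} (he : ∀ i, e i = e' i)
    (hφ : ∀ i, φ i ≪≫ eqToIso (by rw [he]) = ψ i) :
    tensReindex (X := fun i => val X (G i)) (Y := fun y => val X (push f' y)) e h
        (fun i => actBy X (φ i)) =
      tensReindex (X := fun i => val X (G i)) (Y := fun y => val X (push f' y)) e' h'
        (fun i => actBy X (ψ i)) :=
  tensReindex_congr he (fun i => by
    rw [eqToHom_actBy X (show push f' (e i) = push f' (e' i) by rw [he]), actBy_comp, hφ])

theorem transport_eq (X : Collection C E) {A A' B B' : C} (σ : A ≅ A') (ρ : B ≅ B')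
    (f : A ⟶ B) (f' : A' ⟶ B') (w : f ≫ ρ.hom = σ.hom ≫ f') :
    transport X σ ρ f f' w = tensReindex (Y := fun y => val X (push f' y)) (isoIdx σ)
      (perm_of_bijective (inertIdx_bijective σ)) (fun _ => actBy X (cmp (InSq.ofIso w) rfl)) := by
  simp only [transport, compare_eq]

theorem transport_refl (X : Collection C E) {A B : C} (f : A ⟶ B)
    (w : f ≫ (Iso.refl B).hom = (Iso.refl A).hom ≫ f) :
    transport X (Iso.refl A) (Iso.refl B) f f w = 𝟙 _ := by
  have h : tensReindex (X := fun y => val X (push f y)) (Y := fun y => val X (push f y)) id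
      (show ((List.finRange _).map id).Perm (List.finRange _) by simp)
      (fun x : El A => actBy X (Iso.refl (push f x))) = 𝟙 _ := by
    rw [tensReindex_id, tensMap_id' (fun x => actBy_refl X _)]
  rw [transport_eq, ← h]
  exact tensReindex_cmp_congr (e' := id) X (fun x => isoIdx_refl A x) (fun x => by
    rw [cmp_eqToHom _ _ (isoIdx_refl A x), cmp_refl _ rfl rfl])

theorem transport_trans (X : Collection C E) {A A' A'' B B' B'' : C} (σ : A ≅ A') (ρ : B ≅ B')
    (σ' : A' ≅ A'') (ρ' : B' ≅ B'')
    (f : A ⟶ B) (f' : A' ⟶ B') (f'' : A'' ⟶ B'') (w : f ≫ ρ.hom = σ.hom ≫ f')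
    (w' : f' ≫ ρ'.hom = σ'.hom ≫ f'') (w'' : f ≫ (ρ ≪≫ ρ').hom = (σ ≪≫ σ').hom ≫ f'') :
    transport X σ ρ f f' w ≫ transport X σ' ρ' f' f'' w' =
      transport X (σ ≪≫ σ') (ρ ≪≫ ρ') f f'' w'' := by
  rw [transport_eq, transport_eq, transport_eq,
    tensReindex_comp _ _ _ _ _ _ (List.nodup_finRange _)]
  simp only [actBy_comp]
  exact tensReindex_cmp_congr X (fun x => (isoIdx_trans σ σ' x).symm) (fun x => by
    rw [cmp_comp _ _ _ _ ((isoIdx_trans σ σ' x)), cmp_eqToHom _ _ (isoIdx_trans σ σ' x).symm])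

theorem transport_congr (X : Collection C E) {A A' B B' : C} {σ σ' : A ≅ A'} {ρ ρ' : B ≅ B'}
    (f : A ⟶ B) (f' : A' ⟶ B') (w : f ≫ ρ.hom = σ.hom ≫ f') (w' : f ≫ ρ'.hom = σ'.hom ≫ f')
    (hσ : σ = σ') (hρ : ρ = ρ') : transport X σ ρ f f' w = transport X σ' ρ' f f' w' := by
  subst hσ hρ; rfl

instance transport_isIso (X : Collection C E) {A A' B B' : C} (σ : A ≅ A') (ρ : B ≅ B')
    (f : A ⟶ B) (f' : A' ⟶ B') (w : f ≫ ρ.hom = σ.hom ≫ f') : IsIso (transport X σ ρ f f' w) := by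
  rw [transport_eq]
  exact tensReindex_isIso (Y := fun y => val X (push f' y)) _ _ _

theorem tensMap_transport {X Y : Collection C E} (φ : X ⟶ Y) {A A' B B' : C} (σ : A ≅ A')
    (ρ : B ≅ B') (f : A ⟶ B) (f' : A' ⟶ B') (w : f ≫ ρ.hom = σ.hom ≫ f') :
    transport X σ ρ f f' w ≫ tensMap (fun x => φ.app ⟨push f' x⟩) _ =
      tensMap (fun x => φ.app ⟨push f x⟩) _ ≫ transport Y σ ρ f f' w := by
  rw [transport_eq, transport_eq, tensReindex_map _ _ _ _ (List.nodup_finRange _), tensMap_reindex]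
  simp only [actBy_nat]

theorem toUnitary_eq (X : Collection C E) {U A : C} (hU : IsUnit U) (f : U ⟶ A) (hf : act f) :
    toUnitary X hU f hf = have := pushIn_isIso hU f hf hU.idx
      actBy X (asIso (pushIn f hU.idx)).symm ≫
        tensSingle (fun x => val X (push f x)) hU.idx (fun _ => isUnit_eq hU _ _) :=
  single_eq (Z := fun x => val X (push f x)) (fun y => isUnit_eq hU y hU.idx) _

instance toUnitary_isIso (X : Collection C E) {U A : C} (hU : IsUnit U) (f : U ⟶ A) (hf : act f) :
    IsIso (toUnitary X hU f hf) := by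
  rw [toUnitary_eq]; infer_instance

theorem toUnitary_nat {X Y : Collection C E} (φ : X ⟶ Y) {U A : C} (hU : IsUnit U) (f : U ⟶ A)
    (hf : act f) : toUnitary X hU f hf ≫ tensMap (fun x => φ.app ⟨push f x⟩) _ =
      φ.app ⟨A⟩ ≫ toUnitary Y hU f hf := by
  rw [toUnitary_eq, toUnitary_eq, Category.assoc, tensSingle_tensMap, actBy_nat_assoc]

/-- For a unit `U` the identification of `X(A)` with `X(f)`, `f : U ⟶ A`, is natural in isomorphisms
of active morphisms. -/
theorem toUnitary_transport (X : Collection C E) {U U' A A' : C} (hU : IsUnit U) (hU' : IsUnit U')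
    (σ : U ≅ U') (ρ : A ≅ A') (f : U ⟶ A) (hf : act f) (f' : U' ⟶ A') (hf' : act f')
    (w : f ≫ ρ.hom = σ.hom ≫ f') :
    toUnitary X hU f hf ≫ transport X σ ρ f f' w = actBy X ρ ≫ toUnitary X hU' f' hf' := by
  have hx : isoIdx σ hU.idx = hU'.idx := isUnit_eq hU' _ _
  rw [toUnitary_eq, toUnitary_eq, transport_eq, Category.assoc,
    tensSingle_tensReindex _ (fun y => isUnit_eq hU' _ _) _ _ _ hx,
    eqToHom_actBy X (show push f' (isoIdx σ hU.idx) = push f' hU'.idx by rw [hx]),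
    actBy_comp_assoc, actBy_comp_assoc, actBy_comp_assoc]
  congr 2
  rw [Iso.trans_assoc, cmp_eqToHom _ _ hx]
  ext
  have h := cmp_in (InSq.ofIso w) hx
  have := pushIn_isIso hU f hf hU.idx
  have := pushIn_isIso hU' f' hf' hU'.idx
  simp only [Iso.trans_hom, Iso.symm_hom, asIso_inv]
  rw [← cancel_mono (pushIn f' hU'.idx)]
  simp [h]

end Coll

end HypermomentCategory

/-! ### Regrouping the factors of a composite -/

namespace HypermomentCategory

open FinTensor

section Regroup

variable {C : Type u₁} [Category.{v₁} C] {E : Type u} [Category.{v} E]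
variable [HypermomentCategory C] [MonoidalCategory E] [SymmetricCategory E]

/-- Two composites of comparison isomorphisms agree if the composites of their inert sides do. -/
theorem cmp_pair {A A₁ A₂ A₃ B B₁ B₂ B₃ : C} {s₁ : A ⟶ A₁} {t₁ : B ⟶ B₁} {f : A ⟶ B}
    {f₁ : A₁ ⟶ B₁} {s₂ : A₁ ⟶ A₂} {t₂ : B₁ ⟶ B₂} {f₂ : A₂ ⟶ B₂} {s₃ : A ⟶ A₃} {t₃ : B ⟶ B₃}
    {f₃ : A₃ ⟶ B₃} {s₄ : A₃ ⟶ A₂} {t₄ : B₃ ⟶ B₂} (q₁ : InSq s₁ t₁ f f₁) (q₂ : InSq s₂ t₂ f₁ f₂)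
    (q₃ : InSq s₃ t₃ f f₃) (q₄ : InSq s₄ t₄ f₃ f₂) (es : s₁ ≫ s₂ = s₃ ≫ s₄)
    (et : t₁ ≫ t₂ = t₃ ≫ t₄) {x : El A} {x₁ : El A₁} {x₂ x₂' : El A₂} {x₃ : El A₃}
    (h₁ : inertIdx s₁ q₁.hs x = x₁) (h₂ : inertIdx s₂ q₂.hs x₁ = x₂)
    (h₃ : inertIdx s₃ q₃.hs x = x₃) (h₄ : inertIdx s₄ q₄.hs x₃ = x₂') (hx : x₂ = x₂')
    (h' : push f₂ x₂ = push f₂ x₂') :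
    (cmp q₁ h₁ ≪≫ cmp q₂ h₂) ≪≫ eqToIso h' = cmp q₃ h₃ ≪≫ cmp q₄ h₄ := by
  subst hx
  have h₅ : inertIdx (s₃ ≫ s₄) (q₃.comp q₄).hs x = x₂ := by
    rw [inertIdx_comp _ _ q₃.hs q₄.hs, h₃, h₄]
  rw [cmp_trans q₁ q₂ (q₃.comp q₄) es et h₁ h₂ h₅, cmp_comp q₃ q₄ h₃ h₄ h₅]
  simp

/-- The elementary inert subobject of the target that belongs to one of a part `B_x`. -/
noncomputable abbrev nestIdx {A B : C} (f : A ⟶ B) (p : Σ x : El A, El (push f x)) : El B :=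
  inertIdx (pushIn f p.1) (pushIn_inert f p.1) p.2

theorem regroup_eq (X : Collection C E) {A B D : C} (f : A ⟶ B) (hf : act f) (g : B ⟶ D)
    (h : A ⟶ D) (w : f ≫ g = h) :
    regroup X f hf g h w =
      tensSigma (fun (x : El A) (y : El (push f x)) => val X (push (pushMap f g h w x) y))
        (fun _ => List.finRange _) (List.finRange _) ≫
      tensReindex (Y := fun y => val X (push g y)) (nestIdx f)
        (perm_of_bijective_sigma (nested_bijective f hf))
        (fun p => actBy X (cmp (nestSq f g h w p.1) rfl)) := by
  simp only [regroup, nested_eq]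

instance regroup_isIso (X : Collection C E) {A B D : C} (f : A ⟶ B) (hf : act f) (g : B ⟶ D)
    (h : A ⟶ D) (w : f ≫ g = h) : IsIso (regroup X f hf g h w) := by
  rw [regroup_eq]
  have := tensReindex_isIso (Y := fun y => val X (push g y)) (nestIdx f)
        (perm_of_bijective_sigma (nested_bijective f hf))
        (fun p => actBy X (cmp (nestSq f g h w p.1) rfl))
  infer_instance

theorem tensMap_regroup {X Y : Collection C E} (φ : X ⟶ Y) {A B D : C} (f : A ⟶ B) (hf : act f)
    (g : B ⟶ D) (h : A ⟶ D) (w : f ≫ g = h) :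
    regroup X f hf g h w ≫ tensMap (fun x => φ.app ⟨push g x⟩) _ =
      tensMap (fun x => tensMap (fun y => φ.app ⟨push (pushMap f g h w x) y⟩) _) _ ≫
        regroup Y f hf g h w := by
  rw [regroup_eq, regroup_eq, Category.assoc, tensReindex_map _ _ _ _ (List.nodup_finRange _),
    reassoc_of% (tensMap_tensSigma (Y' := fun (x : El A) (y : El (push f x)) =>
      val Y (push (pushMap f g h w x) y)) (fun x => List.finRange _) (List.finRange _)
      (fun x y => φ.app ⟨push (pushMap f g h w x) y⟩)), tensMap_reindex]
  simp only [actBy_nat]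

/-- The isomorphism between the families of tensor products belonging to an isomorphism of
composable pairs. -/
noncomputable def transportNested (X : Collection C E) {A A' B B' D D' : C} (σ : A ≅ A')
    (ρ : B ≅ B') (τ : D ≅ D') (f : A ⟶ B) (f' : A' ⟶ B') (g : B ⟶ D) (g' : B' ⟶ D')
    (h : A ⟶ D) (h' : A' ⟶ D')
    (w : f ≫ g = h) (w' : f' ≫ g' = h') (wf : f ≫ ρ.hom = σ.hom ≫ f')
    (wg : g ≫ τ.hom = ρ.hom ≫ g') (wh : h ≫ τ.hom = σ.hom ≫ h') :
    (tens fun x : El A => valMor X (pushMap f g h w x)) ⟶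
      tens fun x : El A' => valMor X (pushMap f' g' h' w' x) :=
  tensReindex (Y := fun x => valMor X (pushMap f' g' h' w' x)) (isoIdx σ)
    (perm_of_bijective (inertIdx_bijective σ))
    (fun _ => transport X (cmp (InSq.ofIso wf) rfl) (cmp (InSq.ofIso wh) rfl) _ _
      (pushMap_cmp (InSq.ofIso wf) (InSq.ofIso wg) (InSq.ofIso wh) w w' rfl))

/-- Regrouping is natural in isomorphisms of composable pairs of morphisms. -/
theorem transportNested_regroup (X : Collection C E) {A A' B B' D D' : C} (σ : A ≅ A') (ρ : B ≅ B')
    (τ : D ≅ D') (f : A ⟶ B) (hf : act f) (f' : A' ⟶ B') (hf' : act f') (g : B ⟶ D) (g' : B' ⟶ D')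
    (h : A ⟶ D) (h' : A' ⟶ D')
    (w : f ≫ g = h) (w' : f' ≫ g' = h') (wf : f ≫ ρ.hom = σ.hom ≫ f')
    (wg : g ≫ τ.hom = ρ.hom ≫ g') (wh : h ≫ τ.hom = σ.hom ≫ h') :
    transportNested X σ ρ τ f f' g g' h h' w w' wf wg wh ≫ regroup X f' hf' g' h' w' =
      regroup X f hf g h w ≫ transport X ρ τ g g' wg := by
  simp only [transportNested, transport_eq]
  rw [regroup_eq, regroup_eq, reassoc_of% (tensReindex_tensSigma
    (Y := fun (x : El A) (y : El (push f x)) => val X (push (pushMap f g h w x) y))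
    (Y' := fun (x : El A') (y : El (push f' x)) => val X (push (pushMap f' g' h' w' x) y))
    (l := List.finRange _) (l' := List.finRange _) (m := fun x => List.finRange _)
    (m' := fun x => List.finRange _) (isoIdx σ) (perm_of_bijective (inertIdx_bijective σ))
    (fun x => isoIdx (cmp (InSq.ofIso wf) rfl))
    (fun x => perm_of_bijective (inertIdx_bijective (cmp (InSq.ofIso wf) rfl)))
    (fun x y => actBy X (cmp (InSq.ofIso
      (pushMap_cmp (InSq.ofIso wf) (InSq.ofIso wg) (InSq.ofIso wh) w w' (x := x) rfl)) rfl))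
    (List.nodup_finRange _) (fun _ => List.nodup_finRange _)), Category.assoc,
    tensReindex_comp _ _ _ _ _ _ (List.nodup_finRange _),
    tensReindex_comp _ _ _ _ _ _ (List.nodup_finRange _)]
  congr 1
  simp only [actBy_comp]
  have key : ∀ p : Σ x : El A, El (push f x),
      nestIdx f' ⟨isoIdx σ p.1, isoIdx (cmp (InSq.ofIso wf) rfl) p.2⟩ = isoIdx ρ (nestIdx f p) :=
    fun p => inertIdx_w (inert_iso _) (pushIn_inert _ _) (pushIn_inert _ _) (inert_iso _)
      (cmp_in (InSq.ofIso wf) rfl) p.2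
  exact tensReindex_cmp_congr (G := fun p : Σ x : El A, El (push f x) =>
    push (pushMap f g h w p.1) p.2) X key (fun p => cmp_pair _ _ _ _
      (cmp_in (InSq.ofIso wf) rfl) (cmp_in (InSq.ofIso wh) rfl) rfl rfl rfl rfl (key p) _)

end Regroup

end HypermomentCategory

/-! ### Regrouping for three composable active morphisms -/

namespace HypermomentCategory

open FinTensor

section Regroup

variable {C : Type u₁} [Category.{v₁} C] {E : Type u} [Category.{v} E]
variable [HypermomentCategory C] [MonoidalCategory E] [SymmetricCategory E]

/-- A family of multiplications indexed by active morphisms is equivariant. -/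
def Equivariant (X : Collection C E)
    (μ : ∀ {A B : C} (f : A ⟶ B), act f → (val X A ⊗ valMor X f ⟶ val X B)) : Prop :=
  ∀ {A A' B B' : C} (σ : A ≅ A') (ρ : B ≅ B') (f : A ⟶ B) (hf : act f)
    (f' : A' ⟶ B') (hf' : act f') (w : f ≫ ρ.hom = σ.hom ≫ f'),
    (actBy X σ ⊗ₘ transport X σ ρ f f' w) ≫ μ f' hf' = μ f hf ≫ actBy X ρ

section Triple

variable {A₀ A B D : C} {d : A₀ ⟶ A} (hd : act d) {f : A ⟶ B} (hf : act f) {g : B ⟶ D} {k : A₀ ⟶ B}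
  {h : A ⟶ D} {l : A₀ ⟶ D} (wk : d ≫ f = k) (wh : f ≫ g = h) (wl : k ≫ g = l) (wl' : d ≫ h = l)

include wh in
theorem pushMap_triple (x : El A₀) :
    pushMap d f k wk x ≫ pushMap k g l wl x = pushMap d h l wl' x :=
  pushMap_comp wk wl wl' wh x

theorem pushMap_nest (x : El A₀) (y : El (push d x)) :
    pushMap (pushMap d f k wk x) (pushMap k g l wl x) (pushMap d h l wl' x)
        (pushMap_triple wk wh wl wl' x) y ≫ (cmp (nestSq d h l wl' x) rfl).hom =
      (cmp (nestSq d f k wk x) rfl).hom ≫ pushMap f g h wh (nestIdx d ⟨x, y⟩) :=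
  pushMap_cmp (nestSq d f k wk x) (nestSq k g l wl x) (nestSq d h l wl' x) _ _ rfl

/-- For composable `d`, `f`, `g` the factors `X(g_y)`, where `y` runs through the elementary
inert subobjects of the parts of the target of `d`, are the factors of the target itself. -/
noncomputable def regroupNested (X : Collection C E) :
    (tens fun x : El A₀ => tens fun y : El (push d x) =>
      valMor X (pushMap (pushMap d f k wk x) (pushMap k g l wl x) (pushMap d h l wl' x)
        (pushMap_triple wk wh wl wl' x) y)) ⟶
      tens fun y : El A => valMor X (pushMap f g h wh y) :=
  tensSigma (fun (x : El A₀) (y : El (push d x)) =>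
      valMor X (pushMap (pushMap d f k wk x) (pushMap k g l wl x) (pushMap d h l wl' x)
        (pushMap_triple wk wh wl wl' x) y)) (fun _ => List.finRange _) (List.finRange _) ≫
    tensReindex (Y := fun y => valMor X (pushMap f g h wh y)) (nestIdx d)
      (perm_of_bijective_sigma (nested_bijective d hd))
      (fun p => transport X (cmp (nestSq d f k wk p.1) rfl) (cmp (nestSq d h l wl' p.1) rfl) _ _
        (pushMap_nest wk wh wl wl' p.1 p.2))

instance (X : Collection C E) : IsIso (regroupNested hd wk wh wl wl' X) := by
  unfold regroupNested
  have := tensReindex_isIso (Y := fun y => valMor X (pushMap f g h wh y)) (nestIdx d)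
      (perm_of_bijective_sigma (nested_bijective d hd))
      (fun p => transport X (cmp (nestSq d f k wk p.1) rfl) (cmp (nestSq d h l wl' p.1) rfl) _ _
        (pushMap_nest wk wh wl wl' p.1 p.2))
  infer_instance

/-- Regrouping twice does not depend on the order: both sides are the tensor product over triples of
indices, reindexed along the same map with the same comparison isomorphisms. -/
theorem regroup_regroup (X : Collection C E) (hk : act k) :
    tensMap (fun x => regroup X (pushMap d f k wk x) (pushMap_act d f k wk x) (pushMap k g l wl x)
        (pushMap d h l wl' x) (pushMap_triple wk wh wl wl' x)) _ ≫ regroup X k hk g l wl =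
      regroupNested hd wk wh wl wl' X ≫ regroup X f hf g h wh := by
  simp only [regroupNested, regroup_eq, transport_eq]
  rw [tensMap_comp]
  -- regroup within each block, then the blocks
  have h₁ := tensReindex_tensSigma (ι := El A₀) (ι' := El A₀)
    (Y := fun (x : El A₀) (p : Σ y : El (push d x), El (push (pushMap d f k wk x) y)) =>
      val X (push (pushMap (pushMap d f k wk x) (pushMap k g l wl x) (pushMap d h l wl' x)
        (pushMap_triple wk wh wl wl' x) p.1) p.2))
    (m := fun x => (List.finRange _).sigma fun y => List.finRange _)
    (Y' := fun (x : El A₀) (z : El (push k x)) => val X (push (pushMap k g l wl x) z))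
    (m' := fun x => List.finRange _) (l := List.finRange _) (l' := List.finRange _) id
    (by simp) (fun x => nestIdx (pushMap d f k wk x))
    (fun x => perm_of_bijective_sigma (nested_bijective _ (pushMap_act d f k wk x)))
    (fun x p => actBy X (cmp (nestSq (pushMap d f k wk x) (pushMap k g l wl x)
      (pushMap d h l wl' x) (pushMap_triple wk wh wl wl' x) p.1) rfl))
    (List.nodup_finRange _) (fun _ => List.nodup_finRange _)
  rw [tensReindex_id] at h₁
  simp only [id] at h₁
  rw [Category.assoc, reassoc_of% h₁]
  have h₂ := tensSigma_tensSigma (fun (x : El A₀) (y : El (push d x))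
      (z : El (push (pushMap d f k wk x) y)) =>
      val X (push (pushMap (pushMap d f k wk x) (pushMap k g l wl x) (pushMap d h l wl' x)
        (pushMap_triple wk wh wl wl' x) y) z)) (fun x => List.finRange _)
        (fun x y => List.finRange _) (List.finRange _) (List.nodup_finRange _)
        (fun _ => List.nodup_finRange _) (fun _ _ => List.nodup_finRange _)
  rw [reassoc_of% h₂]
  -- the other side: the inner transports move past the sum over pairs
  have h₃ := tensReindex_tensSigma
    (Y := fun (p : Σ x : El A₀, El (push d x)) (z : El (push (pushMap d f k wk p.1) p.2)) =>
      val X (push (pushMap (pushMap d f k wk p.1) (pushMap k g l wl p.1) (pushMap d h l wl' p.1)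
        (pushMap_triple wk wh wl wl' p.1) p.2) z))
    (m := fun p => List.finRange _)
    (Y' := fun (y : El A) (z : El (push f y)) => val X (push (pushMap f g h wh y) z))
    (m' := fun x => List.finRange _)
    (l := (List.finRange _).sigma fun x => List.finRange _) (l' := List.finRange _) (nestIdx d)
    (perm_of_bijective_sigma (nested_bijective d hd))
    (fun p => isoIdx (cmp (nestSq d f k wk p.1) rfl))
    (fun p => perm_of_bijective (inertIdx_bijective _))
    (fun p z => actBy X (cmp (InSq.ofIso (pushMap_nest wk wh wl wl' p.1 p.2)) rfl))
    (List.nodup_finRange _) (fun _ => List.nodup_finRange _)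
  rw [Category.assoc, reassoc_of% h₃]
  rw [tensReindex_comp _ _ _ _ _ _ (List.nodup_finRange _),
    tensReindex_comp _ _ _ _ _ _ (List.nodup_finRange _),
    tensReindex_comp _ _ _ _ _ _ (List.nodup_finRange _)]
  congr 2
  simp only [actBy_comp, Category.id_comp]
  -- both index maps send a triple to the same element
  have key : ∀ p : Σ q : (Σ x : El A₀, El (push d x)), El (push (pushMap d f k wk q.1) q.2),
      nestIdx k ⟨p.1.1, nestIdx (pushMap d f k wk p.1.1) ⟨p.1.2, p.2⟩⟩ =
        nestIdx f ⟨nestIdx d p.1, isoIdx (cmp (nestSq d f k wk p.1.1) rfl) p.2⟩ := fun p =>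
    inertIdx_w (pushIn_inert _ _) (pushIn_inert _ _) (inert_iso _) (pushIn_inert _ _)
      (cmp_in (nestSq d f k wk p.1.1) rfl).symm p.2
  exact tensReindex_cmp_congr (G := fun p : Σ q : (Σ x : El A₀, El (push d x)),
      El (push (pushMap d f k wk q.1) q.2) => push (pushMap (pushMap d f k wk p.1.1)
        (pushMap k g l wl p.1.1) (pushMap d h l wl' p.1.1)
        (pushMap_triple wk wh wl wl' p.1.1) p.1.2) p.2) X key (fun p => cmp_pair _ _ _ _
      (cmp_in (nestSq d f k wk p.1.1) rfl).symm (cmp_in (nestSq d h l wl' p.1.1) rfl).symm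
      rfl rfl rfl rfl (key p) _)

/-- The multiplications of the parts of the parts are those of the parts of `A`. -/
theorem regroup_mul (X : Collection C E)
    (μ : ∀ {A B : C} (f : A ⟶ B), act f → (val X A ⊗ valMor X f ⟶ val X B))
    (hμ : Equivariant X μ) :
    (regroup X d hd f k wk ⊗ₘ regroupNested hd wk wh wl wl' X) ≫ tensMul _ _ _ ≫
        tensMap (fun y => μ (pushMap f g h wh y) (pushMap_act f g h wh y)) _ =
      tensMul _ _ _ ≫ tensMap (fun x => tensMul _ _ _ ≫ tensMap (fun y =>
        μ (pushMap (pushMap d f k wk x) (pushMap k g l wl x) (pushMap d h l wl' x)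
          (pushMap_triple wk wh wl wl' x) y) (pushMap_act _ _ _ _ _)) _) _ ≫
        regroup X d hd h l wl' := by
  simp only [regroupNested, regroup_eq]
  rw [tensMap_comp, ← tensorHom_comp_tensorHom, Category.assoc, Category.assoc,
    reassoc_of% (tensReindex_tensMul
      (X' := fun y => val X (push f y)) (Y' := fun y => valMor X (pushMap f g h wh y))
      (nestIdx d) (perm_of_bijective_sigma (nested_bijective d hd))
      (fun p => actBy X (cmp (nestSq d f k wk p.1) rfl))
      (fun p => transport X (cmp (nestSq d f k wk p.1) rfl) (cmp (nestSq d h l wl' p.1) rfl) _ _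
        (pushMap_nest wk wh wl wl' p.1 p.2)) (List.nodup_finRange _)),
    reassoc_of% tensSigma_tensMul]
  congr 2
  rw [reassoc_of% (tensMap_tensSigma
    (Y' := fun (x : El A₀) (y : El (push d x)) => val X (push (pushMap d h l wl' x) y))
    (fun x => List.finRange _) (List.finRange _) (fun x y =>
        μ (pushMap (pushMap d f k wk x) (pushMap k g l wl x) (pushMap d h l wl' x)
          (pushMap_triple wk wh wl wl' x) y) (pushMap_act _ _ _ _ _)))]
  congr 1
  rw [tensReindex_map _ _ _ _ (List.nodup_finRange _), tensMap_reindex]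
  congr 1
  funext p
  exact hμ _ _ _ _ _ _ _

end Triple

/-- For `f : U ⟶ A` with `U` a unit there is only one part, so that multiplying part by part is
multiplying along `g`. -/
theorem toUnitary_mul (X : Collection C E)
    (μ : ∀ {A B : C} (f : A ⟶ B), act f → (val X A ⊗ valMor X f ⟶ val X B))
    (hμ : Equivariant X μ) {U A B : C} (hU : IsUnit U) (f : U ⟶ A) (hf : act f) (g : A ⟶ B)
    (hg : act g) (h : U ⟶ B) (hh : act h) (w : f ≫ g = h) :
    toUnitary X hU f hf ▷ _ ≫ tensMul _ _ _ ≫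
        tensMap (fun x => μ (pushMap f g h w x) (pushMap_act f g h w x)) _ =
      val X A ◁ regroup X f hf g h w ≫ μ g hg ≫ toUnitary X hU h hh := by
  have := pushIn_isIso hU f hf hU.idx
  have := pushIn_isIso hU h hh hU.idx
  have hi : ∀ y, y = hU.idx := fun y => isUnit_eq hU _ _
  have wg : pushMap f g h w hU.idx ≫ (asIso (pushIn h hU.idx)).hom =
    (asIso (pushIn f hU.idx)).hom ≫ g := pushMap_in f g h w hU.idx
  have hp : ((List.finRange _).map
        (Sigma.mk (β := fun x : El U => El (push f x)) hU.idx)).Perm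
      ((List.finRange _).sigma fun x : El U => List.finRange ((γ.obj (push f x)).card)) := by
    have hn : ((List.finRange _).sigma fun x : El U =>
        List.finRange ((γ.obj (push f x)).card)).Nodup :=
      nodup_sigma (List.nodup_finRange _) (fun _ => List.nodup_finRange _)
    have hm : ((List.finRange _).map
        (Sigma.mk (β := fun x : El U => El (push f x)) hU.idx)).Nodup :=
      (List.nodup_finRange _).map sigma_mk_injective
    refine (List.perm_ext_iff_of_nodup hm hn).2 ?_
    rintro ⟨x, y⟩
    obtain rfl := hi x
    simp
  -- the only factor of the tensor product over `γ U`, regrouped, is transported along the inert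
  -- isomorphisms `A_x ≅ A` and `B_x ≅ B`
  have hreg : tensSingle (fun x => valMor X (pushMap f g h w x)) hU.idx hi ≫
      regroup X f hf g h w = transport X (asIso (pushIn f hU.idx)) (asIso (pushIn h hU.idx))
        (pushMap f g h w hU.idx) g wg := by
    rw [regroup_eq, transport_eq, reassoc_of% (tensSingle_tensSigma hi
      (fun x y => val X (push (pushMap f g h w x) y)) (fun x => List.finRange _) hp
      (fun _ => List.nodup_finRange _)), tensReindex_comp _ _ _ _ _ _ (List.nodup_finRange _)]
    simp only [Category.id_comp]
    rfl
  rw [← cancel_epi (val X A ◁ tensSingle (fun x => valMor X (pushMap f g h w x)) hU.idx hi),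
    ← MonoidalCategory.whiskerLeft_comp_assoc, hreg, toUnitary_eq, toUnitary_eq,
    MonoidalCategory.comp_whiskerRight, Category.assoc, whisker_exchange_assoc,
    ← MonoidalCategory.tensorHom_def'_assoc, reassoc_of% tensSingle_tensMul, tensSingle_tensMap,
    ← cancel_epi (actBy X (asIso (pushIn f hU.idx)) ▷ _), ← MonoidalCategory.tensorHom_def_assoc,
    reassoc_of% (hμ _ _ _ (pushMap_act f g h w hU.idx) g hg wg)]
  rw [← MonoidalCategory.comp_whiskerRight_assoc, actBy_comp, actBy_comp_assoc]
  simp [actBy_refl]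

end Regroup

end HypermomentCategory

/-! ### Universal families and their tensor products -/

namespace FinTensor

section Univ

variable {E : Type u} [Category.{v} E]

/-- The morphisms `ι j : S j ⟶ M` are universal among the families of morphisms out of the `S j`
that are compatible with the relations `rel j j' r`, for `r : S j ⟶ S j'`. -/
structure IsUniv {J : Type*} (S : J → E) (rel : ∀ j j', (S j ⟶ S j') → Prop) {M : E}
    (ι : ∀ j, S j ⟶ M) : Prop where
  compat : ∀ j j' r, rel j j' r → r ≫ ι j' = ι j
  exists_desc : ∀ (Z : E) (g : ∀ j, S j ⟶ Z), (∀ j j' r, rel j j' r → r ≫ g j' = g j) →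
    ∃ k : M ⟶ Z, ∀ j, ι j ≫ k = g j
  hom_ext : ∀ {Z : E} {a b : M ⟶ Z}, (∀ j, ι j ≫ a = ι j ≫ b) → a = b

/-- Universal families exist in a cocomplete category: the coequalizer of the two evident morphisms
between coproducts. -/
theorem exists_isUniv [Limits.HasColimitsOfSize.{w, w} E] {J : Type w} (S : J → E)
    (R : J → J → Type w) (m : ∀ {j j'}, R j j' → (S j ⟶ S j')) :
    ∃ (M : E) (ι : ∀ j, S j ⟶ M), IsUniv S (fun j j' r => ∃ θ : R j j', r = m θ) ι := by
  let src : (Σ j j', R j j') → E := fun p => S p.1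
  let a : (∐ src) ⟶ ∐ S := Limits.Sigma.desc fun p => Limits.Sigma.ι S p.1
  let b : (∐ src) ⟶ ∐ S := Limits.Sigma.desc fun p => m p.2.2 ≫ Limits.Sigma.ι S p.2.1
  have : Limits.HasCoequalizers E := Limits.hasCoequalizers_of_hasColimit_parallelPair _
  refine ⟨Limits.coequalizer a b, fun j => Limits.Sigma.ι S j ≫ Limits.coequalizer.π a b,
    ?_, ?_, ?_⟩
  · rintro j j' _ ⟨θ, rfl⟩
    have h := Limits.Sigma.ι src ⟨j, j', θ⟩ ≫= Limits.coequalizer.condition a b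
    simpa [a, b] using h.symm
  · intro Z g hg
    have hk : a ≫ Limits.Sigma.desc g = b ≫ Limits.Sigma.desc g := by
      refine Limits.Sigma.hom_ext _ _ fun p => ?_
      simp [a, b, hg _ _ _ ⟨p.2.2, rfl⟩, src]
    exact ⟨Limits.coequalizer.desc (Limits.Sigma.desc g) hk, fun j => by simp⟩
  · intro Z k k' h
    refine Limits.coequalizer.hom_ext (Limits.Sigma.hom_ext _ _ fun j => ?_)
    simpa using h j

namespace IsUniv

variable {J : Type*} {S : J → E} {rel : ∀ j j', (S j ⟶ S j') → Prop} {M : E} {ι : ∀ j, S j ⟶ M}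

/-- The morphism out of `M` given by a compatible family. -/
noncomputable def desc (h : IsUniv S rel ι) {Z : E} (g : ∀ j, S j ⟶ Z)
    (hg : ∀ j j' r, rel j j' r → r ≫ g j' = g j) : M ⟶ Z := (h.exists_desc Z g hg).choose

theorem fac (h : IsUniv S rel ι) {Z : E} (g : ∀ j, S j ⟶ Z)
    (hg : ∀ j j' r, rel j j' r → r ≫ g j' = g j) (j : J) : ι j ≫ h.desc g hg = g j :=
  (h.exists_desc Z g hg).choose_spec j

variable [MonoidalCategory E] [SymmetricCategory E] [MonoidalClosed E]

/-- Tensoring preserves universal families because it has a right adjoint. -/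
theorem whiskerLeft (h : IsUniv S rel ι) (W : E) :
    IsUniv (fun j => W ⊗ S j) (fun j j' r => ∃ r₀, rel j j' r₀ ∧ r = W ◁ r₀)
      (fun j => W ◁ ι j) where
  compat := by
    rintro j j' _ ⟨r, hr, rfl⟩
    rw [← MonoidalCategory.whiskerLeft_comp, h.compat _ _ _ hr]
  exists_desc Z g hg := by
    obtain ⟨k, hk⟩ := h.exists_desc _ (fun j => MonoidalClosed.curry (g j)) (fun j j' r hr => by
      rw [← MonoidalClosed.curry_natural_left, hg _ _ _ ⟨r, hr, rfl⟩])
    refine ⟨MonoidalClosed.uncurry k, fun j => ?_⟩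
    rw [← MonoidalClosed.uncurry_natural_left, hk, MonoidalClosed.uncurry_curry]
  hom_ext {Z a b} hab := by
    apply MonoidalClosed.curry_injective
    refine h.hom_ext fun j => ?_
    rw [← MonoidalClosed.curry_natural_left, ← MonoidalClosed.curry_natural_left, hab]

theorem whiskerRight (h : IsUniv S rel ι) (W : E) :
    IsUniv (fun j => S j ⊗ W) (fun j j' r => ∃ r₀, rel j j' r₀ ∧ r = r₀ ▷ W)
      (fun j => ι j ▷ W) where
  compat := by
    rintro j j' _ ⟨r, hr, rfl⟩
    rw [← MonoidalCategory.comp_whiskerRight, h.compat _ _ _ hr]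
  exists_desc Z g hg := by
    obtain ⟨k, hk⟩ := (h.whiskerLeft W).exists_desc Z (fun j => (β_ W (S j)).hom ≫ g j) (by
      rintro j j' _ ⟨r, hr, rfl⟩
      rw [BraidedCategory.braiding_naturality_right_assoc, hg _ _ _ ⟨r, hr, rfl⟩])
    refine ⟨(β_ M W).hom ≫ k, fun j => ?_⟩
    rw [BraidedCategory.braiding_naturality_left_assoc, hk]
    simp
  hom_ext {Z a b} hab := by
    rw [← cancel_epi (β_ W M).hom]
    refine (h.whiskerLeft W).hom_ext fun j => ?_
    rw [BraidedCategory.braiding_naturality_right_assoc, hab,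
      BraidedCategory.braiding_naturality_right_assoc]

/-- The tensor product of two universal families. Reflexivity of the relations is needed in order to
vary one factor at a time. -/
theorem tensor (h : IsUniv S rel ι) (hr : ∀ j, rel j j (𝟙 _)) {J' : Type*} {S' : J' → E}
    {rel' : ∀ j j', (S' j ⟶ S' j') → Prop} {M' : E} {ι' : ∀ j, S' j ⟶ M'} (h' : IsUniv S' rel' ι')
    (hr' : ∀ j, rel' j j (𝟙 _)) :
    IsUniv (J := J × J') (fun p => S p.1 ⊗ S' p.2)
      (fun p p' r => ∃ r₀ r₁, rel p.1 p'.1 r₀ ∧ rel' p.2 p'.2 r₁ ∧ r = (r₀ ⊗ₘ r₁))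
      (fun p => ι p.1 ⊗ₘ ι' p.2) where
  compat := by
    rintro p p' _ ⟨r, r', hr, hr', rfl⟩
    rw [tensorHom_comp_tensorHom, h.compat _ _ _ hr, h'.compat _ _ _ hr']
  exists_desc Z g hg := by
    have h₁ : ∀ j, ∃ k : S j ⊗ M' ⟶ Z, ∀ j', S j ◁ ι' j' ≫ k = g (j, j') := fun j =>
      (h'.whiskerLeft (S j)).exists_desc Z (fun j' => g (j, j')) (by
        rintro j₁ j₂ _ ⟨r, hr₁, rfl⟩
        rw [← hg (j, j₁) (j, j₂) _ ⟨𝟙 _, r, hr j, hr₁, rfl⟩, id_tensorHom])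
    choose k hk using h₁
    obtain ⟨k', hk'⟩ := (h.whiskerRight M').exists_desc Z k (by
      rintro j₁ j₂ _ ⟨r, hr₁, rfl⟩
      refine (h'.whiskerLeft (S j₁)).hom_ext fun j' => ?_
      rw [whisker_exchange_assoc, hk, hk, ← hg (j₁, j') (j₂, j') _ ⟨r, 𝟙 _, hr₁, hr' j', rfl⟩,
        tensorHom_id])
    refine ⟨k', fun p => ?_⟩
    rw [MonoidalCategory.tensorHom_def', Category.assoc, hk', hk]
  hom_ext {Z a b} hab := by
    refine (h.whiskerRight M').hom_ext fun j => (h'.whiskerLeft (S j)).hom_ext fun j' => ?_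
    have := hab (j, j')
    rwa [MonoidalCategory.tensorHom_def', Category.assoc, Category.assoc] at this

end IsUniv

section Tens

variable [MonoidalCategory E]

/-- Splitting off the first factor of a tensor product. -/
def tensSucc {n : ℕ} (X : Fin (n + 1) → E) : X 0 ⊗ tens (fun i => X (Fin.succ i)) ⟶ tens X :=
  X 0 ◁ tensMapIdx (Y := X) Fin.succ (fun _ => 𝟙 _) _ ≫
    tensCast (l := 0 :: (List.finRange n).map Fin.succ) X (List.finRange_succ).symm

instance {n : ℕ} (X : Fin (n + 1) → E) : IsIso (tensSucc X) := by
  unfold tensSucc; infer_instance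

theorem tensSucc_nat {n : ℕ} {X Y : Fin (n + 1) → E} (φ : ∀ i, X i ⟶ Y i) :
    (φ 0 ⊗ₘ tensMap (fun i => φ (Fin.succ i)) _) ≫ tensSucc Y = tensSucc X ≫ tensMap φ _ := by
  simp only [tensSucc, Category.assoc]
  rw [tensCast_nat]
  change _ = _ ≫ (φ 0 ⊗ₘ tensMap φ _) ≫ _
  rw [← Category.assoc, ← Category.assoc]
  congr 1
  rw [tensorHom_comp_whiskerLeft, whiskerLeft_comp_tensorHom, tensMap_mapIdx, tensMapIdx_map]
  simp

end Tens

/-- The tensor product of finitely many universal families is universal. This is where the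
hypothesis that the monoidal category is closed enters. -/
theorem IsUniv.tens [MonoidalCategory E] [SymmetricCategory E] [MonoidalClosed E] {n : ℕ}
    {J : Fin n → Type*} {S : ∀ i, J i → E} {rel : ∀ i j j', (S i j ⟶ S i j') → Prop} {M : Fin n → E}
    {ι : ∀ i j, S i j ⟶ M i} (h : ∀ i, IsUniv (S i) (rel i) (ι i)) (hr : ∀ i j, rel i j j (𝟙 _)) :
    IsUniv (J := ∀ i, J i) (fun j => FinTensor.tens fun i => S i (j i))
      (fun j j' r => ∃ ρ : ∀ i, S i (j i) ⟶ S i (j' i), (∀ i, rel i _ _ (ρ i)) ∧ r = tensMap ρ _)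
      (fun j => tensMap (fun i => ι i (j i)) _) := by
  induction n with
  | zero =>
    refine ⟨?_, ?_, ?_⟩
    · rintro j j' _ ⟨ρ, -, rfl⟩
      exact Category.id_comp _
    · intro Z g hg
      refine ⟨g (fun i => i.elim0), fun j => ?_⟩
      obtain rfl : j = fun i => i.elim0 := funext fun i => i.elim0
      exact Category.id_comp _
    · intro Z a b hab
      have := hab (fun i => i.elim0)
      erw [Category.id_comp, Category.id_comp] at this
      exact this
  | succ n ih =>
    have h₁ := ih (fun i => h (Fin.succ i)) (fun i => hr (Fin.succ i))
    have h₂ := (h 0).tensor (hr 0) h₁ (fun j => ⟨fun i => 𝟙 _, fun i => hr _ _,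
      (tensMap_id _ _).symm⟩)
    have hc : ∀ j : (∀ i, J i), ∃ a b, j = Fin.cons a b :=
      fun j => ⟨j 0, fun i => j (Fin.succ i), (Fin.cons_self_tail j).symm⟩
    -- the splitting of the first factor, for the index families written as `Fin.cons a b`; its
    -- value is forgotten below, only its naturality `hT`, `hι` and its invertibility matter
    let T : ∀ (a : J 0) (b : ∀ i, J (Fin.succ i)),
        S 0 a ⊗ FinTensor.tens (fun i => S (Fin.succ i) (b i)) ⟶
          FinTensor.tens fun i => S i ((Fin.cons a b : ∀ i, J i) i) :=
      fun a b => tensSucc (fun i => S i ((Fin.cons a b : ∀ i, J i) i))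
    have hT : ∀ a b a' b' (r₀ : S 0 a ⟶ S 0 a')
        (ρ : ∀ i, S (Fin.succ i) (b i) ⟶ S (Fin.succ i) (b' i)),
        (r₀ ⊗ₘ tensMap ρ _) ≫ T a' b' =
          T a b ≫ tensMap (Fin.cases r₀ ρ : ∀ i, S i ((Fin.cons a b : ∀ i, J i) i) ⟶
              S i ((Fin.cons a' b' : ∀ i, J i) i)) _ := fun a b a' b' r₀ ρ =>
      tensSucc_nat (X := fun i => S i ((Fin.cons a b : ∀ i, J i) i))
        (Y := fun i => S i ((Fin.cons a' b' : ∀ i, J i) i))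
        (Fin.cases (motive := fun i => S i ((Fin.cons a b : ∀ i, J i) i) ⟶
              S i ((Fin.cons a' b' : ∀ i, J i) i)) r₀ ρ)
    have hι : ∀ a b, (ι 0 a ⊗ₘ tensMap (fun i => ι (Fin.succ i) (b i)) _) ≫ tensSucc M =
        T a b ≫ tensMap (fun i => ι i ((Fin.cons a b : ∀ i, J i) i)) _ := fun a b =>
      tensSucc_nat (fun i => ι i ((Fin.cons a b : ∀ i, J i) i))
    have : ∀ a b, IsIso (T a b) := fun a b =>
      (inferInstance : IsIso (tensSucc (fun i => S i ((Fin.cons a b : ∀ i, J i) i))))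
    clear_value T
    refine ⟨?_, ?_, ?_⟩
    · rintro j j' _ ⟨ρ, hρ, rfl⟩
      rw [tensMap_tensMap]
      congr 1
      funext i
      exact (h i).compat _ _ _ (hρ i)
    · intro Z g hg
      obtain ⟨k, hk⟩ := h₂.exists_desc Z (fun p => T p.1 p.2 ≫ g (Fin.cons p.1 p.2)) (by
          rintro ⟨a, b⟩ ⟨a', b'⟩ _ ⟨r₀, _, h₀, ⟨ρ, hρ, rfl⟩, rfl⟩
          rw [reassoc_of% hT, hg (Fin.cons a b) (Fin.cons a' b') _
            ⟨Fin.cases r₀ ρ, Fin.cases h₀ hρ, rfl⟩])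
      refine ⟨inv (tensSucc M) ≫ k, fun j => ?_⟩
      obtain ⟨a, b, rfl⟩ := hc j
      rw [← cancel_epi (T a b), ← reassoc_of% hι, IsIso.hom_inv_id_assoc]
      exact hk (a, b)
    · intro Z k k' hab
      rw [← cancel_epi (tensSucc M)]
      refine h₂.hom_ext fun p => ?_
      have := T p.1 p.2 ≫= hab (Fin.cons p.1 p.2)
      rw [← reassoc_of% hι, ← reassoc_of% hι] at this
      exact this

end Univ

end FinTensor

/-! ### Trees presented by grafting and the free collection -/

namespace HypermomentCategory

open FinTensor

section Free

variable {C : Type w} [SmallCategory C] [HypermomentCategory C]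

/-- Trees presented by grafting: a tree over `A` is either a unit, or it consists of an active
morphism `d : D ⟶ A` and trees over objects isomorphic to the parts `A_x`, `x ∈ γ(D)`. The node
stands for a vertex labelled by `D`, on which the trees over the parts are grafted. The isomorphisms
`Y x ≅ A_x` make the type stable under replacing the objects by isomorphic ones. -/
inductive GTree : C → Type w
  | leaf (U : C) (hU : IsUnit U) : GTree U
  | node {D A : C} (d : D ⟶ A) (hd : act d) (Y : El D → C) (e : ∀ x, Y x ≅ push d x)
      (Q : ∀ x, GTree (Y x)) : GTree A

/-- An isomorphism of trees presented by grafting, lying over an isomorphism of the objects. The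
index map of a node is an argument `idx` with a proof that it is induced by `σ`, so that the
identity of a node can have `id` as its index map. -/
inductive GIso : ∀ {A A' : C}, GTree A → GTree A' → (A ≅ A') → Type w
  | leaf {U U' : C} (hU : IsUnit U) (hU' : IsUnit U') (ε : U ≅ U') :
      GIso (.leaf U hU) (.leaf U' hU') ε
  | node {D A D' A' : C} {d : D ⟶ A} {hd : act d} {Y : El D → C} {e : ∀ x, Y x ≅ push d x}
      {Q : ∀ x, GTree (Y x)} {d' : D' ⟶ A'} {hd' : act d'} {Y' : El D' → C}
      {e' : ∀ x, Y' x ≅ push d' x} {Q' : ∀ x, GTree (Y' x)} (σ : D ≅ D') (ε : A ≅ A')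
      (w : d ≫ ε.hom = σ.hom ≫ d') (idx : El D → El D') (hidx : ∀ x, isoIdx σ x = idx x)
      (κ : ∀ x, Y x ≅ Y' (idx x)) (θ : ∀ x, GIso (Q x) (Q' (idx x)) (κ x))
      (hκ : ∀ x, κ x ≪≫ e' (idx x) = e x ≪≫ cmp (InSq.ofIso w) (hidx x)) :
      GIso (.node d hd Y e Q) (.node d' hd' Y' e' Q') ε

theorem perm_idx {D D' : C} {σ : D ≅ D'} {idx : El D → El D'} (hidx : ∀ x, isoIdx σ x = idx x) :
    ((List.finRange _).map idx).Perm (List.finRange _) := by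
  obtain rfl : isoIdx σ = idx := funext hidx
  exact perm_of_bijective (inertIdx_bijective σ)

/-- The identity of a tree presented by grafting. -/
noncomputable def GIso.refl : ∀ {A : C} (P : GTree A), GIso P P (Iso.refl A)
  | _, .leaf U hU => .leaf hU hU _
  | _, .node d hd Y e Q =>
      .node (Iso.refl _) (Iso.refl _) (by simp) id (isoIdx_refl _) (fun x => Iso.refl _)
        (fun x => GIso.refl (Q x)) (fun x => by
          rw [cmp_refl (x := x) (InSq.ofIso (σ := Iso.refl _) (ρ := Iso.refl _) (by simp)) rfl rfl
            (isoIdx_refl _ x)]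
          simp)

variable {E : Type u} [Category.{v} E] [MonoidalCategory E]

/-- The tensor product of the objects `X(D)` over the vertices of the tree. -/
@[reducible] noncomputable def GTree.tensor (X : Collection C E) : ∀ {A : C}, GTree A → E
  | _, .leaf _ _ => 𝟙_ E
  | _, .node (D := D) _ _ _ _ Q => val X D ⊗ tens fun x => GTree.tensor X (Q x)

variable [SymmetricCategory E]

/-- The action of an isomorphism of trees on the tensor products over the vertices. -/
noncomputable def GIso.map (X : Collection C E) : ∀ {A A' : C} {P : GTree A} {P' : GTree A'}
    {ε : A ≅ A'}, GIso P P' ε → (P.tensor X ⟶ P'.tensor X)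
  | _, _, _, _, _, .leaf _ _ _ => 𝟙 _
  | _, _, _, _, _, .node (Q' := Q') σ _ _ idx hidx _ θ _ =>
      actBy X σ ⊗ₘ tensReindex (Y := fun x => (Q' x).tensor X) idx (perm_idx hidx)
        (fun x => (θ x).map X)

theorem GIso.map_refl (X : Collection C E) {A : C} (P : GTree A) : (GIso.refl P).map X = 𝟙 _ := by
  induction P with
  | leaf U hU => rfl
  | node d hd Y e Q ih =>
    simp only [GIso.refl, GIso.map, ih]
    rw [tensReindex_id, tensMap_id, actBy_refl]
    exact id_tensorHom_id _ _

variable (C) in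
/-- The index type of the colimit `F(X)(A)`: trees over objects isomorphic to `A`. -/
structure FreeIdx (A : C) : Type w where
  obj : C
  tree : GTree obj
  iso : obj ≅ A

/-- The tensor product over the vertices of a tree. -/
noncomputable abbrev FreeIdx.tensor (X : Collection C E) {A : C} (j : FreeIdx C A) : E :=
  j.tree.tensor X

/-- The isomorphisms of trees over which the colimit `F(X)(A)` is formed. -/
structure FreeRel {A : C} (j j' : FreeIdx C A) : Type w where
  ε : j.obj ≅ j'.obj
  θ : GIso j.tree j'.tree ε
  w : ε ≪≫ j'.iso = j.iso

variable [Limits.HasColimitsOfSize.{w, w} E] (X : Collection C E)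

theorem exists_free (A : C) : ∃ (M : E) (ι : ∀ j : FreeIdx C A, j.tensor X ⟶ M),
    IsUniv (fun j => j.tensor X) (fun j j' r => ∃ θ : FreeRel j j', r = θ.θ.map X) ι :=
  exists_isUniv _ _ _

/-- The value of the free operad on `X`. -/
noncomputable def freeObj (A : C) : E := (exists_free X A).choose

/-- The structure morphisms of the colimit `F(X)(A)`. -/
noncomputable def freeι {A : C} (j : FreeIdx C A) : j.tensor X ⟶ freeObj X A :=
  (exists_free X A).choose_spec.choose j

theorem freeUniv (A : C) : IsUniv (fun j : FreeIdx C A => j.tensor X)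
    (fun j j' r => ∃ θ : FreeRel j j', r = θ.θ.map X) (freeι X) :=
  (exists_free X A).choose_spec.choose_spec

theorem freeRel_refl {A : C} (j : FreeIdx C A) :
    ∃ θ : FreeRel j j, 𝟙 (j.tensor X) = θ.θ.map X :=
  ⟨⟨Iso.refl _, GIso.refl _, by simp⟩, (GIso.map_refl X _).symm⟩

theorem freeι_rel {A A₀ A₁ : C} {P : GTree A₀} {P' : GTree A₁} {ε : A₀ ≅ A₁} (θ : GIso P P' ε)
    {e : A₀ ≅ A} {e' : A₁ ≅ A} (w : ε ≪≫ e' = e) :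
    θ.map X ≫ freeι X ⟨A₁, P', e'⟩ = freeι X ⟨A₀, P, e⟩ :=
  (freeUniv X A).compat ⟨A₀, P, e⟩ ⟨A₁, P', e'⟩ _ ⟨⟨ε, θ, w⟩, rfl⟩

/-- The action of an isomorphism on the colimits `F(X)(A)`. -/
noncomputable def freeMap {A B : C} (e : A ≅ B) : freeObj X A ⟶ freeObj X B :=
  (freeUniv X A).desc (fun j => freeι X ⟨j.obj, j.tree, j.iso ≪≫ e⟩) (by
    rintro j j' _ ⟨θ, rfl⟩
    exact freeι_rel X θ.θ (by rw [← θ.w, Iso.trans_assoc]))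

theorem freeι_freeMap {A B : C} (e : A ≅ B) (j : FreeIdx C A) :
    freeι X j ≫ freeMap X e = freeι X ⟨j.obj, j.tree, j.iso ≪≫ e⟩ :=
  (freeUniv X A).fac _ _ j

/-- The underlying collection of the free operad on `X`. -/
noncomputable def freeColl : Collection C E where
  obj A := freeObj X A.of
  map e := freeMap X e.iso
  map_id A := (freeUniv X A.of).hom_ext fun j => by
    rw [freeι_freeMap, Category.comp_id]
    change freeι X ⟨j.obj, j.tree, j.iso ≪≫ Iso.refl _⟩ = _
    rw [Iso.trans_refl]
  map_comp {A B D} e e' := (freeUniv X A.of).hom_ext fun j => by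
    rw [freeι_freeMap, reassoc_of% (freeι_freeMap X e.iso), freeι_freeMap]
    change freeι X ⟨j.obj, j.tree, j.iso ≪≫ e.iso ≪≫ e'.iso⟩ =
      freeι X ⟨j.obj, j.tree, (j.iso ≪≫ e.iso) ≪≫ e'.iso⟩
    rw [Iso.trans_assoc]

/-- The structure morphism belonging to a tree over an object isomorphic to `A`, with values in
the underlying collection of the free operad. -/
noncomputable def inj {A A₀ : C} (P : GTree A₀) (e : A₀ ≅ A) : P.tensor X ⟶ val (freeColl X) A :=
  freeι X ⟨A₀, P, e⟩

theorem injUniv (A : C) : IsUniv (M := val (freeColl X) A) (fun j : FreeIdx C A => j.tensor X)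
    (fun j j' r => ∃ θ : FreeRel j j', r = θ.θ.map X) (fun j => inj X j.tree j.iso) := freeUniv X A

/-- Isomorphic trees have the same structure morphism, up to the action on the vertices. -/
theorem inj_rel {A A₀ A₁ : C} {P : GTree A₀} {P' : GTree A₁} {ε : A₀ ≅ A₁} (θ : GIso P P' ε)
    {e : A₀ ≅ A} {e' : A₁ ≅ A} (w : ε ≪≫ e' = e) : θ.map X ≫ inj X P' e' = inj X P e :=
  freeι_rel X θ w

theorem inj_actBy {A B A₀ : C} (P : GTree A₀) (e : A₀ ≅ A) (e' : A ≅ B) :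
    inj X P e ≫ actBy (freeColl X) e' = inj X P (e ≪≫ e') :=
  freeι_freeMap X e' ⟨A₀, P, e⟩

end Free

end HypermomentCategory

/-! ### Grafting on an active morphism -/

namespace HypermomentCategory

open FinTensor

section Free

variable {C : Type w} [SmallCategory C] [HypermomentCategory C]
variable {E : Type u} [Category.{v} E] [MonoidalCategory E] [SymmetricCategory E]
variable [Limits.HasColimitsOfSize.{w, w} E] (X : Collection C E)
variable [MonoidalClosed E]

/-- `F(X)(d)` is a colimit over families of trees, one over each part of `d`. -/
theorem valMorUniv {D A : C} (d : D ⟶ A) :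
    IsUniv (M := valMor (freeColl X) d) (J := ∀ x : El D, FreeIdx C (push d x))
      (fun j => tens fun x => (j x).tree.tensor X)
      (fun j j' r => ∃ ρ : ∀ x, (j x).tree.tensor X ⟶ (j' x).tree.tensor X,
        (∀ x, ∃ θ : FreeRel (j x) (j' x), ρ x = θ.θ.map X) ∧ r = tensMap ρ _)
      (fun j => tensMap (fun x => inj X (j x).tree (j x).iso) _) :=
  IsUniv.tens (fun x => injUniv X (push d x)) (fun _ j => freeRel_refl X j)

/-- Grafting of trees on an active morphism `d : D ⟶ A`: a family of elements of `F(X)` over the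
parts of `d` becomes an element over `A` with a new vertex labelled by `D`. -/
noncomputable def freeNode {D A : C} (d : D ⟶ A) (hd : act d) :
    val X D ⊗ valMor (freeColl X) d ⟶ val (freeColl X) A :=
  ((valMorUniv X d).whiskerLeft (val X D)).desc (fun j => inj X (.node d hd
    (fun x => (j x).obj) (fun x => (j x).iso) (fun x => (j x).tree)) (Iso.refl A)) (by
    rintro j j' _ ⟨_, ⟨ρ, hρ, rfl⟩, rfl⟩
    choose θ hθ using hρ
    obtain rfl : ρ = fun x => (θ x).θ.map X := funext hθ
    rw [← inj_rel X (GIso.node (d := d) (d' := d) (hd := hd) (hd' := hd)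
      (e := fun x => (j x).iso) (e' := fun x => (j' x).iso) (Q := fun x => (j x).tree)
      (Q' := fun x => (j' x).tree) (Iso.refl D) (Iso.refl A) (by simp) id
      (isoIdx_refl _) (fun x => (θ x).ε) (fun x => (θ x).θ) (fun x => by
        rw [cmp_refl (x := x) (InSq.ofIso (σ := Iso.refl _) (ρ := Iso.refl _) (by simp)) rfl rfl
            (isoIdx_refl _ x), Iso.trans_refl]
        exact (θ x).w)) (e := Iso.refl A) (e' := Iso.refl A) (Iso.trans_refl _)]
    simp only [GIso.map]
    rw [tensReindex_id, actBy_refl, id_tensorHom])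

variable {X}

theorem inj_freeNode {D A : C} (d : D ⟶ A) (hd : act d) {Y : El D → C} (Q : ∀ x, GTree (Y x))
    (e : ∀ x, Y x ≅ push d x) :
    val X D ◁ tensMap (fun x => inj X (Q x) (e x)) _ ≫ freeNode X d hd =
      inj X (.node d hd Y e Q) (Iso.refl A) :=
  ((valMorUniv X d).whiskerLeft (val X D)).fac _ _ (fun x => ⟨Y x, Q x, e x⟩)

/-- The trees consisting of a unit. -/
noncomputable def freeUnit (X : Collection C E) (U : C) (hU : IsUnit U) :
    𝟙_ E ⟶ val (freeColl X) U := inj X (.leaf U hU) (Iso.refl U)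

/-- A node transported along an isomorphism `ε` of its object is again obtained by grafting, on the
morphism followed by `ε`. -/
theorem inj_node {D A A' : C} (d : D ⟶ A) (hd : act d) {Y : El D → C} (Q : ∀ x, GTree (Y x))
    (e : ∀ x, Y x ≅ push d x) (ε : A ≅ A') (d' : D ⟶ A') (hd' : act d') (w : d ≫ ε.hom = d')
    (e' : ∀ x, Y x ≅ push d' x) (he' : ∀ x, e' x = e x ≪≫ cmp
      (InSq.ofIso (σ := Iso.refl D) (ρ := ε) (f := d) (f' := d') (by simp [w])) (isoIdx_refl D x)) :
    inj X (.node d hd Y e Q) ε =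
      val X D ◁ tensMap (fun x => inj X (Q x) (e' x)) _ ≫ freeNode X d' hd' := by
  rw [inj_freeNode]
  rw [← inj_rel X (GIso.node (d := d) (d' := d') (hd := hd) (hd' := hd') (e := e)
      (e' := e') (Iso.refl D) ε (by simp [w]) id (isoIdx_refl _)
      (fun x => Iso.refl _) (fun x => GIso.refl (Q x)) (fun x => by
        change Iso.refl _ ≪≫ e' x = _
        rw [he' x]; simp))
      (e := ε) (e' := Iso.refl A') (Iso.trans_refl _)]
  simp only [GIso.map, GIso.map_refl]
  rw [tensReindex_id, actBy_refl, tensMap_id, id_tensorHom, MonoidalCategory.whiskerLeft_id,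
    Category.id_comp]

theorem inj_leaf {U A : C} (hU : IsUnit U) (e : U ≅ A) (hA : IsUnit A) :
    inj X (.leaf U hU) e = freeUnit X A hA := by
  have := inj_rel X (GIso.leaf hU hA e) (e := e) (e' := Iso.refl A) (Iso.trans_refl _)
  rw [← this]
  exact Category.id_comp _

theorem freeUnit_actBy {U V : C} (hU : IsUnit U) (hV : IsUnit V) (e : U ≅ V) :
    freeUnit X U hU ≫ actBy (freeColl X) e = freeUnit X V hV := by
  rw [freeUnit, inj_actBy, inj_leaf]

/-- The elements of `F(X)` are generated from units by grafting. -/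
theorem free_induction (p : ∀ {A : C} {T : E}, (T ⟶ val (freeColl X) A) → Prop)
    (leaf : ∀ (A : C) (hA : IsUnit A), p (freeUnit X A hA))
    (node : ∀ {D A : C} (d : D ⟶ A) (hd : act d) (T : El D → E)
      (s : ∀ x, T x ⟶ val (freeColl X) (push d x)), (∀ x, p (s x)) →
        p (val X D ◁ tensMap s _ ≫ freeNode X d hd))
    {A₀ A : C} (P : GTree A₀) (e : A₀ ≅ A) : p (inj X P e) := by
  induction P generalizing A with
  | leaf U hU => rw [inj_leaf hU e (isUnit_of_iso e hU)]; exact leaf _ _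
  | node d hd Y e' Q ih =>
    rw [inj_node d hd Q e' e (d ≫ e.hom) (act_comp _ _ hd (act_iso e)) rfl _ (fun x => rfl)]
    exact node _ _ _ _ (fun x => ih x _)

/-- Morphisms out of `K ⊗ F(X)(f)` may be compared on trees, after an isomorphism of `f`. -/
theorem transport_hom_ext {A A' B B' : C} (σ : A ≅ A') (ρ : B ≅ B') (f : A ⟶ B) (f' : A' ⟶ B')
    (w : f ≫ ρ.hom = σ.hom ≫ f') {K K' Z : E} (i : K ⟶ K') [IsIso i]
    {a : K ⊗ valMor (freeColl X) f ⟶ Z}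
    {b : K' ⊗ valMor (freeColl X) f' ⟶ Z}
    (hab : ∀ (j : ∀ x : El A', FreeIdx C (push f' x)),
      K ◁ tensMap (fun x => inj X (j (isoIdx σ x)).tree
        ((j (isoIdx σ x)).iso ≪≫ (cmp (InSq.ofIso w) rfl).symm)) _ ≫ a =
      (i ⊗ₘ tensReindex (Y := fun x => (j x).tree.tensor X) (isoIdx σ)
        (perm_of_bijective (inertIdx_bijective σ)) (fun _ => 𝟙 _)) ≫
        K' ◁ tensMap (fun x => inj X (j x).tree (j x).iso) _ ≫ b) :
    a = (i ⊗ₘ transport (freeColl X) σ ρ f f' w) ≫ b := by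
  rw [← cancel_epi (inv (i ⊗ₘ transport (freeColl X) σ ρ f f' w))]
  refine ((valMorUniv X f').whiskerLeft K').hom_ext fun j => ?_
  have := tensReindex_isIso (X := fun x => (j (isoIdx σ x)).tree.tensor X)
    (Y := fun x => (j x).tree.tensor X) (isoIdx σ)
        (perm_of_bijective (inertIdx_bijective σ)) (fun x => 𝟙 _)
  have key : K ◁ tensMap (fun x => inj X (j (isoIdx σ x)).tree
        ((j (isoIdx σ x)).iso ≪≫ (cmp (InSq.ofIso w) rfl).symm)) _ ≫
        (i ⊗ₘ transport (freeColl X) σ ρ f f' w) =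
      (i ⊗ₘ tensReindex (Y := fun x => (j x).tree.tensor X) (isoIdx σ)
        (perm_of_bijective (inertIdx_bijective σ)) (fun _ => 𝟙 _)) ≫
        K' ◁ tensMap (fun x => inj X (j x).tree (j x).iso) _ := by
    rw [transport_eq, whiskerLeft_comp_tensorHom, tensorHom_comp_whiskerLeft, tensMap_reindex,
      tensReindex_map _ _ _ _ (List.nodup_finRange _)]
    congr 2
    funext x
    rw [inj_actBy, Iso.trans_assoc, Iso.symm_self_id, Iso.trans_refl, Category.id_comp]
  rw [← cancel_epi (i ⊗ₘ tensReindex (Y := fun x => (j x).tree.tensor X) (isoIdx σ)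
        (perm_of_bijective (inertIdx_bijective σ)) (fun x => 𝟙 _)), ← reassoc_of% key,
    ← reassoc_of% key, IsIso.hom_inv_id_assoc, IsIso.hom_inv_id_assoc, hab, reassoc_of% key]

theorem freeNode_equivariant {D D' A A' : C} (σ : D ≅ D') (ρ : A ≅ A') (d : D ⟶ A) (hd : act d)
    (d' : D' ⟶ A') (hd' : act d') (w : d ≫ ρ.hom = σ.hom ≫ d') :
    (actBy X σ ⊗ₘ transport (freeColl X) σ ρ d d' w) ≫ freeNode X d' hd' =
      freeNode X d hd ≫ actBy (freeColl X) ρ := by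
  refine (transport_hom_ext σ ρ d d' w (actBy X σ) fun j => ?_).symm
  have h₁ := inj_freeNode (X := X) d hd (fun x => (j (isoIdx σ x)).tree)
    (fun x => (j (isoIdx σ x)).iso ≪≫ (cmp (InSq.ofIso w) rfl).symm)
  rw [inj_freeNode d' hd', reassoc_of% h₁, inj_actBy]
  rw [← inj_rel X (GIso.node (d := d) (d' := d') (hd := hd) (hd' := hd')
    (e' := fun x => (j x).iso) (Q' := fun x => (j x).tree) σ ρ w (isoIdx σ)
      (fun _ => rfl) (fun x => Iso.refl _) (fun x => GIso.refl _) (fun x => by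
        rw [Iso.trans_assoc, Iso.symm_self_id]; simp))
      (e := Iso.refl A ≪≫ ρ) (e' := Iso.refl A') (by simp)]
  simp only [GIso.map, GIso.map_refl]

end Free

end HypermomentCategory

/-! ### Grafting onto a tree -/

namespace HypermomentCategory

open FinTensor

section Free

variable {C : Type w} [SmallCategory C] [HypermomentCategory C]
variable {E : Type u} [Category.{v} E] [MonoidalCategory E] [SymmetricCategory E]
variable [Limits.HasColimitsOfSize.{w, w} E] [MonoidalClosed E] (X : Collection C E)

/-- Grafting a family of elements of the free operad onto a tree `P` over the source of an active
morphism `f`. For a unit this is the element over its only part. For a node the family is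
distributed over the parts of `d`, grafted there by recursion, and the results are grafted on `d ≫
f`. -/
noncomputable def GTree.graft : ∀ {A : C} (P : GTree A) {B : C} (f : A ⟶ B), act f →
    (P.tensor X ⊗ valMor (freeColl X) f ⟶ val (freeColl X) B)
  | _, .leaf _ hU, _, f, hf => (λ_ _).hom ≫ inv (toUnitary (freeColl X) hU f hf)
  | _, .node (D := D) d hd _ e Q, _, f, hf =>
    _ ◁ inv (regroup (freeColl X) d hd f (d ≫ f) rfl) ≫ (α_ _ _ _).hom ≫
      val X D ◁ (tensMul (fun x => (Q x).tensor X) _ _ ≫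
        tensMap (fun x => _ ◁ transport (freeColl X) (e x).symm (Iso.refl _)
            (pushMap d f (d ≫ f) rfl x) ((e x).hom ≫ pushMap d f (d ≫ f) rfl x) (by simp) ≫
          (Q x).graft ((e x).hom ≫ pushMap d f (d ≫ f) rfl x)
            (act_comp _ _ (act_iso _) (pushMap_act _ _ _ _ _))) _) ≫
      freeNode X (d ≫ f) (act_comp _ _ hd hf)

/-- Grafting is natural in isomorphisms of trees and of active morphisms, so that it passes to the
colimit over trees. -/
theorem graft_iso {A A' : C} {P : GTree A} {P' : GTree A'} {ε : A ≅ A'} (θ : GIso P P' ε)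
    {B B' : C} (ρ : B ≅ B') (f : A ⟶ B) (hf : act f) (f' : A' ⟶ B') (hf' : act f')
    (w : f ≫ ρ.hom = ε.hom ≫ f') :
    (θ.map X ⊗ₘ transport (freeColl X) ε ρ f f' w) ≫ P'.graft X f' hf' =
      P.graft X f hf ≫ actBy (freeColl X) ρ := by
  induction θ generalizing B B' with
  | leaf hU hU' ε =>
    have h := toUnitary_transport (freeColl X) hU hU' ε ρ f hf f' hf' w
    have h' : transport (freeColl X) ε ρ f f' w ≫ inv (toUnitary (freeColl X) hU' f' hf') =
        inv (toUnitary (freeColl X) hU f hf) ≫ actBy (freeColl X) ρ := by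
      rw [IsIso.comp_inv_eq, Category.assoc, ← h, IsIso.inv_hom_id_assoc]
    simp only [GIso.map, GTree.graft]
    rw [id_tensorHom, leftUnitor_naturality_assoc, h', Category.assoc]
  | @node D A D' A' d hd Y e Q d' hd' Y' e' Q' σ ε wd idx hidx κ θ hκ ih =>
    obtain rfl : isoIdx σ = idx := funext hidx
    have wk : (d ≫ f) ≫ ρ.hom = σ.hom ≫ d' ≫ f' := by
      rw [Category.assoc, w, reassoc_of% wd]
    have h₁ : transport (freeColl X) ε ρ f f' w ≫
          inv (regroup (freeColl X) d' hd' f' (d' ≫ f') rfl) =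
        inv (regroup (freeColl X) d hd f (d ≫ f) rfl) ≫
          transportNested (freeColl X) σ ε ρ d d' f f' _ _ rfl rfl wd w wk := by
      rw [IsIso.comp_inv_eq, Category.assoc, transportNested_regroup (hf := hd),
        IsIso.inv_hom_id_assoc]
    have hκ' : ∀ x, (e x).symm ≪≫ κ x = cmp (InSq.ofIso wd) rfl ≪≫ (e' (isoIdx σ x)).symm := by
      intro x
      have := congrArg Iso.hom (hκ x)
      ext
      simp only [Iso.trans_hom, Iso.symm_hom] at this ⊢
      rw [Iso.inv_comp_eq, ← Category.assoc, Iso.eq_comp_inv]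
      exact this
    have hp := fun x => pushMap_cmp (InSq.ofIso wd) (InSq.ofIso w) (InSq.ofIso wk) (x := x)
      rfl rfl rfl
    have hp' : ∀ x, ((e x).hom ≫ pushMap d f (d ≫ f) rfl x) ≫ (cmp (InSq.ofIso wk) rfl).hom =
        (κ x).hom ≫ (e' (isoIdx σ x)).hom ≫ pushMap d' f' (d' ≫ f') rfl (isoIdx σ x) := by
      intro x
      have := congrArg Iso.hom (hκ x)
      simp only [Iso.trans_hom] at this
      rw [Category.assoc, hp, reassoc_of% this]
    -- the part next to the new vertex: the induction hypothesis for each `Q x`, along the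
    -- isomorphism `κ x`
    have h₂ : (tensReindex (Y := fun x => (Q' x).tensor X) (isoIdx σ) (perm_idx hidx)
          (fun x => (θ x).map X) ⊗ₘ
            transportNested (freeColl X) σ ε ρ d d' f f' _ _ rfl rfl wd w wk) ≫
        tensMul (fun x => (Q' x).tensor X) _ _ ≫
        tensMap (fun x => _ ◁ transport (freeColl X) (e' x).symm (Iso.refl _)
            (pushMap d' f' (d' ≫ f') rfl x) ((e' x).hom ≫ pushMap d' f' (d' ≫ f') rfl x) (by simp) ≫
          (Q' x).graft X ((e' x).hom ≫ pushMap d' f' (d' ≫ f') rfl x)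
            (act_comp _ _ (act_iso _) (pushMap_act _ _ _ _ _))) _ =
      (tensMul (fun x => (Q x).tensor X) _ _ ≫
        tensMap (fun x => _ ◁ transport (freeColl X) (e x).symm (Iso.refl _)
            (pushMap d f (d ≫ f) rfl x) ((e x).hom ≫ pushMap d f (d ≫ f) rfl x) (by simp) ≫
          (Q x).graft X ((e x).hom ≫ pushMap d f (d ≫ f) rfl x)
            (act_comp _ _ (act_iso _) (pushMap_act _ _ _ _ _))) _) ≫
        transport (freeColl X) σ ρ (d ≫ f) (d' ≫ f') wk := by
      rw [transportNested, reassoc_of% (tensReindex_tensMul (X' := fun x => (Q' x).tensor X)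
          (Y' := fun x => valMor (freeColl X) (pushMap d' f' (d' ≫ f') rfl x)) (isoIdx σ)
          (perm_idx hidx) (fun x => (θ x).map X)
          (fun x => transport (freeColl X) (cmp (InSq.ofIso wd) rfl) (cmp (InSq.ofIso wk) rfl) _ _
            (pushMap_cmp (InSq.ofIso wd) (InSq.ofIso w) (InSq.ofIso wk) rfl rfl rfl))
          (List.nodup_finRange _)),
        tensReindex_map _ _ _ _ (List.nodup_finRange _), Category.assoc, transport_eq,
        tensMap_reindex]
      congr 2
      funext x
      rw [tensorHom_comp_whiskerLeft_assoc, transport_trans _ _ _ _ _ _ _ _ _ _ (by simp [hp x])]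
      refine Eq.trans ?_ (Category.assoc _ _ _).symm
      rw [← ih x (cmp (InSq.ofIso wk) rfl) _ _ ((e' (isoIdx σ x)).hom ≫
          pushMap d' f' (d' ≫ f') rfl (isoIdx σ x))
        (act_comp _ _ (act_iso _) (pushMap_act _ _ _ _ _)) (hp' x),
        whiskerLeft_comp_tensorHom_assoc, transport_trans _ _ _ _ _ _ _ _ _ _ (by
          have := hp' x
          simp only [Category.assoc] at this
          simp [← this])]
      congr 2
      exact transport_congr _ _ _ _ _ (hκ' x).symm (by simp)
    simp only [GIso.map, GTree.graft]
    rw [tensorHom_comp_whiskerLeft_assoc, h₁, ← whiskerLeft_comp_tensorHom_assoc,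
      associator_naturality_assoc, tensorHom_comp_whiskerLeft_assoc, h₂,
      ← whiskerLeft_comp_tensorHom_assoc, freeNode_equivariant σ ρ _ (act_comp _ _ hd hf)]
    simp only [Category.assoc]

end Free

end HypermomentCategory

/-! ### The multiplication of the free operad -/

namespace FinTensor

variable {E : Type u} [Category.{v} E] [MonoidalCategory E]

theorem tensMapIdx_tensOne {ι κ : Type*} (e : ι → κ) (l : List ι) :
    tensMapIdx (X := fun _ => 𝟙_ E) (Y := fun _ => 𝟙_ E) e (fun _ => 𝟙 _) l ≫ tensOne (l.map e) =
      tensOne l := by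
  induction l with
  | nil => exact Category.id_comp _
  | cons a l ih =>
    change (𝟙 (𝟙_ E) ⊗ₘ tensMapIdx e (fun _ => 𝟙 _) l) ≫ (λ_ _).hom ≫ tensOne (l.map e) =
      (λ_ _).hom ≫ tensOne l
    rw [id_tensorHom, leftUnitor_naturality_assoc, ih]

theorem tensAppend_tensOne {ι : Type*} (l₁ l₂ : List ι) :
    tensAppend (fun _ : ι => 𝟙_ E) l₂ l₁ ≫ tensOne (l₁ ++ l₂) =
      (tensOne l₁ ⊗ₘ tensOne l₂) ≫ (λ_ _).hom := by
  induction l₁ with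
  | nil =>
    change (λ_ _).hom ≫ tensOne l₂ = (𝟙 _ ⊗ₘ _) ≫ _
    simp
  | cons a l₁ ih =>
    change ((α_ _ _ _).hom ≫ _ ◁ _) ≫ (λ_ _).hom ≫ tensOne (l₁ ++ l₂) =
      (((λ_ _).hom ≫ tensOne l₁) ⊗ₘ _) ≫ _
    rw [Category.assoc, leftUnitor_naturality_assoc, ih]
    rw [← whiskerRight_comp_tensorHom]
    simp

theorem tensSigma_tensOne {ι : Type*} {κ : ι → Type*} (m : ∀ i, List (κ i)) (l : List ι) :
    tensSigma (fun i (_ : κ i) => 𝟙_ E) m l ≫ tensOne (l.sigma m) =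
      tensMap (fun i => tensOne (m i)) l ≫ tensOne l := by
  induction l with
  | nil => rfl
  | cons a l ih =>
    change ((tensMapIdx (X := fun _ => 𝟙_ E) (Y := fun _ => 𝟙_ E) (Sigma.mk a) (fun _ => 𝟙 _) (m a)
        ⊗ₘ tensSigma (fun i (_ : κ i) => 𝟙_ E) m l) ≫
      tensAppend (fun _ => 𝟙_ E) _ _) ≫ tensOne ((m a).map (Sigma.mk a) ++ l.sigma m) =
      (tensOne (m a) ⊗ₘ tensMap _ l) ≫ (λ_ _).hom ≫ tensOne l
    rw [Category.assoc, tensAppend_tensOne, tensorHom_comp_tensorHom_assoc, tensMapIdx_tensOne, ih,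
      ← tensorHom_comp_whiskerLeft, Category.assoc, leftUnitor_naturality]

variable [SymmetricCategory E]

theorem swap₁₂_unit_unit (P : E) : swap₁₂ (𝟙_ E) (𝟙_ E) P = 𝟙 _ := by
  rw [swap₁₂, braiding_tensorUnit_left]
  simp [unitors_equal]

theorem tensPerm_tensOne {ι : Type*} [DecidableEq ι] {l l' : List ι} (h : l.Perm l')
    (hl : l.Nodup) : tensPerm (fun _ => 𝟙_ E) l l' h ≫ tensOne l' = tensOne l := by
  induction h with
  | nil => rw [tensPerm_refl]; exact Category.id_comp _
  | cons a h ih =>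
    rw [tensPerm_cons _ a h]
    change _ ◁ _ ≫ (λ_ _).hom ≫ tensOne _ = (λ_ _).hom ≫ tensOne _
    rw [leftUnitor_naturality_assoc, ih (List.nodup_cons.1 hl).2]
  | swap a b l =>
    have hne : b ≠ a := by
      simp only [List.nodup_cons, List.mem_cons, not_or] at hl
      exact hl.1.1
    rw [tensPerm_swap _ hne, swap₁₂_unit_unit]
    exact Category.id_comp _
  | trans h₁ h₂ ih₁ ih₂ =>
    rw [← tensPerm_trans _ _ _ _ h₁ h₂, Category.assoc, ih₂ (h₁.nodup_iff.1 hl), ih₁ hl]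

theorem tensReindex_tensOne {ι κ : Type*} [DecidableEq κ] {l : List ι} {l' : List κ} (e : ι → κ)
    (h : (l.map e).Perm l') (hl : l'.Nodup) :
    tensReindex (X := fun _ => 𝟙_ E) (Y := fun _ => 𝟙_ E) e h (fun _ => 𝟙 _) ≫ tensOne l' =
      tensOne l := by
  rw [tensReindex, Category.assoc, tensPerm_tensOne h (h.nodup_iff.2 hl), tensMapIdx_tensOne]

theorem tensSingle_tensOne {n : ℕ} {i : Fin n} (hi : ∀ j, j = i) :
    tensSingle (fun _ : Fin n => 𝟙_ E) i hi ≫ tensOne _ = 𝟙 _ := by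
  rw [tensSingle, Category.assoc, tensReindex_tensOne _ _ (List.nodup_finRange n)]
  change _ ≫ (λ_ _).hom ≫ 𝟙 _ = _
  simp [unitors_equal]

/-- The right unitor of a tensor product, computed factor by factor. -/
theorem tensMul_rightUnitor {ι : Type*} (X : ι → E) (l : List ι) :
    tensMul X (fun _ => 𝟙_ E) l ≫ tensMap (fun i => (ρ_ (X i)).hom) l =
      tensL X l ◁ tensOne l ≫ (ρ_ _).hom := by
  induction l with
  | nil =>
    change (λ_ _).hom ≫ 𝟙 _ = 𝟙_ E ◁ 𝟙 _ ≫ (ρ_ _).hom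
    simp [unitors_equal]
  | cons a l ih =>
    change (tensorμ _ _ _ _ ≫ _ ◁ tensMul X _ l) ≫ ((ρ_ _).hom ⊗ₘ tensMap _ l) =
      _ ◁ ((λ_ _).hom ≫ tensOne l) ≫ _
    rw [Category.assoc, whiskerLeft_comp_tensorHom, ih]
    have h₂ := tensorμ_natural (𝟙 (X a)) (𝟙 (tensL X l)) (𝟙 (𝟙_ E)) (tensOne l)
    simp only [id_tensorHom, MonoidalCategory.whiskerLeft_id] at h₂
    have h₃ : ∀ P Q : E, tensorμ P Q (𝟙_ E) (𝟙_ E) ≫ ((ρ_ P).hom ⊗ₘ (ρ_ Q).hom) =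
        (P ⊗ Q) ◁ (λ_ (𝟙_ E)).hom ≫ (ρ_ _).hom := by
      intro P Q
      rw [MonoidalCategory.tensorHom_def]
      simp only [tensorμ, braiding_tensorUnit_right]
      monoidal
    rw [← whiskerLeft_comp_tensorHom, ← reassoc_of% h₂, h₃,
      ← MonoidalCategory.whiskerLeft_comp_assoc, leftUnitor_naturality]

theorem tensMap_whiskerRight_tensMul {ι : Type*} {X X' : ι → E} (φ : ∀ i, X i ⟶ X' i)
    (Y : ι → E) (l : List ι) :
    tensMap φ l ▷ tensL Y l ≫ tensMul X' Y l =
      tensMul X Y l ≫ tensMap (fun i => φ i ▷ Y i) l := by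
  have := tensorHom_tensMap_tensMul φ (fun i => 𝟙 (Y i)) l
  rw [tensMap_id, tensorHom_id] at this
  simp only [tensorHom_id] at this
  exact this

theorem tensMap_whiskerLeft_tensMul {ι : Type*} (X : ι → E) {Y Y' : ι → E} (φ : ∀ i, Y i ⟶ Y' i)
    (l : List ι) :
    tensL X l ◁ tensMap φ l ≫ tensMul X Y' l =
      tensMul X Y l ≫ tensMap (fun i => X i ◁ φ i) l := by
  have := tensorHom_tensMap_tensMul (fun i => 𝟙 (X i)) φ l
  rw [tensMap_id, id_tensorHom] at this
  simp only [id_tensorHom] at this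
  exact this

end FinTensor

namespace HypermomentCategory

open FinTensor

section Free

variable {C : Type w} [SmallCategory C] [HypermomentCategory C]
variable {E : Type u} [Category.{v} E] [MonoidalCategory E] [SymmetricCategory E]
variable [Limits.HasColimitsOfSize.{w, w} E] [MonoidalClosed E] (X : Collection C E)

/-- The multiplication of the free operad: on the summand of a tree over the source of `f`, grafting
onto this tree. -/
noncomputable def freeMul {A B : C} (f : A ⟶ B) (hf : act f) :
    val (freeColl X) A ⊗ valMor (freeColl X) f ⟶ val (freeColl X) B :=
  ((injUniv X A).whiskerRight (valMor (freeColl X) f)).desc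
    (fun j => _ ◁ transport (freeColl X) j.iso.symm (Iso.refl B) f (j.iso.hom ≫ f) (by simp) ≫
      j.tree.graft X (j.iso.hom ≫ f) (act_comp _ _ (act_iso _) hf)) (by
    rintro j j' _ ⟨_, ⟨θ, rfl⟩, rfl⟩
    have h := (graft_iso X θ.θ (Iso.refl B) (j.iso.hom ≫ f) (act_comp _ _ (act_iso _) hf)
      (j'.iso.hom ≫ f) (act_comp _ _ (act_iso _) hf) (by rw [← θ.w]; simp)).trans
      (show _ = GTree.graft X j.tree _ _ by rw [actBy_refl]; exact Category.comp_id _)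
    rw [← h, whiskerLeft_comp_tensorHom_assoc, ← MonoidalCategory.tensorHom_def_assoc,
      transport_trans _ _ _ _ _ _ _ _ _ _ (by rw [← θ.w]; simp)]
    congr 2
    refine transport_congr _ _ _ _ _ ?_ (by simp)
    rw [← θ.w]
    ext
    simp)

variable {X}

theorem inj_freeMul {A₀ A B : C} (P : GTree A₀) (e : A₀ ≅ A) (f : A ⟶ B) (hf : act f) :
    inj X P e ▷ _ ≫ freeMul X f hf =
      P.tensor X ◁ transport (freeColl X) e.symm (Iso.refl B) f (e.hom ≫ f) (by simp) ≫
        P.graft X (e.hom ≫ f) (act_comp _ _ (act_iso _) hf) :=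
  ((injUniv X A).whiskerRight (valMor (freeColl X) f)).fac _ _ ⟨A₀, P, e⟩

theorem inj_freeMul_refl {A B : C} (P : GTree A) (f : A ⟶ B) (hf : act f) :
    inj X P (Iso.refl A) ▷ _ ≫ freeMul X f hf = P.graft X f hf := by
  have key : ∀ (f' : A ⟶ B) (hf' : act f') (w : f ≫ (Iso.refl B).hom = (Iso.refl A).hom ≫ f'),
      P.tensor X ◁ transport (freeColl X) (Iso.refl A) (Iso.refl B) f f' w ≫ P.graft X f' hf' =
        P.graft X f hf := by
    intro f' hf' w
    obtain rfl : f = f' := by simpa using w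
    rw [transport_refl, MonoidalCategory.whiskerLeft_id, Category.id_comp]
  rw [inj_freeMul]
  exact key _ _ _

/-- Multiplying an element obtained by grafting on `d` is multiplying its parts, and grafting the
results on `d ≫ f`. Together with the left unit law this determines the multiplication, and all
properties of it are derived from these two facts by induction on trees. -/
theorem freeNode_freeMul {D A B : C} (d : D ⟶ A) (hd : act d) (f : A ⟶ B) (hf : act f) (k : D ⟶ B)
    (hk : act k) (w : d ≫ f = k) :
    (freeNode X d hd ⊗ₘ regroup (freeColl X) d hd f k w) ≫ freeMul X f hf =
      (α_ _ _ _).hom ≫ val X D ◁ (tensMul _ _ _ ≫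
        tensMap (fun x => freeMul X (pushMap d f k w x) (pushMap_act _ _ _ _ _)) _) ≫
          freeNode X k hk := by
  subst w
  refine (((valMorUniv X d).whiskerLeft (val X D)).whiskerRight _).hom_ext fun j => ?_
  have h₁ := inj_freeNode (X := X) d hd (fun x => (j x).tree) (fun x => (j x).iso)
  rw [whiskerRight_comp_tensorHom_assoc, h₁, MonoidalCategory.tensorHom_def'_assoc,
    inj_freeMul_refl, associator_naturality_middle_assoc, ← MonoidalCategory.whiskerLeft_comp_assoc,
    reassoc_of% tensMap_whiskerRight_tensMul, tensMap_tensMap]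
  simp only [GTree.graft, inj_freeMul]
  rw [← MonoidalCategory.whiskerLeft_comp_assoc, IsIso.hom_inv_id, MonoidalCategory.whiskerLeft_id,
    Category.id_comp]

theorem freeMul_equivariant : Equivariant (freeColl X) (fun f hf => freeMul X f hf) := by
  intro A A' B B' σ ρ f hf f' hf' w
  refine ((injUniv X A).whiskerRight (valMor (freeColl X) f)).hom_ext fun j => ?_
  have h := graft_iso X (GIso.refl j.tree) ρ (j.iso.hom ≫ f) (act_comp _ _ (act_iso _) hf)
      ((j.iso ≪≫ σ).hom ≫ f') (act_comp _ _ (act_iso _) hf') (by simp [w])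
  rw [GIso.map_refl, id_tensorHom] at h
  rw [reassoc_of% (inj_freeMul j.tree j.iso f hf), ← h, whiskerRight_comp_tensorHom_assoc,
    inj_actBy, MonoidalCategory.tensorHom_def'_assoc, inj_freeMul,
    ← MonoidalCategory.whiskerLeft_comp_assoc, ← MonoidalCategory.whiskerLeft_comp_assoc,
    transport_trans _ _ _ _ _ _ _ _ _ _ (by simp [w]),
    transport_trans _ _ _ _ _ _ _ _ _ _ (by simp [w])]
  congr 2
  refine transport_congr _ _ _ _ _ ?_ (by simp)
  ext
  simp

end Free

end HypermomentCategory

/-! ### Unit laws and associativity of the free operad -/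

namespace HypermomentCategory

open FinTensor

section Associator

variable {E : Type u} [Category.{v} E] [MonoidalCategory E]

theorem whiskerLeft_tensorHom_associator {W A A' B B' : E} (f : A ⟶ A') (g : B ⟶ B') :
    (W ◁ f ⊗ₘ g) ≫ (α_ W A' B').hom = (α_ W A B).hom ≫ W ◁ (f ⊗ₘ g) := by
  rw [← id_tensorHom, associator_naturality, id_tensorHom]

theorem whiskerLeft_tensorHom_associator_assoc {W A A' B B' Z : E} (f : A ⟶ A') (g : B ⟶ B')
    (k : W ⊗ (A' ⊗ B') ⟶ Z) :
    (W ◁ f ⊗ₘ g) ≫ (α_ W A' B').hom ≫ k = (α_ W A B).hom ≫ W ◁ (f ⊗ₘ g) ≫ k := by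
  rw [← Category.assoc, whiskerLeft_tensorHom_associator, Category.assoc]

/-- If `M` commutes with grafting on `W`, as expressed by `h`, then so does a multiplication
followed by `M`. -/
theorem associator_inv_nested_tensorHom {W V A B D K L Q Z Z' : E} {n' : W ⊗ V ⟶ K} {R : Q ⟶ L}
    {M : K ⊗ L ⟶ Z} {c : V ⊗ Q ⟶ Z'} {n : W ⊗ Z' ⟶ Z}
    (h : (n' ⊗ₘ R) ≫ M = (α_ _ _ _).hom ≫ W ◁ c ≫ n) (p : A ⊗ B ⟶ V) (q : D ⟶ Q) :
    (α_ _ _ _).inv ≫ (((α_ W A B).hom ≫ W ◁ p ≫ n') ⊗ₘ (q ≫ R)) ≫ M =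
      (α_ _ _ _).hom ≫ W ◁ ((α_ _ _ _).inv ≫ (p ⊗ₘ q) ≫ c) ≫ n := by
  have : (((α_ W A B).hom ≫ W ◁ p ≫ n') ⊗ₘ (q ≫ R)) =
      (α_ W A B).hom ▷ D ≫ (W ◁ p ⊗ₘ q) ≫ (n' ⊗ₘ R) := by
    rw [tensorHom_comp_tensorHom, whiskerRight_comp_tensorHom]
  rw [this, Category.assoc, Category.assoc, h, whiskerLeft_tensorHom_associator_assoc]
  simp

/-- The counterpart of `associator_inv_nested_tensorHom` in which the family of parts is multiplied
first. -/
theorem tensorHom_nested_whiskerLeft {W A D D' K L Q Z Z' : E} {a : W ⊗ A ⟶ K} {R : D ⟶ D'}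
    {m : D' ⟶ L} {q : D ⟶ Q} {r : Q ⟶ L} (hm : R ≫ m = q ≫ r) {M : K ⊗ L ⟶ Z}
    {c : A ⊗ Q ⟶ Z'} {n : W ⊗ Z' ⟶ Z} (h : (a ⊗ₘ r) ≫ M = (α_ _ _ _).hom ≫ W ◁ c ≫ n) :
    (a ⊗ₘ R) ≫ K ◁ m ≫ M = (α_ _ _ _).hom ≫ W ◁ (A ◁ q ≫ c) ≫ n := by
  rw [tensorHom_comp_whiskerLeft_assoc, hm, ← whiskerLeft_comp_tensorHom_assoc, h]
  simp

end Associator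

section Collections

variable {C : Type u₁} [Category.{v₁} C] [HypermomentCategory C]
variable {E : Type u} [Category.{v} E] [MonoidalCategory E] [SymmetricCategory E]

theorem isUnit_push {A B : C} (f : A ⟶ B) (x : El A) (h : IsIso (pushAct f x)) :
    IsUnit (push f x) := isUnit_of_iso (actIso f x h) (elObj_isUnit A x)

theorem isUnit_push_id {A : C} (x : El A) : IsUnit (push (𝟙 A) x) :=
  isUnit_push _ x (pushAct_isIso_of_inert _ (inert_of_isIso _ inferInstance) x)

theorem isUnit_push_pushMap_id {A B : C} (f : A ⟶ B) (x : El A) (y : El (push f x))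
    (w : f ≫ 𝟙 B = f) : IsUnit (push (pushMap f (𝟙 B) f w x) y) := by
  refine isUnit_of_iso (cmp (nestSq f (𝟙 B) f w x) rfl).symm (isUnit_push_id _)

theorem pushMap_id {A B : C} (f : A ⟶ B) (w : f ≫ 𝟙 B = f) (x : El A) :
    pushMap f (𝟙 B) f w x = 𝟙 _ :=
  (pushMap_unique w (𝟙 _) (act_of_isIso _ inferInstance) (by simp) (by simp)).symm

/-- A family of units of a collection that is compatible with isomorphisms, inserted at all parts
of a morphism whose parts are nested units. -/
theorem regroup_unit (X : Collection C E) (η : ∀ U : C, IsUnit U → (𝟙_ E ⟶ val X U))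
    (hη : ∀ {U V : C} (hU : IsUnit U) (hV : IsUnit V) (e : U ≅ V), η U hU ≫ actBy X e = η V hV)
    {A B D : C} (f : A ⟶ B) (hf : act f) (g : B ⟶ D) (h : A ⟶ D) (w : f ≫ g = h)
    (hg : ∀ y, IsUnit (push g y)) (hfg : ∀ x y, IsUnit (push (pushMap f g h w x) y)) :
    ∃ c : (tens fun x : El A => tens fun _ : El (push f x) => 𝟙_ E) ⟶ tens fun _ : El B => 𝟙_ E,
      IsIso c ∧ c ≫ tensOne _ = tensMap (fun _ => tensOne _) _ ≫ tensOne _ ∧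
      c ≫ tensMap (fun y => η _ (hg y)) _ =
        tensMap (fun x => tensMap (fun y => η _ (hfg x y)) _) _ ≫ regroup X f hf g h w := by
  refine ⟨tensSigma (fun (x : El A) (_ : El (push f x)) => 𝟙_ E) (fun _ => List.finRange _)
    (List.finRange _) ≫ tensReindex (X := fun _ => 𝟙_ E) (Y := fun _ => 𝟙_ E) (nestIdx f)
        (perm_of_bijective_sigma (nested_bijective f hf)) (fun _ => 𝟙 _), inferInstance, ?_, ?_⟩
  · rw [Category.assoc, tensReindex_tensOne _ _ (List.nodup_finRange _), tensSigma_tensOne]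
  · rw [regroup_eq, Category.assoc, tensReindex_map _ _ _ _ (List.nodup_finRange _),
      reassoc_of% (tensMap_tensSigma (Y := fun (x : El A) (y : El (push f x)) => 𝟙_ E)
      (Y' := fun (x : El A) (y : El (push f x)) =>
      val X (push (pushMap f g h w x) y)) (fun x => List.finRange _) (List.finRange _)
      (fun x y => η _ (hfg x y))), tensMap_reindex]
    congr 2
    funext p
    rw [Category.id_comp]
    exact (hη _ _ _).symm

end Collections

section Free

variable {C : Type w} [SmallCategory C] [HypermomentCategory C]
variable {E : Type u} [Category.{v} E] [MonoidalCategory E] [SymmetricCategory E]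
variable [Limits.HasColimitsOfSize.{w, w} E] [MonoidalClosed E] {X : Collection C E}

theorem freeUnit_freeMul {U A : C} (hU : IsUnit U) (f : U ⟶ A) (hf : act f) :
    freeUnit X U hU ▷ _ ≫ freeMul X f hf = (λ_ _).hom ≫ inv (toUnitary (freeColl X) hU f hf) := by
  rw [freeUnit, inj_freeMul_refl]
  rfl

theorem free_left_unit {U A : C} (hU : IsUnit U) (f : U ⟶ A) (hf : act f) :
    (freeUnit X U hU ⊗ₘ toUnitary (freeColl X) hU f hf) ≫ freeMul X f hf = (λ_ _).hom := by
  rw [MonoidalCategory.tensorHom_def', Category.assoc, freeUnit_freeMul,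
    leftUnitor_naturality_assoc, IsIso.hom_inv_id, Category.comp_id]

/-- The right unit law on a tree, by induction: for a node, `regroup_unit` splits the units over the
parts of `A` into units over the parts of the `A_x`. -/
theorem free_right_unit_inj {A₀ A : C} (P : GTree A₀) (e : A₀ ≅ A) :
    (inj X P e ⊗ₘ tensMap (fun x => freeUnit X (push (𝟙 A) x) (isUnit_push_id x)) _) ≫
        freeMul X (𝟙 A) (act_of_isIso _ inferInstance) =
      (P.tensor X ◁ tensOne _ ≫ (ρ_ _).hom) ≫ inj X P e := by
  -- the parts `push (𝟙 A) x` occur in the types, so the identity is replaced by a variable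
  suffices h : ∀ (f : A ⟶ A) (hf : act f) (_ : f = 𝟙 A) (hu : ∀ x, IsUnit (push f x)),
      (inj X P e ⊗ₘ tensMap (fun x => freeUnit X (push f x) (hu x)) _) ≫
        freeMul X f hf = (P.tensor X ◁ tensOne _ ≫ (ρ_ _).hom) ≫ inj X P e from h _ _ rfl _
  refine free_induction (X := X) (p := fun {A T} s => ∀ (f : A ⟶ A) (hf : act f) (_ : f = 𝟙 A)
    (hu : ∀ x, IsUnit (push f x)),
      (s ⊗ₘ tensMap (fun x => freeUnit X (push f x) (hu x)) _) ≫
        freeMul X f hf = (T ◁ tensOne _ ≫ (ρ_ _).hom) ≫ s) ?_ ?_ P e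
  · intro U hU f hf _ hu
    have := pushIn_isIso hU f hf hU.idx
    have h₁ : tensMap (fun x => freeUnit X (push f x) (hu x)) _ =
        tensOne _ ≫ freeUnit X U hU ≫ toUnitary (freeColl X) hU f hf := by
      rw [toUnitary_eq, reassoc_of% (freeUnit_actBy hU (hu hU.idx)),
        ← cancel_epi (tensSingle (fun _ => 𝟙_ E) hU.idx (fun y => isUnit_eq hU _ _)),
        tensSingle_tensMap, reassoc_of% (tensSingle_tensOne (E := E) (i := hU.idx)
          (fun y => isUnit_eq hU _ _))]
    rw [h₁, ← whiskerLeft_comp_tensorHom_assoc, Category.assoc]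
    congr 1
    rw [← whiskerLeft_comp_tensorHom_assoc, free_left_unit, leftUnitor_naturality]
    simp [unitors_equal]
  · intro D A d hd T s ih f hf hf1 hu
    subst hf1
    have hw : d ≫ 𝟙 A = d := Category.comp_id d
    obtain ⟨c, hc, hc₁, hc₂⟩ := regroup_unit (freeColl X) (freeUnit X) freeUnit_actBy d hd (𝟙 A)
      d hw hu (fun x y => isUnit_push_pushMap_id d x y hw)
    rw [← cancel_epi (_ ◁ c)]
    rw [whiskerLeft_comp_tensorHom_assoc, hc₂]
    have h₁ := freeNode_freeMul (X := X) d hd (𝟙 A) hf d hd hw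
    have h₂ : (tensMap s (List.finRange (γ.obj D).card) ⊗ₘ tensMap (fun x => tensMap (fun y =>
          freeUnit X _ (isUnit_push_pushMap_id d x y hw)) _) _) ≫ tensMul _ _ _ ≫
        tensMap (fun x => freeMul X (pushMap d (𝟙 A) d hw x) (pushMap_act _ _ _ _ _)) _ =
        _ ◁ tensMap (fun _ => tensOne _) _ ≫ _ ◁ tensOne _ ≫ (ρ_ _).hom ≫ tensMap s _ := by
      rw [reassoc_of% tensorHom_tensMap_tensMul, tensMap_tensMap, ← reassoc_of% tensMul_rightUnitor,
        reassoc_of% tensMap_whiskerLeft_tensMul, tensMap_tensMap, tensMap_tensMap]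
      congr 2
      funext x
      rw [ih x _ _ (pushMap_id d hw x), Category.assoc]
    rw [← tensorHom_comp_tensorHom_assoc, h₁, whiskerLeft_tensorHom_associator_assoc,
      ← MonoidalCategory.whiskerLeft_comp_assoc, h₂, Category.assoc,
      ← MonoidalCategory.whiskerLeft_comp_assoc, ← hc₁]
    simp

/-- `freeNode_freeMul` for a family `s` of generalized elements over the parts. -/
theorem freeNode_freeMul_map {D A B : C} (d : D ⟶ A) (hd : act d) (f : A ⟶ B) (hf : act f)
    (k : D ⟶ B) (hk : act k) (w : d ≫ f = k) {T : El D → E}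
    (s : ∀ x, T x ⟶ val (freeColl X) (push d x)) :
    ((val X D ◁ tensMap s _ ≫ freeNode X d hd) ⊗ₘ regroup (freeColl X) d hd f k w) ≫
        freeMul X f hf =
      (α_ _ _ _).hom ≫ val X D ◁ (tensMul _ _ _ ≫ tensMap (fun x => s x ▷ _ ≫
        freeMul X (pushMap d f k w x) (pushMap_act _ _ _ _ _)) _) ≫ freeNode X k hk := by
  rw [← whiskerRight_comp_tensorHom_assoc, freeNode_freeMul d hd f hf k hk w,
    associator_naturality_middle_assoc, ← MonoidalCategory.whiskerLeft_comp_assoc,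
    reassoc_of% tensMap_whiskerRight_tensMul, tensMap_tensMap]

/-- Associativity on a tree, by induction. For a node both sides are brought into the form of a
grafting on the composite `d ≫ f ≫ g`, applied to families of elements over the parts; these agree
by the induction hypothesis for the parts. The regroupings match by `regroup_regroup` and
`regroup_mul`. -/
theorem free_assoc_inj {A₀ A B D : C} (P : GTree A₀) (e : A₀ ≅ A) (f : A ⟶ B) (hf : act f)
    (g : B ⟶ D) (hg : act g) (h : A ⟶ D) (w : f ≫ g = h) (hh : act h) :
    inj X P e ▷ _ ≫ (α_ _ _ (tens fun x => valMor (freeColl X) (pushMap f g h w x))).inv ≫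
        (freeMul X f hf ⊗ₘ regroup (freeColl X) f hf g h w) ≫ freeMul X g hg =
      inj X P e ▷ _ ≫ val (freeColl X) A ◁ (tensMul _ _ _ ≫
        tensMap (fun x => freeMul X (pushMap f g h w x) (pushMap_act f g h w x)) _) ≫
          freeMul X h hh := by
  refine free_induction (X := X) (p := fun {A T} s => ∀ {B D : C} (f : A ⟶ B) (hf : act f)
    (g : B ⟶ D) (hg : act g) (h : A ⟶ D) (w : f ≫ g = h) (hh : act h),
    s ▷ _ ≫ (α_ _ _ (tens fun x => valMor (freeColl X) (pushMap f g h w x))).inv ≫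
        (freeMul X f hf ⊗ₘ regroup (freeColl X) f hf g h w) ≫ freeMul X g hg =
      s ▷ _ ≫ val (freeColl X) A ◁ (tensMul _ _ _ ≫
        tensMap (fun x => freeMul X (pushMap f g h w x) (pushMap_act f g h w x)) _) ≫
          freeMul X h hh) ?_ ?_ P e f hf g hg h w hh
  · intro U hU B D f hf g hg h w hh
    have h₁ := toUnitary_mul (freeColl X) (fun f hf => freeMul X f hf) freeMul_equivariant hU f hf g
      hg h hh w
    rw [← whisker_exchange_assoc, freeUnit_freeMul, associator_inv_naturality_left_assoc,
      whiskerRight_comp_tensorHom_assoc, freeUnit_freeMul, leftUnitor_naturality_assoc]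
    rw [← cancel_mono (toUnitary (freeColl X) hU h hh)]
    simp only [Category.assoc, IsIso.inv_hom_id, Category.comp_id]
    rw [MonoidalCategory.tensorHom_def_assoc, ← h₁]
    have hZ : ((λ_ _).hom ≫ inv (toUnitary (freeColl X) hU f hf)) ▷
          (tens fun x => valMor (freeColl X) (pushMap f g h w x)) ≫
        toUnitary (freeColl X) hU f hf ▷ (tens fun x => valMor (freeColl X) (pushMap f g h w x)) =
        (λ_ _).hom ▷ _ := by
      rw [← MonoidalCategory.comp_whiskerRight, Category.assoc, IsIso.inv_hom_id, Category.comp_id]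
    rw [reassoc_of% hZ]
    rw [leftUnitor_whiskerRight]
    simp
  · intro A₀ A d hd T s ih B D f hf g hg h w hh
    obtain ⟨k, wk⟩ : ∃ k, d ≫ f = k := ⟨_, rfl⟩
    obtain ⟨l, wl⟩ : ∃ l, k ≫ g = l := ⟨_, rfl⟩
    have wl' : d ≫ h = l := by rw [← wl, ← wk, ← w, Category.assoc]
    have hk : act k := wk ▸ act_comp _ _ hd hf
    have hl : act l := wl ▸ act_comp _ _ hk hg
    -- the families over the parts of `f` and of `g` may be assumed to be regrouped from families
    -- over the parts of `d`
    rw [← cancel_epi ((val X A₀ ⊗ tensL T _) ◁ (regroup (freeColl X) d hd f k wk ⊗ₘ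
      regroupNested hd wk w wl wl' (freeColl X)))]
    -- the induction hypothesis for all parts at once, after rearranging the threefold tensor
    -- product of families
    have key : (α_ _ _ _).inv ≫ ((tensMul T _ _ ≫ tensMap (fun x => s x ▷ _ ≫
          freeMul X (pushMap d f k wk x) (pushMap_act _ _ _ _ _)) _) ⊗ₘ
          tensMap (fun x => regroup (freeColl X) (pushMap d f k wk x) (pushMap_act d f k wk x)
            (pushMap k g l wl x) (pushMap d h l wl' x) (pushMap_triple wk w wl wl' x)) _) ≫
          tensMul _ _ _ ≫ tensMap (fun x =>
            freeMul X (pushMap k g l wl x) (pushMap_act _ _ _ _ _)) (List.finRange _) =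
        tensL T _ ◁ (tensMul _ _ _ ≫ tensMap (fun x => tensMul _ _ _ ≫ tensMap (fun y =>
          freeMul X (pushMap (pushMap d f k wk x) (pushMap k g l wl x) (pushMap d h l wl' x)
          (pushMap_triple wk w wl wl' x) y) (pushMap_act _ _ _ _ _)) _) _) ≫ tensMul _ _ _ ≫
          tensMap (fun x => s x ▷ _ ≫
            freeMul X (pushMap d h l wl' x) (pushMap_act _ _ _ _ _)) _ := by
      have h₁ := tensMul_assoc T (fun x => valMor (freeColl X) (pushMap d f k wk x))
        (fun x => tens fun y => valMor (freeColl X) (pushMap (pushMap d f k wk x)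
          (pushMap k g l wl x) (pushMap d h l wl' x) (pushMap_triple wk w wl wl' x) y))
          (List.finRange _)
      have h₂ : (α_ _ _ _).inv ≫ tensMul T (fun x => valMor (freeColl X) (pushMap d f k wk x))
          (List.finRange _) ▷ _ ≫ tensMul _ _ _ = _ ◁ tensMul _ _ _ ≫ tensMul _ _ _ ≫
            tensMap (fun i => (α_ (T i) (valMor (freeColl X) (pushMap d f k wk i))
            (tens fun y => valMor (freeColl X) (pushMap (pushMap d f k wk i)
          (pushMap k g l wl i) (pushMap d h l wl' i)
            (pushMap_triple wk w wl wl' i) y))).inv) _ := by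
        rw [Iso.inv_comp_eq, ← reassoc_of% h₁, tensMap_tensMap, tensMap_id' (fun i => by simp),
          Category.comp_id]
      rw [← whiskerRight_comp_tensorHom_assoc, reassoc_of% tensorHom_tensMap_tensMul,
        reassoc_of% h₂, tensMap_tensMap, tensMap_tensMap, MonoidalCategory.whiskerLeft_comp,
        Category.assoc, reassoc_of% tensMap_whiskerLeft_tensMul, tensMap_tensMap]
      congr 3
      funext x
      have h₃ := ih x (pushMap d f k wk x) (pushMap_act _ _ _ _ _) (pushMap k g l wl x)
        (pushMap_act _ _ _ _ _) (pushMap d h l wl' x) (pushMap_triple wk w wl wl' x)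
        (pushMap_act _ _ _ _ _)
      rw [← whisker_exchange_assoc, associator_inv_naturality_left_assoc,
        whiskerRight_comp_tensorHom_assoc] at h₃
      exact h₃
    have hL := freeNode_freeMul_map d hd f hf k hk wk s
    have hR := freeNode_freeMul_map d hd h hh l hl wl' s
    trans (α_ _ _ _).hom ≫ val X A₀ ◁ (tensL T _ ◁ (tensMul _ _ _ ≫ tensMap (fun x =>
          tensMul _ _ _ ≫ tensMap (fun y =>
          freeMul X (pushMap (pushMap d f k wk x) (pushMap k g l wl x) (pushMap d h l wl' x)
          (pushMap_triple wk w wl wl' x) y) (pushMap_act _ _ _ _ _)) _) _) ≫ tensMul _ _ _ ≫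
          tensMap (fun x => s x ▷ _ ≫ freeMul X (pushMap d h l wl' x) (pushMap_act _ _ _ _ _)) _) ≫
          freeNode X l hl
    · rw [← key]
      rw [← MonoidalCategory.tensorHom_def'_assoc, associator_inv_naturality_assoc,
        tensorHom_comp_tensorHom_assoc, hL, ← regroup_regroup hd hf wk w wl wl' (freeColl X) hk]
      exact associator_inv_nested_tensorHom (freeNode_freeMul k hk g hg l hl wl (X := X)) _ _
    · have hm := regroup_mul hd wk w wl wl' (freeColl X) (fun f hf => freeMul X f hf)
        freeMul_equivariant
      rw [← MonoidalCategory.tensorHom_def'_assoc]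
      exact (tensorHom_nested_whiskerLeft (hm.trans (Category.assoc _ _ _).symm) hR).symm

end Free

end HypermomentCategory

/-! ### Units of operads and the free operad -/

namespace FinTensor

variable {E : Type u} [Category.{v} E] [MonoidalCategory E]

theorem tensPoint_tensMap {ι : Type*} {X Y : ι → E} (p : ∀ i, 𝟙_ E ⟶ X i) (φ : ∀ i, X i ⟶ Y i)
    (l : List ι) : tensPoint p l ≫ tensMap φ l = tensPoint (fun i => p i ≫ φ i) l := by
  induction l with
  | nil => exact Category.comp_id _
  | cons a l ih =>
    change ((λ_ (𝟙_ E)).inv ≫ (p a ⊗ₘ tensPoint p l)) ≫ (φ a ⊗ₘ tensMap φ l) = _ ≫ (_ ⊗ₘ _)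
    rw [Category.assoc, tensorHom_comp_tensorHom, ih]

theorem tensPoint_tensOne {ι : Type*} (l : List ι) :
    tensPoint (fun _ => 𝟙 (𝟙_ E)) l ≫ tensOne l = 𝟙 _ := by
  induction l with
  | nil => exact Category.comp_id _
  | cons a l ih =>
    change ((λ_ (𝟙_ E)).inv ≫ (𝟙 _ ⊗ₘ tensPoint _ l)) ≫ (λ_ _).hom ≫ tensOne l = _
    rw [id_tensorHom, Category.assoc, leftUnitor_naturality_assoc, ih]
    simp

theorem tensOne_tensPoint {ι : Type*} (l : List ι) :
    tensOne l ≫ tensPoint (fun _ => 𝟙 (𝟙_ E)) l = 𝟙 _ := by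
  induction l with
  | nil => exact Category.comp_id _
  | cons a l ih =>
    change ((λ_ _).hom ≫ tensOne l) ≫ (λ_ (𝟙_ E)).inv ≫ (𝟙 _ ⊗ₘ tensPoint _ l) = 𝟙 _
    rw [id_tensorHom, Category.assoc, leftUnitor_inv_naturality_assoc,
      ← MonoidalCategory.whiskerLeft_comp, ih]
    simp

theorem tensPoint_eq {ι : Type*} {X : ι → E} (p : ∀ i, 𝟙_ E ⟶ X i) (l : List ι) :
    tensPoint p l = tensPoint (fun _ => 𝟙 (𝟙_ E)) l ≫ tensMap p l := by
  rw [tensPoint_tensMap]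
  simp

theorem tensOne_tensPoint_eq {ι : Type*} {X : ι → E} (p : ∀ i, 𝟙_ E ⟶ X i) (l : List ι) :
    tensOne l ≫ tensPoint p l = tensMap p l := by
  rw [tensPoint_eq, reassoc_of% (tensOne_tensPoint (E := E) l)]

variable [SymmetricCategory E]

theorem tensPoint_tensReindex {ι κ : Type*} [DecidableEq κ] {X : ι → E} {Y : κ → E} {l : List ι}
    {l' : List κ} (e : ι → κ) (h : (l.map e).Perm l') (φ : ∀ i, X i ⟶ Y (e i)) (hl : l'.Nodup)
    (p : ∀ i, 𝟙_ E ⟶ X i) (q : ∀ i, 𝟙_ E ⟶ Y i) (hq : ∀ i, p i ≫ φ i = q (e i)) :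
    tensPoint p l ≫ tensReindex e h φ = tensPoint q l' := by
  rw [← cancel_epi (tensOne l), reassoc_of% (tensOne_tensPoint_eq p l), tensMap_reindex,
    ← tensReindex_tensOne e h hl, Category.assoc, tensOne_tensPoint_eq, tensReindex_map _ _ _ _ hl]
  simp [hq]

/-- Tensoring each factor with a unit is viewing it as a tensor product over a one-element set. -/
theorem rightUnitor_inv_tensSigma {ι : Type*} [DecidableEq ι] (Z : ι → E) (l : List ι)
    (h : (l.map fun i => (⟨i, ()⟩ : Σ _ : ι, Unit)).Perm (l.sigma fun _ => [()])) :
    tensMap (Y := fun i => tensL (fun _ : Unit => Z i) [()]) (fun i => (ρ_ (Z i)).inv) l ≫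
        tensSigma (fun i (_ : Unit) => Z i) (fun _ => [()]) l =
      tensReindex (Y := fun p : Σ _ : ι, Unit => Z p.1) (fun i => ⟨i, ()⟩) h (fun _ => 𝟙 _) := by
  have h' : ∀ l : List ι, (l.map fun i => (⟨i, ()⟩ : Σ _ : ι, Unit)) = (l.sigma fun _ => [()]) := by
    intro l
    induction l with
    | nil => rfl
    | cons a l ih => simp [ih, List.sigma]
  rw [tensReindex, ← tensCast_eq_perm _ (h' l)]
  clear h
  induction l with
  | nil => rfl
  | cons a l ih =>
    change ((ρ_ (Z a)).inv ⊗ₘ tensMap (Y := fun i => tensL (fun _ : Unit => Z i) [()]) _ l) ≫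
      ((𝟙 (Z a) ⊗ₘ 𝟙 (𝟙_ E)) ⊗ₘ tensSigma _ _ l) ≫ (α_ _ _ _).hom ≫ Z a ◁ (λ_ _).hom =
      (𝟙 (Z a) ⊗ₘ tensMapIdx _ _ l) ≫
        tensCast (fun p : Σ _ : ι, Unit => Z p.1) (congrArg (List.cons ⟨a, ()⟩) (h' l))
    rw [tensCast_cons _ (h' l)]
    change _ = _ ≫ Z a ◁ _
    rw [id_tensorHom_id, tensorHom_comp_tensorHom_assoc, ih, Category.comp_id, tensorHom_def',
      id_tensorHom, ← MonoidalCategory.whiskerLeft_comp, Category.assoc]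
    simp

end FinTensor

namespace HypermomentCategory

open FinTensor

section Eval

variable {C : Type u₁} [Category.{v₁} C] [HypermomentCategory C]
variable {E : Type u} [Category.{v} E] [MonoidalCategory E] [SymmetricCategory E]

/-- The inclusion of the only part of an active morphism with unital domain. -/
noncomputable abbrev unitaryIso {U A : C} (hU : IsUnit U) (f : U ⟶ A) (hf : act f) (x : El U) :
    push f x ≅ A :=
  have := pushIn_isIso hU f hf x
  asIso (pushIn f x)

theorem nestIdx_id {A : C} (x : El A) (y : El (push (𝟙 A) x)) : nestIdx (𝟙 A) ⟨x, y⟩ = x := by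
  have := (pushIn_range (𝟙 A) x _).1 ⟨y, rfl⟩
  rw [CategoryTheory.Functor.map_id, SegalGamma.id_set] at this
  exact this

/-- Regrouping along the identity of `A`, whose parts are units, is the identity, up to the
identification of `X(f)` with a single factor for morphisms `f` out of units. -/
theorem regroup_id (X : Collection C E) {A B : C} (d : A ⟶ B) (h : act (𝟙 A)) (w : 𝟙 A ≫ d = d) :
    tensMap (fun x => toUnitary X (isUnit_push_id x) (pushMap (𝟙 A) d d w x)
      (pushMap_act _ _ _ _ _)) _ ≫ regroup X (𝟙 A) h d d w = 𝟙 _ := by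
  have h₁ := tensReindex_tensSigma (ι := El A) (ι' := El A)
    (Y := fun (x : El A) (_ : Unit) => val X (push d x)) (m := fun _ => [()])
    (Y' := fun (x : El A) (y : El (push (𝟙 A) x)) => val X (push (pushMap (𝟙 A) d d w x) y))
    (m' := fun x => List.finRange _) (l := List.finRange _) (l' := List.finRange _) id
    (by simp) (fun x _ => (isUnit_push_id x).idx)
    (fun x => perm_single fun _ => isUnit_eq (isUnit_push_id x) _ _)
    (fun x _ => actBy X (unitaryIso (isUnit_push_id x) (pushMap (𝟙 A) d d w x)
        (pushMap_act _ _ _ _ _) (isUnit_push_id x).idx).symm)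
    (List.nodup_finRange _) (fun _ => List.nodup_finRange _)
  rw [tensReindex_id] at h₁
  have h₂ := rightUnitor_inv_tensSigma (fun x => val X (push d x)) (List.finRange (γ.obj A).card)
    (by
      rw [List.perm_ext_iff_of_nodup ((List.nodup_finRange _).map (fun a b h => by simpa using h))
        (nodup_sigma (List.nodup_finRange _) (fun _ => List.nodup_singleton _))]
      rintro ⟨x, ⟨⟩⟩
      simp)
  have h₃ : tensReindex (X := fun x => val X (push d x)) (Y := fun x => val X (push d x)) id
      (show ((List.finRange _).map id).Perm (List.finRange _) by simp)
      (fun x : El A => actBy X (Iso.refl (push d x))) = 𝟙 _ := by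
    rw [tensReindex_id, tensMap_id' (fun x => actBy_refl X _)]
  -- each `toUnitary` is the inverse of a right unitor followed by a reindexing
  have h₄ : tensMap (fun x => toUnitary X (isUnit_push_id x) (pushMap (𝟙 A) d d w x)
      (pushMap_act _ _ _ _ _)) (List.finRange (γ.obj A).card) =
      tensMap (Y := fun i => tensL (fun _ : Unit => val X (push d i)) [()])
        (fun i => (ρ_ (val X (push d i))).inv) _ ≫ tensMap (fun x => tensReindex
        (Y := fun y => val X (push (pushMap (𝟙 A) d d w x) y))
        (fun _ : Unit => (isUnit_push_id x).idx)
      (perm_single fun _ => isUnit_eq (isUnit_push_id x) _ _)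
    (fun _ => actBy X (unitaryIso (isUnit_push_id x) (pushMap (𝟙 A) d d w x)
        (pushMap_act _ _ _ _ _) (isUnit_push_id x).idx).symm)) _ := by
    rw [tensMap_tensMap]
    rfl
  rw [h₄, regroup_eq, Category.assoc, reassoc_of% h₁, reassoc_of% h₂,
    tensReindex_comp _ _ _ _ _ _ (List.nodup_finRange _),
    tensReindex_comp _ _ _ _ _ _ (List.nodup_finRange _)]
  simp only [Category.id_comp, actBy_comp]
  rw [← h₃]
  refine tensReindex_cmp_congr (G := fun x => push d x) (e' := id) X (fun x => nestIdx_id x _)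
    (fun x => ?_)
  -- the comparison isomorphism of a part with itself obtained in this way is the identity, by
  -- uniqueness
  have := pushIn_isIso (isUnit_push_id x) (pushMap (𝟙 A) d d w x)
        (pushMap_act _ _ _ _ _) (isUnit_push_id x).idx
  have := elMap_isIso (isUnit_push_id x) (isUnit_push_id x).idx
  have := pushAct_isIso_of_inert (𝟙 A) (inert_of_isIso _ inferInstance) x
  have hx := nestIdx_id x (isUnit_push_id x).idx
  rw [Iso.trans_assoc]
  obtain ⟨ε, hε⟩ := exists_elIso (nestSq (𝟙 A) d d w x).hs hx
  have ha := cmp_act (nestSq (𝟙 A) d d w x) hx ε hε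
  have hi := cmp_in (nestSq (𝟙 A) d d w x) hx
  have hf := push_fac (pushMap (𝟙 A) d d w x) (isUnit_push_id x).idx
  refine (congrArg (fun z => _ ≪≫ z) (cmp_eqToHom (nestSq (𝟙 A) d d w x) rfl hx _)).trans ?_
  refine (cmp_unique (InSq.ofEq (rfl : d = d)) (inertIdx_id _ _ _) _
    (actIso (𝟙 A) x inferInstance ≪≫
      (asIso (elMap (push (𝟙 A) x) (isUnit_push_id x).idx)).symm ≪≫ ε)
    ?_ ?_ ?_).trans (cmp_refl _ rfl rfl _)
  · simp [hε, actIso, push_fac]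
  · rw [← IsIso.eq_comp_inv] at hf
    have hc := pushAct_pushMap (𝟙 A) d d w x
    simp only [Iso.trans_hom, Iso.symm_hom, asIso_inv, asIso_hom, actIso, Category.assoc, ← ha]
    rw [← hc, hf]
    simp
  · simp [hi]

theorem Operad.η_μ (O : Operad C E) {U A : C} (hU : IsUnit U) (f : U ⟶ A) (hf : act f) :
    O.η U hU ▷ _ ≫ O.μ f hf = (λ_ _).hom ≫ inv (toUnitary O.coll hU f hf) := by
  rw [← cancel_epi (_ ◁ toUnitary O.coll hU f hf), ← MonoidalCategory.tensorHom_def'_assoc,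
    O.left_unit, leftUnitor_naturality_assoc, IsIso.hom_inv_id, Category.comp_id]

theorem Operad.η_tensorHom_μ (O : Operad C E) {U A : C} (hU : IsUnit U) (f : U ⟶ A) (hf : act f)
    {T : E} (z : T ⟶ valMor O.coll f) :
    (O.η U hU ⊗ₘ z) ≫ O.μ f hf = (λ_ _).hom ≫ z ≫ inv (toUnitary O.coll hU f hf) := by
  rw [MonoidalCategory.tensorHom_def', Category.assoc, O.η_μ, leftUnitor_naturality_assoc]

/-- The units of an operad are compatible with isomorphisms. The axioms of an operad do not mention
this: it follows from the unit laws and equivariance in the same way as the uniqueness of units in a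
monoid. -/
theorem Operad.η_actBy (O : Operad C E) {U V : C} (hU : IsUnit U) (hV : IsUnit V) (e : U ≅ V) :
    O.η U hU ≫ actBy O.coll e = O.η V hV := by
  have ha : act (𝟙 V) := act_of_isIso _ inferInstance
  -- the units inserted at the parts of `𝟙 V` are the unit of `V` itself
  obtain ⟨z, hz, hr⟩ : ∃ z : 𝟙_ E ⟶ valMor O.coll (𝟙 V), O.η V hV ≫
      toUnitary O.coll hV (𝟙 V) ha = z ∧ ∀ a : 𝟙_ E ⟶ val O.coll V,
        (a ⊗ₘ z) ≫ O.μ (𝟙 V) ha = (ρ_ _).hom ≫ a := by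
    have hr : ∀ a : 𝟙_ E ⟶ val O.coll V,
        (a ⊗ₘ tensPoint (fun x => O.η (elObj V x) (elObj_isUnit V x) ≫ actBy O.coll
        (actIso (𝟙 V) x (pushAct_isIso_of_inert _ (inert_of_isIso _ inferInstance) x)))
          (List.finRange _)) ≫ O.μ (𝟙 V) ha = (ρ_ _).hom ≫ a := by
      intro a
      rw [tensPoint_eq, ← tensorHom_comp_whiskerLeft_assoc, O.right_unit,
        tensorHom_comp_whiskerLeft_assoc, tensPoint_tensOne]
      simp
    refine ⟨_, ?_, hr⟩
    have h₁ := hr (O.η V hV)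
    rw [O.η_tensorHom_μ, ← unitors_equal, cancel_epi, IsIso.comp_inv_eq] at h₁
    exact h₁.symm
  have hf := act_iso e
  have ht := toUnitary_transport O.coll hU hV e (Iso.refl V) e.hom hf (𝟙 V) ha (by simp)
  have he := O.equivariant e (Iso.refl V) e.hom hf (𝟙 V) ha (by simp)
  have h₁ := hr (O.η U hU ≫ actBy O.coll e)
  rw [actBy_refl, Category.id_comp] at ht
  rw [actBy_refl, Category.comp_id (O.μ e.hom hf)] at he
  rw [← hz, ← ht, ← Category.assoc (O.η V hV), ← tensorHom_comp_tensorHom_assoc, he,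
    O.η_tensorHom_μ, Category.assoc, IsIso.hom_inv_id, Category.comp_id, unitors_equal,
    cancel_epi] at h₁
  exact h₁.symm

end Eval

section Free

variable {C : Type w} [SmallCategory C] [HypermomentCategory C]
variable {E : Type u} [Category.{v} E] [MonoidalCategory E] [SymmetricCategory E]
variable [Limits.HasColimitsOfSize.{w, w} E] [MonoidalClosed E]

/-- The free operad on a collection. -/
noncomputable def freeOperad (X : Collection C E) : Operad C E where
  coll := freeColl X
  η := freeUnit X
  μ f hf := freeMul X f hf
  left_unit := free_left_unit
  right_unit A h := by
    refine ((injUniv X A).whiskerRight _).hom_ext fun j => ?_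
    have h₁ := free_right_unit_inj (X := X) j.tree j.iso
    have h₂ : inj X j.tree j.iso ▷ _ ≫ val (freeColl X) A ◁ tensOne (List.finRange (γ.obj A).card) ≫
        (ρ_ _).hom = (j.tree.tensor X ◁ tensOne _ ≫ (ρ_ _).hom) ≫ inj X j.tree j.iso := by
      rw [← whisker_exchange_assoc]
      simp
    refine Eq.trans ?_ h₂.symm
    rw [← h₁, ← MonoidalCategory.tensorHom_def_assoc]
    congr 3
    funext x
    exact freeUnit_actBy _ _ _
  assoc f hf g hg h w hh := by
    refine ((injUniv X _).whiskerRight _).hom_ext fun j => ?_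
    exact free_assoc_inj j.tree j.iso f hf g hg h w hh
  equivariant := freeMul_equivariant

end Free

end HypermomentCategory

/-! ### The universal property of the free operad -/

namespace FinTensor

variable {E : Type u} [Category.{v} E] [MonoidalCategory E] [SymmetricCategory E]

/-- The left unitor of a tensor product, computed factor by factor. -/
theorem tensMul_leftUnitor {ι : Type*} (X : ι → E) (l : List ι) :
    tensMul (fun _ => 𝟙_ E) X l ≫ tensMap (fun i => (λ_ (X i)).hom) l =
      tensOne l ▷ tensL X l ≫ (λ_ _).hom := by
  induction l with
  | nil =>
    change (λ_ _).hom ≫ 𝟙 _ = 𝟙 _ ▷ 𝟙_ E ≫ (λ_ _).hom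
    simp
  | cons a l ih =>
    change (tensorμ _ _ _ _ ≫ _ ◁ tensMul _ X l) ≫ ((λ_ _).hom ⊗ₘ tensMap _ l) =
      ((λ_ _).hom ≫ tensOne l) ▷ _ ≫ _
    rw [Category.assoc, whiskerLeft_comp_tensorHom, ih]
    have h₂ := tensorμ_natural (𝟙 (𝟙_ E)) (tensOne l) (𝟙 (X a)) (𝟙 (tensL X l))
    simp only [id_tensorHom, tensorHom_id,
      MonoidalCategory.id_whiskerRight] at h₂
    have h₃ : ∀ P Q : E, tensorμ (𝟙_ E) (𝟙_ E) P Q ≫ ((λ_ P).hom ⊗ₘ (λ_ Q).hom) =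
        (λ_ (𝟙_ E)).hom ▷ (P ⊗ Q) ≫ (λ_ _).hom := by
      intro P Q
      rw [MonoidalCategory.tensorHom_def]
      simp only [tensorμ, braiding_tensorUnit_left]
      monoidal
    rw [← whiskerLeft_comp_tensorHom, ← reassoc_of% h₂, h₃,
      ← MonoidalCategory.comp_whiskerRight_assoc, leftUnitor_naturality]

end FinTensor

namespace HypermomentCategory

open FinTensor

section Free

variable {C : Type w} [SmallCategory C] [HypermomentCategory C]
variable {E : Type u} [Category.{v} E] [MonoidalCategory E] [SymmetricCategory E]
variable {X : Collection C E} (O : Operad C E) (φ : X ⟶ O.coll)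

/-- The evaluation in an operad of the trees presented by grafting. -/
noncomputable def GTree.eval : ∀ {A : C} (P : GTree A), P.tensor X ⟶ val O.coll A
  | _, .leaf U hU => O.η U hU
  | _, .node (D := D) d hd _ e Q =>
      (φ.app ⟨D⟩ ⊗ₘ tensMap (fun x => GTree.eval (Q x) ≫ actBy O.coll (e x)) _) ≫ O.μ d hd

/-- Isomorphic trees have the same evaluation, because the operad is equivariant and its units are
compatible with isomorphisms. -/
theorem GIso.map_eval {A A' : C} {P : GTree A} {P' : GTree A'} {ε : A ≅ A'} (θ : GIso P P' ε) :
    θ.map X ≫ P'.eval O φ = P.eval O φ ≫ actBy O.coll ε := by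
  induction θ with
  | leaf hU hU' ε => exact (Category.id_comp _).trans (O.η_actBy hU hU' ε).symm
  | @node D A D' A' d hd Y e Q d' hd' Y' e' Q' σ ε w idx hidx κ θ hκ ih =>
    obtain rfl : isoIdx σ = idx := funext hidx
    simp only [GIso.map, GTree.eval]
    rw [Category.assoc, ← O.equivariant σ ε d hd d' hd' w, tensorHom_comp_tensorHom_assoc,
      tensorHom_comp_tensorHom_assoc, actBy_nat, transport_eq,
      tensReindex_map _ _ _ _ (List.nodup_finRange _), tensMap_reindex]
    congr 3
    funext x
    rw [reassoc_of% ih x, Category.assoc, actBy_comp, actBy_comp, hκ]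

variable [Limits.HasColimitsOfSize.{w, w} E] [MonoidalClosed E]

/-- The extension of a map of collections to the free operad, on one object. -/
noncomputable def freeDesc (A : C) : val (freeColl X) A ⟶ val O.coll A :=
  (injUniv X A).desc (fun j => j.tree.eval O φ ≫ actBy O.coll j.iso) (by
    rintro j j' _ ⟨θ, rfl⟩
    rw [reassoc_of% (θ.θ.map_eval O φ), actBy_comp, θ.w])

theorem inj_freeDesc {A A₀ : C} (P : GTree A₀) (e : A₀ ≅ A) :
    inj X P e ≫ freeDesc O φ A = P.eval O φ ≫ actBy O.coll e :=
  (injUniv X A).fac _ _ ⟨A₀, P, e⟩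

theorem freeUnit_freeDesc {U : C} (hU : IsUnit U) :
    freeUnit X U hU ≫ freeDesc O φ U = O.η U hU := by
  rw [freeUnit, inj_freeDesc, actBy_refl, Category.comp_id]
  rfl

theorem freeNode_freeDesc {D A : C} (d : D ⟶ A) (hd : act d) :
    freeNode X d hd ≫ freeDesc O φ A =
      (φ.app ⟨D⟩ ⊗ₘ tensMap (fun x => freeDesc O φ (push d x)) _) ≫ O.μ d hd := by
  refine ((valMorUniv X d).whiskerLeft (val X D)).hom_ext fun j => ?_
  have h₁ := inj_freeNode (X := X) d hd (fun x => (j x).tree) (fun x => (j x).iso)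
  rw [reassoc_of% h₁, inj_freeDesc, actBy_refl, Category.comp_id, whiskerLeft_comp_tensorHom_assoc,
    tensMap_tensMap]
  simp only [inj_freeDesc]
  rfl

/-- The extension of a map of collections to the free operad. -/
noncomputable def freeDescMap : freeColl X ⟶ O.coll where
  app A := freeDesc O φ A.of
  naturality A B e := by
    refine (injUniv X A.of).hom_ext fun j => ?_
    have h₁ := inj_actBy X j.tree j.iso e.iso
    change inj X j.tree j.iso ≫ actBy (freeColl X) e.iso ≫ _ = inj X j.tree j.iso ≫ _ ≫
      actBy O.coll e.iso
    rw [reassoc_of% h₁, inj_freeDesc, reassoc_of% (inj_freeDesc O φ j.tree j.iso), actBy_comp]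

/-- The extension is multiplicative: induction on the tree in the first factor, using associativity
in the operad for a node. -/
theorem freeMul_freeDesc {A B : C} (f : A ⟶ B) (hf : act f) :
    freeMul X f hf ≫ freeDesc O φ B =
      (freeDesc O φ A ⊗ₘ tensMap (fun x => freeDesc O φ (push f x)) _) ≫ O.μ f hf := by
  refine ((injUniv X A).whiskerRight _).hom_ext fun j => ?_
  refine free_induction (X := X) (p := fun {A T} s => ∀ {B : C} (f : A ⟶ B) (hf : act f),
    s ▷ _ ≫ freeMul X f hf ≫ freeDesc O φ B = s ▷ _ ≫
      (freeDesc O φ A ⊗ₘ tensMap (fun x => freeDesc O φ (push f x)) _) ≫ O.μ f hf)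
    ?_ ?_ j.tree j.iso f hf
  · intro U hU B f hf
    have h₁ := toUnitary_nat (freeDescMap O φ) hU f hf
    rw [reassoc_of% freeUnit_freeMul, whiskerRight_comp_tensorHom_assoc, freeUnit_freeDesc,
      O.η_tensorHom_μ, cancel_epi, IsIso.inv_comp_eq, ← Category.assoc, IsIso.eq_comp_inv]
    exact h₁.symm
  · intro D A d hd T s ih B f hf
    obtain ⟨k, w⟩ : ∃ k, d ≫ f = k := ⟨_, rfl⟩
    have hk : act k := w ▸ act_comp _ _ hd hf
    have h₁ := freeNode_freeMul_map d hd f hf k hk w s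
    have h₂ := tensMap_regroup (freeDescMap O φ) d hd f k w
    have h₃ := O.assoc d hd f hf k w hk
    rw [← cancel_epi (_ ◁ regroup (freeColl X) d hd f k w),
      ← MonoidalCategory.tensorHom_def'_assoc, reassoc_of% h₁, freeNode_freeDesc,
      ← MonoidalCategory.tensorHom_def'_assoc, tensorHom_comp_tensorHom_assoc,
      Category.assoc, freeNode_freeDesc]
    have h₄ : regroup (freeColl X) d hd f k w ≫ tensMap (fun x => freeDesc O φ (push f x)) _ = _ :=
      h₂
    have h₅ : tensMap (fun x => tensMap (fun y => (freeDescMap O φ).app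
        ⟨push (pushMap d f k w x) y⟩) _) (List.finRange _) = tensMap (fun x => tensMap (fun y =>
          freeDesc O φ (push (pushMap d f k w x) y)) (List.finRange (γ.obj (push d x)).card))
          (List.finRange (γ.obj D).card) := rfl
    rw [Iso.inv_comp_eq] at h₃
    rw [h₄, h₅, whiskerLeft_comp_tensorHom_assoc, Category.assoc (tensMul _ _ _), tensMap_tensMap,
      whiskerLeft_comp_tensorHom_assoc, tensMap_tensMap, ← tensorHom_comp_tensorHom_assoc, h₃,
      associator_naturality_assoc,
      tensorHom_comp_whiskerLeft_assoc, reassoc_of% tensorHom_tensMap_tensMul, tensMap_tensMap]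
    congr 5
    funext x
    rw [Category.assoc, ih, whiskerRight_comp_tensorHom_assoc]

/-- The operad map out of the free operad that extends a map of collections. -/
noncomputable def freeLift : freeOperad X ⟶ O where
  map := freeDescMap O φ
  η_map _ hU := freeUnit_freeDesc O φ hU
  μ_map f hf := freeMul_freeDesc O φ f hf

/-- The generators of the free operad: an element of `X(A)` becomes the tree with one vertex, the
node on the identity of `A` with units grafted on it. -/
noncomputable def freeGen (X : Collection C E) : X ⟶ freeColl X where
  app A := (ρ_ _).inv ≫ val X A.of ◁ tensPoint (fun x => freeUnit X (push (𝟙 A.of) x)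
    (isUnit_push_id x)) _ ≫ freeNode X (𝟙 A.of) (act_of_isIso _ inferInstance)
  naturality A B e := by
    have h₁ := freeNode_equivariant (X := X) e.iso e.iso (𝟙 A.of) (act_of_isIso _ inferInstance)
      (𝟙 B.of) (act_of_isIso _ inferInstance) (by simp)
    have h₂ : tensPoint (fun x => freeUnit X (push (𝟙 A.of) x) (isUnit_push_id x)) _ ≫
        transport (freeColl X) e.iso e.iso (𝟙 A.of) (𝟙 B.of) (by simp) =
        tensPoint (fun x => freeUnit X (push (𝟙 B.of) x) (isUnit_push_id x)) _ := by
      rw [transport_eq]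
      exact tensPoint_tensReindex (Y := fun x => val (freeColl X) (push (𝟙 B.of) x)) _ _ _
        (List.nodup_finRange _) _ _ (fun x => freeUnit_actBy _ _ _)
    change actBy X e.iso ≫ _ = _ ≫ actBy (freeColl X) e.iso
    simp only [Category.assoc]
    rw [← h₁, rightUnitor_inv_naturality_assoc, whiskerLeft_comp_tensorHom_assoc, h₂,
      MonoidalCategory.tensorHom_def_assoc]

/-- Grafting on `d : D ⟶ A` is multiplication with a generator along `d`. -/
theorem freeNode_eq {D A : C} (d : D ⟶ A) (hd : act d) :
    ((freeGen X).app ⟨D⟩ ▷ _) ≫ freeMul X d hd = freeNode X d hd := by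
  have h₁ := freeNode_freeMul_map (X := X) (𝟙 D) (act_of_isIso _ inferInstance) d hd d hd
    (Category.id_comp d) (fun x => freeUnit X (push (𝟙 D) x) (isUnit_push_id x))
  have h₂ := regroup_id (freeColl X) d (act_of_isIso _ inferInstance) (Category.id_comp d)
  simp only [freeUnit_freeMul] at h₁
  have h₃ : (freeGen X).app ⟨D⟩ = ((ρ_ _).inv ≫ val X D ◁ tensPoint (fun _ => 𝟙 _) _) ≫
      val X D ◁ tensMap (fun x => freeUnit X (push (𝟙 D) x) (isUnit_push_id x)) _ ≫
        freeNode X (𝟙 D) (act_of_isIso _ inferInstance) := by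
    rw [Category.assoc, ← MonoidalCategory.whiskerLeft_comp_assoc, ← tensPoint_eq]
    rfl
  rw [h₃, ← tensorHom_id, ← h₂, ← tensorHom_comp_tensorHom_assoc, h₁, ← tensMap_tensMap,
    reassoc_of% tensMul_leftUnitor, ← whiskerRight_comp_tensorHom_assoc,
    whiskerLeft_tensorHom_associator_assoc, ← MonoidalCategory.whiskerLeft_comp_assoc,
    tensorHom_comp_whiskerRight_assoc, tensPoint_tensOne, id_tensorHom, leftUnitor_naturality_assoc,
    tensMap_tensMap, tensMap_id' (fun x => IsIso.hom_inv_id _), Category.comp_id]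
  simp

theorem freeGen_freeLift : freeGen X ≫ (freeLift O φ).map = φ := by
  ext A
  have h₁ := O.right_unit A.of (act_of_isIso _ inferInstance)
  have h₂ := freeNode_freeDesc O φ (𝟙 A.of) (act_of_isIso _ inferInstance)
  change ((ρ_ _).inv ≫ val X A.of ◁ tensPoint _ _ ≫ freeNode X (𝟙 A.of) _) ≫ freeDesc O φ A.of = _
  rw [Category.assoc, Category.assoc, h₂, whiskerLeft_comp_tensorHom_assoc, tensPoint_tensMap]
  simp only [freeUnit_freeDesc]
  rw [tensPoint_eq, ← tensorHom_comp_whiskerLeft_assoc]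
  have h₃ : tensMap (fun x => O.η (push (𝟙 A.of) x) (isUnit_push_id x)) _ = tensMap (fun x =>
      O.η (elObj A.of x) (elObj_isUnit A.of x) ≫ actBy O.coll (actIso (𝟙 A.of) x
        (pushAct_isIso_of_inert _ (inert_of_isIso _ inferInstance) x))) (List.finRange _) := by
    congr 1
    funext x
    exact (O.η_actBy _ _ _).symm
  rw [h₃, h₁, tensorHom_comp_whiskerLeft_assoc, tensPoint_tensOne]
  simp

/-- A multiplicative map out of the free operad is determined on generators, since all elements are
obtained from units by multiplication with generators. -/
theorem freeDescMap_unique (g : freeColl X ⟶ O.coll)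
    (hη : ∀ (U : C) (hU : IsUnit U), freeUnit X U hU ≫ g.app ⟨U⟩ = O.η U hU)
    (hμ : ∀ {A B : C} (f : A ⟶ B) (hf : act f), freeMul X f hf ≫ g.app ⟨B⟩ =
      (g.app ⟨A⟩ ⊗ₘ tensMap (fun x => g.app ⟨push f x⟩) _) ≫ O.μ f hf) :
    freeDescMap O (freeGen X ≫ g) = g := by
  ext A
  refine (injUniv X A.of).hom_ext fun j => ?_
  refine free_induction (X := X) (p := fun {A T} s => s ≫ freeDesc O (freeGen X ≫ g) A =
    s ≫ g.app ⟨A⟩) ?_ ?_ j.tree j.iso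
  · intro U hU
    rw [freeUnit_freeDesc, hη]
  · intro D A d hd T s ih
    rw [Category.assoc, freeNode_freeDesc, ← freeNode_eq, Category.assoc, Category.assoc, hμ,
      whiskerLeft_comp_tensorHom_assoc, whiskerRight_comp_tensorHom_assoc,
      whiskerLeft_comp_tensorHom_assoc, tensMap_tensMap, tensMap_tensMap]
    simp only [ih]
    rfl

theorem freeLift_unique (ψ : freeOperad X ⟶ O) :
    freeLift O (freeGen X ≫ (forgetOperad C E).map ψ) = ψ :=
  Operad.Hom.ext (freeDescMap_unique O ψ.map ψ.η_map (fun f hf => ψ.μ_map f hf))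

variable (C E) in
/-- The bijection that makes free operads the values of a left adjoint of the forgetful functor. -/
noncomputable def freeAdjEquiv (X : Collection C E) (O : Operad C E) :
    (freeOperad X ⟶ O) ≃ (X ⟶ (forgetOperad C E).obj O) where
  toFun ψ := freeGen X ≫ (forgetOperad C E).map ψ
  invFun φ := freeLift O φ
  left_inv ψ := freeLift_unique O ψ
  right_inv φ := freeGen_freeLift O φ

variable (C E) in
theorem isRightAdjoint_forgetOperad : (forgetOperad C E).IsRightAdjoint :=
  ⟨_, ⟨Adjunction.adjunctionOfEquivLeft (freeAdjEquiv C E)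
    (fun X _ _ _ _ => (Category.assoc (freeGen X) _ _).symm)⟩⟩

end Free

end HypermomentCategory

/-! ### Monadicity -/

namespace HypermomentCategory

open FinTensor

section Monadicity

variable {C : Type u₁} [Category.{v₁} C] [HypermomentCategory C]
variable {E : Type u} [Category.{v} E] [MonoidalCategory E] [SymmetricCategory E]

instance : (forgetOperad C E).ReflectsIsomorphisms where
  reflects {P Q} f hf := by
    have : IsIso f.map := hf
    have hi : ∀ A : C, f.map.app ⟨A⟩ ≫ (inv f.map).app ⟨A⟩ = 𝟙 _ := fun A => by
      rw [← NatTrans.comp_app, IsIso.hom_inv_id, NatTrans.id_app]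
    have hi' : ∀ A : C, (inv f.map).app ⟨A⟩ ≫ f.map.app ⟨A⟩ = 𝟙 _ := fun A => by
      rw [← NatTrans.comp_app, IsIso.inv_hom_id, NatTrans.id_app]
    refine ⟨⟨⟨inv f.map, fun U hU => ?_, fun {A B} g hg => ?_⟩, ?_, ?_⟩⟩
    · rw [← f.η_map, Category.assoc, hi, Category.comp_id]
    · rw [← cancel_mono (f.map.app ⟨B⟩), Category.assoc, Category.assoc, f.μ_map, hi',
        tensorHom_comp_tensorHom_assoc, tensMap_tensMap, hi', tensMap_id' (fun x => hi' _)]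
      simp
    · exact Operad.Hom.ext (IsIso.hom_inv_id f.map)
    · exact Operad.Hom.ext (IsIso.inv_hom_id f.map)

theorem eq_of_section {T T' W : E} {u : T ⟶ T'} (r : T' ⟶ T) (h : r ≫ u = 𝟙 _) {a b : T' ⟶ W}
    (hab : u ≫ a = u ≫ b) : a = b := by
  rw [← Category.id_comp a, ← h, Category.assoc, hab, reassoc_of% h]

/-- The operad structure on a collection `Z` with a multiplication that is compatible with the one
of an operad along a map `π` to `Z` with sections on each object. The sections need not be natural:
they only serve to make the tensor products of the components of `π` epimorphisms, so that the
axioms for `Z` follow from those of the operad. -/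
def Operad.ofSplitEpi (P : Operad C E) {Z : Collection C E} (π : P.coll ⟶ Z)
    (s : ∀ A : C, val Z A ⟶ val P.coll A) (hs : ∀ A, s A ≫ π.app ⟨A⟩ = 𝟙 _)
    (μ' : ∀ {A B : C} (f : A ⟶ B), act f → (val Z A ⊗ valMor Z f ⟶ val Z B))
    (hμ : ∀ {A B : C} (f : A ⟶ B) (hf : act f),
      (π.app ⟨A⟩ ⊗ₘ tensMap (fun x => π.app ⟨push f x⟩) _) ≫ μ' f hf = P.μ f hf ≫ π.app ⟨B⟩) :
    Operad C E where
  coll := Z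
  η U hU := P.η U hU ≫ π.app ⟨U⟩
  μ f hf := μ' f hf
  left_unit {U A} hU f hf := by
    refine eq_of_section (u := 𝟙_ E ◁ π.app ⟨A⟩) (𝟙_ E ◁ s A)
      (by rw [← MonoidalCategory.whiskerLeft_comp, hs, MonoidalCategory.whiskerLeft_id]) ?_
    rw [whiskerLeft_comp_tensorHom_assoc, ← toUnitary_nat, ← tensorHom_comp_tensorHom_assoc, hμ,
      reassoc_of% P.left_unit, leftUnitor_naturality]
  right_unit A h := by
    refine eq_of_section (u := π.app ⟨A⟩ ▷ _) (s A ▷ _)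
      (by rw [← MonoidalCategory.comp_whiskerRight, hs, MonoidalCategory.id_whiskerRight]) ?_
    have h₁ := P.right_unit A h
    simp only [Category.assoc, ← actBy_nat]
    simp only [← Category.assoc (P.η _ _)]
    rw [← tensMap_tensMap, ← MonoidalCategory.tensorHom_def_assoc,
      ← whiskerLeft_comp_tensorHom_assoc, hμ, reassoc_of% h₁, ← whisker_exchange_assoc,
      rightUnitor_naturality]
  assoc {A B D} f hf g hg h w hh := by
    refine eq_of_section (u := π.app ⟨A⟩ ⊗ₘ (tensMap (fun x => π.app ⟨push f x⟩) _ ⊗ₘ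
      tensMap (fun x => tensMap (fun y => π.app ⟨push (pushMap f g h w x) y⟩) _) _))
      (s A ⊗ₘ (tensMap (fun x => s (push f x)) _ ⊗ₘ
        tensMap (fun x => tensMap (fun y => s (push (pushMap f g h w x) y)) _) _)) ?_ ?_
    · rw [tensorHom_comp_tensorHom, tensorHom_comp_tensorHom, hs, tensMap_tensMap,
        tensMap_tensMap, tensMap_id' (fun x => hs _), tensMap_id' (fun x => by
          rw [tensMap_tensMap, tensMap_id' (fun x => hs _)])]
      simp
    · rw [associator_inv_naturality_assoc, tensorHom_comp_tensorHom_assoc, hμ, ← tensMap_regroup,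
        ← tensorHom_comp_tensorHom_assoc, hμ, reassoc_of% P.assoc f hf g hg h w hh,
        tensorHom_comp_whiskerLeft_assoc, reassoc_of% tensorHom_tensMap_tensMul, tensMap_tensMap]
      simp only [hμ]
      rw [← tensMap_tensMap, ← Category.assoc (tensMul _ _ _), ← whiskerLeft_comp_tensorHom_assoc,
        hμ]
  equivariant {A A' B B'} σ ρ f hf f' hf' w := by
    refine eq_of_section (u := π.app ⟨A⟩ ⊗ₘ tensMap (fun x => π.app ⟨push f x⟩) _)
      (s A ⊗ₘ tensMap (fun x => s (push f x)) _) ?_ ?_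
    · rw [tensorHom_comp_tensorHom, hs, tensMap_tensMap, tensMap_id' (fun x => hs _)]
      simp
    · rw [tensorHom_comp_tensorHom_assoc, ← actBy_nat, ← tensMap_transport,
        ← tensorHom_comp_tensorHom_assoc, hμ, reassoc_of% P.equivariant σ ρ f hf f' hf' w,
        actBy_nat, reassoc_of% hμ]

/-- The coequalizer of a pair of operad maps whose underlying maps of collections have a split
coequalizer `π` exists, and the underlying map of collections is `π`. -/
theorem exists_coequalizer {P Q : Operad C E} (f g : P ⟶ Q) {Z : Collection C E}
    (π : Q.coll ⟶ Z) (s : Z ⟶ Q.coll) (t : Q.coll ⟶ P.coll) (hc : f.map ≫ π = g.map ≫ π)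
    (hs : s ≫ π = 𝟙 Z) (ht : t ≫ g.map = 𝟙 _) (hts : t ≫ f.map = π ≫ s) :
    ∃ (R : Operad C E) (p : Q ⟶ R) (w : f ≫ p = g ≫ p),
      Nonempty (Limits.IsColimit (Limits.Cofork.ofπ p w)) ∧
        ∃ s' : R.coll ⟶ Q.coll, s' ≫ p.map = 𝟙 _ ∧ t ≫ f.map = p.map ≫ s' := by
  have hs' : ∀ A, s.app A ≫ π.app A = 𝟙 _ := fun A => by rw [← NatTrans.comp_app, hs]; rfl
  have ht' : ∀ A, t.app A ≫ g.map.app A = 𝟙 _ := fun A => by rw [← NatTrans.comp_app, ht]; rfl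
  have hts' : ∀ A, t.app A ≫ f.map.app A = π.app A ≫ s.app A := fun A => by
    rw [← NatTrans.comp_app, hts]; rfl
  have hc' : ∀ A, f.map.app A ≫ π.app A = g.map.app A ≫ π.app A := fun A => by
    rw [← NatTrans.comp_app, hc]; rfl
  -- `μ` followed by `π` factors through `π`, because `π ≫ s` is `t` followed by `f`
  have hμ : ∀ {A B : C} (d : A ⟶ B) (hd : act d),
      (π.app ⟨A⟩ ⊗ₘ tensMap (fun x => π.app ⟨push d x⟩) (List.finRange (γ.obj A).card)) ≫
        (s.app ⟨A⟩ ⊗ₘ tensMap (fun x => s.app ⟨push d x⟩) _) ≫ Q.μ d hd ≫ π.app ⟨B⟩ =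
        Q.μ d hd ≫ π.app ⟨B⟩ := by
    intro A B d hd
    rw [tensorHom_comp_tensorHom_assoc, tensMap_tensMap]
    simp only [← hts']
    rw [← tensMap_tensMap, ← tensorHom_comp_tensorHom_assoc, ← Category.assoc _ (Q.μ d hd),
      ← f.μ_map d hd, Category.assoc, hc', ← Category.assoc (P.μ d hd), g.μ_map d hd,
      Category.assoc, tensorHom_comp_tensorHom_assoc, tensMap_tensMap, ht',
      tensMap_id' (fun x => ht' _)]
    simp
  let R : Operad C E := Q.ofSplitEpi π (fun A => s.app ⟨A⟩) (fun A => hs' _)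
    (fun {A B} d hd => (s.app ⟨A⟩ ⊗ₘ tensMap (fun x => s.app ⟨push d x⟩) _) ≫ Q.μ d hd ≫
      π.app ⟨B⟩) hμ
  let p : Q ⟶ R := ⟨π, fun U hU => rfl, fun d hd => (hμ d hd).symm⟩
  have hw : f ≫ p = g ≫ p := Operad.Hom.ext hc
  -- a map out of `Q` that equalizes `f` and `g` factors through `p` by composing it with `s`
  have desc : ∀ {W : Operad C E} (k : Q ⟶ W), f ≫ k = g ≫ k → ∃ l : R ⟶ W, p ≫ l = k := by
    intro W k hfg
    have hk : f.map ≫ k.map = g.map ≫ k.map := congrArg Operad.Hom.map hfg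
    have hπ : π ≫ s ≫ k.map = k.map := by
      rw [← Category.assoc, ← hts, Category.assoc, hk, ← Category.assoc, ht, Category.id_comp]
    have hπ' : ∀ A, π.app A ≫ s.app A ≫ k.map.app A = k.map.app A := fun A => by
      rw [← NatTrans.comp_app, ← NatTrans.comp_app, hπ]
    refine ⟨⟨s ≫ k.map, fun U hU => ?_, fun {A B} d hd => ?_⟩, Operad.Hom.ext hπ⟩
    · change (Q.η U hU ≫ π.app _) ≫ s.app _ ≫ k.map.app _ = _
      rw [Category.assoc, hπ', k.η_map]
    · change ((s.app ⟨A⟩ ⊗ₘ tensMap (fun x => s.app ⟨push d x⟩) _) ≫ Q.μ d hd ≫ π.app ⟨B⟩) ≫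
        s.app _ ≫ k.map.app _ = (s.app _ ≫ k.map.app _ ⊗ₘ tensMap (fun x => s.app _ ≫
          k.map.app _) _) ≫ _
      rw [Category.assoc, Category.assoc, hπ', k.μ_map, tensorHom_comp_tensorHom_assoc,
        tensMap_tensMap]
  have hp : ∀ {W : Operad C E} (l l' : R ⟶ W), p ≫ l = p ≫ l' → l = l' := by
    intro W l l' h
    let r : R.coll ⟶ Q.coll := s
    have hr : r ≫ p.map = 𝟙 R.coll := hs
    have h' : p.map ≫ l.map = p.map ≫ l'.map := congrArg Operad.Hom.map h
    refine Operad.Hom.ext ?_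
    rw [← Category.id_comp l.map, ← Category.id_comp l'.map, ← hr, Category.assoc, h',
      Category.assoc]
  refine ⟨R, p, hw, ⟨Limits.Cofork.IsColimit.mk' _ fun k => ?_⟩, s, hs, hts⟩
  have h := desc k.π k.condition
  exact ⟨h.choose, h.choose_spec, fun {m} hm => hp _ _ (hm.trans h.choose_spec.symm)⟩

/-- Beck's theorem: the forgetful functor reflects isomorphisms, and operads have coequalizers of
pairs with a split coequalizer of collections, which the forgetful functor preserves. -/
theorem nonempty_monadic (h : (forgetOperad C E).IsRightAdjoint) :
    Nonempty (MonadicRightAdjoint (forgetOperad C E)) := by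
  have key : ∀ {P Q : Operad C E} (f g : P ⟶ Q) [(forgetOperad C E).IsSplitPair f g],
      ∃ (R : Operad C E) (p : Q ⟶ R) (w : f ≫ p = g ≫ p),
        Nonempty (Limits.IsColimit (Limits.Cofork.ofπ p w)) ∧
          Nonempty (IsSplitCoequalizer ((forgetOperad C E).map f) ((forgetOperad C E).map g)
            ((forgetOperad C E).map p)) := by
    intro P Q f g _
    have q := HasSplitCoequalizer.isSplitCoequalizer ((forgetOperad C E).map f)
      ((forgetOperad C E).map g)
    obtain ⟨R, p, w, hR, s, hs, hts⟩ := exists_coequalizer f g _ q.rightSection q.leftSection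
      q.condition q.rightSection_π q.leftSection_bottom q.leftSection_top
    exact ⟨R, p, w, hR, ⟨s, q.leftSection, congrArg Operad.Hom.map w, hs, q.leftSection_bottom,
      hts⟩⟩
  have : Monad.HasCoequalizerOfIsSplitPair (forgetOperad C E) := ⟨fun {P Q} f g _ => by
    obtain ⟨R, p, hw, ⟨hR⟩, -⟩ := key f g
    exact ⟨⟨⟨_, hR⟩⟩⟩⟩
  have : Monad.PreservesColimitOfIsSplitPair (forgetOperad C E) := ⟨fun {P Q} f g _ => by
    obtain ⟨R, p, hw, ⟨hR⟩, ⟨q⟩⟩ := key f g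
    exact Limits.preservesColimit_of_preserves_colimit_cocone hR
      ((Limits.isColimitMapCoconeCoforkEquiv _ hw).symm q.isCoequalizer)⟩
  exact ⟨Monad.monadicOfHasPreservesGSplitCoequalizersOfReflectsIsomorphisms
    (Adjunction.ofIsRightAdjoint (forgetOperad C E))⟩

end Monadicity

end HypermomentCategory

/-! ### Evaluation of trees in an operad -/


namespace HypermomentCategory

open FinTensor

section Slot

variable {E : Type u} [Category.{v} E] [MonoidalCategory E]

theorem slotMap_slotMap {P Q R : E} (g : P ⟶ Q) (g' : Q ⟶ R) {b b' b'' : Bool} (h : b = b')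
    (h' : b' = b'') : slotMap g h ≫ slotMap g' h' = slotMap (g ≫ g') (h.trans h') := by
  subst h h'
  cases b
  · rfl
  · exact Category.comp_id _

theorem slotMap_id {P : E} (b : Bool) : slotMap (𝟙 P) (rfl : b = b) = 𝟙 _ := by
  cases b <;> rfl

instance slotMap_isIso {P Q : E} (g : P ⟶ Q) [IsIso g] {b b' : Bool} (h : b = b') :
    IsIso (slotMap g h) :=
  ⟨slotMap (inv g) h.symm, by rw [slotMap_slotMap, IsIso.hom_inv_id, slotMap_id],
    by rw [slotMap_slotMap, IsIso.inv_hom_id]; exact slotMap_id _⟩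

theorem slotMap_slotElim {P P' Q Q' : E} {a : P ⟶ P'} {c : Q ⟶ Q'} {φ : P ⟶ Q} {φ' : P' ⟶ Q'}
    (w : a ≫ φ' = φ ≫ c) {b b' : Bool} (h : b = b') {p : b = true → (𝟙_ E ⟶ Q)}
    {p' : b' = true → (𝟙_ E ⟶ Q')} (hp : ∀ hb hb', p hb ≫ c = p' hb') :
    slotMap a h ≫ slotMap φ' rfl ≫ slotElim b' p' = (slotMap φ rfl ≫ slotElim b p) ≫ c := by
  subst h
  cases b
  · change a ≫ φ' ≫ 𝟙 _ = (φ ≫ 𝟙 _) ≫ c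
    rw [Category.comp_id, Category.comp_id, w]
  · change 𝟙 _ ≫ 𝟙 _ ≫ p' rfl = (𝟙 _ ≫ p rfl) ≫ c
    rw [← hp rfl]
    simp

theorem slotPoint_slotElim {P Q : E} (φ : P ⟶ Q) {b : Bool} (h : b = true)
    (p : b = true → (𝟙_ E ⟶ Q)) : slotPoint P h ≫ slotMap φ rfl ≫ slotElim b p = p h := by
  subst h
  exact (Category.id_comp _).trans (Category.id_comp _)

theorem slotPoint_slotMap {P Q : E} (φ : P ⟶ Q) {b b' : Bool} (h : b = true) (hb : b = b') :
    slotPoint P h ≫ slotMap φ hb = slotPoint Q (hb ▸ h) := by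
  subst h hb
  exact Category.id_comp _

end Slot

section Evaluation

variable {C : Type u₁} [Category.{v₁} C] {E : Type u} [Category.{v} E]
variable [HypermomentCategory C] [MonoidalCategory E] [SymmetricCategory E]
variable {X : Collection C E} (O : Operad C E) (φ : X ⟶ O.coll)

/-- The evaluation of a vertex in an operad: `φ` for an unmarked vertex and a unit for a marked
one. -/
noncomputable def Operad.vertexMap {A B : C} (f : A ⟶ B) {M : El A → Bool}
    (hM : ∀ x, M x = true → IsIso (pushAct f x)) (x : El A) :
    slot (M x) (val X (push f x)) ⟶ val O.coll (push f x) :=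
  slotMap (φ.app ⟨push f x⟩) rfl ≫ slotElim (M x) (fun hx =>
    O.η (elObj A x) (elObj_isUnit A x) ≫ actBy O.coll (actIso f x (hM x hx)))

theorem Operad.treeMap_step {A B : C} (T : CTree A) (f : A ⟶ B) (hf : act f) (M : El A → Bool)
    (hM : ∀ x, M x = true → IsIso (pushAct f x)) :
    O.treeMap φ (.step T f hf M hM) =
      (O.treeMap φ T ⊗ₘ tensMap (O.vertexMap φ f hM) _) ≫ O.μ f hf := by
  simp only [Operad.treeMap, treeTensorMap, Operad.eval]
  rw [tensorHom_comp_tensorHom_assoc, tensMap_tensMap]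
  rfl

theorem Operad.treeMap_root {U : C} (hU : IsUnit U) : O.treeMap φ (.root U hU) = O.η U hU :=
  Category.id_comp _

/-- The evaluation of a vertex is natural in morphisms of squares whose vertical arrows are inert.
-/
theorem Operad.vertexMap_cmp {A A' B B' : C} {s : A ⟶ A'} {t : B ⟶ B'} {f : A ⟶ B} {f' : A' ⟶ B'}
    (q : InSq s t f f') {M : El A → Bool} (hM : ∀ x, M x = true → IsIso (pushAct f x))
    {M' : El A' → Bool} (hM' : ∀ x, M' x = true → IsIso (pushAct f' x)) {x : El A} {x' : El A'}
    (hx : inertIdx s q.hs x = x') (hm : M x = M' x') :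
    slotMap (actBy X (cmp q hx)) hm ≫ O.vertexMap φ f' hM' x' =
      O.vertexMap φ f hM x ≫ actBy O.coll (cmp q hx) := by
  refine slotMap_slotElim (actBy_nat φ _) hm fun hb hb' => ?_
  obtain ⟨ε, hε⟩ := exists_elIso q.hs hx
  rw [← O.η_actBy (elObj_isUnit A x) (elObj_isUnit A' x') ε, Category.assoc, Category.assoc,
    actBy_comp, actBy_comp]
  congr 2
  ext
  exact cmp_act q hx ε hε

theorem CTree.TreeIso.map_step (X : Collection C E) {A A' B B' : C} {T : CTree A} {T' : CTree A'}
    {e : A ≅ A'} (θ : CTree.TreeIso T T' e) (f : A ⟶ B) (hf : act f) (M : El A → Bool)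
    (hM : ∀ x, M x = true → IsIso (pushAct f x)) (f' : A' ⟶ B') (hf' : act f') (M' : El A' → Bool)
    (hM' : ∀ x, M' x = true → IsIso (pushAct f' x)) (e' : B ≅ B') (w : f ≫ e'.hom = e.hom ≫ f')
    (marks : ∀ x, M x = M' (isoIdx e x)) :
    (CTree.TreeIso.step θ f hf M hM f' hf' M' hM' e' w marks).map X = (θ.map X ⊗ₘ
      tensReindex (Y := fun x => slot (M' x) (val X (push f' x))) (isoIdx e)
        (perm_of_bijective (inertIdx_bijective e))
        (fun x => slotMap (actBy X (cmp (InSq.ofIso w) rfl)) (marks x))) := by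
  simp only [CTree.TreeIso.map, compare_eq]

/-- Isomorphic trees have the same evaluation; level by level this is the equivariance of the
multiplication. -/
theorem CTree.TreeIso.map_treeMap {A A' : C} {T : CTree A} {T' : CTree A'} {e : A ≅ A'}
    (θ : CTree.TreeIso T T' e) : θ.map X ≫ O.treeMap φ T' = O.treeMap φ T ≫ actBy O.coll e := by
  induction θ with
  | root hU hU' e =>
    rw [O.treeMap_root, O.treeMap_root, O.η_actBy]
    exact Category.id_comp _
  | step θ f hf M hM f' hf' M' hM' e' w marks ih =>
    rw [CTree.TreeIso.map_step, O.treeMap_step, O.treeMap_step, Category.assoc,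
      ← O.equivariant _ e' f hf f' hf' w, tensorHom_comp_tensorHom_assoc, ih,
      tensorHom_comp_tensorHom_assoc, tensReindex_map _ _ _ _ (List.nodup_finRange _), transport_eq,
      tensMap_reindex]
    simp only [O.vertexMap_cmp φ (InSq.ofIso w) hM hM']

/-- The right unit axiom for the composition along an isomorphism. -/
theorem Operad.μ_iso {A B : C} (e : A ≅ B) (he : act e.hom)
    (h : ∀ x, IsIso (pushAct e.hom x)) (a : 𝟙_ E ⟶ valMor O.coll e.hom)
    (ha : a = tensPoint (fun x => O.η (elObj A x) (elObj_isUnit A x) ≫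
      actBy O.coll (actIso e.hom x (h x))) _) :
    (ρ_ _).inv ≫ val O.coll A ◁ a ≫ O.μ e.hom he = actBy O.coll e := by
  have hi : act (𝟙 A) := act_of_isIso _ inferInstance
  have w : 𝟙 A ≫ e.hom = (Iso.refl A).hom ≫ e.hom := rfl
  have h₁ := O.equivariant (Iso.refl A) e (𝟙 A) hi e.hom he w
  have h₂ := O.right_unit A hi
  -- the units are invariant under transport, so those at the parts of `𝟙 A` go to those at the
  -- parts of `e`
  have h₃ : tensPoint (fun x => O.η (elObj A x) (elObj_isUnit A x) ≫ actBy O.coll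
        (actIso (𝟙 A) x (pushAct_isIso_of_inert _ (inert_of_isIso _ inferInstance) x)))
          (List.finRange _) ≫ transport O.coll (Iso.refl A) e (𝟙 A) e.hom w = a := by
    rw [ha, transport_eq]
    refine tensPoint_tensReindex (Y := fun y => val O.coll (push e.hom y)) _ _ _
      (List.nodup_finRange _) _ _ fun x => ?_
    obtain ⟨ε, hε⟩ := exists_elIso (inert_iso (Iso.refl A)) (x := x) rfl
    rw [← O.η_actBy (elObj_isUnit A x) (elObj_isUnit A _) ε, Category.assoc, Category.assoc,
      actBy_comp, actBy_comp]
    congr 2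
    ext
    exact cmp_act (InSq.ofIso w) rfl ε hε
  rw [← tensOne_tensPoint_eq, MonoidalCategory.whiskerLeft_comp, Category.assoc,
    cancel_epi] at h₂
  rw [actBy_refl, id_tensorHom] at h₁
  rw [← h₃, MonoidalCategory.whiskerLeft_comp, Category.assoc, h₁, reassoc_of% h₂,
    Iso.inv_hom_id_assoc]

/-- A tree and a stretching of it have the same evaluation: by the right unit axiom, an additional
level of isomorphisms with units inserted at all vertices acts as the composite isomorphism. -/
theorem CTree.Stretching.map_treeMap {A B : C} {T : CTree A} {T' : CTree B} {e : A ≅ B}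
    (s : CTree.Stretching T T' e) :
    s.map X ≫ O.treeMap φ T' = O.treeMap φ T ≫ actBy O.coll e := by
  induction s with
  | ofIso θ => exact θ.map_treeMap O φ
  | @step B D T' e s g hg M hM all e' w ih =>
    -- the new level is an isomorphism, since both `A` and `D` are isomorphic to its source and
    -- target
    obtain rfl : g = (e.symm ≪≫ e').hom := by simp [← w]
    have h₁ := O.μ_iso (e.symm ≪≫ e') hg (fun x => hM x (all x)) _ rfl
    have h₂ : tensPoint (fun x => slotPoint (val X (push (e.symm ≪≫ e').hom x)) (all x))
        (List.finRange _) ≫ tensMap (O.vertexMap φ (e.symm ≪≫ e').hom hM) _ =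
          tensPoint (fun x => O.η (elObj B x) (elObj_isUnit B x) ≫
            actBy O.coll (actIso (e.symm ≪≫ e').hom x (hM x (all x)))) _ := by
      rw [tensPoint_tensMap]
      congr 1
      funext x
      exact slotPoint_slotElim _ _ _
    simp only [CTree.Stretching.map]
    rw [O.treeMap_step, Category.assoc, Category.assoc, whiskerLeft_comp_tensorHom_assoc, h₂,
      MonoidalCategory.tensorHom_def_assoc, rightUnitor_inv_naturality_assoc,
      ← MonoidalCategory.comp_whiskerRight_assoc, ih, ← rightUnitor_inv_naturality_assoc,
      Category.assoc, h₁, actBy_comp]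
    simp

theorem isStretchInvariant : IsStretchInvariant O φ := fun _ _ _ s => s.map_treeMap O φ

/-- The part of the shuffle that permutes the factors of one level. -/
noncomputable def regroupSlot (X : Collection C E) {A B D : C} (f : A ⟶ B) (hf : act f) (g : B ⟶ D)
    (h : A ⟶ D) (w : f ≫ g = h) (M : El B → Bool) :
    (tens fun x : El A => tens fun y : El (push f x) =>
      slot (M (nestIdx f ⟨x, y⟩)) (val X (push (pushMap f g h w x) y))) ⟶
      tens fun y : El B => slot (M y) (val X (push g y)) :=
  tensSigma (fun (x : El A) (y : El (push f x)) =>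
      slot (M (nestIdx f ⟨x, y⟩)) (val X (push (pushMap f g h w x) y)))
      (fun _ => List.finRange _) (List.finRange _) ≫
    tensReindex (Y := fun y => slot (M y) (val X (push g y))) (nestIdx f)
      (perm_of_bijective_sigma (nested_bijective f hf))
      (fun p => slotMap (actBy X (cmp (nestSq f g h w p.1) rfl)) rfl)

instance regroupSlot_isIso (X : Collection C E) {A B D : C} (f : A ⟶ B) (hf : act f) (g : B ⟶ D)
    (h : A ⟶ D) (w : f ≫ g = h) (M : El B → Bool) : IsIso (regroupSlot X f hf g h w M) := by
  have := tensReindex_isIso (Y := fun y => slot (M y) (val X (push g y))) (nestIdx f)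
      (perm_of_bijective_sigma (nested_bijective f hf))
      (fun p => slotMap (actBy X (cmp (nestSq f g h w p.1) rfl)) rfl)
  unfold regroupSlot
  infer_instance

theorem Chain.shuffle_snoc (X : Collection C E) {A B D : C} (T : CTree A) {f : A ⟶ B}
    (R : Chain A f) (g : B ⟶ D) (hg : HypermomentCategory.act g) (M : El B → Bool)
    (hM : ∀ x, M x = true → IsIso (pushAct g x)) (h : A ⟶ D) (w : f ≫ g = h) :
    (R.snoc g hg M hM h w).shuffle X T =
      treeTensor X T ◁ tensSplit (fun x => treeTensor X (R.restrict x)) (fun x =>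
          tens fun y : El (push f x) =>
            slot (M (nestIdx f ⟨x, y⟩)) (val X (push (pushMap f g h w x) y))) _ ≫
        (α_ _ _ _).inv ≫ (R.shuffle X T ⊗ₘ regroupSlot X f R.act g h w M) := by
  simp only [Chain.shuffle, nested_eq]
  rfl

/-- Evaluating the vertices of a level commutes with distributing them over the parts of `f`. -/
theorem regroupSlot_tensMap {A B D : C} (f : A ⟶ B) (hf : act f) (g : B ⟶ D)
    (h : A ⟶ D) (w : f ≫ g = h) {M : El B → Bool} (hM : ∀ x, M x = true → IsIso (pushAct g x))
    (hM' : ∀ x y, M (nestIdx f ⟨x, y⟩) = true → IsIso (pushAct (pushMap f g h w x) y)) :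
    regroupSlot X f hf g h w M ≫ tensMap (O.vertexMap φ g hM) _ =
      tensMap (fun x => tensMap (O.vertexMap φ (pushMap f g h w x)
        (M := fun y => M (nestIdx f ⟨x, y⟩)) (hM' x)) _) _ ≫ regroup O.coll f hf g h w := by
  rw [regroupSlot, regroup_eq, Category.assoc, tensReindex_map _ _ _ _ (List.nodup_finRange _),
    reassoc_of% (tensMap_tensSigma (Y' := fun (x : El A) (y : El (push f x)) =>
      val O.coll (push (pushMap f g h w x) y)) (fun x => List.finRange _) (List.finRange _)
      (fun x y => O.vertexMap φ (pushMap f g h w x) (M := fun y => M (nestIdx f ⟨x, y⟩))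
        (hM' x) y)), tensMap_reindex]
  congr 2
  funext p
  exact O.vertexMap_cmp φ (nestSq f g h w p.1) (M := fun y => M (nestIdx f ⟨p.1, y⟩)) (hM' p.1) hM
    rfl rfl

/-- The evaluation of a concatenation. By induction on the chain this is associativity of the
operad; the right unit axiom settles the empty chain. -/
theorem Chain.shuffle_treeMap {A : C} (T : CTree A) {B : C} {f : A ⟶ B} (R : Chain A f)
    (hf : HypermomentCategory.act f) :
    R.shuffle X T ≫ O.treeMap φ (R.append T) =
      (O.treeMap φ T ⊗ₘ tensMap (fun x => O.treeMap φ (R.restrict x)) _) ≫ O.μ f hf := by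
  induction R with
  | nil =>
    have h₂ := O.right_unit A hf
    change (treeTensor X T ◁ tensOne (E := E) (List.finRange (γ.obj A).card) ≫ (ρ_ _).hom) ≫
      O.treeMap φ T = (O.treeMap φ T ⊗ₘ tensMap (X := fun _ => 𝟙_ E)
        (fun x => O.treeMap φ (Chain.restrict x .nil)) _) ≫ _
    rw [Category.assoc, ← rightUnitor_naturality, whisker_exchange_assoc, ← h₂,
      ← MonoidalCategory.tensorHom_def_assoc]
    congr 3
    funext x
    simp only [Chain.restrict]
    rw [O.treeMap_root, O.η_actBy]
  | @snoc B D f R g hg M hM h w ih =>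
    have hm := fun x y => Chain.isIso_nested f g h w x y
    have h₁ := regroupSlot_tensMap O φ f R.act g h w hM (fun x y hy => hm x y (hM _ hy))
    simp only [Chain.append]
    rw [Chain.shuffle_snoc, O.treeMap_step, Category.assoc, Category.assoc,
      tensorHom_comp_tensorHom_assoc, ih R.act, h₁, ← tensorHom_comp_tensorHom_assoc,
      ← associator_inv_naturality_assoc, O.assoc f R.act g hg h w hf,
      whiskerLeft_comp_tensorHom_assoc, tensorHom_comp_whiskerLeft_assoc]
    congr 2
    rw [Category.assoc, reassoc_of% (tensorHom_tensMap_tensMul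
        (fun x => O.treeMap φ (R.restrict x))
        (fun x => tensMap (O.vertexMap φ (pushMap f g h w x)
          (M := fun y => M (nestIdx f ⟨x, y⟩)) (fun y hy => hm x y (hM _ hy))) (List.finRange _))
        (List.finRange _)), reassoc_of% (tensSplit_tensMul (E := E)), tensMap_tensMap]
    congr 1
    funext x
    exact (O.treeMap_step φ (R.restrict x) _ _ _ _).symm

end Evaluation

end HypermomentCategory

/-! ### Active morphisms in extensional categories -/

namespace HypermomentCategory

section Extension

variable {C : Type u₁} [Category.{v₁} C] [HypermomentCategory C]

/-- Effaceability of a vertex is invariant under inert morphisms of squares. -/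
theorem isIso_pushAct_iff {A A' B B' : C} {s : A ⟶ A'} {t : B ⟶ B'} {f : A ⟶ B} {f' : A' ⟶ B'}
    (q : InSq s t f f') {x : El A} {x' : El A'} (hx : inertIdx s q.hs x = x') :
    IsIso (pushAct f x) ↔ IsIso (pushAct f' x') := by
  obtain ⟨ε, hε⟩ := exists_elIso q.hs hx
  have h := cmp_act q hx ε hε
  constructor
  · intro _
    rw [← Iso.inv_comp_eq] at h
    rw [← h]
    infer_instance
  · intro _
    rw [← Iso.eq_comp_inv] at h
    rw [h]
    infer_instance

/-- Active morphisms are monic with respect to active morphisms out of units. -/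
theorem Unital.cancel (hC : Unital C) {U A B : C} (hU : IsUnit U) {a b : U ⟶ A} (ha : act a)
    (hb : act b) {g : A ⟶ B} (hg : act g) (h : a ≫ g = b ≫ g) : a = b := by
  obtain ⟨e, he, -⟩ := hC.unit_unique A b a hU hU hb ha
  have h₁ : e = Iso.refl U := (hC.unit_unique B (a ≫ g) (a ≫ g) hU hU (act_comp _ _ ha hg)
    (act_comp _ _ ha hg)).unique (by rw [← Category.assoc, he, h]) (by simp)
  rw [← he, h₁]
  simp

/-- An active morphism out of a unit lifts along active morphisms. -/
theorem Unital.lift (hC : Unital C) {U A B : C} (hU : IsUnit U) {b : U ⟶ B} (hb : act b)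
    {g : A ⟶ B} (hg : act g) : ∃ a : U ⟶ A, act a ∧ a ≫ g = b := by
  obtain ⟨V, v, hV, hv⟩ := hC.exists_unit A
  obtain ⟨e, he, -⟩ := hC.unit_unique B b (v ≫ g) hU hV hb (act_comp _ _ hv hg)
  exact ⟨e.hom ≫ v, act_comp _ _ (act_iso e) hv, by rw [Category.assoc, he]⟩

/-- An active morphism between units is invertible. -/
theorem Unital.isIso (hC : Unital C) {U V : C} (hU : IsUnit U) (hV : IsUnit V) {b : U ⟶ V}
    (hb : act b) : IsIso b := by
  obtain ⟨e, he, -⟩ := hC.unit_unique V b (𝟙 V) hU hV hb (act_of_isIso _ inferInstance)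
  rw [← he]
  infer_instance

variable (hC : StronglyExtensional C)
include hC

namespace StronglyExtensional

/-- Each family of active morphisms out of the elementary subobjects of `A` consists of the parts of
an active morphism. -/
theorem exists_push {A : C} {B : El A → C} (φ : ∀ x, elObj A x ⟶ B x) (hφ : ∀ x, act (φ x)) :
    ∃ (D : C) (f : A ⟶ D) (κ : ∀ x, push f x ≅ B x),
      act f ∧ ∀ x, pushAct f x ≫ (κ x).hom = φ x := by
  obtain ⟨D, f, j, hf, hj⟩ := hC.exists_ext A B φ hφ
  have h : ∀ x, ∃ κ : push f x ≅ B x, pushAct f x ≫ κ.hom = φ x := fun x => by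
    obtain ⟨κ, hκ, -⟩ := fact_unique (pushAct f x) (pushIn f x) (φ x) (j x) (pushAct_act _ _)
      (pushIn_inert _ _) (hφ x) (hj x).1 (by rw [push_fac, (hj x).2])
    exact ⟨κ, hκ.1⟩
  choose κ hκ using h
  exact ⟨D, f, κ, hf, hκ⟩

/-- An isomorphism of active morphisms out of `A` is determined by its effect on the parts. -/
theorem iso_ext {A B B' : C} {f : A ⟶ B} (hf : act f) {ρ ρ' : B ≅ B'} (h : f ≫ ρ.hom = f ≫ ρ'.hom)
    (h' : ∀ x, pushIn f x ≫ ρ.hom = pushIn f x ≫ ρ'.hom) : ρ = ρ' := by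
  refine (hC.ext_unique A (fun x => push f x) (pushAct f) (pushAct_act f) f (pushIn f)
    (f ≫ ρ'.hom) (fun x => pushIn f x ≫ ρ'.hom) hf
    (fun x => ⟨pushIn_inert _ _, (push_fac f x).symm⟩)
    (act_comp _ _ hf (act_iso _)) (fun x => ⟨inert_comp _ _ (pushIn_inert _ _) (inert_iso _), ?_⟩)
    ).unique ⟨h, h'⟩ ⟨rfl, fun x => rfl⟩
  rw [← Category.assoc, ← push_fac, Category.assoc]

/-- Active morphisms out of isomorphic objects with isomorphic parts are isomorphic. -/
theorem exists_iso {A A' B B' : C} (σ : A ≅ A') {f : A ⟶ B} (hf : act f) {f' : A' ⟶ B'}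
    (hf' : act f') (κ : ∀ x, push f x ≅ push f' (isoIdx σ x))
    (hκ : ∀ x, pushAct f x ≫ (κ x).hom =
      (elIso σ.hom (inert_iso σ) x).hom ≫ pushAct f' (isoIdx σ x)) :
    ∃ (ρ : B ≅ B') (w : f ≫ ρ.hom = σ.hom ≫ f'), ∀ x, κ x = cmp (InSq.ofIso w) rfl := by
  obtain ⟨ρ, ⟨w, hρ⟩, -⟩ := hC.ext_unique A (fun x => push f x) (pushAct f) (pushAct_act f) f
    (pushIn f) (σ.hom ≫ f') (fun x => (κ x).hom ≫ pushIn f' (isoIdx σ x)) hf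
    (fun x => ⟨pushIn_inert _ _, (push_fac f x).symm⟩) (act_comp _ _ (act_iso _) hf')
    (fun x => ⟨inert_comp _ _ (inert_iso _) (pushIn_inert _ _), by
      rw [reassoc_of% hκ, push_fac, reassoc_of% (elIso_hom σ.hom (inert_iso σ) x)]⟩)
  exact ⟨ρ, w, fun x => cmp_unique _ _ _ _ (elIso_hom σ.hom (inert_iso σ) x) (hκ x) (hρ x).symm⟩

/-- Active morphisms out of the same object with isomorphic parts are isomorphic. -/
theorem exists_iso_self {A B B' : C} {f : A ⟶ B} (hf : act f) {f' : A ⟶ B'} (hf' : act f')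
    (κ : ∀ x, push f x ≅ push f' x) (hκ : ∀ x, pushAct f x ≫ (κ x).hom = pushAct f' x) :
    ∃ ρ : B ≅ B', f ≫ ρ.hom = f' ∧ ∀ x, pushIn f x ≫ ρ.hom = (κ x).hom ≫ pushIn f' x := by
  obtain ⟨ρ, hρ, -⟩ := hC.ext_unique A (fun x => push f x) (pushAct f) (pushAct_act f) f
    (pushIn f) f' (fun x => (κ x).hom ≫ pushIn f' x) hf
    (fun x => ⟨pushIn_inert _ _, (push_fac f x).symm⟩) hf'
    (fun x => ⟨inert_comp _ _ (inert_iso _) (pushIn_inert _ _), by rw [reassoc_of% hκ, push_fac]⟩)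
  exact ⟨ρ, hρ⟩

/-- An active morphism `f : A ⟶ B` factors through an active morphism `f' : A ⟶ B'` as soon as
its parts do. -/
theorem exists_factor {A B B' : C} {f : A ⟶ B} (hf : act f) {f' : A ⟶ B'} (hf' : act f')
    (k : ∀ x, push f' x ⟶ push f x) (hk : ∀ x, act (k x))
    (hk' : ∀ x, pushAct f' x ≫ k x = pushAct f x) :
    ∃ (g : B' ⟶ B) (w : f' ≫ g = f), act g ∧ ∀ x, pushMap f' g f w x = k x := by
  -- each `y` lies in exactly one part `B'_x` of `f'`, so the part `Z y` of the morphism `g` in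
  -- question has to be that of `k x`
  have h₁ : ∀ y : El B', ∃ (Z : C) (φ : elObj B' y ⟶ Z), act φ ∧
      ∀ p : Σ x : El A, El (push f' x), nestIdx f' p = y →
        ∃ (i : Z ≅ push (k p.1) p.2) (ε : elObj (push f' p.1) p.2 ≅ elObj B' y),
          ε.hom ≫ elMap B' y = elMap _ p.2 ≫ pushIn f' p.1 ∧
            ε.hom ≫ φ ≫ i.hom = pushAct (k p.1) p.2 := by
    intro y
    obtain ⟨q, hq⟩ := (nested_bijective f' hf').2 y
    obtain ⟨ε, hε⟩ := exists_elIso (pushIn_inert f' q.1) hq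
    refine ⟨_, ε.inv ≫ pushAct (k q.1) q.2, act_comp _ _ (act_iso ε.symm) (pushAct_act _ _),
      fun p hp => ?_⟩
    obtain rfl : p = q := (nested_bijective f' hf').1 (hp.trans hq.symm)
    exact ⟨Iso.refl _, ε, hε, by simp⟩
  choose Z φ hφ h₂ using h₁
  obtain ⟨D, g, κ, hg, hκ⟩ := hC.exists_push φ hφ
  -- the parts of `g` between the parts of `f' ≫ g` agree with `k` up to an isomorphism
  have h₃ : ∀ x, ∃ e : push (f' ≫ g) x ≅ push f x, pushMap f' g _ rfl x ≫ e.hom = k x := by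
    intro x
    choose i ε hε hi using fun z => h₂ _ ⟨x, z⟩ rfl
    obtain ⟨e, he, -⟩ := hC.exists_iso_self (pushMap_act f' g _ rfl x) (hk x)
      (fun z => cmp (nestSq f' g _ rfl x) rfl ≪≫ κ _ ≪≫ i z) (fun z => by
        have h := cmp_act (nestSq f' g _ rfl x) rfl (ε z) (hε z)
        simp only [Iso.trans_hom]
        rw [reassoc_of% h, reassoc_of% hκ, hi])
    exact ⟨e, he⟩
  choose e he using h₃
  -- correct `g` by an isomorphism of its target, so that the composite becomes `f` itself
  obtain ⟨ρ, hρ, hρ'⟩ := hC.exists_iso_self (act_comp _ _ hf' hg) hf e (fun x => by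
    rw [← pushAct_pushMap f' g _ rfl x, Category.assoc, he, hk'])
  refine ⟨g ≫ ρ.hom, by rw [← Category.assoc, hρ], act_comp _ _ hg (act_iso _), fun x => ?_⟩
  refine (pushMap_unique _ _ (hk x) (hk' x) ?_).symm
  rw [← he, Category.assoc, ← hρ', reassoc_of% (pushMap_in f' g _ rfl x)]

/-- Isomorphic squares of parts come from an isomorphism of squares. -/
theorem exists_iso_of_pushMap {A A' B B' D D' : C} {σ : A ≅ A'} {ρ : B ≅ B'} {f : A ⟶ B}
    (hf : act f) {f' : A' ⟶ B'} (wf : f ≫ ρ.hom = σ.hom ≫ f') {g : B ⟶ D}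
    (hg : act g) {g' : B' ⟶ D'} (hg' : act g') {h : A ⟶ D} {h' : A' ⟶ D'} (w : f ≫ g = h)
    (w' : f' ≫ g' = h') (κ : ∀ x, push h x ≅ push h' (isoIdx σ x))
    (hκ : ∀ x, pushMap f g h w x ≫ (κ x).hom =
      (cmp (InSq.ofIso wf) rfl).hom ≫ pushMap f' g' h' w' (isoIdx σ x)) :
    ∃ (τ : D ≅ D') (_ : g ≫ τ.hom = ρ.hom ≫ g') (wh : h ≫ τ.hom = σ.hom ≫ h'),
      ∀ x, κ x = cmp (InSq.ofIso wh) rfl := by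
  have key : ∀ p : Σ x : El A, El (push f x), ∀ y, nestIdx f p = y →
      nestIdx f' ⟨isoIdx σ p.1, isoIdx (cmp (InSq.ofIso wf) rfl) p.2⟩ = isoIdx ρ y := by
    rintro p _ rfl
    exact inertIdx_w (inert_iso _) (pushIn_inert _ _) (pushIn_inert _ _) (inert_iso _)
      (cmp_in (InSq.ofIso wf) rfl) p.2
  -- the comparison of the parts of `g` and `g'` is forced by the one of the nested parts
  have h₁ : ∀ y : El B, ∃ κ' : push g y ≅ push g' (isoIdx ρ y),
      ∀ (p : Σ x : El A, El (push f x)) (hp : nestIdx f p = y),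
        cmp (nestSq f g h w p.1) hp ≪≫ κ' =
          cmp (InSq.ofIso (hκ p.1)) rfl ≪≫ cmp (nestSq f' g' h' w' _) (key p y hp) := by
    intro y
    obtain ⟨q, hq⟩ := (nested_bijective f hf).2 y
    refine ⟨(cmp (nestSq f g h w q.1) hq).symm ≪≫ cmp (InSq.ofIso (hκ q.1)) rfl ≪≫
      cmp (nestSq f' g' h' w' _) (key q y hq), fun p hp => ?_⟩
    obtain rfl : p = q := (nested_bijective f hf).1 (hp.trans hq.symm)
    simp
  choose κ' hκ' using h₁
  obtain ⟨τ, wg, hτ⟩ := hC.exists_iso ρ hg hg' κ' (fun y => by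
    obtain ⟨p, hp⟩ := (nested_bijective f hf).2 y
    obtain ⟨ε, hε⟩ := exists_elIso (pushIn_inert f p.1) hp
    obtain ⟨ε₁, hε₁⟩ := exists_elIso (InSq.ofIso (hκ p.1)).hs (x := p.2) rfl
    obtain ⟨ε₂, hε₂⟩ := exists_elIso (pushIn_inert f' _) (key p y hp)
    have h₂ := cmp_act (nestSq f g h w p.1) hp ε hε
    have h₃ := cmp_act (InSq.ofIso (hκ p.1)) rfl ε₁ hε₁
    have h₄ := cmp_act (nestSq f' g' h' w' _) (key p y hp) ε₂ hε₂
    have h₅ := congrArg Iso.hom (hκ' y p hp)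
    have h₆ : ε ≪≫ elIso ρ.hom (inert_iso ρ) y = ε₁ ≪≫ ε₂ := elMap_iso_ext (by
      have h₇ := elIso_hom ρ.hom (inert_iso ρ) y
      have h₈ := cmp_in (InSq.ofIso wf) (x := p.1) rfl
      simp only [Iso.trans_hom, Category.assoc, h₇, hε₂, reassoc_of% hε₁, reassoc_of% hε, h₈])
    have h₇ := congrArg Iso.hom h₆
    simp only [Iso.trans_hom] at h₅ h₇
    rw [← cancel_epi ε.hom, ← reassoc_of% h₂, h₅, reassoc_of% h₃, h₄, reassoc_of% h₇])
  have wh : h ≫ τ.hom = σ.hom ≫ h' := by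
    rw [← w, ← w', Category.assoc, wg, reassoc_of% wf]
  refine ⟨τ, wg, wh, fun x => hC.iso_ext (pushMap_act f g h w x) ?_ fun z => ?_⟩
  · rw [hκ, pushMap_cmp (InSq.ofIso wf) (InSq.ofIso wg) (InSq.ofIso wh) w w']
  -- `κ x` and the isomorphism induced by `τ` have the same effect on every part of the restriction
  -- of `g` to `x`, as both correspond to `κ'`
  · have q := pushMap_sq (InSq.ofIso wf) (InSq.ofIso wg) (InSq.ofIso wh) w w' (x := x) rfl
    have h₂ := cmp_pair (nestSq f g h w x) (InSq.ofIso wg) q (nestSq f' g' h' w' _)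
      (cmp_in (InSq.ofIso wf) rfl).symm (cmp_in (InSq.ofIso wh) rfl).symm (x := z) rfl rfl rfl
      (key ⟨x, z⟩ _ rfl) rfl rfl
    have h₃ : cmp q (x := z) rfl = cmp (InSq.ofIso (hκ x)) rfl := by
      have h₄ := hκ' _ ⟨x, z⟩ rfl
      rw [hτ] at h₄
      rw [eqToIso_refl, Iso.trans_refl, h₄] at h₂
      ext
      have h₅ := congrArg Iso.hom h₂
      simp only [Iso.trans_hom] at h₅
      exact ((cancel_mono _).1 h₅).symm
    have h₄ := cmp_in (InSq.ofIso (hκ x)) (x := z) rfl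
    have h₅ := cmp_in q (x := z) rfl
    rw [← h₄, ← h₅, h₃]

end StronglyExtensional

end Extension

end HypermomentCategory

/-! ### Gluing families of trees to chains -/

namespace HypermomentCategory

open FinTensor

section Gluing

variable {C : Type u₁} [Category.{v₁} C] [HypermomentCategory C]

/-- The number of levels of a tree. -/
def CTree.height : ∀ {A : C}, CTree A → ℕ
  | _, .root _ _ => 0
  | _, .step T _ _ _ _ => T.height + 1

/-- The number of morphisms of a chain. -/
def Chain.length {A : C} : ∀ {B : C} {f : A ⟶ B}, Chain A f → ℕ
  | _, _, .nil => 0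
  | _, _, .snoc R _ _ _ _ _ _ => R.length + 1

theorem Chain.height_restrict {A B : C} {f : A ⟶ B} (R : Chain A f) (x : El A) :
    (R.restrict x).height = R.length := by
  induction R with
  | nil => rfl
  | snoc R g hg M hM h w ih => exact congrArg (· + 1) ih

theorem Chain.height_append {A B : C} {f : A ⟶ B} (R : Chain A f) (T : CTree A) :
    (R.append T).height = T.height + R.length := by
  induction R with
  | nil => rfl
  | snoc R g hg M hM h w ih => exact congrArg (· + 1) ih

theorem CTree.eq_root {A : C} {T : CTree A} (h : T.height = 0) :
    ∃ hA : IsUnit A, T = .root A hA := by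
  cases T with
  | root _ hA => exact ⟨hA, rfl⟩
  | step => simp [CTree.height] at h

theorem CTree.eq_step {A : C} {T : CTree A} {n : ℕ} (h : T.height = n + 1) :
    ∃ (B : C) (T' : CTree B) (f : B ⟶ A) (hf : act f) (M : El B → Bool)
      (hM : ∀ x, M x = true → IsIso (pushAct f x)), T'.height = n ∧ T = .step T' f hf M hM := by
  cases T with
  | root _ hA => simp [CTree.height] at h
  | step T' f hf M hM => exact ⟨_, T', f, hf, M, hM, by simpa [CTree.height] using h, rfl⟩

theorem CTree.TreeIso.eq_step {A A' B B' : C} {T : CTree A} {T' : CTree A'} {f : A ⟶ B}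
    {hf : act f} {M : El A → Bool} {hM : ∀ x, M x = true → IsIso (pushAct f x)} {f' : A' ⟶ B'}
    {hf' : act f'} {M' : El A' → Bool} {hM' : ∀ x, M' x = true → IsIso (pushAct f' x)} {e' : B ≅ B'}
    (θ : CTree.TreeIso (.step T f hf M hM) (.step T' f' hf' M' hM') e') :
    ∃ (e : A ≅ A') (θ' : CTree.TreeIso T T' e) (w : f ≫ e'.hom = e.hom ≫ f')
      (marks : ∀ x, M x = M' (isoIdx e x)), θ = .step θ' f hf M hM f' hf' M' hM' e' w marks := by
  cases θ with
  | step θ' _ _ _ _ _ _ _ _ _ w marks => exact ⟨_, θ', w, marks, rfl⟩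

/-- A family of trees of the same height over the targets of active morphisms `U_x ⟶ Z_x`,
`x ∈ γ(A)`, is the family of restrictions of a chain starting at `A`. -/
theorem StronglyExtensional.exists_chain (hC : StronglyExtensional C) (n : ℕ) : ∀ {A : C}
    (Z : El A → C) (b : ∀ x, elObj A x ⟶ Z x), (∀ x, act (b x)) → ∀ T : ∀ x, CTree (Z x),
    (∀ x, (T x).height = n) → ∃ (B : C) (f : A ⟶ B) (R : Chain A f) (ζ : ∀ x, Z x ≅ push f x),
      R.length = n ∧ (∀ x, b x ≫ (ζ x).hom = pushAct f x) ∧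
        ∀ x, Nonempty (CTree.TreeIso (T x) (R.restrict x) (ζ x)) := by
  induction n with
  | zero =>
    intro A Z b hb T hT
    choose hZ hT' using fun x => CTree.eq_root (hT x)
    have := fun x => hC.toUnital.isIso (elObj_isUnit A x) (hZ x) (hb x)
    have := fun x => pushAct_isIso_of_inert (𝟙 A) (inert_of_isIso _ inferInstance) x
    refine ⟨A, 𝟙 A, .nil, fun x => (asIso (b x)).symm ≪≫ asIso (pushAct (𝟙 A) x), rfl,
      fun x => by simp, fun x => ⟨?_⟩⟩
    rw [hT']
    exact .root _ _ _
  | succ n ih =>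
    intro A Z b hb T hT
    choose Z' T' g hg M hM hT' hTx using fun x => CTree.eq_step (hT x)
    -- the morphisms `b x` lift to the objects below the top level, so that the induction hypothesis
    -- provides the lower levels of the chain
    choose b' hb' hbg using fun x => hC.toUnital.lift (elObj_isUnit A x) (hb x) (hg x)
    obtain ⟨B', f', R, ζ', hR, hζ', hθ⟩ := ih Z' b' hb' T' hT'
    -- the composite `f` of the chain has the parts `b x`, and it factors through the composite `f'`
    -- of the lower levels
    obtain ⟨B, f, κ, hf, hκ⟩ := hC.exists_push b hb
    obtain ⟨k, w, hk, hk'⟩ := hC.exists_factor hf R.act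
      (fun x => (ζ' x).inv ≫ g x ≫ (κ x).inv)
      (fun x => act_comp _ _ (act_iso (ζ' x).symm) (act_comp _ _ (hg x) (act_iso (κ x).symm)))
      (fun x => by rw [← hζ']; simp [reassoc_of% hbg, ← hκ])
    have hsq : ∀ x, g x ≫ (κ x).symm.hom = (ζ' x).hom ≫ pushMap f' k f w x := fun x => by
      rw [hk']; simp
    -- the marks of the new level are read off from the given trees
    let e := (Equiv.ofBijective _ (nested_bijective f' R.act)).symm
    let N : El B' → Bool := fun y => M (e y).1 (isoIdx (ζ' (e y).1).symm (e y).2)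
    have he : ∀ p : Σ x : El A, El (push f' x), e (nestIdx f' p) = p :=
      fun p => (Equiv.ofBijective _ (nested_bijective f' R.act)).symm_apply_apply p
    have hN : ∀ x z, N (nestIdx f' ⟨x, z⟩) = M x (isoIdx (ζ' x).symm z) := fun x z => by
      simp only [N]
      rw [he]
    have hN' : ∀ y, N y = true → IsIso (pushAct k y) := by
      intro y hy
      obtain ⟨⟨x, z⟩, rfl⟩ := (nested_bijective f' R.act).2 y
      refine (isIso_pushAct_iff (nestSq f' k f w x) rfl).1 ?_
      rw [← isoIdx_isoIdx_symm (ζ' x) z]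
      exact (isIso_pushAct_iff (InSq.ofIso (hsq x)) rfl).1 (hM x _ ((hN x z).symm.trans hy))
    refine ⟨B, f, .snoc R k hk N hN' f w, fun x => (κ x).symm, congrArg (· + 1) hR,
      fun x => by rw [← hκ]; simp, fun x => ?_⟩
    obtain ⟨θ⟩ := hθ x
    rw [hTx]
    exact ⟨.step θ _ _ _ _ _ _ _ _ _ (hsq x) fun z => by
      change M x z = N (nestIdx f' ⟨x, isoIdx (ζ' x) z⟩)
      rw [hN, isoIdx_symm_isoIdx]⟩

variable {E : Type u} [Category.{v} E] [MonoidalCategory E] [SymmetricCategory E]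
variable (X : Collection C E)

theorem slotMap_eqToHom {κ : Type*} {F : κ → C} {M : κ → Bool} {A : C} {b : Bool} {y y' : κ}
    (hy : y = y') (φ : A ≅ F y) (h : b = M y) (h' : b = M y')
    (h'' : slot (M y) (val X (F y)) = slot (M y') (val X (F y'))) :
    slotMap (actBy X φ) h ≫ eqToHom h'' = slotMap (actBy X (φ ≪≫ eqToIso (by rw [hy]))) h' := by
  subst hy
  simp

theorem tensReindex_tensSplit {ι κ : Type*} [DecidableEq κ] {Y Z : ι → E} {Y' Z' : κ → E}
    {l : List ι} {l' : List κ} (e : ι → κ) (h : (l.map e).Perm l') (φ : ∀ i, Y i ⟶ Y' (e i))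
    (ψ : ∀ i, Z i ⟶ Z' (e i)) (hl : l'.Nodup) :
    tensReindex (Y := fun k => Y' k ⊗ Z' k) e h (fun i => φ i ⊗ₘ ψ i) ≫ tensSplit Y' Z' l' =
      tensSplit Y Z l ≫ (tensReindex e h φ ⊗ₘ tensReindex e h ψ) := by
  rw [← cancel_epi (tensMul Y Z l), ← reassoc_of% (tensReindex_tensMul e h φ ψ hl),
    tensMul_tensSplit, reassoc_of% (tensMul_tensSplit Y Z l), Category.comp_id]

/-- Distributing the vertices of a level over the parts of `f` is natural in isomorphisms of
composable active morphisms. -/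
theorem tensReindex_regroupSlot {A A' B B' D D' : C} {σ : A ≅ A'} {ρ : B ≅ B'}
    {τ : D ≅ D'} {f : A ⟶ B} (hf : act f) {f' : A' ⟶ B'} (hf' : act f') {g : B ⟶ D} {g' : B' ⟶ D'}
    {h : A ⟶ D} {h' : A' ⟶ D'}
    (w : f ≫ g = h) (w' : f' ≫ g' = h') (wf : f ≫ ρ.hom = σ.hom ≫ f')
    (wg : g ≫ τ.hom = ρ.hom ≫ g') (wh : h ≫ τ.hom = σ.hom ≫ h') {M : El B → Bool}
    {M' : El B' → Bool} (hM : ∀ y, M y = M' (isoIdx ρ y))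
    (hk : ∀ x, pushMap f g h w x ≫ (cmp (InSq.ofIso wh) rfl).hom =
      (cmp (InSq.ofIso wf) rfl).hom ≫ pushMap f' g' h' w' (isoIdx σ x))
    (hM' : ∀ x y, M (nestIdx f ⟨x, y⟩) =
      M' (nestIdx f' ⟨isoIdx σ x, isoIdx (cmp (InSq.ofIso wf) rfl) y⟩)) :
    tensReindex (Y := fun x => tens fun y : El (push f' x) =>
        slot (M' (nestIdx f' ⟨x, y⟩)) (val X (push (pushMap f' g' h' w' x) y))) (isoIdx σ)
      (perm_of_bijective (inertIdx_bijective σ))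
      (fun x => tensReindex (Y := fun y : El (push f' (isoIdx σ x)) =>
          slot (M' (nestIdx f' ⟨isoIdx σ x, y⟩)) (val X (push (pushMap f' g' h' w' _) y)))
        (isoIdx (cmp (InSq.ofIso wf) rfl))
        (perm_of_bijective (inertIdx_bijective (cmp (InSq.ofIso wf) rfl)))
        (fun y => slotMap (actBy X (cmp (InSq.ofIso (hk x)) rfl)) (hM' x y))) ≫
      regroupSlot X f' hf' g' h' w' M' =
    regroupSlot X f hf g h w M ≫
      tensReindex (Y := fun y => slot (M' y) (val X (push g' y))) (isoIdx ρ)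
        (perm_of_bijective (inertIdx_bijective ρ))
        (fun y => slotMap (actBy X (cmp (InSq.ofIso wg) rfl)) (hM y)) := by
  rw [regroupSlot, regroupSlot, reassoc_of% (tensReindex_tensSigma
    (Y := fun (x : El A) (y : El (push f x)) =>
      slot (M (nestIdx f ⟨x, y⟩)) (val X (push (pushMap f g h w x) y)))
    (Y' := fun (x : El A') (y : El (push f' x)) =>
      slot (M' (nestIdx f' ⟨x, y⟩)) (val X (push (pushMap f' g' h' w' x) y)))
    (l := List.finRange _) (l' := List.finRange _) (m := fun x => List.finRange _)
    (m' := fun x => List.finRange _) (isoIdx σ) (perm_of_bijective (inertIdx_bijective σ))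
    (fun x => isoIdx (cmp (InSq.ofIso wf) rfl))
    (fun x => perm_of_bijective (inertIdx_bijective (cmp (InSq.ofIso wf) rfl)))
    (fun x y => slotMap (actBy X (cmp (InSq.ofIso (hk x)) rfl)) (hM' x y))
    (List.nodup_finRange _) (fun _ => List.nodup_finRange _)), Category.assoc,
    tensReindex_comp _ _ _ _ _ _ (List.nodup_finRange _),
    tensReindex_comp _ _ _ _ _ _ (List.nodup_finRange _)]
  congr 1
  simp only [slotMap_slotMap, actBy_comp]
  have key : ∀ p : Σ x : El A, El (push f x),
      nestIdx f' ⟨isoIdx σ p.1, isoIdx (cmp (InSq.ofIso wf) rfl) p.2⟩ = isoIdx ρ (nestIdx f p) :=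
    fun p => inertIdx_w (inert_iso _) (pushIn_inert _ _) (pushIn_inert _ _) (inert_iso _)
      (cmp_in (InSq.ofIso wf) rfl) p.2
  refine tensReindex_congr (Y := fun y => slot (M' y) (val X (push g' y))) key fun p => ?_
  rw [slotMap_eqToHom X (F := fun y => push g' y) (M := M') (key p) _ _ (hM _)]
  congr 2
  exact cmp_pair _ _ _ _ (cmp_in (InSq.ofIso wf) rfl) (cmp_in (InSq.ofIso wh) rfl) rfl rfl rfl rfl
    (key p) _

theorem CTree.TreeIso.map_root {U V : C} {hU : IsUnit U} {hV : IsUnit V} {e : U ≅ V}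
    (θ : CTree.TreeIso (.root U hU) (.root V hV) e) : θ.map X = 𝟙 (𝟙_ E) := by
  cases θ
  rfl

/-- Isomorphisms between the restrictions of two chains come from an isomorphism of the trees
obtained by concatenation. -/
theorem StronglyExtensional.exists_treeIso (hC : StronglyExtensional C) {A B : C} {f : A ⟶ B}
    (R : Chain A f) {A' B' : C} {f' : A' ⟶ B'} (R' : Chain A' f') (hl : R.length = R'.length)
    (σ : A ≅ A') (κ : ∀ x, push f x ≅ push f' (isoIdx σ x))
    (hκ : ∀ x, pushAct f x ≫ (κ x).hom =
      (elIso σ.hom (inert_iso σ) x).hom ≫ pushAct f' (isoIdx σ x))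
    (θ : ∀ x, CTree.TreeIso (R.restrict x) (R'.restrict (isoIdx σ x)) (κ x)) {T : CTree A}
    {T' : CTree A'} (τ : CTree.TreeIso T T' σ) :
    ∃ (ρ : B ≅ B') (w : f ≫ ρ.hom = σ.hom ≫ f') (_ : ∀ x, κ x = cmp (InSq.ofIso w) rfl)
      (τ' : CTree.TreeIso (R.append T) (R'.append T') ρ),
      (τ.map X ⊗ₘ tensReindex (Y := fun x => treeTensor X (R'.restrict x)) (isoIdx σ)
        (perm_of_bijective (inertIdx_bijective σ)) (fun x => (θ x).map X)) ≫ R'.shuffle X T' =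
      R.shuffle X T ≫ τ'.map X := by
  induction R generalizing B' with
  | nil =>
    cases R' with
    | snoc => simp [Chain.length] at hl
    | nil =>
      have w : 𝟙 A ≫ σ.hom = σ.hom ≫ 𝟙 A' := by simp
      refine ⟨σ, w, fun x => ?_, τ, ?_⟩
      · have h₁ := elIso_hom σ.hom (inert_iso σ) x
        refine cmp_unique _ _ _ _ h₁ (hκ x) ?_
        have := pushAct_isIso_of_inert (𝟙 A) (inert_of_isIso _ inferInstance) x
        rw [← cancel_epi (pushAct (𝟙 A) x), reassoc_of% hκ, push_fac,
          ← Category.assoc (pushAct _ _), push_fac]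
        simp [h₁]
      · have h₁ : ∀ x, (θ x).map X = 𝟙 (𝟙_ E) := fun x => CTree.TreeIso.map_root X (θ x)
        change (τ.map X ⊗ₘ tensReindex (X := fun _ => 𝟙_ E) (Y := fun _ => 𝟙_ E) (isoIdx σ)
          (perm_of_bijective (inertIdx_bijective σ)) (fun x => (θ x).map X)) ≫ treeTensor X T' ◁
            tensOne (E := E) (List.finRange _) ≫ (ρ_ _).hom =
              (treeTensor X T ◁ tensOne (E := E) (List.finRange _) ≫ (ρ_ _).hom) ≫ τ.map X
        simp only [h₁]
        rw [tensorHom_comp_whiskerLeft_assoc, tensReindex_tensOne _ _ (List.nodup_finRange _),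
          MonoidalCategory.tensorHom_def'_assoc, rightUnitor_naturality, Category.assoc]
  | @snoc B D f R g hg M hM h w ih =>
    cases R' with
    | nil => simp [Chain.length] at hl
    | @snoc B' _ f' R' g' hg' M' hM' _ w' =>
      -- the isomorphisms `e` of the previous level satisfy the hypothesis of the induction because
      -- active morphisms are monic with respect to active morphisms out of units
      choose e θ' wk marks hθ using fun x => (θ x).eq_step
      obtain ⟨ρ, wf, he, τ', hτ'⟩ := ih R' (by simpa [Chain.length] using hl) e (fun x => by
        refine hC.toUnital.cancel (elObj_isUnit A x) (act_comp _ _ (pushAct_act _ _) (act_iso _))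
          (act_comp _ _ (act_iso _) (pushAct_act _ _)) (pushMap_act f' g' _ w' _) ?_
        rw [Category.assoc, ← wk, reassoc_of% (pushAct_pushMap f g h w x), hκ, Category.assoc,
          pushAct_pushMap]) θ'
      obtain rfl : e = fun x => cmp (InSq.ofIso wf) rfl := funext he
      -- the isomorphisms on the parts at the top level glue to an isomorphism of the top objects
      obtain ⟨τ₁, wg, wh, hτ₁⟩ := hC.exists_iso_of_pushMap R.act wf hg hg' w w' κ wk
      obtain rfl : κ = fun x => cmp (InSq.ofIso wh) rfl := funext hτ₁
      -- marks agree because every vertex lies over some `x`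
      have hm : ∀ y, M y = M' (isoIdx ρ y) := by
        intro y
        obtain ⟨⟨x, z⟩, rfl⟩ := (nested_bijective f R.act).2 y
        refine (marks x z).trans (congrArg M' ?_)
        exact inertIdx_w (inert_iso _) (pushIn_inert _ _) (pushIn_inert _ _) (inert_iso _)
          (cmp_in (InSq.ofIso wf) rfl) z
      refine ⟨τ₁, wh, fun x => rfl, .step τ' g hg M hM g' hg' M' hM' τ₁ wg hm, ?_⟩
      rw [CTree.TreeIso.map_step, Chain.shuffle_snoc, Chain.shuffle_snoc]
      simp only [hθ, CTree.TreeIso.map_step]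
      rw [tensorHom_comp_whiskerLeft_assoc,
        tensReindex_tensSplit (Y' := fun x => treeTensor X (R'.restrict x))
          (Z' := fun x => tens fun y : El (push f' x) =>
            slot (M' (nestIdx f' ⟨x, y⟩)) (val X (push (pushMap f' g' _ w' x) y))) _ _ _ _
          (List.nodup_finRange _),
        ← whiskerLeft_comp_tensorHom_assoc, associator_inv_naturality_assoc,
        tensorHom_comp_tensorHom, hτ', Category.assoc, Category.assoc, tensorHom_comp_tensorHom,
        tensReindex_regroupSlot X R.act R'.act w w' wf wg wh hm wk marks]

end Gluing

end HypermomentCategory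

/-! ### Heights and marks -/

namespace HypermomentCategory

section Marks

variable {C : Type u₁} [Category.{v₁} C] [HypermomentCategory C]

/-- Inert morphisms of squares preserve and reflect the relation that a vertex `y` lies above a
vertex `x`. -/
theorem mem_set_iff {A A' B B' : C} {s : A ⟶ A'} {t : B ⟶ B'} {f : A ⟶ B} {f' : A' ⟶ B'}
    (q : InSq s t f f') (x : El A) (y : El B) :
    inertIdx t q.ht y ∈ (γ.map f').set (inertIdx s q.hs x) ↔ y ∈ (γ.map f).set x := by
  have h : (γ.map (f ≫ t)).set x = (γ.map (s ≫ f')).set x := by rw [q.w]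
  simp only [Functor.map_comp, SegalGamma.comp_set, inertIdx_spec _ q.hs, inertIdx_spec _ q.ht,
    Set.mem_singleton_iff, Set.iUnion_iUnion_eq_left] at h
  rw [← h]
  simp only [Set.mem_iUnion, Set.mem_singleton_iff, exists_prop]
  constructor
  · rintro ⟨z, hz, h⟩
    rwa [inertIdx_injective _ _ h]
  · exact fun h => ⟨y, h, rfl⟩

namespace CTree

/-- All vertices above a marked vertex are marked. -/
def MarksUp : ∀ {A : C}, CTree A → Prop
  | _, root _ _ => True
  | _, step T _ _ M _ => MarksUp T ∧ MarksAbove T M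

/-- The top level has an unmarked vertex. -/
def TopFree : ∀ {A : C}, CTree A → Prop
  | _, root _ _ => False
  | _, step _ _ _ M _ => ∃ x, M x = false

/-- If the vertices above marked vertices are marked, an unmarked vertex at the top level forces one
at each lower level. -/
theorem normal_iff {A : C} (T : CTree A) : T.Normal ↔ T.MarksUp ∧ (T.height = 0 ∨ T.TopFree) := by
  induction T with
  | root => simp [Normal, MarksUp, height]
  | @step A B T f hf M hM ih =>
    simp only [Normal, MarksUp, height, Nat.add_eq_zero_iff, one_ne_zero, and_false, false_or,
      TopFree, ih]
    constructor
    · rintro ⟨⟨h₁, -⟩, h₂, h₃⟩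
      exact ⟨⟨h₁, h₂⟩, h₃⟩
    · rintro ⟨⟨h₁, h₂⟩, x, hx⟩
      refine ⟨⟨h₁, ?_⟩, h₂, x, hx⟩
      cases T with
      | root => exact Or.inl rfl
      | @step A' _ T' g hg N hN =>
        -- the vertex below an unmarked vertex is unmarked
        obtain ⟨y, hy⟩ := γ_act g hg x
        refine Or.inr ⟨y, ?_⟩
        by_contra h
        have := h₂ y (by simpa using h) x hy
        simp [this] at hx

namespace TreeIso

theorem height_eq {A A' : C} {T : CTree A} {T' : CTree A'} {e : A ≅ A'} (θ : TreeIso T T' e) :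
    T.height = T'.height := by
  induction θ with
  | root => rfl
  | step θ f hf M hM f' hf' M' hM' e' w marks ih => simp only [height, ih]

theorem marksAbove {A A' : C} {T : CTree A} {T' : CTree A'} {e : A ≅ A'} (θ : TreeIso T T' e)
    {N : El A → Bool} {N' : El A' → Bool} (hN : ∀ x, N x = N' (isoIdx e x)) (h : T.MarksAbove N) :
    T'.MarksAbove N' := by
  cases θ with
  | root => exact trivial
  | @step _ _ _ _ _ _ e₀ θ f hf M hM f' hf' M' hM' _ w marks =>
    intro x' hx' y' hy'
    obtain ⟨x, rfl⟩ := (inertIdx_bijective e₀).2 x'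
    obtain ⟨y, rfl⟩ := (inertIdx_bijective e).2 y'
    exact (hN y).symm.trans (h x ((marks x).trans hx') y ((mem_set_iff (InSq.ofIso w) x y).1 hy'))

theorem marksUp {A A' : C} {T : CTree A} {T' : CTree A'} {e : A ≅ A'} (θ : TreeIso T T' e)
    (h : T.MarksUp) : T'.MarksUp := by
  induction θ with
  | root => exact trivial
  | step θ f hf M hM f' hf' M' hM' e' w marks ih => exact ⟨ih h.1, θ.marksAbove marks h.2⟩

theorem topFree {A A' : C} {T : CTree A} {T' : CTree A'} {e : A ≅ A'} (θ : TreeIso T T' e) :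
    T.TopFree ↔ T'.TopFree := by
  cases θ with
  | root => exact Iff.rfl
  | @step _ _ _ _ _ _ e₀ θ f hf M hM f' hf' M' hM' _ w marks =>
    constructor
    · rintro ⟨x, hx⟩
      exact ⟨_, (marks x).symm.trans hx⟩
    · rintro ⟨x', hx'⟩
      obtain ⟨x, rfl⟩ := (inertIdx_bijective e₀).2 x'
      exact ⟨x, (marks x).trans hx'⟩

end TreeIso

/-- The tree of height one on an active morphism out of a unit, without marked vertices. -/
@[reducible] def corolla {U D : C} (hU : IsUnit U) (u : U ⟶ D) (hu : act u) : CTree D :=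
  .step (.root U hU) u hu (fun _ => false) (fun _ h => by cases h)

/-- All vertices of a stretching of a unit are marked. -/
theorem Stretching.root_marks {U A : C} {hU : IsUnit U} {T : CTree A} {e : U ≅ A}
    (s : Stretching (.root U hU) T e) : T.MarksUp ∧ ¬ T.TopFree := by
  induction s with
  | ofIso θ => exact ⟨θ.marksUp trivial, fun h => θ.topFree.2 h⟩
  | @step B D T' e s g hg M hM all e' w ih =>
    refine ⟨⟨ih.1, ?_⟩, fun ⟨x, hx⟩ => by simp [all x] at hx⟩
    cases T' with
    | root => exact trivial
    | step => exact fun _ _ y _ => all y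

end CTree

open CTree

namespace Chain

theorem marksAbove_restrict {A B : C} {f : A ⟶ B} (R : Chain A f) {T : CTree A} {N : El B → Bool}
    (h : (R.append T).MarksAbove N) (x : El A) :
    (R.restrict x).MarksAbove (fun y => N (nestIdx f ⟨x, y⟩)) := by
  cases R with
  | nil => exact trivial
  | snoc R g hg M hM _ w =>
    exact fun y hy z hz => h _ hy _ ((mem_set_iff (nestSq _ g _ w x) y z).2 hz)

theorem marksUp_restrict {A B : C} {f : A ⟶ B} (R : Chain A f) {T : CTree A}
    (h : (R.append T).MarksUp) (x : El A) : (R.restrict x).MarksUp := by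
  induction R with
  | nil => exact trivial
  | snoc R g hg M hM _ w ih => exact ⟨ih h.1, R.marksAbove_restrict h.2 x⟩

/-- No vertex of the corolla is marked, and vertices of the chain that lie above one another lie
over the same part. -/
theorem marksAbove_append {A B U : C} {f : A ⟶ B} (R : Chain A f) {hU : IsUnit U} {u : U ⟶ A}
    {hu : HypermomentCategory.act u} {N : El B → Bool}
    (h : ∀ x, (R.restrict x).MarksAbove (fun y => N (nestIdx f ⟨x, y⟩))) :
    (R.append (corolla hU u hu)).MarksAbove N := by
  cases R with
  | nil => exact fun x hx => by cases hx
  | @snoc B _ f₁ R g hg M hM _ w =>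
    intro y hy z hz
    obtain ⟨⟨x, y⟩, rfl⟩ := (nested_bijective f₁ R.act).2 y
    obtain ⟨z, rfl⟩ := (pushIn_range f x z).2 (by
      rw [← w, Functor.map_comp, SegalGamma.comp_set]
      exact Set.mem_biUnion ((pushIn_range f₁ x _).1 ⟨_, rfl⟩) hz)
    exact h x _ hy z ((mem_set_iff (nestSq _ g _ w x) _ z).1 hz)

theorem marksUp_append {A B U : C} {f : A ⟶ B} (R : Chain A f) {hU : IsUnit U} {u : U ⟶ A}
    {hu : HypermomentCategory.act u} (h : ∀ x, (R.restrict x).MarksUp) :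
    (R.append (corolla hU u hu)).MarksUp := by
  induction R with
  | nil => exact ⟨trivial, trivial⟩
  | snoc R g hg M hM _ w ih => exact ⟨ih fun x => (h x).1, R.marksAbove_append fun x => (h x).2⟩

theorem topFree_append {A B U : C} {f : A ⟶ B} (R : Chain A f) {hU : IsUnit U} {u : U ⟶ A}
    {hu : HypermomentCategory.act u} :
    (R.append (corolla hU u hu)).TopFree ↔ R.length = 0 ∨ ∃ x, (R.restrict x).TopFree := by
  cases R with
  | nil => exact ⟨fun _ => Or.inl rfl, fun _ => ⟨hU.idx, rfl⟩⟩
  | @snoc B _ f R g hg M hM _ w =>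
    constructor
    · rintro ⟨y, hy⟩
      obtain ⟨⟨x, y⟩, rfl⟩ := (nested_bijective f R.act).2 y
      exact Or.inr ⟨x, y, hy⟩
    · rintro (h | ⟨x, y, hy⟩)
      · simp [length] at h
      · exact ⟨_, hy⟩

end Chain

/-- A tree in which the vertices above marked vertices are marked is a stretching of a unit, or its
first level is unmarked. -/
theorem CTree.stretching_or_append {A : C} (T : CTree A) (h : T.MarksUp) :
    (∃ (U : C) (hU : IsUnit U) (ε : U ≅ A), Nonempty (Stretching (.root U hU) T ε)) ∨
      ∃ (U D : C) (hU : IsUnit U) (u : U ⟶ D) (hu : act u) (f : D ⟶ A) (R : Chain D f),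
        T = R.append (corolla hU u hu) := by
  induction T with
  | root U hU => exact Or.inl ⟨U, hU, Iso.refl U, ⟨.ofIso (.root hU hU _)⟩⟩
  | @step A B T f hf M hM ih =>
    rcases ih h.1 with ⟨U, hU, ε, ⟨s⟩⟩ | ⟨U, D, hU, u, hu, d, R, rfl⟩
    · have hA := isUnit_of_iso ε hU
      by_cases hm : M hA.idx = true
      · have hm' : ∀ x, M x = true := fun x => isUnit_eq hA hA.idx x ▸ hm
        have := hM _ hm
        have := pushIn_isIso hA f hf hA.idx
        have := elMap_isIso hA hA.idx
        -- the only part of `f` is `f` itself up to isomorphism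
        have : IsIso f := by
          have h₁ : f = inv (elMap A hA.idx) ≫ pushAct f hA.idx ≫ pushIn f hA.idx := by
            rw [push_fac, IsIso.inv_hom_id_assoc]
          rw [h₁]
          infer_instance
        exact Or.inl ⟨U, hU, ε ≪≫ asIso f, ⟨s.step f hf M hM hm' _ rfl⟩⟩
      · have hm' : M = fun _ => false := by
          funext x
          rw [isUnit_eq hA x hA.idx]
          simpa using hm
        subst hm'
        cases T with
        | root => exact Or.inr ⟨_, _, hA, f, hf, 𝟙 _, .nil, rfl⟩
        | step T' g hg N hN =>
          -- all vertices of a stretched unit are marked, and so are the vertices above them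
          exfalso
          obtain ⟨y, hy⟩ := γ_act g hg hA.idx
          have hN' : N y = true := by
            by_contra hc
            exact s.root_marks.2 ⟨y, by simpa using hc⟩
          have := h.2 y hN' _ hy
          cases this
    · exact Or.inr ⟨U, D, hU, u, hu, d ≫ f, R.snoc f hf M hM _ rfl, rfl⟩

end Marks

end HypermomentCategory

/-! ### The groupoid of trees -/

namespace HypermomentCategory

open FinTensor CTree

section Groupoid

variable {C : Type u₁} [Category.{v₁} C] {E : Type u} [Category.{v} E]
variable [HypermomentCategory C] [MonoidalCategory E] [SymmetricCategory E]
variable (X : Collection C E)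

/-- The isomorphisms between the factors of one level induced by isomorphisms of morphisms compose.
-/
theorem slotReindex_trans {A A' A'' B B' B'' : C} {σ : A ≅ A'} {ρ : B ≅ B'}
    {σ' : A' ≅ A''} {ρ' : B' ≅ B''} {f : A ⟶ B} {f' : A' ⟶ B'} {f'' : A'' ⟶ B''}
    (w : f ≫ ρ.hom = σ.hom ≫ f') (w' : f' ≫ ρ'.hom = σ'.hom ≫ f'')
    (w'' : f ≫ (ρ ≪≫ ρ').hom = (σ ≪≫ σ').hom ≫ f'') {M : El A → Bool} {M' : El A' → Bool}
    {M'' : El A'' → Bool} (h : ∀ x, M x = M' (isoIdx σ x)) (h' : ∀ x, M' x = M'' (isoIdx σ' x))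
    (h'' : ∀ x, M x = M'' (isoIdx (σ ≪≫ σ') x)) :
    tensReindex (X := fun x => slot (M x) (val X (push f x)))
        (Y := fun x => slot (M' x) (val X (push f' x))) (isoIdx σ)
        (perm_of_bijective (inertIdx_bijective σ))
        (fun x => slotMap (actBy X (cmp (InSq.ofIso w) rfl)) (h x)) ≫
      tensReindex (Y := fun x => slot (M'' x) (val X (push f'' x))) (isoIdx σ')
        (perm_of_bijective (inertIdx_bijective σ'))
        (fun x => slotMap (actBy X (cmp (InSq.ofIso w') rfl)) (h' x)) =
    tensReindex (Y := fun x => slot (M'' x) (val X (push f'' x))) (isoIdx (σ ≪≫ σ'))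
        (perm_of_bijective (inertIdx_bijective (σ ≪≫ σ')))
        (fun x => slotMap (actBy X (cmp (InSq.ofIso w'') rfl)) (h'' x)) := by
  rw [tensReindex_comp _ _ _ _ _ _ (List.nodup_finRange _)]
  simp only [slotMap_slotMap, actBy_comp]
  refine tensReindex_congr (Y := fun x => slot (M'' x) (val X (push f'' x)))
    (fun x => (isoIdx_trans σ σ' x).symm) fun x => ?_
  rw [slotMap_eqToHom X (F := fun y => push f'' y) (M := M'') (isoIdx_trans σ σ' x).symm _ _
      (h'' x),
    cmp_comp _ _ _ _ ((isoIdx_trans σ σ' x)), cmp_eqToHom _ _ (isoIdx_trans σ σ' x).symm]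

theorem slotReindex_refl {A B : C} {f : A ⟶ B} (w : f ≫ (Iso.refl B).hom = (Iso.refl A).hom ≫ f)
    {M : El A → Bool} (h : ∀ x, M x = M (isoIdx (Iso.refl A) x)) :
    tensReindex (X := fun x => slot (M x) (val X (push f x)))
        (Y := fun x => slot (M x) (val X (push f x))) (isoIdx (Iso.refl A))
        (perm_of_bijective (inertIdx_bijective (Iso.refl A)))
        (fun x => slotMap (actBy X (cmp (InSq.ofIso w) rfl)) (h x)) = 𝟙 _ := by
  have h₁ : tensReindex (X := fun x => slot (M x) (val X (push f x)))
      (Y := fun x => slot (M x) (val X (push f x))) id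
      (show ((List.finRange _).map id).Perm (List.finRange _) by simp)
      (fun x : El A => slotMap (actBy X (Iso.refl (push f x))) rfl) = 𝟙 _ := by
    rw [tensReindex_id, tensMap_id' (fun x => by rw [actBy_refl, slotMap_id])]
  rw [← h₁]
  refine tensReindex_congr (Y := fun x => slot (M x) (val X (push f x)))
    (fun x => isoIdx_refl A x) fun x => ?_
  rw [slotMap_eqToHom X (F := fun y => push f y) (M := M) (isoIdx_refl A x) _ _ rfl,
    cmp_eqToHom _ _ (isoIdx_refl A x), cmp_refl _ rfl rfl]

namespace CTree.TreeIso

/-- The identity of a tree. -/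
theorem exists_refl {A : C} (T : CTree A) : ∃ θ : TreeIso T T (Iso.refl A), θ.map X = 𝟙 _ := by
  induction T with
  | root U hU => exact ⟨.root hU hU _, rfl⟩
  | step T f hf M hM ih =>
    obtain ⟨θ, hθ⟩ := ih
    have w : f ≫ (Iso.refl _).hom = (Iso.refl _).hom ≫ f := by simp
    refine ⟨.step θ f hf M hM f hf M hM (Iso.refl _) w (fun x => by
      rw [show inertIdx _ _ x = x from isoIdx_refl _ x]), ?_⟩
    rw [map_step, hθ, slotReindex_refl X w]
    exact id_tensorHom_id _ _

/-- The composite of isomorphisms of trees. -/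
theorem exists_trans {A A' A'' : C} {T : CTree A} {T' : CTree A'} {T'' : CTree A''} {e : A ≅ A'}
    (θ : TreeIso T T' e) {e' : A' ≅ A''} (θ' : TreeIso T' T'' e') :
    ∃ θ'' : TreeIso T T'' (e ≪≫ e'), θ''.map X = θ.map X ≫ θ'.map X := by
  induction θ generalizing A'' with
  | root hU hU' e =>
    cases θ' with
    | root _ hU'' e' => exact ⟨.root hU hU'' _, (Category.comp_id (𝟙 (𝟙_ E))).symm⟩
  | @step _ _ _ _ _ _ e₀ θ f hf M hM f' hf' M' hM' e₁ w marks ih =>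
    cases θ' with
    | @step _ _ _ _ _ _ e₀' θ' _ _ _ _ f'' hf'' M'' hM'' e₁' w' marks' =>
      obtain ⟨θ'', hθ⟩ := ih θ'
      have w'' : f ≫ (e₁ ≪≫ e').hom = (e₀ ≪≫ e₀').hom ≫ f'' := by
        simp only [Iso.trans_hom, Category.assoc, reassoc_of% w, w']
      have m'' : ∀ x, M x = M'' (isoIdx (e₀ ≪≫ e₀') x) := fun x => by
        rw [marks, marks', isoIdx_trans]
      refine ⟨.step θ'' f hf M hM f'' hf'' M'' hM'' (e₁ ≪≫ e') w'' m'', ?_⟩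
      rw [map_step, map_step, map_step, tensorHom_comp_tensorHom, hθ,
        slotReindex_trans X w w' w'' marks marks' m'']

/-- The inverse of an isomorphism of trees. -/
theorem exists_symm {A A' : C} {T : CTree A} {T' : CTree A'} {e : A ≅ A'} (θ : TreeIso T T' e) :
    ∃ θ' : TreeIso T' T e.symm, θ.map X ≫ θ'.map X = 𝟙 _ := by
  induction θ with
  | root hU hU' e => exact ⟨.root hU' hU _, Category.comp_id (𝟙 (𝟙_ E))⟩
  | @step _ _ _ _ _ _ e₀ θ f hf M hM f' hf' M' hM' e₁ w marks ih =>
    obtain ⟨θ', hθ⟩ := ih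
    have w' : f' ≫ e₁.symm.hom = e₀.symm.hom ≫ f := (InSq.ofIso w).symm.w
    have m' : ∀ x, M' x = M (isoIdx e₀.symm x) := fun x => by
      rw [marks]
      exact congrArg M' (isoIdx_isoIdx_symm e₀ x).symm
    refine ⟨.step θ' f' hf' M' hM' f hf M hM e₁.symm w' m', ?_⟩
    rw [map_step, map_step, tensorHom_comp_tensorHom, hθ]
    -- `e₀ ≪≫ e₀.symm` is only propositionally equal to the identity, hence the generalization
    have h₁ : ∀ (σ : _ ≅ _) (ρ : _ ≅ _) (hσ : σ = Iso.refl _) (hρ : ρ = Iso.refl _)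
        (w'' : f ≫ ρ.hom = σ.hom ≫ f) (m'' : ∀ x, M x = M (isoIdx σ x)),
        tensReindex (X := fun x => slot (M x) (val X (push f x)))
          (Y := fun x => slot (M x) (val X (push f x))) (isoIdx σ)
          (perm_of_bijective (inertIdx_bijective σ))
          (fun x => slotMap (actBy X (cmp (InSq.ofIso w'') rfl)) (m'' x)) = 𝟙 _ := by
      rintro _ _ rfl rfl w'' m''
      exact slotReindex_refl X w'' m''
    have w'' : f ≫ (e₁ ≪≫ e₁.symm).hom = (e₀ ≪≫ e₀.symm).hom ≫ f := by
      rw [Iso.self_symm_id, Iso.self_symm_id, Iso.refl_hom, Iso.refl_hom, Category.comp_id,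
        Category.id_comp]
    rw [slotReindex_trans X w w' w'' marks m' (fun x => by
        rw [isoIdx_trans, isoIdx_symm_isoIdx]),
      h₁ _ _ (Iso.self_symm_id e₀) (Iso.self_symm_id e₁) w'']
    exact id_tensorHom_id _ _

end CTree.TreeIso

include X in
/-- The tree `T` with its top object replaced by an isomorphic one. -/
theorem CTree.exists_treeIso {A B : C} (T : CTree A) (e : A ≅ B) :
    ∃ T' : CTree B, Nonempty (TreeIso T T' e) := by
  cases T with
  | root _ hU => exact ⟨.root B (isUnit_of_iso e hU), ⟨.root _ _ _⟩⟩
  | step T f hf M hM =>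
    obtain ⟨θ, -⟩ := TreeIso.exists_refl X T
    have w : f ≫ e.hom = (Iso.refl _).hom ≫ f ≫ e.hom := by simp
    exact ⟨.step T (f ≫ e.hom) (act_comp _ _ hf (act_iso e)) M (fun x hx =>
      (isIso_pushAct_iff (InSq.ofIso w) (isoIdx_refl _ x)).1 (hM x hx)),
      ⟨.step θ _ _ _ _ _ _ _ _ _ w (fun x => by
        rw [show inertIdx _ _ x = x from isoIdx_refl _ x])⟩⟩

include X in
/-- A tree has stretchings of every larger height. -/
theorem CTree.exists_stretching {A : C} (T : CTree A) {n : ℕ} (hn : T.height ≤ n) :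
    ∃ T' : CTree A, T'.height = n ∧ Nonempty (Stretching T T' (Iso.refl A)) := by
  induction n, hn using Nat.le_induction with
  | base => exact ⟨T, rfl, ⟨.ofIso (TreeIso.exists_refl X T).choose⟩⟩
  | succ n _ ih =>
    obtain ⟨T', hT', ⟨s⟩⟩ := ih
    exact ⟨.step T' (𝟙 A) (act_of_isIso _ inferInstance) (fun _ => true) (fun x _ =>
      pushAct_isIso_of_inert _ (inert_of_isIso _ inferInstance) x), by rw [CTree.height, hT'],
      ⟨.step s _ _ _ _ (fun _ => rfl) _ (Category.comp_id _)⟩⟩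

/-- Two stretchings of units of the same height are isomorphic. -/
theorem CTree.Stretching.exists_treeIso {U U' A A' : C} {hU : IsUnit U} {hU' : IsUnit U'}
    {T : CTree A} {T' : CTree A'} {e : U ≅ A} {ε' : U' ≅ A'} (s : Stretching (.root U hU) T e)
    (s' : Stretching (.root U' hU') T' ε') (hT : T.height = T'.height) (κ : U ≅ U') :
    ∃ τ : TreeIso T T' (e.symm ≪≫ κ ≪≫ ε'), s.map X ≫ τ.map X = s'.map X := by
  induction s generalizing A' with
  | @ofIso _ _ e θ =>
    cases θ
    cases s' with
    | ofIso θ' =>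
      cases θ'
      exact ⟨.root _ _ _, Category.comp_id (𝟙 (𝟙_ E))⟩
    | step => simp [height] at hT
  | @step B D T e s g hg M hM all e₁ w ih =>
    cases s' with
    | ofIso θ' =>
      cases θ'
      simp [height] at hT
    | @step B' _ T' e' s' g' hg' M' hM' all' _ w' =>
      obtain ⟨τ, hτ⟩ := ih s' (by simpa [height] using hT)
      have w₂ : g ≫ (e₁.symm ≪≫ κ ≪≫ ε').hom = (e.symm ≪≫ κ ≪≫ e').hom ≫ g' := by
        rw [← Iso.eq_inv_comp] at w
        simp [w, w']
      have m₂ : ∀ x, M x = M' (isoIdx (e.symm ≪≫ κ ≪≫ e') x) := fun x => by rw [all, all']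
      refine ⟨.step τ g hg M hM g' hg' M' hM' _ w₂ m₂, ?_⟩
      rw [TreeIso.map_step]
      simp only [Stretching.map]
      rw [Category.assoc, Category.assoc, whiskerLeft_comp_tensorHom,
        tensPoint_tensReindex (Y := fun x => slot (M' x) (val X (push g' x))) _ _ _
          (List.nodup_finRange _) _ (fun x => slotPoint _ (all' x))
          (fun x => slotPoint_slotMap _ _ _),
        MonoidalCategory.tensorHom_def, rightUnitor_inv_naturality_assoc,
        ← MonoidalCategory.comp_whiskerRight_assoc, hτ, ← rightUnitor_inv_naturality_assoc]

end Groupoid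

end HypermomentCategory

/-! ### Corollas -/

namespace HypermomentCategory

open FinTensor CTree

section Corolla

variable {C : Type u₁} [Category.{v₁} C] [HypermomentCategory C]
variable {E : Type u} [Category.{v} E] [MonoidalCategory E] [SymmetricCategory E]
variable (X : Collection C E)

/-- The identification of `X(D)` with `S(X, T)` for the corolla `T` over `D`. -/
noncomputable def corollaMap {U D : C} (hU : IsUnit U) (u : U ⟶ D) (hu : act u) :
    val X D ⟶ treeTensor X (corolla hU u hu) :=
  toUnitary X hU u hu ≫ (λ_ (valMor X u)).inv

instance {U D : C} (hU : IsUnit U) (u : U ⟶ D) (hu : act u) : IsIso (corollaMap X hU u hu) := by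
  change IsIso (toUnitary X hU u hu ≫ (λ_ (valMor X u)).inv)
  infer_instance

variable {X} in
/-- The evaluation of the corolla over `D` is the given map `φ` at `D`, by the left unit axiom. -/
theorem corollaMap_treeMap (O : Operad C E) (φ : X ⟶ O.coll) {U D : C} (hU : IsUnit U)
    (u : U ⟶ D) (hu : act u) :
    corollaMap X hU u hu ≫ O.treeMap φ (corolla hU u hu) = φ.app ⟨D⟩ := by
  rw [Operad.treeMap_step, Operad.treeMap_root, Operad.η_tensorHom_μ]
  have h : tensMap (O.vertexMap φ u (M := fun _ => false) (fun x hx => by simp at hx))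
      (List.finRange _) = tensMap (fun x => φ.app ⟨push u x⟩) _ := by
    congr 1
    funext x
    exact Category.comp_id _
  rw [h]
  change (toUnitary X hU u hu ≫ (λ_ (valMor X u)).inv) ≫ (λ_ (valMor X u)).hom ≫
    tensMap (fun x => φ.app ⟨push u x⟩) _ ≫ inv (toUnitary O.coll hU u hu) = _
  rw [Category.assoc, Iso.inv_hom_id_assoc, ← Category.assoc,
    toUnitary_nat, Category.assoc, IsIso.hom_inv_id, Category.comp_id]

/-- Every isomorphism of objects extends to their corollas, since active morphisms out of units are
essentially unique. -/
theorem exists_corolla_treeIso (hC : Unital C) {U D U' D' : C} (hU : IsUnit U) (u : U ⟶ D)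
    (hu : act u) (hU' : IsUnit U') (u' : U' ⟶ D') (hu' : act u') (σ : D ≅ D') :
    ∃ τ : TreeIso (corolla hU u hu) (corolla hU' u' hu') σ,
      corollaMap X hU u hu ≫ τ.map X = actBy X σ ≫ corollaMap X hU' u' hu' := by
  obtain ⟨h, hh, -⟩ := hC.unit_unique D' (u ≫ σ.hom) u' hU hU' (act_comp _ _ hu (act_iso σ)) hu'
  have w : u ≫ σ.hom = h.hom ≫ u' := hh.symm
  refine ⟨.step (.root hU hU' h) _ _ _ _ _ _ _ _ σ w (fun _ => rfl), ?_⟩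
  rw [TreeIso.map_step, TreeIso.map_root]
  have h₁ := toUnitary_transport X hU hU' h σ u hu u' hu' w
  rw [transport_eq] at h₁
  change (_ ≫ (λ_ (valMor X u)).inv) ≫ (𝟙 (𝟙_ E) ⊗ₘ tensReindex (Y := fun x => val X (push u' x))
    (isoIdx h) (perm_of_bijective (inertIdx_bijective h))
    (fun x => actBy X (cmp (InSq.ofIso w) rfl))) = _ ≫ _ ≫ (λ_ (valMor X u')).inv
  rw [id_tensorHom, Category.assoc, ← leftUnitor_inv_naturality, reassoc_of% h₁]

end Corolla

section Isos

variable {C : Type u₁} [Category.{v₁} C] [HypermomentCategory C]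
variable {E : Type u} [Category.{v} E] [MonoidalCategory E] [SymmetricCategory E]
variable (X : Collection C E)

instance CTree.TreeIso.map_isIso {A A' : C} {T : CTree A} {T' : CTree A'} {e : A ≅ A'}
    (θ : TreeIso T T' e) : IsIso (θ.map X) := by
  induction θ with
  | root => exact inferInstanceAs (IsIso (𝟙 (𝟙_ E)))
  | step θ f hf M hM f' hf' M' hM' e' w marks ih =>
    rw [TreeIso.map_step]
    infer_instance

instance slotPoint_isIso {P : E} {b : Bool} (h : b = true) : IsIso (slotPoint P h) := by
  subst h
  exact inferInstanceAs (IsIso (𝟙 (𝟙_ E)))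

instance tensPoint_isIso {ι : Type*} {X : ι → E} (p : ∀ i, 𝟙_ E ⟶ X i) [∀ i, IsIso (p i)]
    (l : List ι) : IsIso (tensPoint p l) := by
  have h := tensOne_tensPoint_eq p l
  rw [← IsIso.eq_inv_comp] at h
  rw [h]
  exact IsIso.comp_isIso

instance CTree.Stretching.map_isIso {A B : C} {T : CTree A} {T' : CTree B} {e : A ≅ B}
    (s : Stretching T T' e) : IsIso (s.map X) := by
  induction s with
  | ofIso θ => exact inferInstanceAs (IsIso (θ.map X))
  | step s g hg M hM all e' w ih =>
    change IsIso (s.map X ≫ (ρ_ _).inv ≫ _ ◁ tensPoint (fun x => slotPoint _ (all x)) _)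
    infer_instance

instance tensSplit_isIso {ι : Type*} (X Y : ι → E) (l : List ι) : IsIso (tensSplit X Y l) :=
  ⟨tensMul X Y l, tensSplit_tensMul X Y l, tensMul_tensSplit X Y l⟩

instance Chain.shuffle_isIso {A B : C} {f : A ⟶ B} (T : CTree A) (R : Chain A f) :
    IsIso (R.shuffle X T) := by
  induction R with
  | nil => exact inferInstanceAs (IsIso (treeTensor X T ◁ tensOne _ ≫ (ρ_ _).hom))
  | snoc R g hg M hM h w ih =>
    rw [Chain.shuffle_snoc]
    infer_instance

end Isos

end HypermomentCategory

/-! ### Representing trees presented by grafting by trees with levels -/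

namespace HypermomentCategory

open FinTensor CTree

section Represents

variable {C : Type w} [SmallCategory C] [HypermomentCategory C]

/-- The height of a tree presented by grafting. -/
def GTree.height : ∀ {A : C}, GTree A → ℕ
  | _, .leaf _ _ => 0
  | _, .node _ _ _ _ Q => Finset.univ.sup (fun x => (Q x).height) + 1

theorem GIso.height_eq {A A' : C} {P : GTree A} {P' : GTree A'} {ε : A ≅ A'} (θ : GIso P P' ε) :
    P.height = P'.height := by
  induction θ with
  | leaf => rfl
  | @node D A D' A' d hd Y e Q d' hd' Y' e' Q' σ ε w idx hidx κ θ hκ ih =>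
    obtain rfl : isoIdx σ = idx := funext hidx
    simp only [GTree.height, ih]
    congr 1
    refine (Finset.sup_image Finset.univ (isoIdx σ) (fun x => (Q' x).height)).symm.trans ?_
    rw [Finset.image_univ_of_surjective (inertIdx_bijective σ).2]

variable {E : Type u} [Category.{v} E] [MonoidalCategory E] [SymmetricCategory E]
variable (X : Collection C E)

/-- The tree with levels `T` arises from the tree `P` presented by grafting by stretching its
leaves in such a way that all of them have the same height; `s` is the induced identification of
the tensor products over the vertices, and `ε` that of the top objects. -/
def Represents : ∀ {A : C} (P : GTree A) {A' : C} (T : CTree A') (_ : A ≅ A')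
    (_ : P.tensor X ⟶ treeTensor X T), Prop
  | A, .leaf _ hU, A', T, ε, s => ∃ (A₀ : C) (T₀ : CTree A₀) (ε₀ : A ≅ A₀)
      (s₀ : Stretching (.root _ hU) T₀ ε₀) (e : A₀ ≅ A') (θ : TreeIso T₀ T e),
      ε₀ ≪≫ e = ε ∧ s = s₀.map X ≫ θ.map X
  | A, .node (D := D) d _ _ e Q, A', T, ε, s => ∃ (U : C) (hU : IsUnit U) (u : U ⟶ D) (hu : act u)
      (B : C) (f : D ⟶ B) (R : Chain D f) (ρ : A ≅ B) (w : d ≫ ρ.hom = (Iso.refl D).hom ≫ f)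
      (t : ∀ x, (Q x).tensor X ⟶ treeTensor X (R.restrict x)) (ε₀ : B ≅ A')
      (θ : TreeIso (R.append (corolla hU u hu)) T ε₀),
      (∀ x, Represents (Q x) (R.restrict x) (e x ≪≫ cmp (InSq.ofIso w) (isoIdx_refl D x)) (t x)) ∧
      ρ ≪≫ ε₀ = ε ∧ s = (corollaMap X hU u hu ⊗ₘ tensMap t _) ≫ R.shuffle X _ ≫ θ.map X

variable {X}

theorem Represents.trans {A A' A'' : C} {P : GTree A} {T : CTree A'} {T' : CTree A''} {ε : A ≅ A'}
    {s : P.tensor X ⟶ treeTensor X T} (h : Represents X P T ε s) {e : A' ≅ A''}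
    (θ : TreeIso T T' e) : Represents X P T' (ε ≪≫ e) (s ≫ θ.map X) := by
  cases P with
  | leaf U hU =>
    obtain ⟨A₀, T₀, ε₀, s₀, e₀, θ₀, rfl, rfl⟩ := h
    obtain ⟨θ', hθ'⟩ := θ₀.exists_trans X θ
    exact ⟨A₀, T₀, ε₀, s₀, _, θ', (Iso.trans_assoc _ _ _).symm, by rw [hθ', Category.assoc]⟩
  | node d hd Y e Q =>
    obtain ⟨U, hU, u, hu, B, f, R, ρ, w, t, ε₀, θ₀, ht, rfl, rfl⟩ := h
    obtain ⟨θ', hθ'⟩ := θ₀.exists_trans X θ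
    exact ⟨U, hU, u, hu, B, f, R, ρ, w, t, _, θ', ht, (Iso.trans_assoc _ _ _).symm, by
      rw [hθ', Category.assoc, Category.assoc]⟩

theorem Represents.isIso {A A' : C} {P : GTree A} {T : CTree A'} {ε : A ≅ A'}
    {s : P.tensor X ⟶ treeTensor X T} (h : Represents X P T ε s) : IsIso s := by
  induction P generalizing A' with
  | leaf U hU =>
    obtain ⟨A₀, T₀, ε₀, s₀, e₀, θ₀, rfl, rfl⟩ := h
    exact IsIso.comp_isIso
  | node d hd Y e Q ih =>
    obtain ⟨U, hU, u, hu, B, f, R, ρ, w, t, ε₀, θ₀, ht, rfl, rfl⟩ := h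
    have := fun x => ih x (ht x)
    exact IsIso.comp_isIso

/-- The shape of a tree with levels that arises from a tree presented by grafting. -/
theorem Represents.marks {A A' : C} {P : GTree A} {T : CTree A'} {ε : A ≅ A'}
    {s : P.tensor X ⟶ treeTensor X T} (h : Represents X P T ε s) :
    T.MarksUp ∧ P.height ≤ T.height ∧ (T.TopFree ↔ 0 < P.height ∧ P.height = T.height) := by
  induction P generalizing A' with
  | leaf U hU =>
    obtain ⟨A₀, T₀, ε₀, s₀, e₀, θ₀, rfl, rfl⟩ := h
    refine ⟨θ₀.marksUp s₀.root_marks.1, Nat.zero_le _, ?_⟩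
    rw [← θ₀.topFree]
    simpa [GTree.height] using s₀.root_marks.2
  | node d hd Y e Q ih =>
    obtain ⟨U, hU, u, hu, B, f, R, ρ, w, t, ε₀, θ₀, ht, rfl, rfl⟩ := h
    have hx := fun x => ih x (ht x)
    have hl : T.height = R.length + 1 := by
      rw [← θ₀.height_eq, R.height_append, add_comm]
      rfl
    have hle : Finset.univ.sup (fun x => (Q x).height) ≤ R.length :=
      Finset.sup_le fun x _ => (hx x).2.1.trans (R.height_restrict x).le
    refine ⟨θ₀.marksUp (R.marksUp_append fun x => (hx x).1), ?_, ?_⟩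
    · simpa [GTree.height, hl] using hle
    · rw [← θ₀.topFree, R.topFree_append, hl]
      simp only [GTree.height, Nat.succ_pos, true_and, Nat.add_right_cancel_iff]
      constructor
      · rintro (h | ⟨x, h⟩)
        · omega
        · have h₁ := ((hx x).2.2.1 h).2
          rw [R.height_restrict] at h₁
          exact le_antisymm hle
            (h₁ ▸ Finset.le_sup (f := fun x => (Q x).height) (Finset.mem_univ x))
      · intro h
        rcases Nat.eq_zero_or_pos R.length with h₀ | h₀
        · exact Or.inl h₀
        · right
          by_contra! hn
          refine absurd h (ne_of_lt ((Finset.sup_lt_iff h₀).2 fun x _ => ?_))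
          have h₁ := (hx x).2.1
          have h₂ := mt (hx x).2.2.2 (hn x)
          rw [R.height_restrict] at h₁ h₂
          omega

/-- Of the trees with levels that arise from a tree presented by grafting, the normal ones are those
of least height. -/
theorem Represents.normal_iff {A A' : C} {P : GTree A} {T : CTree A'} {ε : A ≅ A'}
    {s : P.tensor X ⟶ treeTensor X T} (h : Represents X P T ε s) :
    T.Normal ↔ T.height = P.height := by
  obtain ⟨h₁, h₂, h₃⟩ := h.marks
  rw [CTree.normal_iff, h₃]
  constructor
  · rintro ⟨-, h | h⟩ <;> omega
  · intro h
    exact ⟨h₁, by omega⟩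

/-- Every tree presented by grafting is, up to isomorphism of the top object, represented by trees
with levels of all sufficiently large heights. -/
theorem StronglyExtensional.exists_represents (hC : StronglyExtensional C) {A : C} (P : GTree A)
    {n : ℕ} (hn : P.height ≤ n) : ∃ (A' : C) (T : CTree A') (ε : A ≅ A')
      (s : P.tensor X ⟶ treeTensor X T), Represents X P T ε s ∧ T.height = n := by
  induction P generalizing n with
  | leaf U hU =>
    obtain ⟨T, hT, ⟨s⟩⟩ := (CTree.root U hU).exists_stretching (X := X) (Nat.zero_le n)
    obtain ⟨θ, -⟩ := TreeIso.exists_refl X T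
    exact ⟨U, T, _, _, ⟨U, T, _, s, _, θ, rfl, rfl⟩, hT⟩
  | @node D A d hd Y e Q ih =>
    obtain ⟨m, rfl⟩ : ∃ m, n = m + 1 := ⟨n - 1, by simp only [GTree.height] at hn; omega⟩
    have hm : ∀ x, (Q x).height ≤ m := fun x =>
      (Finset.le_sup (f := fun x => (Q x).height) (Finset.mem_univ x)).trans
        (by simpa [GTree.height] using hn)
    choose Z T ε s hs hT using fun x => ih x (hm x)
    -- trees of height `m` representing the subtrees are the restrictions of a chain, whose
    -- composite has the same parts as `d` and can therefore replace `d`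
    obtain ⟨B, f, R, ζ, hR, hζ, hθ⟩ := hC.exists_chain m Z
      (fun x => pushAct d x ≫ (e x).inv ≫ (ε x).hom)
      (fun x => act_comp _ _ (pushAct_act _ _)
        (act_comp _ _ (act_iso (e x).symm) (act_iso (ε x)))) T hT
    have θ := fun x => (hθ x).some
    obtain ⟨ρ, w, hρ⟩ := hC.exists_iso_self hd R.act
      (fun x => (e x).symm ≪≫ ε x ≪≫ ζ x) (fun x => by
        rw [← hζ x]
        simp)
    have w' : d ≫ ρ.hom = (Iso.refl D).hom ≫ f := by rw [w, Iso.refl_hom, Category.id_comp]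
    have hκ : ∀ x, ε x ≪≫ ζ x = e x ≪≫ cmp (InSq.ofIso w') (isoIdx_refl D x) := fun x => by
      rw [← cmp_unique (InSq.ofIso w') (isoIdx_refl D x) ((e x).symm ≪≫ ε x ≪≫ ζ x) (Iso.refl _)
        (by simp) (by rw [← hζ x]; simp) (hρ x).symm]
      simp
    obtain ⟨U, u, hU, hu⟩ := hC.exists_unit D
    obtain ⟨θ', -⟩ := TreeIso.exists_refl X (R.append (corolla hU u hu))
    exact ⟨B, _, ρ, _, ⟨U, hU, u, hu, B, f, R, ρ, w', fun x => s x ≫ (θ x).map X, _, θ',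
      fun x => hκ x ▸ (hs x).trans (θ x), Iso.trans_refl _, rfl⟩, by
        rw [R.height_append, hR, add_comm]; rfl⟩

/-- Trees with levels in which the vertices above marked vertices are marked come from trees
presented by grafting. -/
theorem exists_represents_of_marksUp {A' : C} (T : CTree A') (hT : T.MarksUp) :
    ∃ (A : C) (P : GTree A) (ε : A ≅ A') (s : P.tensor X ⟶ treeTensor X T),
      Represents X P T ε s := by
  obtain ⟨n, hn⟩ : ∃ n, T.height ≤ n := ⟨_, le_rfl⟩
  induction n generalizing A' with
  | zero =>
    obtain ⟨hU, rfl⟩ := CTree.eq_root (Nat.le_zero.1 hn)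
    obtain ⟨θ, -⟩ := TreeIso.exists_refl X (.root A' hU)
    exact ⟨A', .leaf A' hU, _, _, ⟨_, _, _, .ofIso θ, _, θ, rfl, rfl⟩⟩
  | succ n ih =>
    obtain ⟨U, hU, ε, ⟨s⟩⟩ | ⟨U, D, hU, u, hu, f, R, rfl⟩ := T.stretching_or_append hT
    · obtain ⟨θ, -⟩ := TreeIso.exists_refl X T
      exact ⟨U, .leaf U hU, _, _, ⟨_, _, _, s, _, θ, rfl, rfl⟩⟩
    -- an unmarked first level is the root vertex, and the restrictions of the rest are the subtrees
    · have hR : R.length ≤ n := by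
        rw [R.height_append] at hn
        simp only [CTree.height] at hn
        omega
      choose Y Q ε t ht using fun x => ih (R.restrict x) (R.marksUp_restrict hT x)
        ((R.height_restrict x).le.trans hR)
      obtain ⟨θ, -⟩ := TreeIso.exists_refl X (R.append (corolla hU u hu))
      have w : f ≫ (Iso.refl A').hom = (Iso.refl D).hom ≫ f := by simp
      refine ⟨A', .node f R.act Y ε Q, _, _, ⟨U, hU, u, hu, A', f, R, Iso.refl _, w, t, _, θ,
        fun x => ?_, rfl, rfl⟩⟩
      rw [cmp_refl (InSq.ofIso w) rfl rfl, Iso.trans_refl]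
      exact ht x

end Represents

end HypermomentCategory

/-! ### Comparison of isomorphisms and evaluations -/

namespace HypermomentCategory

open FinTensor CTree

section Comparison

variable {C : Type w} [SmallCategory C] [HypermomentCategory C]
variable {E : Type u} [Category.{v} E] [MonoidalCategory E] [SymmetricCategory E]
variable {X : Collection C E}

/-- Isomorphisms of trees presented by grafting induce isomorphisms of the representing trees with
levels, if these have the same height. -/
theorem Represents.exists_treeIso (hC : StronglyExtensional C) {A A' B B' : C} {P : GTree A}
    {P' : GTree A'} {κ : A ≅ A'} (θ : GIso P P' κ) {T : CTree B} {T' : CTree B'} {ε : A ≅ B}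
    {ε' : A' ≅ B'} {s : P.tensor X ⟶ treeTensor X T} {s' : P'.tensor X ⟶ treeTensor X T'}
    (h : Represents X P T ε s) (h' : Represents X P' T' ε' s') (hT : T.height = T'.height)
    {β : B ≅ B'} (hβ : ε.symm ≪≫ κ ≪≫ ε' = β) :
    ∃ τ : TreeIso T T' β, s ≫ τ.map X = θ.map X ≫ s' := by
  induction θ generalizing B B' with
  | leaf hU hU' κ =>
    obtain ⟨A₀, T₀, ε₀, s₀, e₀, θ₀, rfl, rfl⟩ := h
    obtain ⟨A₁, T₁, ε₁, s₁, e₁, θ₁, rfl, rfl⟩ := h'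
    obtain ⟨τ, hτ⟩ := s₀.exists_treeIso X s₁ (by rw [θ₀.height_eq, hT, θ₁.height_eq]) κ
    obtain ⟨θ₂, hθ₂⟩ := θ₀.exists_symm X
    obtain ⟨τ₁, hτ₁⟩ := τ.exists_trans X θ₁
    obtain ⟨τ₂, hτ₂⟩ := θ₂.exists_trans X τ₁
    obtain rfl : e₀.symm ≪≫ (ε₀.symm ≪≫ κ ≪≫ ε₁) ≪≫ e₁ = β := by
      rw [← hβ]
      ext
      simp
    refine ⟨τ₂, ?_⟩
    rw [hτ₂, hτ₁, Category.assoc, reassoc_of% hθ₂, reassoc_of% hτ]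
    exact (Category.id_comp _).symm
  | @node D A D' A' d hd Y e Q d' hd' Y' e' Q' σ κ w idx hidx κ₀ θ hκ ih =>
    obtain rfl : isoIdx σ = idx := funext hidx
    obtain ⟨U, hU, u, hu, B₀, f, R, ρ, w₀, t, ε₀, θ₀, ht, rfl, rfl⟩ := h
    obtain ⟨U', hU', u', hu', B₁, f', R', ρ', w₁, t', ε₁, θ₁, ht', rfl, rfl⟩ := h'
    have hR : R.length = R'.length := by
      rw [← θ₀.height_eq, ← θ₁.height_eq, R.height_append, R'.height_append] at hT
      simpa [CTree.height] using hT
    have w₂ : f ≫ (ρ.symm ≪≫ κ ≪≫ ρ').hom = σ.hom ≫ f' := by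
      rw [Iso.refl_hom, Category.id_comp] at w₀ w₁
      rw [← w₀, ← w₁]
      simp [reassoc_of% w]
    -- the isomorphisms of the subtrees lie over the isomorphisms of the parts of `f` and `f'` that
    -- are induced by `w₂`
    have hc : ∀ x, (e x ≪≫ cmp (InSq.ofIso w₀) (isoIdx_refl D x)).symm ≪≫ κ₀ x ≪≫
        e' (isoIdx σ x) ≪≫ cmp (InSq.ofIso w₁) (isoIdx_refl D' _) = cmp (InSq.ofIso w₂) rfl := by
      intro x
      have r : InSq σ.hom (κ.hom ≫ ρ'.hom) d f' := by
        have := (InSq.ofIso w).comp (InSq.ofIso w₁)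
        rwa [Iso.refl_hom, Category.comp_id] at this
      have h₁ := cmp_trans (InSq.ofIso w) (InSq.ofIso w₁) r (Category.comp_id _) rfl
        (x := x) rfl (isoIdx_refl D' _) rfl
      have h₂ := cmp_trans (InSq.ofIso w₀) (InSq.ofIso w₂) r (Category.id_comp _) (by simp)
        (x := x) (isoIdx_refl D x) rfl rfl
      rw [← Iso.trans_assoc (κ₀ x), hκ x, Iso.trans_assoc, h₁, ← h₂]
      ext
      simp
    choose τ hτ using fun x => ih x (ht x) (ht' (isoIdx σ x))
      (by rw [R.height_restrict, R'.height_restrict, hR]) (hc x)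
    obtain ⟨τ₀, hτ₀⟩ := exists_corolla_treeIso X hC.toUnital hU u hu hU' u' hu' σ
    -- glue the isomorphisms of the restrictions and that of the corollas
    obtain ⟨ρ₂, w₃, hρ₂, τ₁, hτ₁⟩ := hC.exists_treeIso X R R' hR σ
      (fun x => cmp (InSq.ofIso w₂) rfl) (fun x => cmp_act _ _ _ (elIso_hom _ _ _)) τ τ₀
    obtain rfl : ρ₂ = ρ.symm ≪≫ κ ≪≫ ρ' := hC.iso_ext R.act (by rw [w₂, w₃]) fun x => by
      rw [← cmp_in (InSq.ofIso w₂) rfl, hρ₂ x]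
      exact (cmp_in (InSq.ofIso w₃) rfl).symm
    obtain ⟨θ₂, hθ₂⟩ := θ₀.exists_symm X
    obtain ⟨τ₂, hτ₂⟩ := τ₁.exists_trans X θ₁
    obtain ⟨τ₃, hτ₃⟩ := θ₂.exists_trans X τ₂
    obtain rfl : ε₀.symm ≪≫ (ρ.symm ≪≫ κ ≪≫ ρ') ≪≫ ε₁ = β := by
      rw [← hβ]
      ext
      simp
    refine ⟨τ₃, ?_⟩
    have h₁ : (corollaMap X hU u hu ⊗ₘ tensMap t _) ≫ (τ₀.map X ⊗ₘ
        tensReindex (Y := fun x => treeTensor X (R'.restrict x)) (isoIdx σ)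
        (perm_of_bijective (inertIdx_bijective σ)) (fun x => (τ x).map X)) =
        (actBy X σ ⊗ₘ tensReindex (Y := fun x => (Q' x).tensor X) (isoIdx σ) (perm_idx hidx)
          (fun x => (θ x).map X)) ≫ (corollaMap X hU' u' hu' ⊗ₘ tensMap t' _) := by
      rw [tensorHom_comp_tensorHom, tensorHom_comp_tensorHom, hτ₀, tensMap_reindex,
        tensReindex_map _ _ _ _ (List.nodup_finRange _)]
      simp only [hτ]
    rw [hτ₃, hτ₂, Category.assoc, Category.assoc, reassoc_of% hθ₂, ← reassoc_of% hτ₁]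
    rw [reassoc_of% h₁]
    rfl

end Comparison

section Evaluation

variable {C : Type w} [SmallCategory C] [HypermomentCategory C]
variable {E : Type u} [Category.{v} E] [MonoidalCategory E] [SymmetricCategory E]
variable {X : Collection C E} (O : Operad C E) (φ : X ⟶ O.coll)

/-- A tree presented by grafting and a tree with levels representing it have the same evaluation in
every operad. -/
theorem Represents.treeMap {A A' : C} {P : GTree A} {T : CTree A'} {ε : A ≅ A'}
    {s : P.tensor X ⟶ treeTensor X T} (h : Represents X P T ε s) :
    s ≫ O.treeMap φ T = P.eval O φ ≫ actBy O.coll ε := by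
  induction P generalizing A' with
  | leaf U hU =>
    obtain ⟨A₀, T₀, ε₀, s₀, e₀, θ₀, rfl, rfl⟩ := h
    rw [Category.assoc, θ₀.map_treeMap, reassoc_of% (s₀.map_treeMap O φ), Operad.treeMap_root,
      actBy_comp]
    rfl
  | @node D A d hd Y e Q ih =>
    obtain ⟨U, hU, u, hu, B, f, R, ρ, w, t, ε₀, θ₀, ht, rfl, rfl⟩ := h
    have h₁ : transport O.coll (Iso.refl D) ρ d f w =
        tensMap (fun x => actBy O.coll (cmp (InSq.ofIso w) (isoIdx_refl D x))) _ := by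
      rw [← tensReindex_id (show ((List.finRange _).map id).Perm (List.finRange _) by simp),
        transport_eq]
      exact tensReindex_cmp_congr (e' := id) O.coll (fun x => isoIdx_refl D x)
        (fun x => cmp_eqToHom _ _ (isoIdx_refl D x) _)
    have h₂ := O.equivariant (Iso.refl D) ρ d hd f R.act w
    rw [h₁, actBy_refl] at h₂
    -- the evaluation of the concatenation of the corolla and `R` is a multiplication in `O`
    rw [Category.assoc, Category.assoc, θ₀.map_treeMap,
      reassoc_of% (R.shuffle_treeMap O φ (corolla hU u hu) R.act),
      tensorHom_comp_tensorHom_assoc, corollaMap_treeMap, tensMap_tensMap]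
    simp only [fun x => ih x (ht x), ← actBy_comp]
    rw [GTree.eval, Category.assoc, ← reassoc_of% h₂, tensorHom_comp_tensorHom_assoc,
      Category.comp_id, tensMap_tensMap]
    simp only [Category.assoc]

end Evaluation

end HypermomentCategory

/-! ### The coend formula -/

namespace HypermomentCategory

open FinTensor CTree

section Coend

variable {C : Type w} [SmallCategory C] [HypermomentCategory C]
variable {E : Type u} [Category.{v} E] [MonoidalCategory E] [SymmetricCategory E]

/-- Every tree presented by grafting is represented by a normal tree. -/
theorem StronglyExtensional.exists_normal (hC : StronglyExtensional C) (X : Collection C E)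
    {A A₀ : C} (P : GTree A₀) (e : A₀ ≅ A) :
    ∃ (T : CTree A) (_ : T.Normal) (s : P.tensor X ⟶ treeTensor X T), Represents X P T e s := by
  obtain ⟨A', T, ε, s, hs, hT⟩ := hC.exists_represents (X := X) P le_rfl
  obtain ⟨T', ⟨θ⟩⟩ := T.exists_treeIso X (ε.symm ≪≫ e)
  have h := hs.trans θ
  rw [← Iso.trans_assoc, Iso.self_symm_id, Iso.refl_trans] at h
  exact ⟨T', h.normal_iff.2 (by rw [← θ.height_eq, hT]), _, h⟩

variable [Limits.HasColimitsOfSize.{w, w} E] [MonoidalClosed E]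
variable {X : Collection C E} (O : Operad C E) (φ : X ⟶ O.coll)

/-- The universal property of an operad isomorphic to the free operad, in terms of trees presented
by grafting. -/
theorem evalUniv (A : C) [IsIso (freeDesc O φ A)] :
    IsUniv (M := val O.coll A) (fun j : FreeIdx C A => j.tensor X)
      (fun j j' r => ∃ θ : FreeRel j j', r = θ.θ.map X)
      (fun j => j.tree.eval O φ ≫ actBy O.coll j.iso) where
  compat := by
    rintro j j' _ ⟨θ, rfl⟩
    rw [reassoc_of% (θ.θ.map_eval O φ), actBy_comp, θ.w]
  exists_desc Z g hg := ⟨inv (freeDesc O φ A) ≫ (injUniv X A).desc g hg, fun j => by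
    rw [← inj_freeDesc, Category.assoc, IsIso.hom_inv_id_assoc, (injUniv X A).fac]⟩
  hom_ext {Z a b} h := by
    rw [← cancel_epi (freeDesc O φ A)]
    refine (injUniv X A).hom_ext fun j => ?_
    rw [reassoc_of% (inj_freeDesc O φ j.tree j.iso), reassoc_of% (inj_freeDesc O φ j.tree j.iso)]
    simpa using h j

/-- The evaluation maps exhibit an operad isomorphic to the free one as the colimit over normal
trees: this colimit agrees with the one over the trees presented by grafting, as a tree presented by
grafting is represented by a normal tree which is unique up to isomorphism. -/
theorem isTreeCoend (hC : StronglyExtensional C) (h : ∀ A, IsIso (freeDesc O φ A)) :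
    IsTreeCoend O φ := by
  intro A
  refine ⟨fun T T' _ _ θ => ?_, fun Z g hg => ?_⟩
  · rw [θ.map_treeMap, actBy_refl, Category.comp_id]
  have hU := evalUniv O φ A
  choose T hT s hs using fun j : FreeIdx C A => hC.exists_normal X j.tree j.iso
  -- normal trees representing isomorphic trees have the same height, hence are isomorphic
  have hk : ∀ j j' r, (∃ θ : FreeRel j j', r = θ.θ.map X) →
      r ≫ s j' ≫ g (T j') (hT j') = s j ≫ g (T j) (hT j) := by
    rintro j j' _ ⟨θ, rfl⟩
    obtain ⟨τ, hτ⟩ := (hs j).exists_treeIso hC θ.θ (hs j')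
      (by rw [(hs j).normal_iff.1 (hT j), (hs j').normal_iff.1 (hT j'), θ.θ.height_eq])
      (β := Iso.refl A) (by rw [θ.w, Iso.symm_self_id])
    rw [← reassoc_of% hτ, hg]
  refine ⟨hU.desc _ hk, fun T' hT' => ?_, fun k hk' => hU.hom_ext fun j => ?_⟩
  -- a normal tree comes from a tree presented by grafting, hence is isomorphic to the normal tree
  -- that was chosen to represent it
  · obtain ⟨A₀, P, ε, t, ht⟩ := exists_represents_of_marksUp (X := X) T'
      ((CTree.normal_iff T').1 hT').1
    have := ht.isIso
    obtain ⟨τ, hτ⟩ := (hs ⟨A₀, P, ε⟩).exists_treeIso hC (GIso.refl P) ht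
      (by rw [(hs ⟨A₀, P, ε⟩).normal_iff.1 (hT _), ht.normal_iff.1 hT'])
      (β := Iso.refl A) (by rw [Iso.refl_trans, Iso.symm_self_id])
    rw [GIso.map_refl, Category.id_comp] at hτ
    rw [← cancel_epi t, reassoc_of% (ht.treeMap O φ)]
    have h₁ := hU.fac _ hk ⟨A₀, P, ε⟩
    rw [Category.assoc] at h₁
    rw [h₁, ← hτ, Category.assoc, hg]
  · rw [hU.fac _ hk, ← hk' _ (hT j), reassoc_of% ((hs j).treeMap O φ), Category.assoc]

end Coend

section Adjunction

variable {C : Type w} [SmallCategory C] [HypermomentCategory C]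
variable {E : Type u} [Category.{v} E] [MonoidalCategory E] [SymmetricCategory E]
variable [Limits.HasColimitsOfSize.{w, w} E] [MonoidalClosed E]

/-- A left adjoint of the forgetful functor takes `X` to an operad isomorphic to the free operad
constructed from trees. -/
theorem freeDesc_isIso {F : Collection C E ⥤ Operad C E} (adj : F ⊣ forgetOperad C E)
    (X : Collection C E) (A : C) :
    IsIso (freeDesc (F.obj X) (adj.unit.app X) A) := by
  let φ : X ⟶ (F.obj X).coll := adj.unit.app X
  let ψ : F.obj X ⟶ freeOperad X := (adj.homEquiv X (freeOperad X)).symm (freeGen X)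
  have hψ : φ ≫ (forgetOperad C E).map ψ = freeGen X := by
    exact (adj.homEquiv_unit (f := ψ)).symm.trans (Equiv.apply_symm_apply _ _)
  have h₁ : freeLift (F.obj X) φ ≫ ψ = 𝟙 (freeOperad X) := by
    rw [← freeLift_unique (freeOperad X) (freeLift (F.obj X) φ ≫ ψ),
      ← freeLift_unique (freeOperad X) (𝟙 _), CategoryTheory.Functor.map_id, Functor.map_comp]
    congr 1
    exact (Category.assoc _ _ _).symm.trans
      ((congrArg (· ≫ ψ.map) (freeGen_freeLift (F.obj X) φ)).trans
        (hψ.trans (Category.comp_id _).symm))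
  have h₂ : ψ ≫ freeLift (F.obj X) φ = 𝟙 (F.obj X) := by
    apply (adj.homEquiv _ _).injective
    rw [adj.homEquiv_unit, adj.homEquiv_unit, CategoryTheory.Functor.map_id, Functor.map_comp]
    exact (Category.assoc _ _ _).symm.trans
      ((congrArg (· ≫ (freeLift (F.obj X) φ).map) hψ).trans
        ((freeGen_freeLift (F.obj X) φ).trans (Category.comp_id _).symm))
  exact ⟨ψ.map.app ⟨A⟩, congrArg (fun χ => (Operad.Hom.map χ).app ⟨A⟩) h₁,
    congrArg (fun χ => (Operad.Hom.map χ).app ⟨A⟩) h₂⟩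

end Adjunction

end HypermomentCategory

/-! ### Simultaneous insertion -/

namespace HypermomentCategory

open FinTensor CTree

section Insertion

variable {C : Type u₁} [Category.{v₁} C] [HypermomentCategory C]
variable {E : Type u} [Category.{v} E] [MonoidalCategory E] [SymmetricCategory E]
variable {X : Collection C E}

include X in
/-- A tree isomorphic to a stretching is a stretching. -/
theorem CTree.Stretching.exists_trans_treeIso {A B : C} {T : CTree A} {T' : CTree B} {e : A ≅ B}
    (s : Stretching T T' e) {D : C} {T'' : CTree D} {e' : B ≅ D} (θ : TreeIso T' T'' e') :
    Nonempty (Stretching T T'' (e ≪≫ e')) := by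
  induction s generalizing D with
  | ofIso θ₀ => exact ⟨.ofIso (θ₀.exists_trans X θ).choose⟩
  | step s g hg M hM all e₁ w ih =>
    cases θ with
    | @step _ _ _ _ _ _ e₀ θ _ _ _ _ g' hg' M' hM' _ w' marks =>
      obtain ⟨s'⟩ := ih θ
      refine ⟨.step s' g' hg' M' hM' (fun y => ?_) _ ?_⟩
      · obtain ⟨x, rfl⟩ := (inertIdx_bijective e₀).2 y
        rw [← marks, all]
      · rw [Iso.trans_hom, Iso.trans_hom, ← w, Category.assoc, Category.assoc, w']

include X in
/-- Trees over the parts of an active morphism can be stretched to a chain of active morphisms with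
the given composite. -/
theorem StronglyExtensional.exists_chain_stretching (hC : StronglyExtensional C) {A B : C}
    (f : A ⟶ B) (hf : act f) (Q : ∀ x : El A, CTree (push f x)) :
    ∃ R : Chain A f, ∀ x, Nonempty (Stretching (Q x) (R.restrict x) (Iso.refl _)) := by
  -- stretch the given trees to their maximal height
  choose Q' hQ' s using fun x => (Q x).exists_stretching (X := X)
    (Finset.le_sup (f := fun x => (Q x).height) (Finset.mem_univ x))
  obtain ⟨D, f₀, R, ζ, -, hζ, θ⟩ := hC.exists_chain _ (fun x => push f x) (pushAct f)
    (pushAct_act f) Q' hQ'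
  -- the composite of `R` is `f` up to the isomorphism `ρ`, which is added as a marked level
  obtain ⟨ρ, w, hρ⟩ := hC.exists_iso_self R.act hf (fun x => (ζ x).symm) (fun x => by
    rw [← hζ x]
    simp)
  refine ⟨R.snoc ρ.hom (act_iso ρ) (fun _ => true)
    (fun x _ => pushAct_isIso_of_inert _ (inert_iso ρ) x) f w, fun x => ?_⟩
  obtain ⟨s'⟩ := (s x).some.exists_trans_treeIso (X := X) (θ x).some
  have hp : pushMap f₀ ρ.hom f w x = (ζ x).inv :=
    (pushMap_unique w _ (act_iso (ζ x).symm) (by rw [← hζ x]; simp) (hρ x).symm).symm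
  exact ⟨.step s' _ _ _ _ (fun _ => rfl) _ (by rw [hp]; simp)⟩

theorem isComposedByInsertion (hC : StronglyExtensional C) (O : Operad C E) (φ : X ⟶ O.coll) :
    IsComposedByInsertion O φ := by
  intro A B f hf T Q
  refine ⟨hC.exists_chain_stretching (X := X) f hf Q, fun R s => ?_⟩
  rw [R.shuffle_treeMap O φ T hf, whiskerLeft_comp_tensorHom_assoc, tensMap_tensMap]
  simp only [fun x => (s x).map_treeMap O φ, actBy_refl, Category.comp_id]

end Insertion

end HypermomentCategory

/-! ### Monadicity and the description of the free operad -/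

theorem mainTheorem2 (C : Type w) [SmallCategory C] [HypermomentCategory C]
    (hC : HypermomentCategory.StronglyExtensional C)
    (E : Type u) [Category.{v} E] [MonoidalCategory E] [SymmetricCategory E] [MonoidalClosed E]
    [Limits.HasColimitsOfSize.{w, w} E] :
    Nonempty (MonadicRightAdjoint (HypermomentCategory.forgetOperad C E)) ∧
    ∀ (F : HypermomentCategory.Collection C E ⥤ HypermomentCategory.Operad C E)
      (adj : F ⊣ HypermomentCategory.forgetOperad C E)
      (X : HypermomentCategory.Collection C E),
      HypermomentCategory.IsTreeCoend (F.obj X) (adj.unit.app X) ∧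
      HypermomentCategory.IsStretchInvariant (F.obj X) (adj.unit.app X) ∧
      HypermomentCategory.IsComposedByInsertion (F.obj X) (adj.unit.app X) := by
  refine ⟨HypermomentCategory.nonempty_monadic
    (HypermomentCategory.isRightAdjoint_forgetOperad C E), fun F adj X => ⟨?_, ?_, ?_⟩⟩
  · exact HypermomentCategory.isTreeCoend _ _ hC (HypermomentCategory.freeDesc_isIso adj X)
  · exact HypermomentCategory.isStretchInvariant _ _
  · exact HypermomentCategory.isComposedByInsertion hC _ _
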